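/- Let $d\ge 2$. For real $k\ge 1$ and $f\in\mathcal S(\mathbb R^d)$ let $$\wp_k f(x)=\frac1{(2\pi)^d}\int_{k-1\le|\xi|^2<k}e^{ix\cdot\xi}\,\widehat f(\xi)\,d\xi,\qquad \widehat f(\xi)=\int_{\mathbb R^d} e^{-ix\cdot\xi}f(x)\,dx .$$ For (quasi-)normed function spaces $X,Y$ on $\mathbb R^d$ let $\|\wp_k\|_{X\to Y}=\sup\{\|\wp_kf\|_Y: f\in\mathcal S(\mathbb R^d),\ \|f\|_X\le1\}$, and write $\|\wp_k\|_{p\to q}$ when $X=L^p$, $Y=L^q$. Here $L^{p,r}$ denotes the Lorentz spaces, with $\|g\|_{L^{q,\infty}}=\sup_{s>0}s\,|\{|g|>s\}|^{1/q}$ and $\|f\|_{L^{p,1}}=p\int_0^\infty|\{|f|>s\}|^{1/p}\,ds$. For $X=(a,b)\in[\frac12,1]\times[0,\frac12]$ put $X'=(1-b,1-a)$, and $\mathfrak Z'=\{X':X\in\mathfrak Z\}$ for a set $\mathfrak Z$ of such points. Let $$\mathfrak A=\Big(\tfrac{d+3}{2(d+1)},\tfrac12\Big),\quad \mathfrak C=\Big(\tfrac{d^2+4d-1}{2d(d+1)},\tfrac{d-1}{2d}\Big),\quad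 \mathfrak D=\Big(1,\tfrac{d-1}{2d}\Big).$$ Let $\mathcal R_1$ be the closed pentagon with vertices $(\frac12,\frac12),\mathfrak A,\mathfrak C,\mathfrak C',\mathfrak A'$ with the two points $\mathfrak C,\mathfrak C'$ removed, let $\mathcal R_2$ be the closed trapezoid with vertices $\mathfrak A,(1,\frac12),\mathfrak D,\mathfrak C$ with the closed segment $[\mathfrak C,\mathfrak D]$ removed, and let $\overline{\mathcal R_3}$ be the closed pentagon with vertices $\mathfrak C,\mathfrak D,(1,0),\mathfrak D',\mathfrak C'$. These sets together with $\mathcal R_2'$ cover the square $[\frac12,1]\times[0,\frac12]$. For $1\le p\le2\le q\le\infty$ define $$\beta(p,q)=\begin{cases}-\frac12\big(\frac1p-\frac1q\big),&(\frac1p,\frac1q)\in\mathcal R_1,\\ \frac d2\big(\frac1p+\frac1q\big)-\frac{d+1}2,&(\frac1p,\frac1q)\in\mathcal R_2,\\ \frac{d-1}2-\frac d2\big(\frac1p+\frac1q\big),&(\frac1p,\frac1q)\in\mathcal R_2',\\ \frac d2\big(\frac1p-\frac1q\big)-1,&(\frac1p,\frac1q)\in\overline{\mathcal R_3},\end{cases}$$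 which is well defined, since the formulas agree where the sets overlap. Let $1\le p\le 2\le q\le\infty$. If $(\frac1p,\frac1q)\notin[\mathfrak C,\mathfrak D]\cup[\mathfrak C',\mathfrak D']$ (closed segments), there are constants $c,C>0$ depending only on $d,p,q$ such that $$c\,k^{\beta(p,q)}\le\|\wp_k\|_{p\to q}\le C\,k^{\beta(p,q)}\qquad\text{for all } k\ge1 .$$ Additionally, with a constant $C$ depending only on $d,p,q$ and for all $k\ge1$: (i) if $(\frac1p,\frac1q)\in[\mathfrak C,\mathfrak D]\setminus\{\mathfrak C\}$, then $\|\wp_k\|_{L^p\to L^{q,\infty}}\le C\,k^{\beta(p,q)}$; (ii) if $(\frac1p,\frac1q)=\mathfrak C$ or $(\frac1p,\frac1q)=\mathfrak C'$, then $\|\wp_k\|_{L^{p,1}\to L^{q,\infty}}\le C\,k^{\beta(p,q)}$. -/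

import Mathlib

open MeasureTheory Set
open scoped ENNReal NNReal SchwartzMap

noncomputable section

namespace ShellProjection

/-- The Euclidean space `ℝ^d`. -/
abbrev E (d : ℕ) : Type := EuclideanSpace ℝ (Fin d)

/-! ### The operator -/

/-- The Fourier transform `∫ e^{-i x·ξ} f(x) dx`. -/
def hat {d : ℕ} (f : 𝓢(E d, ℂ)) (ξ : E d) : ℂ :=
  ∫ x : E d, Complex.exp (-(Complex.I * ((inner ℝ x ξ : ℝ) : ℂ))) * f x

/-- The frequency shell `k - 1 ≤ |ξ|² < k`. -/
def shell (d : ℕ) (k : ℝ) : Set (E d) :=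
  {ξ | k - 1 ≤ ‖ξ‖ ^ 2 ∧ ‖ξ‖ ^ 2 < k}

/-- The spectral projection of `-Δ` onto the shell:
`(2π)^{-d} ∫_{k - 1 ≤ |ξ|² < k} e^{i x·ξ} (hat f)(ξ) dξ`. -/
def wp {d : ℕ} (k : ℝ) (f : 𝓢(E d, ℂ)) (x : E d) : ℂ :=
  (1 / (2 * (Real.pi : ℂ)) ^ d) *
    ∫ ξ in shell d k, Complex.exp (Complex.I * ((inner ℝ x ξ : ℝ) : ℂ)) * hat f ξ

/-! ### Norms -/

/-- The distribution function `s ↦ |{x : |f(x)| > s}|`. -/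
def distribution {d : ℕ} (f : E d → ℂ) (s : ℝ) : ℝ≥0∞ :=
  volume {x | s < ‖f x‖}

/-- The Lorentz (quasi-)norm of `L^{p,r}(ℝ^d)`, for `0 < p < ∞` and `0 < r ≤ ∞`, written with
the distribution function `m` of `f`: it is `sup_{s > 0} s m(s)^{1/p}` if `r = ∞` and
`(p ∫_0^∞ (s m(s)^{1/p})^r ds/s)^{1/r}` if `r < ∞`; the latter is
`(∫_0^∞ (t^{1/p} f^*(t))^r dt/t)^{1/r}` with `f^*` the decreasing rearrangement of `f`. -/
def lorentzNorm {d : ℕ} (p r : ℝ≥0∞) (f : E d → ℂ) : ℝ≥0∞ :=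
  if r = ∞ then
    ⨆ s ∈ Ioi (0 : ℝ), ENNReal.ofReal s * distribution f s ^ (1 / p.toReal)
  else
    (p * ∫⁻ s in Ioi (0 : ℝ),
      (ENNReal.ofReal s * distribution f s ^ (1 / p.toReal)) ^ r.toReal / ENNReal.ofReal s)
        ^ (1 / r.toReal)

/-- The Lebesgue norm of `L^p(ℝ^d)`. -/
def lebesgueNorm {d : ℕ} (p : ℝ≥0∞) (f : E d → ℂ) : ℝ≥0∞ :=
  eLpNorm f p volume

/-- The norm of an operator `T` defined on Schwartz functions, with respect to a source
(quasi-)norm `N` and a target (quasi-)norm `M`: `sup {M (T f) : N f ≤ 1, f Schwartz}`. -/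
def opNorm {d : ℕ} (N M : (E d → ℂ) → ℝ≥0∞) (T : 𝓢(E d, ℂ) → E d → ℂ) : ℝ≥0∞ :=
  ⨆ (f : 𝓢(E d, ℂ)) (_ : N f ≤ 1), M (T f)

/-! ### Points and regions of the square `[1/2, 1] × [0, 1/2]` -/

/-- The point `(1/p, 1/q)`, with `1/∞ = 0`. -/
def expPoint (p q : ℝ≥0∞) : ℝ × ℝ := (p⁻¹.toReal, q⁻¹.toReal)

/-- The duality `(a, b)' = (1 - b, 1 - a)`. -/
def dual (X : ℝ × ℝ) : ℝ × ℝ := (1 - X.2, 1 - X.1)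

def ptA (d : ℕ) : ℝ × ℝ := (((d : ℝ) + 3) / (2 * ((d : ℝ) + 1)), 1 / 2)

def ptC (d : ℕ) : ℝ × ℝ :=
  (((d : ℝ) ^ 2 + 4 * (d : ℝ) - 1) / (2 * (d : ℝ) * ((d : ℝ) + 1)),
    ((d : ℝ) - 1) / (2 * (d : ℝ)))

def ptD (d : ℕ) : ℝ × ℝ := (1, ((d : ℝ) - 1) / (2 * (d : ℝ)))

/-- The closed pentagon with vertices `(1/2, 1/2), A, C, C', A'`, without `C` and `C'`. -/
def regionR1 (d : ℕ) : Set (ℝ × ℝ) :=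
  convexHull ℝ {(1 / 2, 1 / 2), ptA d, ptC d, dual (ptC d), dual (ptA d)}
    \ {ptC d, dual (ptC d)}

/-- The closed trapezoid with vertices `A, (1, 1/2), D, C`, without the closed segment
`[C, D]`. -/
def regionR2 (d : ℕ) : Set (ℝ × ℝ) :=
  convexHull ℝ {ptA d, (1, 1 / 2), ptD d, ptC d} \ segment ℝ (ptC d) (ptD d)

open scoped Classical in
/-- The exponent `β`, as a function of the point `X = (1/p, 1/q)` of the square
`[1/2, 1] × [0, 1/2]`. The part of the square outside `R1`, `R2` and `R2'` consists of points of
the closed pentagon with vertices `C, D, (1, 0), D', C'`. -/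
def beta (d : ℕ) (X : ℝ × ℝ) : ℝ :=
  if X ∈ regionR1 d then -(1 / 2) * (X.1 - X.2)
  else if X ∈ regionR2 d then (d : ℝ) / 2 * (X.1 + X.2) - ((d : ℝ) + 1) / 2
  else if X ∈ dual '' regionR2 d then ((d : ℝ) - 1) / 2 - (d : ℝ) / 2 * (X.1 + X.2)
  else (d : ℝ) / 2 * (X.1 - X.2) - 1

end ShellProjection

end

namespace ShellProjection

/-! ### Oscillatory integrals -/

/-! Put δ = 1/k. Dilating by √k/(2π) turns ℘_k into the projection onto the shell 1 - δ ≤ |ξ|² < 1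
(`wp_eq`), and a bound Cδ^γ for its bilinear form `shellForm` at X = (1/p, 1/q) becomes C k^{d/2
(1/p - 1/q) - γ} for ℘_k. The theorem thus says that the best γ is (d+1)/2 · (1/p - 1/q) on R1,
(d+1)/2 - d/q on R2, its dual on R2', and 1 in the remaining corner.

Upper bounds rest on restricted estimates (for functions dominated by indicators) at A and C. The
Poisson kernel 2ε/(ε² + (|ξ|² - s)²) is the time integral of e^{it(|ξ|² - s) - ε|t|}; the extra
factor e^{-(|ξ|² - s)} makes all symbols integrable and the kernels explicit Gaussians. The window t
~ 2^i has a kernel of size 2^{-i(d-1)/2}: t^{-d/2} from the amplitude, t^{1/2} from van der Corput.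
Playing this against the L² bound 2^i by Bourgain's summation trick (`exists_sum_min_le`) gives
Stein–Tomas, the point A (`exists_integral_poissonSymbol_le`). Stein–Tomas in turn gives each window
an estimate into L² of size 2^{i/2}, and a second summation gives C
(`exists_restricted_poissonSymbol_C`). Averaging in s over [1 - δ, 1] and letting ε → 0 recovers the
shell and gains the factor δ.

Convexity and duality spread the restricted estimates over the closed pentagon. Marcinkiewicz
interpolation (`exists_strong_of_restricted`) makes them strong wherever the point lies between two
points that differ in both coordinates; on the horizontal side through A the T T^* argument replaces
it. Since the shell lies in the unit ball, Bernstein's inequality (`exists_strong_of_strong`) lets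
1/p grow and 1/q shrink at fixed γ, which covers the trapezoids and the corner. Applied to the
restricted estimate at C it gives weak type on ]C, D]; summation over level sets gives the Lorentz
bound at C and C'.

Lower bounds come from three tests: a Knapp wave packet on R1, the kernel of the projection
localized at scale 1/δ on R2, and a fixed Schwartz function in the corner. -/

open Complex in
theorem vanDerCorput_first {φ φ' φ'' : ℝ → ℝ} {a b μ : ℝ} (hab : a ≤ b) (hμ : 0 < μ)
    (h1 : ∀ t ∈ Icc a b, HasDerivAt φ (φ' t) t) (h2 : ∀ t ∈ Icc a b, HasDerivAt φ' (φ'' t) t)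
    (hc : ContinuousOn φ'' (Icc a b)) (hneg : ∀ t ∈ Icc a b, φ'' t ≤ 0)
    (hμ' : ∀ t ∈ Icc a b, μ ≤ |φ' t|) :
    ‖∫ t in a..b, exp (I * φ t)‖ ≤ 3 / μ := by
  have huIcc : uIcc a b = Icc a b := uIcc_of_le hab
  have hne : ∀ t ∈ Icc a b, φ' t ≠ 0 := fun t ht h => by
    have := hμ' t ht; rw [h, abs_zero] at this; linarith
  have hc1 : ContinuousOn φ (Icc a b) := fun t ht => (h1 t ht).continuousAt.continuousWithinAt
  have hc2 : ContinuousOn φ' (Icc a b) := fun t ht => (h2 t ht).continuousAt.continuousWithinAt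
  have hinv : ∀ t ∈ uIcc a b, HasDerivAt (fun t => (φ' t)⁻¹) (-φ'' t / φ' t ^ 2) t := fun t ht =>
    (h2 t (huIcc ▸ ht)).inv (hne t (huIcc ▸ ht))
  have hcinv : ContinuousOn (fun t => -φ'' t / φ' t ^ 2) (Icc a b) :=
    hc.neg.div (hc2.pow 2) fun t ht => pow_ne_zero 2 (hne t ht)
  have hiinv : IntervalIntegrable (fun t => -φ'' t / φ' t ^ 2) volume a b :=
    (huIcc ▸ hcinv).intervalIntegrable
  have hexp : ContinuousOn (fun t => exp (I * φ t)) (Icc a b) :=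
    (continuous_exp.comp_continuousOn (continuousOn_const.mul
      (continuous_ofReal.comp_continuousOn hc1)))
  have hu : ∀ t ∈ uIcc a b, HasDerivAt (fun t => (((φ' t)⁻¹ : ℝ) : ℂ))
      (((-φ'' t / φ' t ^ 2 : ℝ)) : ℂ) t := fun t ht => (hinv t ht).ofReal_comp
  have hv : ∀ t ∈ uIcc a b, HasDerivAt (fun t => -I * exp (I * φ t)) (φ' t * exp (I * φ t)) t := by
    intro t ht
    have := ((h1 t (huIcc ▸ ht)).ofReal_comp.const_mul I).cexp.const_mul (-I)
    refine this.congr_deriv ?_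
    linear_combination (-(φ' t * exp (I * φ t)) : ℂ) * I_sq
  -- Integration by parts in e^{iφ} = (1/φ') · (φ' e^{iφ}); the two boundary terms and the remaining
  -- integral each cost 1/μ.
  have key := intervalIntegral.integral_mul_deriv_eq_deriv_mul hu hv
    (((continuous_ofReal.comp_continuousOn (huIcc ▸ hcinv))).intervalIntegrable)
    ((((continuous_ofReal.comp_continuousOn (huIcc ▸ hc2)).mul (huIcc ▸ hexp))).intervalIntegrable)
  have hL : ∫ t in a..b, exp (I * φ t)
      = ∫ t in a..b, (((φ' t)⁻¹ : ℝ) : ℂ) * (φ' t * exp (I * φ t)) := by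
    apply intervalIntegral.integral_congr
    intro t ht
    have : (φ' t : ℂ) ≠ 0 := by exact_mod_cast hne t (huIcc ▸ ht)
    simp only [ofReal_inv]
    field_simp
  have hnexp : ∀ t : ℝ, ‖exp (I * φ t)‖ = 1 := fun t => by
    rw [mul_comm]; exact norm_exp_ofReal_mul_I _
  have hinvle : ∀ t ∈ Icc a b, |(φ' t)⁻¹| ≤ 1 / μ := fun t ht => by
    rw [abs_inv, ← one_div]
    exact one_div_le_one_div_of_le hμ (hμ' t ht)
  have hint : ∫ t in a..b, (-φ'' t / φ' t ^ 2) = (φ' b)⁻¹ - (φ' a)⁻¹ :=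
    intervalIntegral.integral_eq_sub_of_hasDerivAt hinv hiinv
  -- As φ'' ≤ 0, the function 1/φ' is increasing and this difference is its total variation. Since
  -- φ' decreases, either φ' < 0 at both ends or φ' > 0 at `a`, so one of the two terms can be
  -- dropped.
  have hsame : (φ' b)⁻¹ - (φ' a)⁻¹ ≤ 1 / μ := by
    have hanti : φ' b ≤ φ' a := by
      have := intervalIntegral.integral_eq_sub_of_hasDerivAt (fun t ht => h2 t (huIcc ▸ ht))
        ((huIcc ▸ hc).intervalIntegrable)
      have h0 : ∫ t in a..b, φ'' t ≤ 0 := by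
        rw [← neg_nonneg, ← intervalIntegral.integral_neg]
        exact intervalIntegral.integral_nonneg hab fun t ht => by linarith [hneg t ht]
      linarith
    have hb := abs_le.1 (hinvle b (right_mem_Icc.2 hab))
    have ha := abs_le.1 (hinvle a (left_mem_Icc.2 hab))
    rcases lt_or_gt_of_ne (hne a (left_mem_Icc.2 hab)) with h | h
    · have : (φ' b)⁻¹ ≤ 0 := inv_nonpos.2 (by linarith)
      linarith
    · have : 0 ≤ (φ' a)⁻¹ := inv_nonneg.2 h.le
      linarith
  rw [hL, key]
  have e1 : ‖(((φ' b)⁻¹ : ℝ) : ℂ) * (-I * exp (I * φ b))‖ ≤ 1 / μ := by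
    rw [norm_mul, norm_mul, hnexp, norm_real, norm_neg, norm_I, mul_one, mul_one]
    exact hinvle b (right_mem_Icc.2 hab)
  have e2 : ‖(((φ' a)⁻¹ : ℝ) : ℂ) * (-I * exp (I * φ a))‖ ≤ 1 / μ := by
    rw [norm_mul, norm_mul, hnexp, norm_real, norm_neg, norm_I, mul_one, mul_one]
    exact hinvle a (left_mem_Icc.2 hab)
  have e3 : ‖∫ t in a..b, (((-φ'' t / φ' t ^ 2 : ℝ)) : ℂ) * (-I * exp (I * φ t))‖ ≤ 1 / μ := by
    refine (intervalIntegral.norm_integral_le_of_norm_le hab ?_ hiinv).trans (hint.le.trans hsame)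
    filter_upwards with t ht
    rw [norm_mul, norm_mul, hnexp, norm_real, norm_neg, norm_I, mul_one, mul_one, Real.norm_eq_abs,
      abs_of_nonneg]
    exact div_nonneg (by linarith [hneg t (Ioc_subset_Icc_self ht)]) (sq_nonneg _)
  calc _ ≤ 1 / μ + 1 / μ + 1 / μ := (norm_sub_le _ _).trans
        (add_le_add ((norm_sub_le _ _).trans (add_le_add e1 e2)) e3)
    _ = 3 / μ := by ring

open Complex in
theorem norm_integral_cexp_le {φ : ℝ → ℝ} {a b : ℝ} (hab : a ≤ b) :
    ‖∫ t in a..b, exp (I * φ t)‖ ≤ b - a := by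
  have := intervalIntegral.norm_integral_le_of_norm_le_const (a := a) (b := b) (C := 1)
    (f := fun t => exp (I * φ t)) (fun t _ => by rw [mul_comm, norm_exp_ofReal_mul_I])
  rwa [one_mul, abs_of_nonneg (by linarith)] at this

-- φ' decreases with slope at least `lam`, so |φ'| ≥ √lam at distance 1/√lam from its zero. The
-- trivial bound serves near the zero and the first-derivative test beyond it; each side costs
-- 1/√lam + 3/√lam.
open Complex in
theorem vanDerCorput_second {φ φ' φ'' : ℝ → ℝ} {a b lam : ℝ} (hab : a ≤ b) (hlam : 0 < lam)
    (h1 : ∀ t ∈ Icc a b, HasDerivAt φ (φ' t) t) (h2 : ∀ t ∈ Icc a b, HasDerivAt φ' (φ'' t) t)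
    (hc : ContinuousOn φ'' (Icc a b)) (hneg : ∀ t ∈ Icc a b, φ'' t ≤ -lam) :
    ‖∫ t in a..b, exp (I * φ t)‖ ≤ 8 / √lam := by
  have hs : 0 < √lam := Real.sqrt_pos.2 hlam
  have hss : √lam * √lam = lam := Real.mul_self_sqrt hlam.le
  have hc1 : ContinuousOn φ (Icc a b) := fun t ht => (h1 t ht).continuousAt.continuousWithinAt
  have hc2 : ContinuousOn φ' (Icc a b) := fun t ht => (h2 t ht).continuousAt.continuousWithinAt
  have hexp : ContinuousOn (fun t => exp (I * φ t)) (Icc a b) :=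
    (continuous_exp.comp_continuousOn (continuousOn_const.mul
      (continuous_ofReal.comp_continuousOn hc1)))
  have hint : ∀ u ∈ Icc a b, ∀ v ∈ Icc a b,
      IntervalIntegrable (fun t => exp (I * φ t)) volume u v := fun u hu v hv =>
    (hexp.mono (uIcc_subset_Icc hu hv)).intervalIntegrable
  have hdecr : ∀ u ∈ Icc a b, ∀ v ∈ Icc a b, u ≤ v → φ' v + lam * (v - u) ≤ φ' u := by
    intro u hu v hv huv
    have hsub : uIcc u v ⊆ Icc a b := uIcc_subset_Icc hu hv
    have e := intervalIntegral.integral_eq_sub_of_hasDerivAt (fun t ht => h2 t (hsub ht))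
      ((hc.mono hsub).intervalIntegrable)
    have : ∫ t in u..v, φ'' t ≤ ∫ _ in u..v, -lam :=
      intervalIntegral.integral_mono_on huv (hc.mono hsub).intervalIntegrable (by simp)
        fun t ht => hneg t (hsub (by rwa [uIcc_of_le huv]))
    rw [e, intervalIntegral.integral_const, smul_eq_mul] at this
    linarith
  have hfirst : ∀ u ∈ Icc a b, ∀ v ∈ Icc a b, u ≤ v → (∀ t ∈ Icc u v, √lam ≤ |φ' t|) →
      ‖∫ t in u..v, exp (I * φ t)‖ ≤ 3 / √lam := by
    intro u hu v hv huv h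
    have hsub : Icc u v ⊆ Icc a b := Icc_subset_Icc hu.1 hv.2
    exact vanDerCorput_first huv hs (fun t ht => h1 t (hsub ht)) (fun t ht => h2 t (hsub ht))
      (hc.mono hsub) (fun t ht => by linarith [hneg t (hsub ht)]) h
  have hh : lam * (1 / √lam) = √lam := by
    rw [mul_one_div, div_eq_iff hs.ne', hss]
  have hpos : ∀ u ∈ Icc a b, 0 ≤ φ' u → ‖∫ t in a..u, exp (I * φ t)‖ ≤ 4 / √lam := by
    intro u hu h0
    rcases le_total (u - 1 / √lam) a with h | h
    · refine (norm_integral_cexp_le hu.1).trans ?_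
      have : 1 / √lam ≤ 4 / √lam := by gcongr; norm_num
      linarith
    · have hm : u - 1 / √lam ∈ Icc a b := ⟨h, by have := one_div_pos.2 hs; linarith [hu.2]⟩
      rw [← intervalIntegral.integral_add_adjacent_intervals
        (hint a (left_mem_Icc.2 hab) _ hm) (hint _ hm u hu)]
      have e1 := hfirst a (left_mem_Icc.2 hab) _ hm h fun t ht => by
        have := hdecr t ⟨ht.1, ht.2.trans hm.2⟩ u hu (by linarith [ht.2, one_div_pos.2 hs])
        have h3 : lam * (1 / √lam) ≤ lam * (u - t) := by gcongr; linarith [ht.2]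
        rw [hh] at h3
        exact le_trans (by linarith) (le_abs_self _)
      have e2 := norm_integral_cexp_le (φ := φ) (a := u - 1 / √lam) (b := u)
        (by linarith [one_div_pos.2 hs])
      calc _ ≤ 3 / √lam + 1 / √lam := (norm_add_le _ _).trans (add_le_add e1 (by linarith))
        _ = _ := by ring
  have hnegv : ∀ u ∈ Icc a b, φ' u ≤ 0 → ‖∫ t in u..b, exp (I * φ t)‖ ≤ 4 / √lam := by
    intro u hu h0
    rcases le_total b (u + 1 / √lam) with h | h
    · refine (norm_integral_cexp_le hu.2).trans ?_
      have : 1 / √lam ≤ 4 / √lam := by gcongr; norm_num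
      linarith
    · have hm : u + 1 / √lam ∈ Icc a b := ⟨by have := one_div_pos.2 hs; linarith [hu.1], h⟩
      rw [← intervalIntegral.integral_add_adjacent_intervals
        (hint u hu _ hm) (hint _ hm b (right_mem_Icc.2 hab))]
      have e1 := hfirst _ hm b (right_mem_Icc.2 hab) h fun t ht => by
        have := hdecr u hu t ⟨hm.1.trans ht.1, ht.2⟩ (by linarith [ht.1, one_div_pos.2 hs])
        have h3 : lam * (1 / √lam) ≤ lam * (t - u) := by gcongr; linarith [ht.1]
        rw [hh] at h3
        exact le_trans (by linarith) (neg_le_abs _)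
      have e2 := norm_integral_cexp_le (φ := φ) (a := u) (b := u + 1 / √lam)
        (by linarith [one_div_pos.2 hs])
      calc _ ≤ 1 / √lam + 3 / √lam := (norm_add_le _ _).trans (add_le_add (by linarith) e1)
        _ = _ := by ring
  have h48 : 4 / √lam ≤ 8 / √lam := by gcongr; norm_num
  rcases le_total 0 (φ' b) with hb | hb
  · exact (hpos b (right_mem_Icc.2 hab) hb).trans h48
  rcases le_total (φ' a) 0 with ha | ha
  · exact (hnegv a (left_mem_Icc.2 hab) ha).trans h48
  obtain ⟨m, hm, hm0⟩ := intermediate_value_Icc' hab hc2 ⟨hb, ha⟩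
  rw [← intervalIntegral.integral_add_adjacent_intervals
        (hint a (left_mem_Icc.2 hab) _ hm) (hint _ hm b (right_mem_Icc.2 hab))]
  calc _ ≤ 4 / √lam + 4 / √lam := (norm_add_le _ _).trans
        (add_le_add (hpos m hm hm0.ge) (hnegv m hm hm0.le))
    _ = _ := by ring

/-- Partial summation: an amplitude of bounded variation costs its size and its variation. -/
theorem norm_integral_mul_le_of_deriv {G A A' : ℝ → ℂ} {a b v K L : ℝ} (hab : a ≤ b)
    (hG : Continuous G) (hA : ∀ t ∈ Icc a b, HasDerivAt A (A' t) t)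
    (hA' : ContinuousOn A' (Icc a b)) (hv : ∀ u ∈ Icc a b, ‖∫ t in a..u, G t‖ ≤ v)
    (hK : ‖A b‖ ≤ K) (hL : ∀ t ∈ Icc a b, ‖A' t‖ ≤ L) :
    ‖∫ t in a..b, A t * G t‖ ≤ v * (K + L * (b - a)) := by
  have huIcc : uIcc a b = Icc a b := uIcc_of_le hab
  have hF : ∀ u, HasDerivAt (fun u => ∫ t in a..u, G t) (G u) u := fun u =>
    intervalIntegral.integral_hasDerivAt_right (hG.intervalIntegrable _ _)
      (hG.stronglyMeasurableAtFilter _ _) hG.continuousAt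
  have key := intervalIntegral.integral_mul_deriv_eq_deriv_mul
    (fun t ht => hA t (huIcc ▸ ht)) (fun t _ => hF t)
    (huIcc ▸ hA').intervalIntegrable (hG.intervalIntegrable a b)
  rw [key, intervalIntegral.integral_same, mul_zero, sub_zero]
  have hv0 : 0 ≤ v := (norm_nonneg _).trans (hv a (left_mem_Icc.2 hab))
  have hL0 : 0 ≤ L := (norm_nonneg _).trans (hL a (left_mem_Icc.2 hab))
  have e1 : ‖A b * ∫ t in a..b, G t‖ ≤ K * v := by
    rw [norm_mul]
    exact mul_le_mul hK (hv b (right_mem_Icc.2 hab)) (norm_nonneg _) ((norm_nonneg _).trans hK)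
  have e2 : ‖∫ t in a..b, A' t * ∫ x in a..t, G x‖ ≤ L * v * |b - a| := by
    apply intervalIntegral.norm_integral_le_of_norm_le_const
    intro t ht
    rw [uIoc_of_le hab] at ht
    rw [norm_mul]
    exact mul_le_mul (hL t (Ioc_subset_Icc_self ht)) (hv t (Ioc_subset_Icc_self ht))
      (norm_nonneg _) hL0
  rw [abs_of_nonneg (by linarith)] at e2
  calc _ ≤ K * v + L * v * (b - a) := (norm_sub_le _ _).trans (add_le_add e1 e2)
    _ = _ := by ring

end ShellProjection

/-! ### The kernel of the damped Schrödinger propagator on a time window -/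

namespace ShellProjection

open Complex FourierTransform

/-- The multiplier `∫_a^b e^{-εt} e^{-(1 - it)(v - s)} dt`, a function of `v = |ξ|²`. -/
noncomputable def timeSymbol (ε s a b v : ℝ) : ℂ :=
  ∫ t in a..b, exp (-(ε * t : ℝ) - (1 - I * t) * ((v - s : ℝ) : ℂ))

/-- The amplitude of the kernel of the damped Schrödinger propagator. -/
noncomputable def kernelAmplitude (d : ℕ) (ε s r : ℝ) (z : ℂ) : ℂ :=
  exp (-(ε * z) + s) * (Real.pi / (1 - I * z)) ^ ((d : ℂ) / 2) * exp (-(r / (1 + z ^ 2)))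

/-- The phase of the kernel of the damped Schrödinger propagator. -/
noncomputable def kernelPhase (s r t : ℝ) : ℝ := -s * t - r * (t / (1 + t ^ 2))

theorem one_sub_I_mul_ne_zero (t : ℝ) : (1 - I * t : ℂ) ≠ 0 := fun h => by
  have := congrArg re h; simp at this

theorem one_add_sq_ofReal_ne_zero (t : ℝ) : (1 + (t : ℂ) ^ 2 : ℂ) ≠ 0 := by
  have : (1 + t ^ 2 : ℝ) ≠ 0 := by positivity
  exact_mod_cast this

/-- Fubini, then the Fourier transform of the Gaussian with complex parameter 1 - it. Since 1/(1 -
it) = (1 + it)/(1 + t²), its exponent splits into the decay e^{-r/(1+t²)} and the oscillation, with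
r = π²|w|². -/
theorem fourier_timeSymbol {d : ℕ} {ε s a b : ℝ} (ha : 0 ≤ a) (hab : a ≤ b) (hε : 0 ≤ ε)
    (w : E d) :
    𝓕 (fun ξ : E d => timeSymbol ε s a b (‖ξ‖ ^ 2)) w =
      ∫ t in a..b, kernelAmplitude d ε s (Real.pi ^ 2 * ‖w‖ ^ 2) t *
        exp (I * kernelPhase s (Real.pi ^ 2 * ‖w‖ ^ 2) t) := by
  set F : E d → ℝ → ℂ := fun ξ t => (Real.fourierChar (-inner ℝ ξ w) : ℂ) *
    exp (-(ε * t : ℝ) - (1 - I * t) * ((‖ξ‖ ^ 2 - s : ℝ) : ℂ)) with hF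
  have hFc : Continuous (Function.uncurry F) := by
    have h1 : Continuous fun p : E d × ℝ => (Real.fourierChar (-inner ℝ p.1 w) : ℂ) :=
      continuous_subtype_val.comp (Real.continuous_fourierChar.comp (by fun_prop))
    exact h1.mul (by fun_prop)
  have hbound : Integrable (fun p : E d × ℝ => Real.exp (-1 * ‖p.1‖ ^ 2) * Real.exp s)
      (volume.prod (volume.restrict (Ioc a b))) := by
    have : Integrable (fun v : E d => Real.exp (-1 * ‖v‖ ^ 2)) := by
      have := (GaussianFourier.integrable_cexp_neg_mul_sq_norm_add (b := 1) (by simp) 0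
        (0 : E d)).norm
      refine this.congr (Filter.Eventually.of_forall fun v => ?_)
      simp only [norm_exp]
      congr 1
      simp [← ofReal_pow]
    exact this.mul_prod (g := fun _ => Real.exp s) (by simp)
  have hFi : Integrable (Function.uncurry F) (volume.prod (volume.restrict (Ioc a b))) := by
    refine hbound.mono' hFc.aestronglyMeasurable ?_
    have : ∀ᵐ p : E d × ℝ ∂(volume.prod (volume.restrict (Ioc a b))), p.2 ∈ Ioc a b := by
      have := Measure.quasiMeasurePreserving_snd (μ := (volume : Measure (E d)))
        (ν := volume.restrict (Ioc a b))
      exact this.ae (ae_restrict_mem measurableSet_Ioc)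
    filter_upwards [this] with p hp
    rw [Function.uncurry, hF]
    simp only [norm_mul, Circle.norm_coe, one_mul, norm_exp]
    rw [← Real.exp_add]
    apply Real.exp_le_exp.2
    have : 0 ≤ ε * p.2 := mul_nonneg hε (ha.trans hp.1.le)
    simp [-ofReal_pow]
    linarith
  have e1 : 𝓕 (fun ξ : E d => timeSymbol ε s a b (‖ξ‖ ^ 2)) w =
      ∫ ξ : E d, ∫ t in Ioc a b, F ξ t := by
    rw [Real.fourier_eq]
    congr 1; ext ξ
    rw [timeSymbol, intervalIntegral.integral_of_le hab, hF]
    simp only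
    rw [integral_const_mul, Circle.smul_def, smul_eq_mul]
  rw [e1, integral_integral_swap hFi, intervalIntegral.integral_of_le hab]
  congr 1; ext t
  have e2 : ∫ ξ : E d, F ξ t = exp (-(ε * t) + s * (1 - I * t)) *
      𝓕 (fun v : E d => exp (-(1 - I * t) * ‖v‖ ^ 2)) w := by
    rw [Real.fourier_eq, ← integral_const_mul]
    congr 1; ext ξ
    rw [hF]
    simp only [Circle.smul_def, smul_eq_mul]
    rw [mul_left_comm, ← exp_add]
    congr 2
    push_cast; ring
  rw [e2, fourier_gaussian_innerProductSpace (by simp), finrank_euclideanSpace_fin]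
  rw [kernelAmplitude, kernelPhase]
  have h1 := one_sub_I_mul_ne_zero t
  have h2 := one_add_sq_ofReal_ne_zero t
  have h3 : exp (-(ε * t) + s * (1 - I * t)) * exp (-Real.pi ^ 2 * ‖w‖ ^ 2 / (1 - I * t)) =
      exp (-(ε * t) + s) * exp (-(((Real.pi ^ 2 * ‖w‖ ^ 2 : ℝ) : ℂ) / (1 + (t : ℂ) ^ 2))) *
        exp (I * ((-s * t - Real.pi ^ 2 * ‖w‖ ^ 2 * (t / (1 + t ^ 2)) : ℝ) : ℂ)) := by
    rw [← exp_add, ← exp_add, ← exp_add]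
    congr 1
    have h4 : (1 + (t : ℂ) ^ 2) = (1 - I * t) * (1 + I * t) := by
      linear_combination ((t : ℂ) ^ 2) * I_sq
    have h5 : 1 / (1 - I * t : ℂ) = (1 + I * t) / (1 + (t : ℂ) ^ 2) := by
      rw [div_eq_div_iff h1 h2, h4]; ring
    push_cast
    linear_combination (-(Real.pi : ℂ) ^ 2 * ‖w‖ ^ 2) * h5
  linear_combination (Real.pi / (1 - I * t)) ^ ((d : ℂ) / 2) * h3

theorem norm_kernelAmplitude_le {d : ℕ} {ε s r t : ℝ} (ht : 0 < t) (hs : s ≤ 1) :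
    ‖kernelAmplitude d ε s r t‖ ≤
      Real.exp 1 * (Real.pi / t) ^ ((d : ℝ) / 2) *
        (Real.exp (-(ε * t)) * Real.exp (-(r / (1 + t ^ 2)))) := by
  rw [kernelAmplitude, norm_mul, norm_mul, norm_exp, norm_exp]
  have e1 : ((d : ℂ) / 2) = (((d : ℝ) / 2 : ℝ) : ℂ) := by push_cast; ring
  rw [e1, norm_cpow_real, norm_div, norm_real, Real.norm_of_nonneg Real.pi_pos.le]
  have e2 : t ≤ ‖(1 - I * t : ℂ)‖ := by
    have := abs_im_le_norm (1 - I * t : ℂ)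
    simp only [sub_im, one_im, mul_im, I_re, ofReal_im, I_im, ofReal_re, zero_sub, abs_neg] at this
    simpa [abs_of_pos ht] using this
  have e3 : (-(ε * t : ℂ) + s).re = -(ε * t) + s := by simp
  have e4 : (-(r / (1 + (t : ℂ) ^ 2)) : ℂ).re = -(r / (1 + t ^ 2)) := by
    have : (-(r / (1 + (t : ℂ) ^ 2)) : ℂ) = ((-(r / (1 + t ^ 2)) : ℝ) : ℂ) := by push_cast; ring
    rw [this, ofReal_re]
  rw [e3, e4, Real.exp_add]
  have e5 : (Real.pi / ‖(1 - I * t : ℂ)‖) ^ ((d : ℝ) / 2) ≤ (Real.pi / t) ^ ((d : ℝ) / 2) := by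
    have := Real.pi_pos
    gcongr
  calc _ ≤ Real.exp (-(ε * t)) * Real.exp 1 * (Real.pi / t) ^ ((d : ℝ) / 2) *
        Real.exp (-(r / (1 + t ^ 2))) := by gcongr
    _ = _ := by ring

theorem hasDerivAt_kernelAmplitude (d : ℕ) (ε s r t : ℝ) :
    HasDerivAt (fun t : ℝ => kernelAmplitude d ε s r t)
      (kernelAmplitude d ε s r t *
        (-ε + (d : ℂ) / 2 * (I / (1 - I * t)) + 2 * r * t / (1 + (t : ℂ) ^ 2) ^ 2)) t := by
  have h1 := one_sub_I_mul_ne_zero t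
  have h2 := one_add_sq_ofReal_ne_zero t
  have hpi : (Real.pi : ℂ) ≠ 0 := by exact_mod_cast Real.pi_ne_zero
  have hslit : (Real.pi / (1 - I * t) : ℂ) ∈ slitPlane := by
    left
    rw [div_re]
    have : 0 < normSq (1 - I * t : ℂ) := normSq_pos.2 h1
    have := Real.pi_pos
    simp
    positivity
  have d1 : HasDerivAt (fun z : ℂ => exp (-(ε * z) + s)) (exp (-(ε * (t : ℂ)) + s) * -ε) (t : ℂ) := by
    have := (((hasDerivAt_id (t : ℂ)).const_mul (ε : ℂ)).neg.add_const (s : ℂ)).cexp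
    simpa using this
  have d2 : HasDerivAt (fun z : ℂ => (Real.pi / (1 - I * z) : ℂ))
      (Real.pi * I / (1 - I * t) ^ 2) (t : ℂ) := by
    have := (((hasDerivAt_id (t : ℂ)).const_mul I).const_sub 1).inv h1
    have := this.const_mul (Real.pi : ℂ)
    refine (this.congr_deriv ?_)
    simp; ring
  have d3 := d2.cpow_const (c := (d : ℂ) / 2) hslit
  have d4 : HasDerivAt (fun z : ℂ => exp (-(r / (1 + z ^ 2))))
      (exp (-(r / (1 + (t : ℂ) ^ 2))) * (2 * r * t / (1 + (t : ℂ) ^ 2) ^ 2)) (t : ℂ) := by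
    have := ((((((hasDerivAt_id (t : ℂ)).pow 2).const_add 1).inv h2).const_mul (r : ℂ)).neg).cexp
    refine (this.congr_deriv ?_)
    simp [div_eq_mul_inv]
    ring
  have := ((d1.mul d3).mul d4).comp_ofReal
  refine this.congr_deriv ?_
  rw [cpow_sub _ _ (slitPlane_ne_zero hslit), cpow_one, kernelAmplitude]
  simp only [Pi.mul_apply]
  field_simp

/-- Every term of the logarithmic derivative costs 1/t uniformly in ε and r: the factors εt and r/(1
+ t²) are absorbed by the exponentials in the amplitude, because y e^{-y} ≤ 1. -/
theorem norm_kernelAmplitude_deriv_le {d : ℕ} {ε s r t : ℝ} (ht : 0 < t) (hs : s ≤ 1) (hε : 0 ≤ ε)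
    (hr : 0 ≤ r) :
    ‖kernelAmplitude d ε s r t *
        (-ε + (d : ℂ) / 2 * (I / (1 - I * t)) + 2 * r * t / (1 + (t : ℂ) ^ 2) ^ 2)‖ ≤
      Real.exp 1 * (Real.pi / t) ^ ((d : ℝ) / 2) * ((3 + d / 2) / t) := by
  set x := r / (1 + t ^ 2) with hx
  have hx0 : 0 ≤ x := by positivity
  have e2 : t ≤ ‖(1 - I * t : ℂ)‖ := by
    have := abs_im_le_norm (1 - I * t : ℂ)
    simp only [sub_im, one_im, mul_im, I_re, ofReal_im, I_im, ofReal_re, zero_sub, abs_neg] at this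
    simpa [abs_of_pos ht] using this
  have hL : ‖(-ε + (d : ℂ) / 2 * (I / (1 - I * t)) + 2 * r * t / (1 + (t : ℂ) ^ 2) ^ 2)‖ ≤
      ε + (d / 2) / t + 2 * x / t := by
    refine (norm_add_le _ _).trans (add_le_add ((norm_add_le _ _).trans (add_le_add ?_ ?_)) ?_)
    · simp [abs_of_nonneg hε]
    · rw [norm_mul, norm_div (d : ℂ), norm_div I, norm_I, RCLike.norm_natCast, div_eq_mul_inv _ t]
      have : ‖(2 : ℂ)‖ = 2 := by simp
      rw [this, one_div]
      gcongr
    · have : (2 * r * t / (1 + (t : ℂ) ^ 2) ^ 2 : ℂ) = ((2 * r * t / (1 + t ^ 2) ^ 2 : ℝ) : ℂ) := by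
        push_cast; ring
      rw [this, norm_real, Real.norm_of_nonneg (by positivity), hx]
      rw [div_le_div_iff₀ (by positivity) ht]
      have : 2 * (r / (1 + t ^ 2)) * (1 + t ^ 2) ^ 2 = 2 * r * (1 + t ^ 2) := by field_simp
      rw [this]
      nlinarith
  have hA := norm_kernelAmplitude_le (d := d) (ε := ε) (r := r) ht hs
  rw [norm_mul]
  refine (mul_le_mul hA hL (norm_nonneg _) (by have := Real.pi_pos; positivity)).trans ?_
  rw [mul_assoc]
  have hpi := Real.pi_pos
  gcongr
  rw [← hx]
  have k1 : Real.exp (-(ε * t)) * (ε * t) ≤ 1 := by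
    have := Real.mul_exp_neg_le_exp_neg_one (ε * t)
    have h1 : Real.exp (-1) ≤ 1 := Real.exp_le_one_iff.2 (by norm_num)
    linarith
  have k2 : Real.exp (-x) * x ≤ 1 := by
    have := Real.mul_exp_neg_le_exp_neg_one x
    have h1 : Real.exp (-1) ≤ 1 := Real.exp_le_one_iff.2 (by norm_num)
    linarith
  have k3 : Real.exp (-(ε * t)) ≤ 1 := Real.exp_le_one_iff.2 (by have := mul_nonneg hε ht.le; linarith)
  have k4 : Real.exp (-x) ≤ 1 := Real.exp_le_one_iff.2 (by linarith)
  have p1 := Real.exp_pos (-(ε * t))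
  have p2 := Real.exp_pos (-x)
  have : Real.exp (-(ε * t)) * Real.exp (-x) * (ε + (d / 2) / t + 2 * x / t) =
      (Real.exp (-x) * (Real.exp (-(ε * t)) * (ε * t)) + Real.exp (-(ε * t)) * Real.exp (-x) * (d / 2)
        + 2 * (Real.exp (-(ε * t)) * (Real.exp (-x) * x))) / t := by
    field_simp
  rw [this]
  refine div_le_div_of_nonneg_right ?_ ht.le
  have q1 : Real.exp (-x) * (Real.exp (-(ε * t)) * (ε * t)) ≤ 1 * 1 :=
    mul_le_mul k4 k1 (by positivity) zero_le_one
  have q2 : Real.exp (-(ε * t)) * Real.exp (-x) * (d / 2 : ℝ) ≤ 1 * 1 * (d / 2 : ℝ) := by gcongr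
  have q3 : Real.exp (-(ε * t)) * (Real.exp (-x) * x) ≤ 1 * 1 :=
    mul_le_mul k3 k2 (by positivity) zero_le_one
  linarith

theorem hasDerivAt_kernelPhase (s r t : ℝ) :
    HasDerivAt (kernelPhase s r) (-s - r * ((1 - t ^ 2) / (1 + t ^ 2) ^ 2)) t := by
  have h : (1 + t ^ 2 : ℝ) ≠ 0 := by positivity
  have := ((hasDerivAt_id t).const_mul (-s)).sub
    (((hasDerivAt_id t).div (((hasDerivAt_id t).pow 2).const_add 1) h).const_mul r)
  refine this.congr_deriv ?_
  simp; left; ring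

theorem hasDerivAt_kernelPhase_deriv (s r t : ℝ) :
    HasDerivAt (fun t => -s - r * ((1 - t ^ 2) / (1 + t ^ 2) ^ 2))
      (-(r * (2 * t * (t ^ 2 - 3) / (1 + t ^ 2) ^ 3))) t := by
  have h : (1 + t ^ 2 : ℝ) ≠ 0 := by positivity
  have := (((((hasDerivAt_id t).pow 2).const_sub 1).div ((((hasDerivAt_id t).pow 2).const_add 1).pow 2)
    (pow_ne_zero 2 h)).const_mul r).const_sub (-s)
  refine this.congr_deriv ?_
  simp only [id]
  field_simp
  simp; ring

/-- Starting at time 2 makes t² - 3 positive, so φ'' ≤ 0. If r ≤ a²/4, the term -s dominates φ' and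
|φ'| ≥ 1/2 - 1/4; if r ≥ a²/4, the second derivative has size at least about 1/a. -/
theorem norm_integral_kernelPhase_le {s r a u : ℝ} (hs : 1 / 2 ≤ s) (hr : 0 ≤ r) (ha : 2 ≤ a)
    (hu : u ∈ Icc a (2 * a)) : ‖∫ t in a..u, exp (I * kernelPhase s r t)‖ ≤ 90 * √a := by
  have ha0 : 0 < a := by linarith
  have hcont : ContinuousOn (fun t : ℝ => -(r * (2 * t * (t ^ 2 - 3) / (1 + t ^ 2) ^ 3))) (Icc a u) := by
    refine Continuous.continuousOn ?_
    refine (continuous_const.mul (Continuous.div (by fun_prop) (by fun_prop) fun t => ?_)).neg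
    positivity
  have hsqrt : 1 ≤ √a := Real.one_le_sqrt.2 (by linarith)
  rcases le_total r (a ^ 2 / 4) with h | h
  · have := vanDerCorput_first (μ := 1 / 4) hu.1 (by norm_num)
      (fun t _ => hasDerivAt_kernelPhase s r t) (fun t _ => hasDerivAt_kernelPhase_deriv s r t)
      hcont (fun t ht => ?_) (fun t ht => ?_)
    · linarith
    · have : 2 ≤ t := ha.trans ht.1
      have : 0 ≤ t ^ 2 - 3 := by nlinarith
      rw [neg_nonpos]
      positivity
    · have h2 : a ≤ t := ht.1
      have h3 : (t ^ 2 - 1) / (1 + t ^ 2) ^ 2 ≤ 1 / a ^ 2 := by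
        rw [div_le_div_iff₀ (by positivity) (by positivity)]
        nlinarith [mul_self_nonneg (t ^ 2), mul_le_mul h2 h2 ha0.le (by linarith)]
      have h4 : r * ((t ^ 2 - 1) / (1 + t ^ 2) ^ 2) ≤ a ^ 2 / 4 * (1 / a ^ 2) := by
        refine mul_le_mul h h3 (div_nonneg (by nlinarith) (by positivity)) (by positivity)
      have h5 : a ^ 2 / 4 * (1 / a ^ 2) = 1 / 4 := by field_simp
      rw [abs_of_neg]
      · have : (1 - t ^ 2) / (1 + t ^ 2) ^ 2 = -((t ^ 2 - 1) / (1 + t ^ 2) ^ 2) := by ring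
        rw [this]; linarith
      · have : (1 - t ^ 2) / (1 + t ^ 2) ^ 2 = -((t ^ 2 - 1) / (1 + t ^ 2) ^ 2) := by ring
        rw [this]; linarith
  -- With t² - 3 ≥ t²/4 and 1 + t² ≤ 5t²/4 one gets -φ'' ≥ 8a²/(125t³), which is at least 1/(125a)
  -- for t ≤ 2a.
  · have := vanDerCorput_second (lam := 1 / (125 * a)) hu.1 (by positivity)
      (fun t _ => hasDerivAt_kernelPhase s r t) (fun t _ => hasDerivAt_kernelPhase_deriv s r t)
      hcont (fun t ht => ?_)
    · refine this.trans ?_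
      rw [one_div, Real.sqrt_inv, div_inv_eq_mul, Real.sqrt_mul (by norm_num), ← mul_assoc]
      gcongr
      have : √125 ≤ 90 / 8 := Real.sqrt_le_iff.2 ⟨by norm_num, by norm_num⟩
      linarith
    · have h2 : a ≤ t := ht.1
      have h22 : 2 ≤ t := ha.trans h2
      have h3 : t ≤ 2 * a := ht.2.trans hu.2
      rw [neg_le_neg_iff]
      have h4 : t ^ 2 / 4 ≤ t ^ 2 - 3 := by nlinarith
      have h5 : 1 + t ^ 2 ≤ 5 / 4 * t ^ 2 := by nlinarith
      have ht0 : 0 < t := by linarith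
      have h6 : (a ^ 2 / 4) * (2 * t * (t ^ 2 / 4) / (5 / 4 * t ^ 2) ^ 3) ≤
          r * (2 * t * (t ^ 2 - 3) / (1 + t ^ 2) ^ 3) := by
        refine mul_le_mul h ?_ (by positivity) hr
        refine div_le_div₀ (mul_nonneg (by positivity) (by nlinarith)) ?_ (by positivity) ?_
        · gcongr
        · gcongr
      refine le_trans ?_ h6
      have h7 : (a ^ 2 / 4) * (2 * t * (t ^ 2 / 4) / (5 / 4 * t ^ 2) ^ 3) =
          8 * a ^ 2 / (125 * t ^ 3) := by field_simp; norm_num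
      rw [h7, div_le_div_iff₀ (by positivity) (by positivity)]
      have h8 : t ^ 3 ≤ (2 * a) ^ 3 := by gcongr
      nlinarith

/-- The dispersive estimate for a dyadic time window. -/
theorem norm_fourier_timeSymbol_dyadic_le {d : ℕ} {ε s a : ℝ} (hε : 0 ≤ ε) (hs : 1 / 2 ≤ s)
    (hs1 : s ≤ 1) (ha : 2 ≤ a) (w : E d) :
    ‖𝓕 (fun ξ : E d => timeSymbol ε s a (2 * a) (‖ξ‖ ^ 2)) w‖ ≤
      90 * Real.exp 1 * Real.pi ^ ((d : ℝ) / 2) * (4 + d / 2) * a ^ ((1 - d : ℝ) / 2) := by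
  have ha0 : 0 < a := by linarith
  have hpi := Real.pi_pos
  rw [fourier_timeSymbol ha0.le (by linarith) hε]
  set r := Real.pi ^ 2 * ‖w‖ ^ 2 with hr
  have hr0 : 0 ≤ r := by positivity
  have hph : Continuous fun t => exp (I * kernelPhase s r t) := by
    have : Continuous (kernelPhase s r) := continuous_iff_continuousAt.2 fun t =>
      (hasDerivAt_kernelPhase s r t).continuousAt
    fun_prop
  have hcont : ContinuousOn (fun t : ℝ => kernelAmplitude d ε s r t *
      (-ε + (d : ℂ) / 2 * (I / (1 - I * t)) + 2 * r * t / (1 + (t : ℂ) ^ 2) ^ 2)) (Icc a (2 * a)) := by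
    refine Continuous.continuousOn (Continuous.mul ?_ ?_)
    · exact continuous_iff_continuousAt.2 fun t =>
        (hasDerivAt_kernelAmplitude d ε s r t).continuousAt
    · refine (continuous_const.add (continuous_const.mul (continuous_const.div (by fun_prop)
        fun t => one_sub_I_mul_ne_zero t))).add (Continuous.div (by fun_prop) (by fun_prop)
        fun t => pow_ne_zero 2 (one_add_sq_ofReal_ne_zero t))
  -- The amplitude has size (π/a)^{d/2} and its derivative an extra (3 + d/2)/a on an interval of
  -- length a; hence the factor 4 + d/2.
  have key := norm_integral_mul_le_of_deriv (a := a) (b := 2 * a) (v := 90 * √a)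
    (K := Real.exp 1 * (Real.pi / a) ^ ((d : ℝ) / 2))
    (L := Real.exp 1 * (Real.pi / a) ^ ((d : ℝ) / 2) * ((3 + d / 2) / a)) (by linarith) hph
    (fun t _ => hasDerivAt_kernelAmplitude d ε s r t) hcont
    (fun u hu => norm_integral_kernelPhase_le hs hr0 ha hu) ?_ ?_
  · refine key.trans (le_of_eq ?_)
    have e1 : a ^ ((1 - d : ℝ) / 2) = √a * (a ^ ((d : ℝ) / 2))⁻¹ := by
      rw [Real.sqrt_eq_rpow, ← Real.rpow_neg ha0.le, ← Real.rpow_add ha0]; congr 1; ring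
    rw [e1, Real.div_rpow hpi.le ha0.le]
    field_simp
    ring
  · refine (norm_kernelAmplitude_le (t := 2 * a) (by linarith) hs1).trans ?_
    have k3 : Real.exp (-(ε * (2 * a))) ≤ 1 :=
      Real.exp_le_one_iff.2 (by rw [neg_nonpos]; positivity)
    have k4 : Real.exp (-(r / (1 + (2 * a) ^ 2))) ≤ 1 :=
      Real.exp_le_one_iff.2 (by rw [neg_nonpos]; positivity)
    calc _ ≤ Real.exp 1 * (Real.pi / a) ^ ((d : ℝ) / 2) * (1 * 1) := by gcongr; linarith
      _ = _ := by ring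
  · intro t ht
    have ht0 : 0 < t := ha0.trans_le ht.1
    refine (norm_kernelAmplitude_deriv_le ht0 hs1 hε hr0).trans ?_
    have := ht.1
    gcongr

/-- No oscillation is needed here: the Gaussian damping replaces t^{-d/2} by |1 - it|^{-d/2} ≤ 1, so
the kernel stays bounded down to t = 0. -/
theorem norm_fourier_timeSymbol_initial_le {d : ℕ} {ε s : ℝ} (hε : 0 ≤ ε) (hs1 : s ≤ 1) (w : E d) :
    ‖𝓕 (fun ξ : E d => timeSymbol ε s 0 2 (‖ξ‖ ^ 2)) w‖ ≤
      2 * Real.exp 1 * Real.pi ^ ((d : ℝ) / 2) := by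
  have hpi := Real.pi_pos
  rw [fourier_timeSymbol le_rfl (by norm_num) hε]
  set r := Real.pi ^ 2 * ‖w‖ ^ 2 with hr
  have hr0 : 0 ≤ r := by positivity
  have := intervalIntegral.norm_integral_le_of_norm_le_const (a := 0) (b := 2)
    (C := Real.exp 1 * Real.pi ^ ((d : ℝ) / 2))
    (f := fun t : ℝ => kernelAmplitude d ε s r t * exp (I * kernelPhase s r t)) ?_
  · refine this.trans (le_of_eq ?_)
    norm_num; ring
  · intro t ht
    rw [uIoc_of_le (by norm_num)] at ht
    rw [norm_mul, mul_comm I, norm_exp_ofReal_mul_I, mul_one]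
    rw [kernelAmplitude, norm_mul, norm_mul, norm_exp, norm_exp]
    have e1 : ((d : ℂ) / 2) = (((d : ℝ) / 2 : ℝ) : ℂ) := by push_cast; ring
    rw [e1, norm_cpow_real, norm_div, norm_real, Real.norm_of_nonneg hpi.le]
    have e2 : 1 ≤ ‖(1 - I * t : ℂ)‖ := by
      have := abs_re_le_norm (1 - I * t : ℂ)
      simpa using this
    have e3 : (-(ε * t : ℂ) + s).re = -(ε * t) + s := by simp
    have e4 : (-(r / (1 + (t : ℂ) ^ 2)) : ℂ).re = -(r / (1 + t ^ 2)) := by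
      have : (-(r / (1 + (t : ℂ) ^ 2)) : ℂ) = ((-(r / (1 + t ^ 2)) : ℝ) : ℂ) := by push_cast; ring
      rw [this, ofReal_re]
    rw [e3, e4]
    have e5 : Real.exp (-(ε * t) + s) ≤ Real.exp 1 :=
      Real.exp_le_exp.2 (by have := mul_nonneg hε ht.1.le; linarith)
    have e6 : Real.exp (-(r / (1 + t ^ 2))) ≤ 1 :=
      Real.exp_le_one_iff.2 (by rw [neg_nonpos]; positivity)
    have e7 : (Real.pi / ‖(1 - I * t : ℂ)‖) ^ ((d : ℝ) / 2) ≤ Real.pi ^ ((d : ℝ) / 2) := by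
      apply Real.rpow_le_rpow (by positivity) (div_le_self hpi.le e2) (by positivity)
    calc _ ≤ Real.exp 1 * Real.pi ^ ((d : ℝ) / 2) * 1 := by gcongr
      _ = _ := by ring

end ShellProjection

/-! ### Test functions and the bilinear forms of Fourier multipliers -/

namespace ShellProjection

open Complex FourierTransform

/-- Measurable, integrable and bounded functions. -/
structure IsTest {α : Type*} [MeasurableSpace α] (μ : Measure α) (f : α → ℂ) : Prop where
  measurable : Measurable f
  integrable : Integrable f μ
  bounded : ∃ C, ∀ x, ‖f x‖ ≤ C

namespace IsTest

variable {α : Type*} [MeasurableSpace α] {μ : Measure α} {f g : α → ℂ}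

theorem memLp_top (hf : IsTest μ f) : MemLp f ∞ μ := by
  obtain ⟨C, hC⟩ := hf.bounded
  exact memLp_top_of_bound hf.measurable.aestronglyMeasurable C (Filter.Eventually.of_forall hC)

theorem memLp (hf : IsTest μ f) {p : ℝ≥0∞} (hp : 1 ≤ p) : MemLp f p μ := by
  rcases eq_or_ne p ∞ with rfl | h
  · exact hf.memLp_top
  obtain ⟨C, hC⟩ := hf.bounded
  have h1 : MemLp f 1 μ := memLp_one_iff_integrable.2 hf.integrable
  refine ⟨hf.measurable.aestronglyMeasurable, ?_⟩
  rw [eLpNorm_lt_top_iff_lintegral_rpow_enorm_lt_top (by positivity) h]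
  have hp' : 1 ≤ p.toReal := by
    rw [← ENNReal.toReal_one]; exact ENNReal.toReal_mono h hp
  have hle : ∀ x, ‖f x‖ₑ ^ p.toReal ≤ ENNReal.ofReal C ^ (p.toReal - 1) * ‖f x‖ₑ := fun x => by
    have hx : ‖f x‖ₑ ≤ ENNReal.ofReal C := by
      rw [← ofReal_norm]; exact ENNReal.ofReal_le_ofReal (hC x)
    calc ‖f x‖ₑ ^ p.toReal = ‖f x‖ₑ ^ ((p.toReal - 1) + 1) := by rw [sub_add_cancel]
      _ = ‖f x‖ₑ ^ (p.toReal - 1) * ‖f x‖ₑ := by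
        rw [ENNReal.rpow_add_of_nonneg _ _ (by linarith) zero_le_one, ENNReal.rpow_one]
      _ ≤ _ := by gcongr
  refine (lintegral_mono hle).trans_lt ?_
  rw [lintegral_const_mul' _ _ (ENNReal.rpow_ne_top_of_nonneg (by linarith) ENNReal.ofReal_ne_top)]
  exact ENNReal.mul_lt_top
    (ENNReal.rpow_lt_top_of_nonneg (by linarith) ENNReal.ofReal_ne_top) hf.integrable.2

theorem integrable_rpow (hf : IsTest μ f) {p : ℝ} (hp : 1 ≤ p) :
    Integrable (fun x => ‖f x‖ ^ p) μ := by
  have h1 : (1 : ℝ≥0∞) ≤ ENNReal.ofReal p := by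
    rw [← ENNReal.ofReal_one]; exact ENNReal.ofReal_le_ofReal hp
  have := (hf.memLp h1).integrable_norm_rpow (by positivity) ENNReal.ofReal_ne_top
  rwa [ENNReal.toReal_ofReal (by linarith)] at this

theorem integrable_sq (hf : IsTest μ f) : Integrable (fun x => ‖f x‖ ^ 2) μ := by
  simpa using hf.integrable_rpow (p := 2) (by norm_num)

theorem add (hf : IsTest μ f) (hg : IsTest μ g) : IsTest μ (f + g) := by
  obtain ⟨C, hC⟩ := hf.bounded
  obtain ⟨D, hD⟩ := hg.bounded
  exact ⟨hf.measurable.add hg.measurable, hf.integrable.add hg.integrable, C + D, fun x =>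
    (norm_add_le _ _).trans (add_le_add (hC x) (hD x))⟩

theorem smul (hf : IsTest μ f) (c : ℂ) : IsTest μ (c • f) := by
  obtain ⟨C, hC⟩ := hf.bounded
  exact ⟨hf.measurable.const_smul c, hf.integrable.smul c, ‖c‖ * C, fun x => by
    rw [Pi.smul_apply, norm_smul]; gcongr; exact hC x⟩

theorem conj (hf : IsTest μ f) : IsTest μ (fun x => (starRingEnd ℂ) (f x)) := by
  obtain ⟨C, hC⟩ := hf.bounded
  have h1 : Measurable fun x => (starRingEnd ℂ) (f x) :=
    continuous_conj.measurable.comp hf.measurable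
  exact ⟨h1, hf.integrable.mono h1.aestronglyMeasurable (by simp), C, by simpa using hC⟩

theorem indicator (hf : IsTest μ f) {s : Set α} (hs : MeasurableSet s) :
    IsTest μ (s.indicator f) := by
  obtain ⟨C, hC⟩ := hf.bounded
  exact ⟨hf.measurable.indicator hs, hf.integrable.indicator hs, C, fun x =>
    (norm_indicator_le_norm_self _ _).trans (hC x)⟩

end IsTest

variable {d : ℕ} {m f g : E d → ℂ}

theorem integral_fourier_mul (hf : Integrable f) (hg : Integrable g) :
    ∫ ξ, 𝓕 f ξ * g ξ = ∫ x, f x * 𝓕 g x := by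
  have := VectorFourier.integral_fourierIntegral_smul_eq_flip (L := innerₗ (E d))
    (e := Real.fourierChar) (μ := volume) (ν := volume) (f := f) (g := g)
    Real.continuous_fourierChar (by simpa using continuous_inner) hf hg
  simp only [flip_innerₗ, smul_eq_mul] at this
  exact this

theorem norm_fourier_le (f : E d → ℂ) (ξ : E d) : ‖𝓕 f ξ‖ ≤ ∫ x, ‖f x‖ :=
  VectorFourier.norm_fourierIntegral_le_integral_norm _ _ _ _ _

theorem norm_fourierInv_le (f : E d → ℂ) (ξ : E d) : ‖𝓕⁻ f ξ‖ ≤ ∫ x, ‖f x‖ := by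
  rw [Real.fourierInv_eq_fourier_neg]; exact norm_fourier_le _ _

theorem continuous_fourier (hf : Integrable f) : Continuous (𝓕 f) :=
  VectorFourier.fourierIntegral_continuous Real.continuous_fourierChar
    (innerSL ℝ).continuous₂ hf

theorem continuous_fourierInv (hf : Integrable f) : Continuous (𝓕⁻ f) := by
  have : 𝓕⁻ f = fun ξ => 𝓕 f (-ξ) := funext fun ξ => Real.fourierInv_eq_fourier_neg _ _
  rw [this]; exact (continuous_fourier hf).comp continuous_neg

theorem fourierInv_conj (f : E d → ℂ) (ξ : E d) :
    𝓕⁻ (fun x => (starRingEnd ℂ) (f x)) ξ = (starRingEnd ℂ) (𝓕 f ξ) := by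
  rw [Real.fourierInv_eq', Real.fourier_eq', ← integral_conj]
  congr 1; ext x
  rw [smul_eq_mul, smul_eq_mul, map_mul, ← exp_conj]
  congr 2
  simp only [map_mul, conj_ofReal, conj_I]
  push_cast
  ring

theorem fourier_conj (f : E d → ℂ) (ξ : E d) :
    𝓕 (fun x => (starRingEnd ℂ) (f x)) ξ = (starRingEnd ℂ) (𝓕⁻ f ξ) := by
  rw [Real.fourierInv_eq', Real.fourier_eq', ← integral_conj]
  congr 1; ext x
  rw [smul_eq_mul, smul_eq_mul, map_mul, ← exp_conj]
  congr 2
  simp only [map_mul, conj_ofReal, conj_I]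
  push_cast
  ring

/-- The abstract L² transform and the integral transform agree as distributions: both are tested
against smooth compactly supported functions, and the transform is moved onto the test function. -/
theorem fourier_toLp_ae_eq (hf : IsTest volume f) :
    (𝓕 ((hf.memLp (p := 2) (by norm_num)).toLp f) : Lp ℂ 2 (volume : Measure (E d)))
      =ᵐ[volume] 𝓕 f := by
  set u := (hf.memLp (p := 2) (by norm_num)).toLp f with hu
  set F : Lp ℂ 2 (volume : Measure (E d)) := 𝓕 u with hF
  have h1 : LocallyIntegrable F := (Lp.memLp F).locallyIntegrable (by norm_num)
  have h2 : LocallyIntegrable (𝓕 f) := (continuous_fourier hf.integrable).locallyIntegrable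
  refine ae_eq_of_integral_contDiff_smul_eq h1 h2 fun g hg hgc => ?_
  have hgC : ContDiff ℝ (⊤ : ℕ∞) fun x => (g x : ℂ) := ofRealCLM.contDiff.comp hg
  have hgcC : HasCompactSupport fun x => (g x : ℂ) := hgc.comp_left ofReal_zero
  set G : 𝓢(E d, ℂ) := hgcC.toSchwartzMap hgC with hG
  have hGx : ∀ x, G x = (g x : ℂ) := fun x => rfl
  have key := congrArg (fun T => T G) (Lp.fourier_toTemperedDistribution_eq u)
  simp only [TemperedDistribution.fourier_apply, Lp.toTemperedDistribution_apply] at key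
  rw [← hF] at key
  have e1 : ∫ x, g x • F x = ∫ x, G x • F x := by
    congr 1
  have e2 : ∫ x, g x • 𝓕 f x = ∫ x, 𝓕 f x * G x := by
    congr 1; ext x; rw [hGx, mul_comm]; rfl
  rw [e1, ← key, e2, integral_fourier_mul hf.integrable G.integrable]
  refine integral_congr_ae ?_
  filter_upwards [(hf.memLp (p := 2) (by norm_num)).coeFn_toLp] with x hx
  rw [hu, hx, smul_eq_mul, mul_comm, SchwartzMap.fourier_coe]

theorem integrable_norm_sq_fourier (hf : IsTest volume f) :
    Integrable (fun ξ => ‖𝓕 f ξ‖ ^ 2) := by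
  have := (Lp.memLp (𝓕 ((hf.memLp (p := 2) (by norm_num)).toLp f) :
    Lp ℂ 2 (volume : Measure (E d)))).ae_eq (fourier_toLp_ae_eq hf)
  exact this.integrable_norm_pow (by norm_num)

/-- Plancherel's identity for bounded integrable functions. -/
theorem integral_norm_sq_fourier (hf : IsTest volume f) :
    ∫ ξ, ‖𝓕 f ξ‖ ^ 2 = ∫ x, ‖f x‖ ^ 2 := by
  set u := (hf.memLp (p := 2) (by norm_num)).toLp f with hu
  have h := Lp.norm_fourier_eq u
  have h2 : ∀ v : Lp ℂ 2 (volume : Measure (E d)), ∫ x, ‖v x‖ ^ 2 = ‖v‖ ^ 2 := fun v => by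
    have := L2.inner_def (𝕜 := ℂ) v v
    rw [inner_self_eq_norm_sq_to_K] at this
    have h3 : ∀ x, inner ℂ (v x) (v x) = ((‖v x‖ ^ 2 : ℝ) : ℂ) := fun x => by
      rw [inner_self_eq_norm_sq_to_K]; norm_cast
    simp_rw [h3] at this
    rw [integral_complex_ofReal] at this
    apply ofReal_injective
    rw [← this]
    push_cast
    rfl
  have e1 : ∫ ξ, ‖𝓕 f ξ‖ ^ 2 = ∫ x, ‖(𝓕 u : Lp ℂ 2 (volume : Measure (E d))) x‖ ^ 2 := by
    refine integral_congr_ae ?_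
    filter_upwards [fourier_toLp_ae_eq hf] with x hx
    rw [hu, hx]
  have e2 : ∫ x, ‖f x‖ ^ 2 = ∫ x, ‖u x‖ ^ 2 := by
    refine integral_congr_ae ?_
    filter_upwards [(hf.memLp (p := 2) (by norm_num)).coeFn_toLp] with x hx
    rw [hu, hx]
  rw [e1, e2, h2, h2, h]

theorem integrable_norm_sq_fourierInv (hf : IsTest volume f) :
    Integrable (fun ξ => ‖𝓕⁻ f ξ‖ ^ 2) := by
  have := (integrable_norm_sq_fourier hf).comp_neg
  simpa [Real.fourierInv_eq_fourier_neg] using this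

theorem integral_norm_sq_fourierInv (hf : IsTest volume f) :
    ∫ ξ, ‖𝓕⁻ f ξ‖ ^ 2 = ∫ x, ‖f x‖ ^ 2 := by
  rw [← integral_norm_sq_fourier hf, ← integral_neg_eq_self]
  simp [Real.fourierInv_eq_fourier_neg]

/-- The bilinear form of a Fourier multiplier. -/
noncomputable def form (m f g : E d → ℂ) : ℂ := ∫ ξ, m ξ * 𝓕 f ξ * 𝓕⁻ g ξ

theorem integrable_form (hm : Integrable m) (hf : Integrable f) (hg : Integrable g) :
    Integrable fun ξ => m ξ * 𝓕 f ξ * 𝓕⁻ g ξ :=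
  (hm.mul_bdd (c := ∫ x, ‖f x‖) (continuous_fourier hf).aestronglyMeasurable
    (Filter.Eventually.of_forall (norm_fourier_le f))).mul_bdd (c := ∫ x, ‖g x‖)
    (continuous_fourierInv hg).aestronglyMeasurable
    (Filter.Eventually.of_forall (norm_fourierInv_le g))

theorem form_eq_integral_mul (hm : Integrable m) (hf : Integrable f) (hg : Integrable g) :
    form m f g = ∫ x, 𝓕⁻ (fun ξ => m ξ * 𝓕 f ξ) x * g x := by
  have h1 : Integrable fun ξ => m ξ * 𝓕 f ξ :=
    hm.mul_bdd (c := ∫ x, ‖f x‖) (continuous_fourier hf).aestronglyMeasurable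
      (Filter.Eventually.of_forall (norm_fourier_le f))
  have h2 := integral_fourier_mul hg h1.comp_neg
  rw [← integral_neg_eq_self] at h2
  simp only [neg_neg] at h2
  rw [form]
  have e1 : ∫ ξ, m ξ * 𝓕 f ξ * 𝓕⁻ g ξ = ∫ ξ, 𝓕 g (-ξ) * (m ξ * 𝓕 f ξ) := by
    congr 1; ext ξ; rw [Real.fourierInv_eq_fourier_neg, mul_comm]
  rw [e1, h2]
  congr 1; ext x
  rw [mul_comm, Real.fourierInv_eq_fourier_comp_neg]

/-- The operator is convolution with the transform of `m`. Moving 𝓕 from `f` onto the modulated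
symbol, whose transform is a translate of 𝓕 m, gives the bound without writing the convolution. -/
theorem norm_fourierInv_mul_fourier_le {K : ℝ} (hm : Integrable m) (hf : Integrable f)
    (hK : ∀ w, ‖𝓕 m w‖ ≤ K) (x : E d) :
    ‖𝓕⁻ (fun ξ => m ξ * 𝓕 f ξ) x‖ ≤ K * ∫ y, ‖f y‖ := by
  have hmx : Integrable fun ξ => Real.fourierChar (inner ℝ ξ x) • m ξ := by
    have := (Real.fourierIntegral_convergent_iff (f := m) (μ := volume) (-x)).2 hm
    simpa using this
  have e1 : 𝓕⁻ (fun ξ => m ξ * 𝓕 f ξ) x =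
      ∫ ξ, 𝓕 f ξ * (Real.fourierChar (inner ℝ ξ x) • m ξ) := by
    rw [Real.fourierInv_eq]
    congr 1; ext ξ
    rw [Circle.smul_def, Circle.smul_def, smul_eq_mul, smul_eq_mul]; ring
  rw [e1, integral_fourier_mul hf hmx, mul_comm, ← integral_mul_const]
  refine norm_integral_le_of_norm_le (hf.norm.mul_const K) (Filter.Eventually.of_forall fun y => ?_)
  rw [norm_mul]
  gcongr
  have : 𝓕 (fun ξ => Real.fourierChar (inner ℝ ξ x) • m ξ) y = 𝓕 m (y - x) := by
    rw [Real.fourier_eq, Real.fourier_eq]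
    congr 1; ext ξ
    rw [smul_smul, ← AddChar.map_add_eq_mul, inner_sub_right]
    congr 2; ring
  rw [this]; exact hK _

theorem norm_form_le_of_kernel {K : ℝ} (hm : Integrable m) (hf : Integrable f) (hg : Integrable g)
    (hK : ∀ w, ‖𝓕 m w‖ ≤ K) : ‖form m f g‖ ≤ K * (∫ x, ‖f x‖) * ∫ x, ‖g x‖ := by
  rw [form_eq_integral_mul hm hf hg, ← integral_const_mul]
  refine norm_integral_le_of_norm_le (hg.norm.const_mul _) (Filter.Eventually.of_forall fun y => ?_)
  rw [norm_mul]
  gcongr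
  exact norm_fourierInv_mul_fourier_le hm hf hK y

theorem integral_norm_mul_le_sqrt {α : Type*} [MeasurableSpace α] {μ : Measure α} {u v : α → ℂ}
    (hu : AEStronglyMeasurable u μ) (hv : AEStronglyMeasurable v μ)
    (hu2 : Integrable (fun x => ‖u x‖ ^ 2) μ) (hv2 : Integrable (fun x => ‖v x‖ ^ 2) μ) :
    ∫ x, ‖u x‖ * ‖v x‖ ∂μ ≤ √(∫ x, ‖u x‖ ^ 2 ∂μ) * √(∫ x, ‖v x‖ ^ 2 ∂μ) := by
  have h2 : (2 : ℝ≥0∞) = ENNReal.ofReal 2 := by norm_num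
  have hu' : MemLp u (ENNReal.ofReal 2) μ := by
    rw [← h2]; exact (memLp_two_iff_integrable_sq_norm hu).2 hu2
  have hv' : MemLp v (ENNReal.ofReal 2) μ := by
    rw [← h2]; exact (memLp_two_iff_integrable_sq_norm hv).2 hv2
  have := integral_mul_norm_le_Lp_mul_Lq (Real.HolderConjugate.two_two) hu' hv'
  simpa [Real.sqrt_eq_rpow] using this

/-- Cauchy–Schwarz, with Plancherel applied to `g` alone; the weighted norm of 𝓕 f is kept so that
Stein–Tomas can be inserted there. -/
theorem norm_form_le_l2 (hm : AEStronglyMeasurable m) (hf : IsTest volume f) (hg : IsTest volume g)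
    (hmf : Integrable fun ξ => ‖m ξ‖ ^ 2 * ‖𝓕 f ξ‖ ^ 2) :
    ‖form m f g‖ ≤ √(∫ ξ, ‖m ξ‖ ^ 2 * ‖𝓕 f ξ‖ ^ 2) * √(∫ x, ‖g x‖ ^ 2) := by
  have h1 := integral_norm_mul_le_sqrt
    (hm.mul (continuous_fourier hf.integrable).aestronglyMeasurable)
    (continuous_fourierInv hg.integrable).aestronglyMeasurable
    (by simpa [mul_pow] using hmf) (integrable_norm_sq_fourierInv hg)
  rw [integral_norm_sq_fourierInv hg] at h1
  refine (norm_integral_le_integral_norm _).trans ?_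
  simpa [mul_pow] using h1

theorem norm_form_le_bound {K : ℝ} (hK0 : 0 ≤ K) (hm : AEStronglyMeasurable m)
    (hK : ∀ ξ, ‖m ξ‖ ≤ K) (hf : IsTest volume f) (hg : IsTest volume g) :
    ‖form m f g‖ ≤ K * (√(∫ x, ‖f x‖ ^ 2) * √(∫ x, ‖g x‖ ^ 2)) := by
  have hle : ∀ ξ, ‖m ξ‖ ^ 2 * ‖𝓕 f ξ‖ ^ 2 ≤ K ^ 2 * ‖𝓕 f ξ‖ ^ 2 := fun ξ => by
    gcongr; exact hK ξ
  have hi : Integrable fun ξ => ‖m ξ‖ ^ 2 * ‖𝓕 f ξ‖ ^ 2 := by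
    refine ((integrable_norm_sq_fourier hf).const_mul (K ^ 2)).mono'
      ((hm.norm.pow 2).mul ((continuous_fourier hf.integrable).norm.pow 2).aestronglyMeasurable)
      (Filter.Eventually.of_forall fun ξ => ?_)
    rw [Real.norm_of_nonneg (by positivity)]
    exact hle ξ
  refine (norm_form_le_l2 hm hf hg hi).trans ?_
  rw [← mul_assoc]
  gcongr
  rw [← Real.sqrt_sq hK0, ← Real.sqrt_mul (by positivity), ← integral_norm_sq_fourier hf,
    ← integral_const_mul]
  exact Real.sqrt_le_sqrt (integral_mono hi ((integrable_norm_sq_fourier hf).const_mul _) hle)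

/-- This transfers estimates from the positive times to the negative ones, whose symbols are the
complex conjugates. -/
theorem form_conj (hm : ∀ ξ, m (-ξ) = m ξ) :
    form (fun ξ => (starRingEnd ℂ) (m ξ)) f g =
      (starRingEnd ℂ) (form m (fun x => (starRingEnd ℂ) (f x)) fun x => (starRingEnd ℂ) (g x)) := by
  rw [form, form, ← integral_conj, ← integral_neg_eq_self]
  congr 1; ext ξ
  rw [map_mul, map_mul, fourierInv_conj, fourier_conj, hm, conj_conj, conj_conj,
    Real.fourierInv_eq_fourier_neg, Real.fourierInv_eq_fourier_neg, neg_neg]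

theorem form_swap (hm : ∀ ξ, m (-ξ) = m ξ) : form m f g = form m g f := by
  rw [form, form, ← integral_neg_eq_self]
  congr 1; ext ξ
  rw [hm, Real.fourierInv_eq_fourier_neg, Real.fourierInv_eq_fourier_neg, neg_neg]
  ring

end ShellProjection

namespace ShellProjection

open Complex FourierTransform

/-! ### Geometric sums -/

/-- The bound is uniform in the centre `L`: replacing `L` by its integer part costs 2^κ, and then
the sum is a translate of a fixed two-sided geometric series. -/
theorem exists_sum_two_rpow_le {κ : ℝ} (hκ : 0 < κ) :
    ∃ C : ℝ, 0 < C ∧ ∀ (L : ℝ) (s : Finset ℤ), ∑ n ∈ s, (2 : ℝ) ^ (-κ * |n - L|) ≤ C := by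
  set r : ℝ := 2 ^ (-κ) with hr
  have hr0 : 0 < r := by positivity
  have hr1 : r < 1 := Real.rpow_lt_one_of_one_lt_of_neg (by norm_num) (by linarith)
  have hsum : Summable fun n : ℤ => r ^ n.natAbs := by
    refine Summable.of_nat_of_neg ?_ ?_
    · simpa using summable_geometric_of_lt_one hr0.le hr1
    · simpa using summable_geometric_of_lt_one hr0.le hr1
  refine ⟨2 ^ κ * (1 + ∑' n : ℤ, r ^ n.natAbs), by
    have : 0 ≤ ∑' n : ℤ, r ^ n.natAbs := tsum_nonneg fun n => by positivity
    positivity, fun L s => ?_⟩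
  have hterm : ∀ n : ℤ, (2 : ℝ) ^ (-κ * |n - L|) ≤ 2 ^ κ * r ^ (n - ⌊L⌋).natAbs := fun n => by
    have h1 : ((n - ⌊L⌋).natAbs : ℝ) - 1 ≤ |n - L| := by
      have h2 : ((n - ⌊L⌋).natAbs : ℝ) = |(n : ℝ) - ⌊L⌋| := by
        rw [Nat.cast_natAbs]; push_cast; rfl
      rw [h2]
      have h3 : |(L : ℝ) - ⌊L⌋| ≤ 1 := by
        rw [abs_of_nonneg (by linarith [Int.floor_le L])]; linarith [Int.lt_floor_add_one L]
      have := abs_sub_le (n : ℝ) L ⌊L⌋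
      linarith
    rw [hr, ← Real.rpow_natCast, ← Real.rpow_mul (by norm_num), ← Real.rpow_add (by norm_num)]
    apply Real.rpow_le_rpow_of_exponent_le (by norm_num)
    nlinarith
  refine (Finset.sum_le_sum fun n _ => hterm n).trans ?_
  rw [← Finset.mul_sum]
  gcongr
  have h2 : ∑ n ∈ s, r ^ (n - ⌊L⌋).natAbs ≤ ∑' n : ℤ, r ^ (n - ⌊L⌋).natAbs :=
    ((Equiv.subRight ⌊L⌋).summable_iff.2 hsum).sum_le_tsum s fun n _ => by positivity
  have h3 : ∑' n : ℤ, r ^ (n - ⌊L⌋).natAbs = ∑' n : ℤ, r ^ n.natAbs :=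
    (Equiv.subRight ⌊L⌋).tsum_eq fun n : ℤ => r ^ n.natAbs
  linarith

/-- Bourgain's summation trick. The decreasing and the increasing geometric sequence cross at i =
log₂(X/Y)/(α + β), where both equal the right-hand product; away from the crossing their minimum
decays geometrically. -/
theorem exists_sum_min_le {α β : ℝ} (hα : 0 < α) (hβ : 0 < β) :
    ∃ C : ℝ, 0 < C ∧ ∀ (X Y : ℝ) (n : ℕ), 0 ≤ X → 0 ≤ Y →
      ∑ i ∈ Finset.range n, min (2 ^ (-α * i) * X) (2 ^ (β * i) * Y) ≤
        C * (X ^ (β / (α + β)) * Y ^ (α / (α + β))) := by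
  obtain ⟨C, hC, hsum⟩ := exists_sum_two_rpow_le (lt_min hα hβ)
  refine ⟨C, hC, fun X Y n hX hY => ?_⟩
  have hab : 0 < α + β := by positivity
  rcases hX.eq_or_lt with rfl | hX
  · rw [Real.zero_rpow (by positivity), zero_mul, mul_zero]
    refine Finset.sum_nonpos fun i _ => ?_
    rw [mul_zero]; exact min_le_left _ _
  rcases hY.eq_or_lt with rfl | hY
  · rw [Real.zero_rpow (by positivity), mul_zero, mul_zero]
    refine Finset.sum_nonpos fun i _ => ?_
    rw [mul_zero]; exact min_le_right _ _
  set L : ℝ := Real.logb 2 (X / Y) / (α + β) with hL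
  set Z := X ^ (β / (α + β)) * Y ^ (α / (α + β)) with hZ
  have hZ0 : 0 < Z := by positivity
  have hXY : (2 : ℝ) ^ ((α + β) * L) = X / Y := by
    rw [hL, mul_div_cancel₀ _ hab.ne', Real.rpow_logb (by norm_num) (by norm_num) (by positivity)]
  have hpow : ∀ t, (2 : ℝ) ^ (t * L) = (X / Y) ^ (t / (α + β)) := fun t => by
    rw [← hXY, ← Real.rpow_mul (by norm_num)]; congr 1; field_simp
  have hXZ : X = Z * 2 ^ (α * L) := by
    rw [hpow, Real.div_rpow hX.le hY.le, hZ]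
    have : X ^ (β / (α + β)) * X ^ (α / (α + β)) = X := by
      rw [← Real.rpow_add hX, ← add_div, add_comm β, div_self hab.ne', Real.rpow_one]
    field_simp
    rw [this]
  have hYZ : Y = Z * 2 ^ (-(β * L)) := by
    rw [← neg_mul, hpow, Real.div_rpow hX.le hY.le, hZ, neg_div, Real.rpow_neg hX.le,
      Real.rpow_neg hY.le]
    have : Y ^ (α / (α + β)) * Y ^ (β / (α + β)) = Y := by
      rw [← Real.rpow_add hY, ← add_div, div_self hab.ne', Real.rpow_one]
    field_simp
    rw [this]
  have hterm : ∀ i : ℕ, min (2 ^ (-α * i) * X) (2 ^ (β * i) * Y) ≤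
      Z * 2 ^ (-(min α β) * |((i : ℤ) : ℝ) - L|) := fun i => by
    rcases le_total L i with h | h
    · refine (min_le_left _ _).trans ?_
      rw [hXZ, mul_left_comm, ← Real.rpow_add (by norm_num)]
      gcongr
      · norm_num
      · simp only [Int.cast_natCast]
        rw [abs_of_nonneg (by linarith)]
        nlinarith [min_le_left α β]
    · refine (min_le_right _ _).trans ?_
      rw [hYZ, mul_left_comm, ← Real.rpow_add (by norm_num)]
      gcongr
      · norm_num
      · simp only [Int.cast_natCast]
        rw [abs_of_nonpos (by linarith)]
        nlinarith [min_le_right α β]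
  refine (Finset.sum_le_sum fun i _ => hterm i).trans ?_
  rw [← Finset.mul_sum, mul_comm C]
  gcongr
  have := hsum L ((Finset.range n).map Nat.castEmbedding)
  simpa using this

/-! ### Restricted estimates -/

/-- `f` is measurable and dominated by the indicator of `X`, a set of finite measure. -/
structure SubInd {α : Type*} [MeasurableSpace α] (μ : Measure α) (f : α → ℂ) (X : Set α) :
    Prop where
  measurable : Measurable f
  measurableSet : MeasurableSet X
  finite : μ X ≠ ∞
  le : ∀ x, ‖f x‖ ≤ X.indicator 1 x

namespace SubInd

variable {α : Type*} [MeasurableSpace α] {μ : Measure α} {f : α → ℂ} {X : Set α}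

theorem norm_le_one (h : SubInd μ f X) (x : α) : ‖f x‖ ≤ 1 :=
  (h.le x).trans (indicator_le_self' (fun _ _ => zero_le_one) x)

theorem integrable_indicator (h : SubInd μ f X) : Integrable (X.indicator (1 : α → ℝ)) μ :=
  (integrable_indicator_iff h.measurableSet).2 (integrableOn_const h.finite)

theorem isTest (h : SubInd μ f X) : IsTest μ f :=
  ⟨h.measurable, h.integrable_indicator.mono' h.measurable.aestronglyMeasurable
    (Filter.Eventually.of_forall h.le), 1, h.norm_le_one⟩

theorem integral_norm_le (h : SubInd μ f X) : ∫ x, ‖f x‖ ∂μ ≤ μ.real X := by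
  refine (integral_mono h.isTest.integrable.norm h.integrable_indicator h.le).trans ?_
  rw [integral_indicator_one h.measurableSet]

theorem integral_norm_sq_le (h : SubInd μ f X) : ∫ x, ‖f x‖ ^ 2 ∂μ ≤ μ.real X := by
  refine (integral_mono h.isTest.integrable_sq h.isTest.integrable.norm fun x => ?_).trans
    h.integral_norm_le
  have := h.norm_le_one x
  have := norm_nonneg (f x)
  simp only
  nlinarith

theorem conj (h : SubInd μ f X) : SubInd μ (fun x => (starRingEnd ℂ) (f x)) X :=
  ⟨h.isTest.conj.measurable, h.measurableSet, h.finite, fun x => by simpa using h.le x⟩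

end SubInd

/-- The restricted estimate `|B(f, g)| ≤ M |X|^a |Y|^c` for `|f| ≤ 1_X` and `|g| ≤ 1_Y`. -/
def Restricted {α : Type*} [MeasurableSpace α] (μ : Measure α)
    (B : (α → ℂ) → (α → ℂ) → ℂ) (a c M : ℝ) : Prop :=
  ∀ f g X Y, SubInd μ f X → SubInd μ g Y → ‖B f g‖ ≤ M * (μ.real X ^ a * μ.real Y ^ c)

variable {d : ℕ} {m f g : E d → ℂ}

/-! ### The time symbols -/

theorem norm_timeIntegrand {ε s v t : ℝ} :
    ‖exp (-(ε * t : ℝ) - (1 - I * t) * ((v - s : ℝ) : ℂ))‖ =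
      Real.exp (-(ε * t)) * Real.exp (-(v - s)) := by
  rw [norm_exp, ← Real.exp_add]
  congr 1
  simp
  ring

theorem norm_timeSymbol_le {ε s a b : ℝ} (ha : 0 ≤ a) (hab : a ≤ b) (hε : 0 ≤ ε) (v : ℝ) :
    ‖timeSymbol ε s a b v‖ ≤ Real.exp (-(v - s)) * (b - a) := by
  have := intervalIntegral.norm_integral_le_of_norm_le_const (a := a) (b := b)
    (C := Real.exp (-(v - s)))
    (f := fun t : ℝ => exp (-(ε * t : ℝ) - (1 - I * t) * ((v - s : ℝ) : ℂ))) ?_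
  · rwa [abs_of_nonneg (by linarith)] at this
  · intro t ht
    rw [uIoc_of_le hab] at ht
    rw [norm_timeIntegrand]
    have : Real.exp (-(ε * t)) ≤ 1 := Real.exp_le_one_iff.2
      (by have := mul_nonneg hε (ha.trans ht.1.le); linarith)
    exact mul_le_of_le_one_left (Real.exp_pos _).le this

theorem timeSymbol_eq {ε s v : ℝ} (a b : ℝ) (h : (I * ((v - s : ℝ) : ℂ) - ε : ℂ) ≠ 0) :
    timeSymbol ε s a b v = exp (-((v - s : ℝ) : ℂ)) *
      ((exp ((I * ((v - s : ℝ) : ℂ) - ε) * b) - exp ((I * ((v - s : ℝ) : ℂ) - ε) * a)) /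
        (I * ((v - s : ℝ) : ℂ) - ε)) := by
  rw [timeSymbol, ← integral_exp_mul_complex h, ← intervalIntegral.integral_const_mul]
  congr 1; ext t
  rw [← exp_add]
  congr 1
  push_cast; ring

/-- The time integral is explicit, and the exponentials at its two ends have modulus at most 1. The
imaginary and the real part of the denominator yield the bounds by 1/|v - s| and by 1/ε. -/
theorem norm_timeSymbol_mul_norm_le {ε s a b v : ℝ} (ha : 0 ≤ a) (hab : a ≤ b) (hε : 0 ≤ ε) :
    ‖timeSymbol ε s a b v‖ * ‖(I * ((v - s : ℝ) : ℂ) - ε : ℂ)‖ ≤ 2 * Real.exp (-(v - s)) := by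
  rcases eq_or_ne (I * ((v - s : ℝ) : ℂ) - ε : ℂ) 0 with h | hne
  · rw [h, norm_zero, mul_zero]; positivity
  have hpos := norm_pos_iff.2 hne
  have hexp : ∀ t : ℝ, 0 ≤ t → ‖exp ((I * ((v - s : ℝ) : ℂ) - ε) * t)‖ ≤ 1 := fun t ht => by
    rw [norm_exp]
    apply Real.exp_le_one_iff.2
    simp
    positivity
  rw [timeSymbol_eq a b hne, norm_mul, norm_exp, norm_div]
  have e1 : (-((v - s : ℝ) : ℂ)).re = -(v - s) := by simp
  rw [e1]
  have e2 := (norm_sub_le (exp ((I * ((v - s : ℝ) : ℂ) - ε) * b))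
    (exp ((I * ((v - s : ℝ) : ℂ) - ε) * a))).trans
    (add_le_add (hexp b (ha.trans hab)) (hexp a ha))
  set D := ‖(I * ((v - s : ℝ) : ℂ) - ε : ℂ)‖
  calc _ ≤ Real.exp (-(v - s)) * ((1 + 1) / D) * D := by gcongr
    _ = _ := by field_simp; norm_num

theorem norm_timeSymbol_mul_le {ε s a b v : ℝ} (ha : 0 ≤ a) (hab : a ≤ b) (hε : 0 ≤ ε) :
    ‖timeSymbol ε s a b v‖ * |v - s| ≤ 2 * Real.exp (-(v - s)) := by
  refine le_trans ?_ (norm_timeSymbol_mul_norm_le ha hab hε)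
  gcongr
  simpa using abs_im_le_norm (I * ((v - s : ℝ) : ℂ) - ε : ℂ)

theorem norm_timeSymbol_le_div {ε s a b v : ℝ} (ha : 0 ≤ a) (hab : a ≤ b) (hε : 0 < ε) :
    ‖timeSymbol ε s a b v‖ ≤ Real.exp (-(v - s)) * (2 / ε) := by
  have h : ‖timeSymbol ε s a b v‖ * ε ≤ 2 * Real.exp (-(v - s)) := by
    refine le_trans ?_ (norm_timeSymbol_mul_norm_le ha hab hε.le)
    gcongr
    simpa [abs_of_pos hε] using abs_re_le_norm (I * ((v - s : ℝ) : ℂ) - ε : ℂ)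
  rw [← mul_div_assoc, le_div_iff₀ hε]
  linarith

theorem timeSymbol_add {ε s a b c v : ℝ} :
    timeSymbol ε s a b v + timeSymbol ε s b c v = timeSymbol ε s a c v :=
  intervalIntegral.integral_add_adjacent_intervals
    ((by fun_prop : Continuous _).intervalIntegrable _ _)
    ((by fun_prop : Continuous _).intervalIntegrable _ _)

theorem continuous_timeSymbol (ε s a b : ℝ) : Continuous (timeSymbol ε s a b) :=
  intervalIntegral.continuous_parametric_intervalIntegral_of_continuous'
    (f := fun v t => exp (-(ε * t : ℝ) - (1 - I * t) * ((v - s : ℝ) : ℂ))) (by fun_prop) _ _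

theorem integrable_exp_neg_norm_sq (s : ℝ) :
    Integrable fun ξ : E d => Real.exp (-(‖ξ‖ ^ 2 - s)) := by
  have := (GaussianFourier.integrable_cexp_neg_mul_sq_norm_add (b := 1) (by simp) 0
    (0 : E d)).norm.mul_const (Real.exp s)
  refine this.congr (Filter.Eventually.of_forall fun v => ?_)
  simp only [norm_exp]
  rw [← Real.exp_add]
  congr 1
  simp [← ofReal_pow]
  ring

theorem integrable_timeSymbol {ε s a b : ℝ} (ha : 0 ≤ a) (hab : a ≤ b) (hε : 0 ≤ ε) :
    Integrable fun ξ : E d => timeSymbol ε s a b (‖ξ‖ ^ 2) :=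
  ((integrable_exp_neg_norm_sq s).mul_const (b - a)).mono'
    ((continuous_timeSymbol ε s a b).comp (by fun_prop)).aestronglyMeasurable
    (Filter.Eventually.of_forall fun _ => norm_timeSymbol_le ha hab hε _)

/-- The damped Poisson kernel `e^{-(v - s)} 2ε / (ε² + (v - s)²)`. -/
noncomputable def poissonSymbol (ε s v : ℝ) : ℝ :=
  Real.exp (-(v - s)) * (2 * ε / (ε ^ 2 + (v - s) ^ 2))

theorem poissonSymbol_nonneg {ε : ℝ} (hε : 0 ≤ ε) (s v : ℝ) : 0 ≤ poissonSymbol ε s v := by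
  unfold poissonSymbol; positivity

theorem continuous_poissonSymbol {ε : ℝ} (hε : 0 < ε) :
    Continuous fun p : ℝ × ℝ => poissonSymbol ε p.1 p.2 := by
  unfold poissonSymbol
  refine (by fun_prop : Continuous _).mul ((by fun_prop : Continuous _).div (by fun_prop) ?_)
  intro p; positivity

theorem poissonSymbol_le {ε : ℝ} (hε : 0 < ε) (s v : ℝ) :
    poissonSymbol ε s v ≤ Real.exp (-(v - s)) * (2 / ε) := by
  refine mul_le_mul_of_nonneg_left ?_ (Real.exp_pos _).le
  rw [div_le_div_iff₀ (by positivity) hε]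
  nlinarith [sq_nonneg (v - s)]

/-- With u = v - s, the integral of e^{-εt + itu} over t > 0 is 1/(ε - iu), and adding the conjugate
gives 2ε/(ε² + u²). -/
theorem tendsto_timeSymbol {ε : ℝ} (hε : 0 < ε) (s v : ℝ) :
    Filter.Tendsto (fun n : ℕ => timeSymbol ε s 0 (2 ^ n) v +
      (starRingEnd ℂ) (timeSymbol ε s 0 (2 ^ n) v)) Filter.atTop
      (nhds (poissonSymbol ε s v : ℂ)) := by
  have hne : (I * ((v - s : ℝ) : ℂ) - ε : ℂ) ≠ 0 := fun h0 => by
    have := congrArg re h0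
    simp at this
    exact hε.ne' this
  have h1 : Filter.Tendsto (fun n : ℕ => exp ((I * ((v - s : ℝ) : ℂ) - ε) * ((2 ^ n : ℝ) : ℂ)))
      Filter.atTop (nhds 0) := by
    rw [tendsto_zero_iff_norm_tendsto_zero]
    have h2 : Filter.Tendsto (fun n : ℕ => Real.exp (-(ε * 2 ^ n))) Filter.atTop (nhds 0) :=
      Real.tendsto_exp_neg_atTop_nhds_zero.comp
        ((tendsto_pow_atTop_atTop_of_one_lt (by norm_num : (1 : ℝ) < 2)).const_mul_atTop hε)
    refine h2.congr fun n => ?_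
    rw [norm_exp]
    congr 1
    simp [-ofReal_pow]
  have h3 : Filter.Tendsto (fun n : ℕ => timeSymbol ε s 0 (2 ^ n) v) Filter.atTop
      (nhds (exp (-((v - s : ℝ) : ℂ)) * ((0 - exp ((I * ((v - s : ℝ) : ℂ) - ε) * (0 : ℝ))) /
        (I * ((v - s : ℝ) : ℂ) - ε)))) := by
    simp_rw [fun n : ℕ => timeSymbol_eq 0 ((2 : ℝ) ^ n) hne]
    exact ((h1.sub_const _).div_const _).const_mul _
  have h4 := h3.add ((continuous_conj.tendsto _).comp h3)
  refine h4.trans (le_of_eq (congrArg nhds ?_))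
  have hne' : (starRingEnd ℂ) (I * ((v - s : ℝ) : ℂ) - ε : ℂ) ≠ 0 := by
    rwa [Ne, map_eq_zero]
  have hne2 : ((ε : ℂ) ^ 2 + ((v : ℂ) - s) ^ 2) ≠ 0 := by
    have : (ε ^ 2 + (v - s) ^ 2 : ℝ) ≠ 0 := by positivity
    exact_mod_cast this
  rw [poissonSymbol]
  simp only [ofReal_zero, mul_zero, exp_zero, zero_sub, map_mul, map_div₀, map_neg, map_one]
  rw [← exp_conj]
  simp only [map_sub, map_neg, map_mul, conj_I, conj_ofReal] at hne' ⊢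
  push_cast at hne hne' ⊢
  rw [← mul_add]
  congr 1
  rw [div_add_div _ _ hne hne', div_eq_div_iff (mul_ne_zero hne hne') hne2]
  ring_nf
  simp only [I_sq]
  ring

end ShellProjection

/-! ### Dyadic time windows and restricted estimates for the Poisson kernels -/

namespace ShellProjection

open Complex FourierTransform

variable {d : ℕ} {m f g : E d → ℂ}

/-- The endpoints `0, 2, 4, 8, …` of the dyadic time windows. -/
noncomputable def dyadicTime (i : ℕ) : ℝ := if i = 0 then 0 else 2 ^ i

theorem dyadicTime_nonneg (i : ℕ) : 0 ≤ dyadicTime i := by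
  unfold dyadicTime; split_ifs <;> positivity

theorem dyadicTime_succ (i : ℕ) : dyadicTime (i + 1) = 2 ^ (i + 1) := by
  simp [dyadicTime]

theorem dyadicTime_le_pow (i : ℕ) : dyadicTime i ≤ 2 ^ i := by
  unfold dyadicTime; split_ifs
  · positivity
  · exact le_rfl

theorem dyadicTime_le_succ (i : ℕ) : dyadicTime i ≤ dyadicTime (i + 1) := by
  rw [dyadicTime_succ]
  exact (dyadicTime_le_pow i).trans (pow_le_pow_right₀ (by norm_num) (by omega))

/-- The radial multiplier of the `i`-th dyadic time window. -/
noncomputable def dyadicSymbol (d : ℕ) (ε s : ℝ) (i : ℕ) (ξ : E d) : ℂ :=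
  timeSymbol ε s (dyadicTime i) (dyadicTime (i + 1)) (‖ξ‖ ^ 2)

theorem integrable_dyadicSymbol {ε s : ℝ} (hε : 0 ≤ ε) (i : ℕ) :
    Integrable (dyadicSymbol d ε s i) :=
  integrable_timeSymbol (dyadicTime_nonneg i) (dyadicTime_le_succ i) hε

theorem exists_fourier_dyadicSymbol_le (d : ℕ) : ∃ C : ℝ, 0 < C ∧ ∀ (ε s : ℝ) (i : ℕ) (w : E d),
    0 ≤ ε → s ∈ Icc (1 / 2 : ℝ) 1 →
      ‖𝓕 (dyadicSymbol d ε s i) w‖ ≤ C * 2 ^ (-(((d : ℝ) - 1) / 2) * i) := by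
  have hpi := Real.pi_pos
  refine ⟨90 * Real.exp 1 * Real.pi ^ ((d : ℝ) / 2) * (4 + d / 2), by positivity,
    fun ε s i w hε hs => ?_⟩
  rcases i with _ | i
  · have := norm_fourier_timeSymbol_initial_le (d := d) hε hs.2 w
    have e : dyadicSymbol d ε s 0 = fun ξ : E d => timeSymbol ε s 0 2 (‖ξ‖ ^ 2) := by
      ext ξ; simp [dyadicSymbol, dyadicTime]
    rw [e]
    refine this.trans ?_
    simp only [Nat.cast_zero, mul_zero, Real.rpow_zero, mul_one]
    have h1 : 0 < Real.exp 1 * Real.pi ^ ((d : ℝ) / 2) := by positivity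
    have h2 : (0 : ℝ) ≤ d := Nat.cast_nonneg d
    nlinarith
  · have h2 : (2 : ℝ) ≤ 2 ^ (i + 1) := by
      calc (2 : ℝ) = 2 ^ 1 := by norm_num
        _ ≤ 2 ^ (i + 1) := pow_le_pow_right₀ (by norm_num) (by omega)
    have := norm_fourier_timeSymbol_dyadic_le (d := d) hε hs.1 hs.2 h2 w
    have e : dyadicSymbol d ε s (i + 1) =
        fun ξ : E d => timeSymbol ε s (2 ^ (i + 1)) (2 * 2 ^ (i + 1)) (‖ξ‖ ^ 2) := by
      ext ξ
      rw [dyadicSymbol, dyadicTime_succ, dyadicTime_succ, pow_succ' 2 (i + 1)]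
    rw [e]
    refine this.trans (le_of_eq ?_)
    congr 1
    rw [← Real.rpow_natCast, ← Real.rpow_mul (by norm_num)]
    congr 1
    ring

theorem exp_neg_sub_le {s v : ℝ} (hs : s ≤ 1) (hv : 0 ≤ v) :
    Real.exp (-(v - s)) ≤ Real.exp 1 := Real.exp_le_exp.2 (by linarith)

theorem norm_dyadicSymbol_le {ε s : ℝ} (hε : 0 ≤ ε) (i : ℕ) (ξ : E d) :
    ‖dyadicSymbol d ε s i ξ‖ ≤ Real.exp (-(‖ξ‖ ^ 2 - s)) * 2 ^ (i + 1) := by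
  refine (norm_timeSymbol_le (dyadicTime_nonneg i) (dyadicTime_le_succ i) hε _).trans ?_
  gcongr
  rw [dyadicTime_succ]
  linarith [dyadicTime_nonneg i]

/-- The window symbol is at most min(2^{i+1}, 2/|u|) e^{-u} with u = |ξ|² - s, and the square of
such a bump is 2^i times a Poisson kernel of width 2^{-i}. An L² bound for a window thus follows
from the quadratic form of a Poisson kernel. -/
theorem norm_sq_dyadicSymbol_le {ε s : ℝ} (hε : 0 ≤ ε) (hs : s ≤ 1) (i : ℕ) (ξ : E d) :
    ‖dyadicSymbol d ε s i ξ‖ ^ 2 ≤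
      4 * Real.exp 1 * 2 ^ i * poissonSymbol ((2 ^ i)⁻¹) s (‖ξ‖ ^ 2) := by
  set u := ‖ξ‖ ^ 2 - s with hu
  set W := ‖dyadicSymbol d ε s i ξ‖ with hW
  have h1 : W * (2 ^ i)⁻¹ ≤ 2 * Real.exp (-u) := by
    have := norm_dyadicSymbol_le hε i ξ (s := s)
    rw [← div_eq_mul_inv, div_le_iff₀ (by positivity)]
    rw [pow_succ (2 : ℝ) i] at this
    linarith
  have h2 : W * |u| ≤ 2 * Real.exp (-u) :=
    norm_timeSymbol_mul_le (dyadicTime_nonneg i) (dyadicTime_le_succ i) hε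
  have hW0 : 0 ≤ W := norm_nonneg _
  have hden : 0 < ((2 ^ i : ℝ)⁻¹) ^ 2 + u ^ 2 := by positivity
  have h3 : W ^ 2 * (((2 ^ i : ℝ)⁻¹) ^ 2 + u ^ 2) ≤ 8 * (Real.exp (-u) * Real.exp (-u)) := by
    have k1 : (W * (2 ^ i)⁻¹) ^ 2 ≤ (2 * Real.exp (-u)) ^ 2 := by gcongr
    have k2 : (W * |u|) ^ 2 ≤ (2 * Real.exp (-u)) ^ 2 := by gcongr
    rw [mul_pow, sq_abs] at k2
    rw [mul_pow] at k1
    nlinarith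
  have h4 : Real.exp (-u) ≤ Real.exp 1 := exp_neg_sub_le hs (by positivity)
  have h5 : 8 * (Real.exp (-u) * Real.exp (-u)) ≤ 8 * (Real.exp 1 * Real.exp (-u)) := by gcongr
  rw [poissonSymbol, ← hu]
  have e : 4 * Real.exp 1 * 2 ^ i * (Real.exp (-u) * (2 * (2 ^ i)⁻¹ / (((2 ^ i : ℝ)⁻¹) ^ 2 + u ^ 2)))
      = 8 * (Real.exp 1 * Real.exp (-u)) / (((2 ^ i : ℝ)⁻¹) ^ 2 + u ^ 2) := by
    field_simp; norm_num
  rw [e, le_div_iff₀ hden]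
  linarith

theorem form_add {m' : E d → ℂ} (hm : Integrable m) (hm' : Integrable m') (hf : Integrable f)
    (hg : Integrable g) : form (fun ξ => m ξ + m' ξ) f g = form m f g + form m' f g := by
  rw [form, form, form, ← integral_add (integrable_form hm hf hg) (integrable_form hm' hf hg)]
  congr 1; ext ξ; ring

theorem sum_form_dyadicSymbol {ε s : ℝ} (hε : 0 ≤ ε) (hf : Integrable f) (hg : Integrable g)
    (n : ℕ) : form (fun ξ => timeSymbol ε s 0 (dyadicTime n) (‖ξ‖ ^ 2)) f g =
      ∑ i ∈ Finset.range n, form (dyadicSymbol d ε s i) f g := by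
  induction n with
  | zero => simp [dyadicTime, timeSymbol, form]
  | succ n ih =>
    rw [Finset.sum_range_succ, ← ih, ← form_add
      (integrable_timeSymbol le_rfl (dyadicTime_nonneg n) hε) (integrable_dyadicSymbol hε n) hf hg]
    congr 1; ext ξ
    exact timeSymbol_add.symm

theorem tendsto_form_timeSymbol {ε : ℝ} (hε : 0 < ε) (s : ℝ) (hf : Integrable f)
    (hg : Integrable g) : Filter.Tendsto (fun n : ℕ =>
      form (fun ξ => timeSymbol ε s 0 (2 ^ n) (‖ξ‖ ^ 2)) f g +
      form (fun ξ => (starRingEnd ℂ) (timeSymbol ε s 0 (2 ^ n) (‖ξ‖ ^ 2))) f g) Filter.atTop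
      (nhds (form (fun ξ => (poissonSymbol ε s (‖ξ‖ ^ 2) : ℂ)) f g)) := by
  have hi : ∀ n : ℕ, Integrable fun ξ : E d => timeSymbol ε s 0 (2 ^ n) (‖ξ‖ ^ 2) := fun n =>
    integrable_timeSymbol le_rfl (by positivity) hε.le
  have hic : ∀ n : ℕ, Integrable fun ξ : E d =>
      (starRingEnd ℂ) (timeSymbol ε s 0 (2 ^ n) (‖ξ‖ ^ 2)) := fun n =>
    (hi n).mono (continuous_conj.comp_aestronglyMeasurable (hi n).aestronglyMeasurable) (by simp)
  simp_rw [fun n => (form_add (hi n) (hic n) hf hg).symm]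
  refine tendsto_integral_of_dominated_convergence
    (fun ξ => Real.exp (-(‖ξ‖ ^ 2 - s)) * (2 / ε) * 2 * (∫ x, ‖f x‖) * ∫ x, ‖g x‖)
    (fun n => (integrable_form ((hi n).add (hic n)) hf hg).aestronglyMeasurable)
    ((((integrable_exp_neg_norm_sq s).mul_const _).mul_const _).mul_const _ |>.mul_const _)
    (fun n => Filter.Eventually.of_forall fun ξ => ?_)
    (Filter.Eventually.of_forall fun ξ =>
      ((tendsto_timeSymbol hε s (‖ξ‖ ^ 2)).mul_const _).mul_const _)
  rw [norm_mul, norm_mul]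
  have h1 : ‖timeSymbol ε s 0 (2 ^ n) (‖ξ‖ ^ 2)‖ ≤ Real.exp (-(‖ξ‖ ^ 2 - s)) * (2 / ε) :=
    norm_timeSymbol_le_div le_rfl (by positivity) hε
  have h2 := norm_add_le (timeSymbol ε s 0 (2 ^ n) (‖ξ‖ ^ 2))
    ((starRingEnd ℂ) (timeSymbol ε s 0 (2 ^ n) (‖ξ‖ ^ 2)))
  rw [RCLike.norm_conj] at h2
  have h3 := norm_fourier_le f ξ
  have h4 := norm_fourierInv_le g ξ
  have : 0 ≤ ∫ x, ‖f x‖ := integral_nonneg fun _ => norm_nonneg _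
  gcongr
  linarith

/-- Summation of dyadic windows: interpolation of a window estimate with the dispersive one. -/
theorem exists_restricted_poissonSymbol (hd : 2 ≤ d) {a c β C₀ : ℝ} (ha : 0 ≤ a) (hc : 0 ≤ c)
    (hβ : 0 < β) (hC₀ : 0 < C₀)
    (h : ∀ (ε s : ℝ) (i : ℕ), 0 < ε → s ∈ Icc (1 / 2 : ℝ) 1 →
      Restricted volume (form (dyadicSymbol d ε s i)) a c (C₀ * 2 ^ (β * i))) :
    ∃ C : ℝ, 0 < C ∧ ∀ ε s : ℝ, 0 < ε → s ∈ Icc (1 / 2 : ℝ) 1 →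
      Restricted volume (form fun ξ : E d => (poissonSymbol ε s (‖ξ‖ ^ 2) : ℂ))
        (β / (((d : ℝ) - 1) / 2 + β) + (((d : ℝ) - 1) / 2) / (((d : ℝ) - 1) / 2 + β) * a)
        (β / (((d : ℝ) - 1) / 2 + β) + (((d : ℝ) - 1) / 2) / (((d : ℝ) - 1) / 2 + β) * c) C := by
  set α : ℝ := ((d : ℝ) - 1) / 2 with hα
  have hα0 : 0 < α := by
    have : (2 : ℝ) ≤ d := by exact_mod_cast hd
    rw [hα]; linarith
  obtain ⟨C₁, hC₁, hker⟩ := exists_fourier_dyadicSymbol_le d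
  obtain ⟨C₂, hC₂, hsum⟩ := exists_sum_min_le hα0 hβ
  set θ := β / (α + β) with hθ
  set η := α / (α + β) with hη
  have hθ0 : 0 ≤ θ := by positivity
  have hη0 : 0 ≤ η := by positivity
  set C := C₂ * (C₁ ^ θ * C₀ ^ η) with hC
  have hwin : ∀ (ε s : ℝ) (n : ℕ), 0 < ε → s ∈ Icc (1 / 2 : ℝ) 1 →
      Restricted volume (form fun ξ : E d => timeSymbol ε s 0 (dyadicTime n) (‖ξ‖ ^ 2))
        (θ + η * a) (θ + η * c) C := by
    intro ε s n hε hs f g X Y hf hg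
    rw [sum_form_dyadicSymbol hε.le hf.isTest.integrable hg.isTest.integrable]
    set x := volume.real X
    set y := volume.real Y
    have hx : 0 ≤ x := measureReal_nonneg
    have hy : 0 ≤ y := measureReal_nonneg
    refine (norm_sum_le _ _).trans ?_
    -- The first entry is the dispersive bound, which decays in `i`; the second is the hypothesis,
    -- which grows.
    have hterm : ∀ i ∈ Finset.range n, ‖form (dyadicSymbol d ε s i) f g‖ ≤
        min (2 ^ (-α * i) * (C₁ * (x * y))) (2 ^ (β * i) * (C₀ * (x ^ a * y ^ c))) := by
      intro i _
      refine le_min ?_ ?_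
      · refine (norm_form_le_of_kernel (integrable_dyadicSymbol hε.le i) hf.isTest.integrable
          hg.isTest.integrable fun w => hker ε s i w hε.le hs).trans ?_
        have h1 := hf.integral_norm_le
        have h2 := hg.integral_norm_le
        have h3 : 0 ≤ ∫ x, ‖f x‖ := integral_nonneg fun _ => norm_nonneg _
        have h4 : 0 ≤ ∫ x, ‖g x‖ := integral_nonneg fun _ => norm_nonneg _
        calc _ ≤ C₁ * 2 ^ (-α * i) * x * y := by gcongr
          _ = _ := by ring
      · refine (h ε s i hε hs f g X Y hf hg).trans (le_of_eq ?_)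
        ring
    refine (Finset.sum_le_sum hterm).trans ((hsum _ _ n (by positivity) (by positivity)).trans
      (le_of_eq ?_))
    rw [Real.mul_rpow hC₁.le (by positivity), Real.mul_rpow hx hy,
      Real.mul_rpow hC₀.le (by positivity), Real.mul_rpow (by positivity) (by positivity),
      ← Real.rpow_mul hx, ← Real.rpow_mul hy, Real.rpow_add_of_nonneg hx hθ0 (by positivity),
      Real.rpow_add_of_nonneg hy hθ0 (by positivity), mul_comm a, mul_comm c]
    ring
  -- The factor 2 accounts for the negative times, obtained by conjugation.
  refine ⟨2 * C, by positivity, fun ε s hε hs f g X Y hf hg => ?_⟩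
  have hlim := (tendsto_form_timeSymbol hε s hf.isTest.integrable hg.isTest.integrable).norm
  refine le_of_tendsto hlim ?_
  -- The index 0 is left out because `dyadicTime 0` is 0 and not 2^0.
  filter_upwards [Filter.eventually_ge_atTop 1] with n hn
  have hn' : (2 : ℝ) ^ n = dyadicTime n := by
    rw [dyadicTime, if_neg (by omega)]
  rw [hn']
  refine (norm_add_le _ _).trans ?_
  rw [form_conj (m := fun ξ => timeSymbol ε s 0 (dyadicTime n) (‖ξ‖ ^ 2)) (by simp),
    RCLike.norm_conj]
  have h1 := hwin ε s n hε hs f g X Y hf hg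
  have h2 := hwin ε s n hε hs _ _ X Y hf.conj hg.conj
  linarith

theorem form_self_conj {p : E d → ℝ} (f : E d → ℂ) :
    form (fun ξ => (p ξ : ℂ)) f (fun x => (starRingEnd ℂ) (f x)) =
      ((∫ ξ, p ξ * ‖𝓕 f ξ‖ ^ 2 : ℝ) : ℂ) := by
  rw [form, ← integral_complex_ofReal]
  congr 1; ext ξ
  rw [fourierInv_conj, mul_assoc, mul_conj, normSq_eq_norm_sq]
  push_cast; rfl

/-- The restricted Stein–Tomas estimate, for the Poisson kernels. -/
theorem exists_integral_poissonSymbol_le (hd : 2 ≤ d) : ∃ C : ℝ, 0 < C ∧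
    ∀ (ε s : ℝ) (f : E d → ℂ) (X : Set (E d)), 0 < ε → s ∈ Icc (1 / 2 : ℝ) 1 → SubInd volume f X →
      ∫ ξ, poissonSymbol ε s (‖ξ‖ ^ 2) * ‖𝓕 f ξ‖ ^ 2 ≤
        C * (volume.real X ^ (((d : ℝ) + 3) / (2 * (d + 1)))) ^ 2 := by
  have hd' : (2 : ℝ) ≤ d := by exact_mod_cast hd
  -- The window estimate is the trivial L² bound by the length of the window. With β = 1 the weights
  -- are 2/(d+1) and (d-1)/(d+1), so both exponents become 2/(d+1) + (d-1)/(2(d+1)) =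
  -- (d+3)/(2(d+1)).
  obtain ⟨C, hC, h⟩ := exists_restricted_poissonSymbol hd (a := 1 / 2) (c := 1 / 2) (β := 1)
    (C₀ := 2 * Real.exp 1) (by norm_num) (by norm_num) one_pos (by positivity) (by
    intro ε s i hε hs f g X Y hf hg
    refine (norm_form_le_bound (K := 2 * Real.exp 1 * 2 ^ (1 * (i : ℝ))) (by positivity)
      (integrable_dyadicSymbol hε.le i).aestronglyMeasurable (fun ξ => ?_) hf.isTest
      hg.isTest).trans ?_
    · refine (norm_dyadicSymbol_le hε.le i ξ).trans ?_
      have := exp_neg_sub_le hs.2 (sq_nonneg ‖ξ‖)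
      rw [one_mul, Real.rpow_natCast, pow_succ (2 : ℝ) i]
      calc _ ≤ Real.exp 1 * (2 ^ i * 2) := by gcongr
        _ = _ := by ring
    · rw [← Real.sqrt_eq_rpow, ← Real.sqrt_eq_rpow]
      gcongr
      · exact hf.integral_norm_sq_le
      · exact hg.integral_norm_sq_le)
  refine ⟨C, hC, fun ε s f X hε hs hf => ?_⟩
  -- Pairing `f` with its conjugate turns the form into the quadratic form of a nonnegative symbol.
  have := h ε s hε hs f _ X X hf hf.conj
  rw [form_self_conj, norm_real] at this
  refine (le_abs_self _).trans (this.trans (le_of_eq ?_))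
  rw [sq]
  have e : ((d : ℝ) - 1) / 2 + 1 = (d + 1) / 2 := by ring
  congr 3
  all_goals rw [e]; field_simp; ring

/-- A second pass of the summation. Cauchy–Schwarz and Stein–Tomas at width 2^{-i} bound the `i`-th
window by 2^{i/2} |X|^{(d+3)/(2(d+1))} |Y|^{1/2}. With β = 1/2 the weights are 1/d and (d-1)/d, and
they produce exactly the coordinates of C. -/
theorem exists_restricted_poissonSymbol_C (hd : 2 ≤ d) : ∃ C : ℝ, 0 < C ∧
    ∀ ε s : ℝ, 0 < ε → s ∈ Icc (1 / 2 : ℝ) 1 →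
      Restricted volume (form fun ξ : E d => (poissonSymbol ε s (‖ξ‖ ^ 2) : ℂ))
        (ptC d).1 (1 - (ptC d).2) C := by
  have hd' : (2 : ℝ) ≤ d := by exact_mod_cast hd
  obtain ⟨C₁, hC₁, h₁⟩ := exists_integral_poissonSymbol_le hd
  obtain ⟨C, hC, h⟩ := exists_restricted_poissonSymbol hd (a := ((d : ℝ) + 3) / (2 * (d + 1)))
    (c := 1 / 2) (β := 1 / 2) (C₀ := √(4 * Real.exp 1 * C₁)) (by positivity) (by norm_num)
    (by norm_num) (by positivity) (by
    intro ε s i hε hs f g X Y hf hg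
    have hpi : (0 : ℝ) < (2 ^ i)⁻¹ := by positivity
    have hint : Integrable fun ξ : E d => 4 * Real.exp 1 * 2 ^ i *
        (poissonSymbol ((2 ^ i)⁻¹) s (‖ξ‖ ^ 2) * ‖𝓕 f ξ‖ ^ 2) := by
      refine Integrable.const_mul ?_ _
      refine ((integrable_norm_sq_fourier hf.isTest).const_mul (Real.exp 1 * (2 / (2 ^ i)⁻¹))).mono'
        ?_ (Filter.Eventually.of_forall fun ξ => ?_)
      · refine Continuous.aestronglyMeasurable ?_
        exact ((continuous_poissonSymbol hpi).comp
          (by fun_prop : Continuous fun ξ : E d => (s, ‖ξ‖ ^ 2))).mul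
          ((continuous_fourier hf.isTest.integrable).norm.pow 2)
      · have h0 := poissonSymbol_nonneg hpi.le s (‖ξ‖ ^ 2)
        rw [Real.norm_of_nonneg (by positivity)]
        gcongr
        refine (poissonSymbol_le hpi _ _).trans ?_
        have := exp_neg_sub_le hs.2 (sq_nonneg ‖ξ‖)
        gcongr
    have hle : ∀ ξ, ‖dyadicSymbol d ε s i ξ‖ ^ 2 * ‖𝓕 f ξ‖ ^ 2 ≤ 4 * Real.exp 1 * 2 ^ i *
        (poissonSymbol ((2 ^ i)⁻¹) s (‖ξ‖ ^ 2) * ‖𝓕 f ξ‖ ^ 2) := fun ξ => by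
      rw [← mul_assoc]
      exact mul_le_mul_of_nonneg_right (norm_sq_dyadicSymbol_le hε.le hs.2 i ξ) (by positivity)
    have hint2 : Integrable fun ξ : E d => ‖dyadicSymbol d ε s i ξ‖ ^ 2 * ‖𝓕 f ξ‖ ^ 2 := by
      refine hint.mono' (((integrable_dyadicSymbol hε.le i).aestronglyMeasurable.norm.pow 2).mul
        ((continuous_fourier hf.isTest.integrable).norm.pow 2).aestronglyMeasurable)
        (Filter.Eventually.of_forall fun ξ => ?_)
      rw [Real.norm_of_nonneg (by positivity)]
      exact hle ξ
    refine (norm_form_le_l2 (integrable_dyadicSymbol hε.le i).aestronglyMeasurable hf.isTest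
      hg.isTest hint2).trans ?_
    have h2 := h₁ _ s f X hpi hs hf
    have h3 := (integral_mono hint2 hint hle)
    rw [integral_const_mul] at h3
    have h4 : ∫ ξ, ‖dyadicSymbol d ε s i ξ‖ ^ 2 * ‖𝓕 f ξ‖ ^ 2 ≤
        4 * Real.exp 1 * C₁ * 2 ^ i * (volume.real X ^ (((d : ℝ) + 3) / (2 * (d + 1)))) ^ 2 := by
      refine h3.trans ?_
      calc _ ≤ 4 * Real.exp 1 * 2 ^ i *
          (C₁ * (volume.real X ^ (((d : ℝ) + 3) / (2 * (d + 1)))) ^ 2) := by gcongr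
        _ = _ := by ring
    have h5 : √(∫ ξ, ‖dyadicSymbol d ε s i ξ‖ ^ 2 * ‖𝓕 f ξ‖ ^ 2) ≤
        √(4 * Real.exp 1 * C₁) * 2 ^ ((1 / 2 : ℝ) * i) *
          volume.real X ^ (((d : ℝ) + 3) / (2 * (d + 1))) := by
      refine (Real.sqrt_le_sqrt h4).trans (le_of_eq ?_)
      rw [Real.sqrt_mul (by positivity), Real.sqrt_sq (by positivity),
        Real.sqrt_mul (by positivity), Real.sqrt_eq_rpow (2 ^ i), ← Real.rpow_natCast 2 i,
        ← Real.rpow_mul (by norm_num), mul_comm (i : ℝ)]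
    rw [← Real.sqrt_eq_rpow, ← mul_assoc]
    gcongr
    exact hg.integral_norm_sq_le)
  refine ⟨C, hC, fun ε s hε hs => ?_⟩
  have := h ε s hε hs
  have hd0 : (0 : ℝ) < d := by linarith
  have e : ((d : ℝ) - 1) / 2 + 1 / 2 = d / 2 := by ring
  convert this using 1
  · rw [ptC, e]; field_simp; ring
  · rw [ptC, e]; field_simp; ring

end ShellProjection

/-! ### The normalized shell and its bilinear form -/

namespace ShellProjection

open Complex FourierTransform

variable {d : ℕ} {m f g : E d → ℂ}

/-- The normalized shell `1 - δ ≤ |ξ|² < 1`. -/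
def unitShell (d : ℕ) (δ : ℝ) : Set (E d) := {ξ | 1 - δ ≤ ‖ξ‖ ^ 2 ∧ ‖ξ‖ ^ 2 < 1}

theorem measurableSet_unitShell (d : ℕ) (δ : ℝ) : MeasurableSet (unitShell d δ) := by
  have h : Measurable fun ξ : E d => ‖ξ‖ ^ 2 := by fun_prop
  exact (measurableSet_le measurable_const h).inter (measurableSet_lt h measurable_const)

theorem unitShell_subset_ball (d : ℕ) (δ : ℝ) : unitShell d δ ⊆ Metric.ball 0 1 := fun ξ hξ => by
  rw [mem_ball_zero_iff]
  have := hξ.2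
  nlinarith [norm_nonneg ξ]

theorem volume_unitShell_ne_top (d : ℕ) (δ : ℝ) : volume (unitShell d δ) ≠ ∞ :=
  ((measure_mono (unitShell_subset_ball d δ)).trans_lt Metric.isBounded_ball.measure_lt_top).ne

theorem neg_mem_unitShell {δ : ℝ} {ξ : E d} : -ξ ∈ unitShell d δ ↔ ξ ∈ unitShell d δ := by
  simp [unitShell]

/-- The symbol of the projection onto the normalized shell. -/
noncomputable def shellSymbol (d : ℕ) (δ : ℝ) : E d → ℂ := (unitShell d δ).indicator 1

theorem shellSymbol_neg (δ : ℝ) (ξ : E d) : shellSymbol d δ (-ξ) = shellSymbol d δ ξ := by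
  classical
  simp only [shellSymbol, indicator_apply, neg_mem_unitShell, Pi.one_apply]

theorem norm_shellSymbol_le (δ : ℝ) (ξ : E d) : ‖shellSymbol d δ ξ‖ ≤ 1 := by
  classical
  rw [shellSymbol, indicator_apply]
  split_ifs <;> simp

theorem measurable_shellSymbol (d : ℕ) (δ : ℝ) : Measurable (shellSymbol d δ) :=
  measurable_one.indicator (measurableSet_unitShell d δ)

theorem integrable_shellSymbol (d : ℕ) (δ : ℝ) : Integrable (shellSymbol d δ) :=
  (integrable_indicator_iff (measurableSet_unitShell d δ)).2
    (integrableOn_const (volume_unitShell_ne_top d δ))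

theorem isTest_shellSymbol (d : ℕ) (δ : ℝ) : IsTest volume (shellSymbol d δ) :=
  ⟨measurable_shellSymbol d δ, integrable_shellSymbol d δ, 1, norm_shellSymbol_le δ⟩

/-- The bilinear form of the projection onto the normalized shell. -/
noncomputable def shellForm (d : ℕ) (δ : ℝ) : (E d → ℂ) → (E d → ℂ) → ℂ := form (shellSymbol d δ)

/-! ### Approximation of the shell by Poisson kernels -/

theorem integral_poisson_eq {ε : ℝ} (hε : 0 < ε) (a b v : ℝ) :
    ∫ s in a..b, 2 * ε / (ε ^ 2 + (v - s) ^ 2) =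
      2 * Real.arctan ((b - v) / ε) - 2 * Real.arctan ((a - v) / ε) := by
  have hc : Continuous fun s : ℝ => 2 * ε / (ε ^ 2 + (v - s) ^ 2) :=
    continuous_const.div (by fun_prop) fun s => by positivity
  refine intervalIntegral.integral_eq_sub_of_hasDerivAt
    (f := fun s => 2 * Real.arctan ((s - v) / ε)) (fun s _ => ?_) (hc.intervalIntegrable _ _)
  have := ((((hasDerivAt_id s).sub_const v).div_const ε).arctan).const_mul 2
  refine this.congr_deriv ?_
  simp only [id]
  have h1 : (1 + ((s - v) / ε) ^ 2) ≠ 0 := by positivity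
  have h2 : (ε ^ 2 + (v - s) ^ 2) ≠ 0 := by positivity
  field_simp
  ring

/-- The average of the damped Poisson kernels over the shell. -/
noncomputable def poissonAverage (ε δ v : ℝ) : ℝ := ∫ s in (1 - δ)..1, poissonSymbol ε s v

theorem continuous_poissonSymbol_left {ε : ℝ} (hε : 0 < ε) (v : ℝ) :
    Continuous fun s => poissonSymbol ε s v :=
  (continuous_poissonSymbol hε).comp (by fun_prop : Continuous fun s : ℝ => (s, v))

theorem poissonAverage_nonneg {ε δ : ℝ} (hε : 0 < ε) (hδ : 0 ≤ δ) (v : ℝ) :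
    0 ≤ poissonAverage ε δ v :=
  intervalIntegral.integral_nonneg (by linarith) fun _ _ => poissonSymbol_nonneg hε.le _ _

theorem poissonAverage_le {ε δ : ℝ} (hε : 0 < ε) (hδ : 0 ≤ δ) (v : ℝ) :
    poissonAverage ε δ v ≤ Real.exp (-(v - 1)) * (2 * Real.pi) := by
  have hc : Continuous fun s : ℝ => 2 * ε / (ε ^ 2 + (v - s) ^ 2) :=
    continuous_const.div (by fun_prop) fun s => by positivity
  have h1 : poissonAverage ε δ v ≤
      ∫ s in (1 - δ)..1, Real.exp (-(v - 1)) * (2 * ε / (ε ^ 2 + (v - s) ^ 2)) := by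
    refine intervalIntegral.integral_mono_on (by linarith)
      ((continuous_poissonSymbol_left hε v).intervalIntegrable _ _)
      ((hc.const_mul _).intervalIntegrable _ _) fun s hs => ?_
    unfold poissonSymbol
    have : Real.exp (-(v - s)) ≤ Real.exp (-(v - 1)) := Real.exp_le_exp.2 (by linarith [hs.2])
    gcongr
  rw [intervalIntegral.integral_const_mul, integral_poisson_eq hε] at h1
  refine h1.trans ?_
  gcongr
  linarith [Real.arctan_lt_pi_div_two ((1 - v) / ε), Real.neg_pi_div_two_lt_arctan ((1 - δ - v) / ε)]

theorem tendsto_inv_succ : Filter.Tendsto (fun n : ℕ => ((n : ℝ) + 1)⁻¹) Filter.atTop (nhds 0) := by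
  simpa using tendsto_one_div_add_atTop_nhds_zero_nat (𝕜 := ℝ)

theorem tendsto_arctan_div_pos {x : ℝ} (hx : 0 < x) :
    Filter.Tendsto (fun n : ℕ => Real.arctan (x / ((n : ℝ) + 1)⁻¹)) Filter.atTop
      (nhds (Real.pi / 2)) := by
  refine (Real.tendsto_arctan_atTop.mono_right nhdsWithin_le_nhds).comp ?_
  simp_rw [div_inv_eq_mul]
  exact (Filter.tendsto_atTop_add_const_right _ 1 tendsto_natCast_atTop_atTop).const_mul_atTop hx

theorem tendsto_arctan_div_neg {x : ℝ} (hx : x < 0) :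
    Filter.Tendsto (fun n : ℕ => Real.arctan (x / ((n : ℝ) + 1)⁻¹)) Filter.atTop
      (nhds (-(Real.pi / 2))) := by
  have := (tendsto_arctan_div_pos (neg_pos.2 hx)).neg
  simpa [neg_div, Real.arctan_neg] using this

theorem abs_exp_sub_one_le_mul (x : ℝ) : |Real.exp x - 1| ≤ |x| * Real.exp |x| := by
  rcases le_total 0 x with h | h
  · rw [abs_of_nonneg h, abs_of_nonneg (by linarith [Real.one_le_exp h])]
    have h1 := Real.add_one_le_exp (-x)
    have h2 : Real.exp x * Real.exp (-x) = 1 := by rw [← Real.exp_add]; simp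
    nlinarith [Real.exp_pos x]
  · rw [abs_of_nonpos h, abs_of_nonpos (by linarith [Real.exp_le_one_iff.2 h])]
    have h1 := Real.add_one_le_exp x
    have h2 := Real.one_le_exp (neg_nonneg.2 h)
    nlinarith

-- Without the damping, the average is a difference of arctangents with the stated limit. The
-- damping contributes an error with the factor e^{-(v-s)} - 1 = O(|v - s|), which cancels the
-- singularity of the Poisson kernel, so dominated convergence sends it to 0. The excluded values of
-- `v` are spheres, hence null.
open scoped Classical in
theorem tendsto_poissonAverage {δ v : ℝ} (hδ : 0 ≤ δ) (h0 : v ≠ 1 - δ) (h1 : v ≠ 1) :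
    Filter.Tendsto (fun n : ℕ => poissonAverage ((n : ℝ) + 1)⁻¹ δ v) Filter.atTop
      (nhds (if 1 - δ ≤ v ∧ v < 1 then 2 * Real.pi else 0)) := by
  have hε : ∀ n : ℕ, 0 < ((n : ℝ) + 1)⁻¹ := fun n => by positivity
  have hc : ∀ n : ℕ, Continuous fun s : ℝ =>
      2 * ((n : ℝ) + 1)⁻¹ / ((((n : ℝ) + 1)⁻¹) ^ 2 + (v - s) ^ 2) := fun n =>
    continuous_const.div (by fun_prop) fun s => by have := hε n; positivity
  have hsplit : ∀ n : ℕ, poissonAverage ((n : ℝ) + 1)⁻¹ δ v =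
      (2 * Real.arctan ((1 - v) / ((n : ℝ) + 1)⁻¹) -
        2 * Real.arctan ((1 - δ - v) / ((n : ℝ) + 1)⁻¹)) +
      ∫ s in (1 - δ)..1, (Real.exp (-(v - s)) - 1) *
        (2 * ((n : ℝ) + 1)⁻¹ / ((((n : ℝ) + 1)⁻¹) ^ 2 + (v - s) ^ 2)) := fun n => by
    rw [← integral_poisson_eq (hε n), ← intervalIntegral.integral_add
      ((hc n).intervalIntegrable _ _)
      (g := fun s => (Real.exp (-(v - s)) - 1) *
        (2 * ((n : ℝ) + 1)⁻¹ / ((((n : ℝ) + 1)⁻¹) ^ 2 + (v - s) ^ 2)))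
      (((by fun_prop : Continuous fun s : ℝ => Real.exp (-(v - s)) - 1).mul
        (hc n)).intervalIntegrable _ _)]
    unfold poissonAverage poissonSymbol
    congr 1; ext s; ring
  simp_rw [hsplit]
  have herr : Filter.Tendsto (fun n : ℕ => ∫ s in (1 - δ)..1, (Real.exp (-(v - s)) - 1) *
      (2 * ((n : ℝ) + 1)⁻¹ / ((((n : ℝ) + 1)⁻¹) ^ 2 + (v - s) ^ 2))) Filter.atTop (nhds 0) := by
    have : Filter.Tendsto (fun n : ℕ => ∫ s in (1 - δ)..1, (Real.exp (-(v - s)) - 1) *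
      (2 * ((n : ℝ) + 1)⁻¹ / ((((n : ℝ) + 1)⁻¹) ^ 2 + (v - s) ^ 2))) Filter.atTop
        (nhds (∫ s in (1 - δ)..1, (0 : ℝ))) := by
      refine intervalIntegral.tendsto_integral_filter_of_dominated_convergence
        (fun s => Real.exp |v - s|)
        (Filter.Eventually.of_forall fun n =>
          ((by fun_prop : Continuous fun s : ℝ => Real.exp (-(v - s)) - 1).mul
            (hc n)).aestronglyMeasurable)
        (Filter.Eventually.of_forall fun n => Filter.Eventually.of_forall fun s _ => ?_)
        ((by fun_prop : Continuous fun s : ℝ => Real.exp |v - s|).intervalIntegrable _ _) ?_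
      · set e := ((n : ℝ) + 1)⁻¹
        have he : 0 < e := hε n
        have k1 : |Real.exp (-(v - s)) - 1| ≤ |v - s| * Real.exp |v - s| := by
          simpa [abs_sub_comm] using abs_exp_sub_one_le_mul (-(v - s))
        have k2 : |v - s| * (2 * e / (e ^ 2 + (v - s) ^ 2)) ≤ 1 := by
          rw [← mul_div_assoc, div_le_one (by positivity), ← sq_abs (v - s)]
          nlinarith [sq_nonneg (e - |v - s|)]
        rw [norm_mul, Real.norm_eq_abs, Real.norm_of_nonneg (by positivity)]
        calc _ ≤ |v - s| * Real.exp |v - s| * (2 * e / (e ^ 2 + (v - s) ^ 2)) := by gcongr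
          _ = Real.exp |v - s| * (|v - s| * (2 * e / (e ^ 2 + (v - s) ^ 2))) := by ring
          _ ≤ Real.exp |v - s| * 1 := by gcongr
          _ = _ := mul_one _
      · have hne : ∀ᵐ s : ℝ, s ≠ v := by simp [ae_iff, measure_singleton]
        filter_upwards [hne] with s hs _
        have hvs : (v - s) ^ 2 ≠ 0 := pow_ne_zero 2 (sub_ne_zero.2 hs.symm)
        have t1 := (tendsto_inv_succ.const_mul 2).div ((tendsto_inv_succ.pow 2).add_const
          ((v - s) ^ 2)) (by simpa using hvs)
        have := t1.const_mul (Real.exp (-(v - s)) - 1)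
        simpa using this
    simpa using this
  rw [← add_zero (if 1 - δ ≤ v ∧ v < 1 then 2 * Real.pi else 0)]
  refine Filter.Tendsto.add ?_ herr
  rcases lt_or_gt_of_ne h0 with h | h
  · rw [if_neg (by intro hh; linarith [hh.1])]
    have := ((tendsto_arctan_div_pos (x := 1 - v) (by linarith)).const_mul 2).sub
      ((tendsto_arctan_div_pos (x := 1 - δ - v) (by linarith)).const_mul 2)
    simpa using this
  · rcases lt_or_gt_of_ne h1 with h' | h'
    · rw [if_pos ⟨h.le, h'⟩]
      have := ((tendsto_arctan_div_pos (x := 1 - v) (by linarith)).const_mul 2).sub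
        ((tendsto_arctan_div_neg (x := 1 - δ - v) (by linarith)).const_mul 2)
      refine this.trans (le_of_eq (congrArg nhds ?_))
      ring
    · rw [if_neg (by intro hh; linarith [hh.2])]
      have := ((tendsto_arctan_div_neg (x := 1 - v) (by linarith)).const_mul 2).sub
        ((tendsto_arctan_div_neg (x := 1 - δ - v) (by linarith)).const_mul 2)
      simpa using this

theorem form_poissonAverage {ε δ : ℝ} (hε : 0 < ε) (hδ : 0 ≤ δ) (hf : Integrable f)
    (hg : Integrable g) :
    form (fun ξ => (poissonAverage ε δ (‖ξ‖ ^ 2) : ℂ)) f g =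
      ∫ s in (1 - δ)..1, form (fun ξ => (poissonSymbol ε s (‖ξ‖ ^ 2) : ℂ)) f g := by
  have hle : (1 - δ) ≤ 1 := by linarith
  set F : E d → ℝ → ℂ := fun ξ s => (poissonSymbol ε s (‖ξ‖ ^ 2) : ℂ) * 𝓕 f ξ * 𝓕⁻ g ξ with hF
  have hFc : Continuous (Function.uncurry F) := by
    have h1 : Continuous fun p : E d × ℝ => (poissonSymbol ε p.2 (‖p.1‖ ^ 2) : ℂ) :=
      continuous_ofReal.comp ((continuous_poissonSymbol hε).comp
        (by fun_prop : Continuous fun p : E d × ℝ => (p.2, ‖p.1‖ ^ 2)))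
    exact (h1.mul ((continuous_fourier hf).comp continuous_fst)).mul
      ((continuous_fourierInv hg).comp continuous_fst)
  have hFi : Integrable (Function.uncurry F) (volume.prod (volume.restrict (Ioc (1 - δ) 1))) := by
    have hb : Integrable (fun p : E d × ℝ => (Real.exp (-(‖p.1‖ ^ 2 - 1)) * (2 / ε) *
        (∫ x, ‖f x‖) * ∫ x, ‖g x‖) * 1) (volume.prod (volume.restrict (Ioc (1 - δ) 1))) :=
      ((((integrable_exp_neg_norm_sq 1).mul_const _).mul_const _).mul_const _).mul_prod
        (g := fun _ => (1 : ℝ)) (by simp)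
    refine hb.mono' hFc.aestronglyMeasurable ?_
    have : ∀ᵐ p : E d × ℝ ∂(volume.prod (volume.restrict (Ioc (1 - δ) 1))),
        p.2 ∈ Ioc (1 - δ) 1 := by
      have := Measure.quasiMeasurePreserving_snd (μ := (volume : Measure (E d)))
        (ν := volume.restrict (Ioc (1 - δ) 1))
      exact this.ae (ae_restrict_mem measurableSet_Ioc)
    filter_upwards [this] with p hp
    rw [Function.uncurry, hF]
    simp only [norm_mul, norm_real, mul_one]
    rw [Real.norm_of_nonneg (poissonSymbol_nonneg hε.le _ _)]
    have k1 := poissonSymbol_le hε p.2 (‖p.1‖ ^ 2)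
    have k2 : Real.exp (-(‖p.1‖ ^ 2 - p.2)) ≤ Real.exp (-(‖p.1‖ ^ 2 - 1)) :=
      Real.exp_le_exp.2 (by linarith [hp.2])
    have k3 := norm_fourier_le f p.1
    have k4 := norm_fourierInv_le g p.1
    have : 0 ≤ ∫ x, ‖f x‖ := integral_nonneg fun _ => norm_nonneg _
    gcongr
    exact k1.trans (by gcongr)
  rw [intervalIntegral.integral_of_le hle]
  unfold form
  rw [← integral_integral_swap hFi]
  congr 1; ext ξ
  rw [hF]
  simp only
  rw [integral_mul_const, integral_mul_const, poissonAverage, intervalIntegral.integral_of_le hle,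
    integral_complex_ofReal]

theorem ae_norm_sq_ne (hd : 2 ≤ d) (r : ℝ) : ∀ᵐ ξ : E d, ‖ξ‖ ^ 2 ≠ r := by
  have : Nontrivial (E d) := by
    have : Nonempty (Fin d) := ⟨⟨0, by omega⟩⟩
    infer_instance
  have h := Measure.addHaar_sphere (volume : Measure (E d)) 0 (√r)
  rw [ae_iff]
  refine measure_mono_null (fun ξ hξ => ?_) h
  simp only [ne_eq, not_not, mem_ofPred_eq] at hξ
  rw [mem_sphere_zero_iff_norm, ← hξ, Real.sqrt_sq (norm_nonneg _)]

theorem tendsto_form_poissonAverage (hd : 2 ≤ d) {δ : ℝ} (hδ : 0 ≤ δ) (hf : Integrable f)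
    (hg : Integrable g) : Filter.Tendsto (fun n : ℕ =>
      form (fun ξ => (poissonAverage ((n : ℝ) + 1)⁻¹ δ (‖ξ‖ ^ 2) : ℂ)) f g) Filter.atTop
      (nhds (2 * Real.pi * shellForm d δ f g)) := by
  have hε : ∀ n : ℕ, 0 < ((n : ℝ) + 1)⁻¹ := fun n => by positivity
  have hc : ∀ n : ℕ, Continuous fun ξ : E d => (poissonAverage ((n : ℝ) + 1)⁻¹ δ (‖ξ‖ ^ 2) : ℂ) := by
    intro n
    refine continuous_ofReal.comp ?_
    exact intervalIntegral.continuous_parametric_intervalIntegral_of_continuous'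
      (f := fun (ξ : E d) s => poissonSymbol ((n : ℝ) + 1)⁻¹ s (‖ξ‖ ^ 2))
      ((continuous_poissonSymbol (hε n)).comp
        (by fun_prop : Continuous fun p : E d × ℝ => (p.2, ‖p.1‖ ^ 2))) _ _
  have e : 2 * Real.pi * shellForm d δ f g =
      ∫ ξ, (2 * Real.pi * shellSymbol d δ ξ) * 𝓕 f ξ * 𝓕⁻ g ξ := by
    rw [shellForm, form, ← integral_const_mul]
    congr 1; ext ξ; ring
  rw [e]
  refine tendsto_integral_of_dominated_convergence
    (fun ξ => Real.exp (-(‖ξ‖ ^ 2 - 1)) * (2 * Real.pi) * (∫ x, ‖f x‖) * ∫ x, ‖g x‖)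
    (fun n => (((hc n).mul (continuous_fourier hf)).mul
      (continuous_fourierInv hg)).aestronglyMeasurable)
    ((((integrable_exp_neg_norm_sq 1).mul_const _).mul_const _).mul_const _)
    (fun n => Filter.Eventually.of_forall fun ξ => ?_) ?_
  · rw [norm_mul, norm_mul, norm_real, Real.norm_of_nonneg (poissonAverage_nonneg (hε n) hδ _)]
    have h1 := poissonAverage_le (hε n) hδ (‖ξ‖ ^ 2)
    have h3 := norm_fourier_le f ξ
    have h4 := norm_fourierInv_le g ξ
    have : 0 ≤ ∫ x, ‖f x‖ := integral_nonneg fun _ => norm_nonneg _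
    gcongr
  · filter_upwards [ae_norm_sq_ne hd (1 - δ), ae_norm_sq_ne hd 1] with ξ h0 h1
    refine Filter.Tendsto.mul_const _ (Filter.Tendsto.mul_const _ ?_)
    have := (continuous_ofReal.tendsto _).comp (tendsto_poissonAverage hδ h0 h1)
    refine this.trans (le_of_eq (congrArg nhds ?_))
    classical
    simp only [shellSymbol, indicator_apply, unitShell, mem_ofPred_eq, Pi.one_apply]
    split_ifs <;> simp

/-- The shell is, up to 2π and in the limit ε → 0, the integral of Poisson kernels over s in [1 - δ,
1]; a bound uniform in `s` integrates to δ. The condition δ ≤ 1/2 keeps `s` in [1/2, 1], where the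
dispersive estimate holds uniformly. -/
theorem restricted_shellForm_of_poissonSymbol (hd : 2 ≤ d) {a c C δ : ℝ} (hδ : 0 ≤ δ)
    (hδ1 : δ ≤ 1 / 2)
    (h : ∀ ε s : ℝ, 0 < ε → s ∈ Icc (1 / 2 : ℝ) 1 →
      Restricted volume (form fun ξ : E d => (poissonSymbol ε s (‖ξ‖ ^ 2) : ℂ)) a c C) :
    Restricted volume (shellForm d δ) a c (C * δ) := by
  intro f g X Y hf hg
  have hlim := (tendsto_form_poissonAverage hd hδ hf.isTest.integrable hg.isTest.integrable).norm
  set Q := volume.real X ^ a * volume.real Y ^ c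
  have hQ : 0 ≤ Q := by positivity
  have hle : ‖2 * Real.pi * shellForm d δ f g‖ ≤ C * δ * Q := by
    refine le_of_tendsto hlim (Filter.Eventually.of_forall fun n => ?_)
    have hε : 0 < ((n : ℝ) + 1)⁻¹ := by positivity
    rw [form_poissonAverage hε hδ hf.isTest.integrable hg.isTest.integrable]
    refine (intervalIntegral.norm_integral_le_of_norm_le_const (C := C * Q) fun s hs => ?_).trans
      (le_of_eq ?_)
    · rw [uIoc_of_le (by linarith)] at hs
      exact h _ s hε ⟨by linarith [hs.1], hs.2⟩ f g X Y hf hg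
    · rw [sub_sub_cancel, abs_of_nonneg hδ]; ring
  refine le_trans ?_ hle
  rw [norm_mul]
  refine le_mul_of_one_le_left (norm_nonneg _) ?_
  rw [norm_mul, norm_real, Real.norm_of_nonneg Real.pi_pos.le]
  have := Real.pi_gt_three
  norm_num
  linarith

theorem exists_restricted_shellForm_C (hd : 2 ≤ d) : ∃ C : ℝ, 0 < C ∧ ∀ δ : ℝ, 0 ≤ δ → δ ≤ 1 / 2 →
    Restricted volume (shellForm d δ) (ptC d).1 (1 - (ptC d).2) (C * δ) := by
  obtain ⟨C, hC, h⟩ := exists_restricted_poissonSymbol_C hd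
  exact ⟨C, hC, fun δ hδ hδ1 => restricted_shellForm_of_poissonSymbol hd hδ hδ1 h⟩

theorem integral_shell_eq (δ : ℝ) (f : E d → ℂ) :
    ∫ ξ, ‖shellSymbol d δ ξ‖ ^ 2 * ‖𝓕 f ξ‖ ^ 2 = ∫ ξ in unitShell d δ, ‖𝓕 f ξ‖ ^ 2 := by
  classical
  rw [← integral_indicator (measurableSet_unitShell d δ)]
  congr 1; ext ξ
  simp only [shellSymbol, indicator_apply]
  split_ifs <;> simp

theorem norm_shellForm_le_sqrt {δ : ℝ} (hf : IsTest volume f) (hg : IsTest volume g) :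
    ‖shellForm d δ f g‖ ≤ √(∫ ξ in unitShell d δ, ‖𝓕 f ξ‖ ^ 2) * √(∫ x, ‖g x‖ ^ 2) := by
  have := norm_form_le_l2 (isTest_shellSymbol d δ).measurable.aestronglyMeasurable hf hg ?_
  · rwa [integral_shell_eq] at this
  · refine (integrable_norm_sq_fourier hf).mono' (((measurable_shellSymbol d δ).norm.pow_const
      2).aestronglyMeasurable.mul ((continuous_fourier hf.integrable).norm.pow 2).aestronglyMeasurable)
      (Filter.Eventually.of_forall fun ξ => ?_)
    rw [Real.norm_of_nonneg (by positivity)]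
    have := norm_shellSymbol_le δ ξ
    have h0 := norm_nonneg (shellSymbol d δ ξ)
    exact mul_le_of_le_one_left (by positivity) (by nlinarith)

/-- The restricted Stein–Tomas estimate. -/
theorem exists_integral_shell_le (hd : 2 ≤ d) : ∃ C : ℝ, 0 < C ∧ ∀ (δ : ℝ) (f : E d → ℂ)
    (X : Set (E d)), 0 < δ → SubInd volume f X →
      ∫ ξ in unitShell d δ, ‖𝓕 f ξ‖ ^ 2 ≤ C * δ * (volume.real X ^ (ptA d).1) ^ 2 := by
  obtain ⟨C, hC, h⟩ := exists_integral_poissonSymbol_le hd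
  refine ⟨C, hC, fun δ f X hδ hf => ?_⟩
  have h1 := h δ 1 f X hδ ⟨by norm_num, le_rfl⟩ hf
  have hi : Integrable fun ξ => poissonSymbol δ 1 (‖ξ‖ ^ 2) * ‖𝓕 f ξ‖ ^ 2 := by
    refine ((integrable_norm_sq_fourier hf.isTest).const_mul (Real.exp 1 * (2 / δ))).mono'
        ?_ (Filter.Eventually.of_forall fun ξ => ?_)
    · refine Continuous.aestronglyMeasurable ?_
      exact ((continuous_poissonSymbol hδ).comp
        (by fun_prop : Continuous fun ξ : E d => ((1 : ℝ), ‖ξ‖ ^ 2))).mul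
        ((continuous_fourier hf.isTest.integrable).norm.pow 2)
    · have h0 := poissonSymbol_nonneg hδ.le 1 (‖ξ‖ ^ 2)
      rw [Real.norm_of_nonneg (by positivity)]
      gcongr
      refine (poissonSymbol_le hδ _ _).trans ?_
      have := exp_neg_sub_le le_rfl (sq_nonneg ‖ξ‖)
      gcongr
  -- On the shell, δ times the Poisson kernel of width δ centred at 1 is at least 1: there ||ξ|² -
  -- 1| ≤ δ, and the damping factor is at least 1 because |ξ|² < 1.
  have h2 : ∫ ξ in unitShell d δ, ‖𝓕 f ξ‖ ^ 2 ≤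
      ∫ ξ, δ * (poissonSymbol δ 1 (‖ξ‖ ^ 2) * ‖𝓕 f ξ‖ ^ 2) := by
    rw [← integral_indicator (measurableSet_unitShell d δ)]
    refine integral_mono ((integrable_norm_sq_fourier hf.isTest).indicator
      (measurableSet_unitShell d δ)) (hi.const_mul δ) fun ξ => ?_
    refine indicator_le' (f := fun ξ => ‖𝓕 f ξ‖ ^ 2)
      (g := fun ξ => δ * (poissonSymbol δ 1 (‖ξ‖ ^ 2) * ‖𝓕 f ξ‖ ^ 2))
      (fun ξ hξ => ?_) (fun ξ _ => ?_) ξ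
    · rw [← mul_assoc]
      refine le_mul_of_one_le_left (by positivity) ?_
      unfold poissonSymbol
      have e1 : 1 ≤ Real.exp (-(‖ξ‖ ^ 2 - 1)) := Real.one_le_exp (by linarith [hξ.2])
      have e2 : 1 ≤ δ * (2 * δ / (δ ^ 2 + (‖ξ‖ ^ 2 - 1) ^ 2)) := by
        rw [← mul_div_assoc, one_le_div (by positivity)]
        have := hξ.1
        have := hξ.2
        nlinarith
      calc (1 : ℝ) = 1 * 1 := by norm_num
        _ ≤ Real.exp (-(‖ξ‖ ^ 2 - 1)) * (δ * (2 * δ / (δ ^ 2 + (‖ξ‖ ^ 2 - 1) ^ 2))) := by gcongr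
        _ = _ := by ring
    · have h0 := poissonSymbol_nonneg hδ.le 1 (‖ξ‖ ^ 2)
      positivity
  rw [integral_const_mul] at h2
  refine h2.trans ?_
  calc _ ≤ δ * (C * (volume.real X ^ (ptA d).1) ^ 2) := by gcongr; exact h1
    _ = _ := by ring

theorem exists_restricted_shellForm_A (hd : 2 ≤ d) : ∃ C : ℝ, 0 < C ∧ ∀ δ : ℝ, 0 < δ →
    Restricted volume (shellForm d δ) (ptA d).1 (1 / 2) (C * δ ^ (1 / 2 : ℝ)) := by
  obtain ⟨C, hC, h⟩ := exists_integral_shell_le hd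
  refine ⟨√C, by positivity, fun δ hδ f g X Y hf hg => ?_⟩
  refine (norm_shellForm_le_sqrt hf.isTest hg.isTest).trans ?_
  have h1 := Real.sqrt_le_sqrt (h δ f X hδ hf)
  rw [Real.sqrt_mul (by positivity), Real.sqrt_mul (by positivity), Real.sqrt_sq (by positivity)] at h1
  have h2 := Real.sqrt_le_sqrt hg.integral_norm_sq_le
  rw [← Real.sqrt_eq_rpow, ← Real.sqrt_eq_rpow, ← mul_assoc]
  gcongr

theorem restricted_shellForm_half (d : ℕ) (δ : ℝ) :
    Restricted volume (shellForm d δ) (1 / 2) (1 / 2) 1 := by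
  intro f g X Y hf hg
  refine (norm_form_le_bound zero_le_one (measurable_shellSymbol d δ).aestronglyMeasurable
    (norm_shellSymbol_le δ) hf.isTest hg.isTest).trans ?_
  rw [← Real.sqrt_eq_rpow, ← Real.sqrt_eq_rpow]
  gcongr
  · exact hf.integral_norm_sq_le
  · exact hg.integral_norm_sq_le

theorem shellForm_swap (δ : ℝ) (f g : E d → ℂ) : shellForm d δ f g = shellForm d δ g f :=
  form_swap (shellSymbol_neg δ)

theorem Restricted.swap {a c M δ : ℝ} (h : Restricted volume (shellForm d δ) a c M) :
    Restricted volume (shellForm d δ) c a M := fun f g X Y hf hg => by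
  rw [shellForm_swap, mul_comm (volume.real X ^ c)]
  exact h g f Y X hg hf

end ShellProjection

namespace ShellProjection

/-! ### Interpolation of restricted estimates -/

section Interpolation

/-- The points where `2^m < |f| ≤ 2^{m+1}`. -/
def levelSet {α : Type*} (f : α → ℂ) (m : ℤ) : Set α :=
  {x | (2 : ℝ) ^ (m : ℝ) < ‖f x‖ ∧ ‖f x‖ ≤ 2 ^ ((m : ℝ) + 1)}

theorem disjoint_levelSet {α : Type*} (f : α → ℂ) {m n : ℤ} (h : m ≠ n) :
    Disjoint (levelSet f m) (levelSet f n) := by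
  rw [Set.disjoint_left]
  intro x hm hn
  have key : ∀ k l : ℤ, k < l → x ∈ levelSet f k → x ∈ levelSet f l → False := fun k l hkl hk hl => by
    have h1 : (2 : ℝ) ^ ((k : ℝ) + 1) ≤ 2 ^ (l : ℝ) :=
      Real.rpow_le_rpow_of_exponent_le (by norm_num) (by exact_mod_cast hkl)
    linarith [hk.2, hl.1]
  rcases lt_or_gt_of_ne h with h | h
  · exact key m n h hm hn
  · exact key n m h hn hm

/-- The truncation of `f` to a level set. -/
noncomputable def levelPart {α : Type*} (f : α → ℂ) (m : ℤ) : α → ℂ := (levelSet f m).indicator f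

theorem levelPart_eq {α : Type*} {f : α → ℂ} (m : ℤ) : levelPart f m =
    ((2 ^ ((m : ℝ) + 1) : ℝ) : ℂ) • (((2 ^ (-((m : ℝ) + 1)) : ℝ) : ℂ) • levelPart f m) := by
  rw [smul_smul, ← Complex.ofReal_mul, ← Real.rpow_add (by norm_num)]
  simp

variable {α : Type*} [MeasurableSpace α] {μ : Measure α}

/-- A bilinear form on bounded integrable functions, bounded with respect to the `L¹` norm. -/
structure IsTestForm (μ : Measure α) (B : (α → ℂ) → (α → ℂ) → ℂ) : Prop where
  add_left : ∀ f f' g, IsTest μ f → IsTest μ f' → IsTest μ g → B (f + f') g = B f g + B f' g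
  add_right : ∀ f g g', IsTest μ f → IsTest μ g → IsTest μ g' → B f (g + g') = B f g + B f g'
  smul_left : ∀ (c : ℂ) f g, IsTest μ f → IsTest μ g → B (c • f) g = c * B f g
  smul_right : ∀ (c : ℂ) f g, IsTest μ f → IsTest μ g → B f (c • g) = c * B f g
  bound : ∃ K, 0 ≤ K ∧ ∀ f g, IsTest μ f → IsTest μ g →
    ‖B f g‖ ≤ K * (∫ x, ‖f x‖ ∂μ) * ∫ x, ‖g x‖ ∂μ

/-- The `L^{1/a}` norm. -/
noncomputable def powNorm (μ : Measure α) (a : ℝ) (f : α → ℂ) : ℝ := (∫ x, ‖f x‖ ^ (1 / a) ∂μ) ^ a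

/-- The estimate `|B(f, g)| ≤ M ‖f‖_{1/a} ‖g‖_{1/c}`. -/
def Strong (μ : Measure α) (B : (α → ℂ) → (α → ℂ) → ℂ) (a c M : ℝ) : Prop :=
  ∀ f g, IsTest μ f → IsTest μ g → ‖B f g‖ ≤ M * (powNorm μ a f * powNorm μ c g)

theorem integral_rpow_nonneg (a : ℝ) (f : α → ℂ) : 0 ≤ ∫ x, ‖f x‖ ^ (1 / a) ∂μ :=
  integral_nonneg fun _ => by positivity

theorem powNorm_nonneg (a : ℝ) (f : α → ℂ) : 0 ≤ powNorm μ a f :=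
  Real.rpow_nonneg (integral_rpow_nonneg a f) _

theorem powNorm_rpow {a : ℝ} (ha : 0 < a) (f : α → ℂ) :
    powNorm μ a f ^ (1 / a) = ∫ x, ‖f x‖ ^ (1 / a) ∂μ := by
  rw [powNorm, ← Real.rpow_mul (integral_rpow_nonneg a f), mul_one_div_cancel ha.ne', Real.rpow_one]

theorem powNorm_smul {a : ℝ} (ha : 0 < a) (c : ℂ) (f : α → ℂ) :
    powNorm μ a (c • f) = ‖c‖ * powNorm μ a f := by
  unfold powNorm
  simp only [Pi.smul_apply, smul_eq_mul, norm_mul, Real.mul_rpow (norm_nonneg _) (norm_nonneg _)]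
  rw [integral_const_mul, Real.mul_rpow (by positivity) (integral_rpow_nonneg a f),
    ← Real.rpow_mul (norm_nonneg _), one_div_mul_cancel ha.ne', Real.rpow_one]

theorem ae_eq_zero_of_powNorm_eq_zero {a : ℝ} (ha : 0 < a) (ha1 : a ≤ 1) {f : α → ℂ}
    (hf : IsTest μ f) (h : powNorm μ a f = 0) : f =ᵐ[μ] 0 := by
  have h1 : ∫ x, ‖f x‖ ^ (1 / a) ∂μ = 0 := by
    rw [← powNorm_rpow ha, h, Real.zero_rpow (by positivity)]
  rw [integral_eq_zero_iff_of_nonneg (fun x => by simp only [Pi.zero_apply]; positivity)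
    (hf.integrable_rpow (by rw [le_div_iff₀ ha]; linarith))] at h1
  filter_upwards [h1] with x hx
  have := (Real.rpow_eq_zero (norm_nonneg (f x)) (by positivity)).1 hx
  simpa using this

theorem measurableSet_levelSet {f : α → ℂ} (hf : Measurable f) (m : ℤ) :
    MeasurableSet (levelSet f m) :=
  (measurableSet_lt measurable_const hf.norm).inter (measurableSet_le hf.norm measurable_const)

theorem two_rpow_mul_measureReal_levelSet_le {a : ℝ} (ha : 0 < a) (ha1 : a ≤ 1) {f : α → ℂ}
    (hf : IsTest μ f) (m : ℤ) :
    (2 : ℝ) ^ ((m : ℝ) / a) * μ.real (levelSet f m) ≤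
      ∫ x in levelSet f m, ‖f x‖ ^ (1 / a) ∂μ ∧ μ (levelSet f m) ≠ ∞ := by
  have hi : Integrable (fun x => ‖f x‖ ^ (1 / a)) μ :=
    hf.integrable_rpow (by rw [le_div_iff₀ ha]; linarith)
  have hms := measurableSet_levelSet hf.measurable m
  have hfin : μ (levelSet f m) ≠ ∞ := by
    have := hf.integrable.measure_norm_ge_lt_top (ε := (2 : ℝ) ^ (m : ℝ)) (by positivity)
    exact (measure_mono (fun x hx => hx.1.le)).trans_lt this |>.ne
  refine ⟨?_, hfin⟩
  rw [mul_comm, ← smul_eq_mul, ← setIntegral_const]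
  refine setIntegral_mono_on (integrableOn_const hfin) hi.integrableOn hms fun x hx => ?_
  have : (2 : ℝ) ^ ((m : ℝ) / a) = (2 ^ (m : ℝ)) ^ (1 / a) := by
    rw [← Real.rpow_mul (by norm_num)]; congr 1; ring
  rw [this]
  exact Real.rpow_le_rpow (by positivity) hx.1.le (by positivity)

theorem sum_levelSet_le {a : ℝ} (ha : 0 < a) (ha1 : a ≤ 1) {f : α → ℂ} (hf : IsTest μ f)
    (s : Finset ℤ) : ∑ m ∈ s, (2 : ℝ) ^ ((m : ℝ) / a) * μ.real (levelSet f m) ≤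
      ∫ x, ‖f x‖ ^ (1 / a) ∂μ := by
  have hi : Integrable (fun x => ‖f x‖ ^ (1 / a)) μ :=
    hf.integrable_rpow (by rw [le_div_iff₀ ha]; linarith)
  refine (Finset.sum_le_sum fun m _ => (two_rpow_mul_measureReal_levelSet_le ha ha1 hf m).1).trans ?_
  rw [← integral_biUnion_finset s (fun m _ => measurableSet_levelSet hf.measurable m)
    (fun m _ n _ h => disjoint_levelSet f h) (fun m _ => hi.integrableOn)]
  exact setIntegral_le_integral hi (Filter.Eventually.of_forall fun x => by positivity)

theorem levelPart_isTest {f : α → ℂ} (hf : IsTest μ f) (m : ℤ) : IsTest μ (levelPart f m) :=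
  hf.indicator (measurableSet_levelSet hf.measurable m)

theorem levelPart_subInd {f : α → ℂ} (hf : IsTest μ f) (m : ℤ) :
    SubInd μ (((2 ^ (-((m : ℝ) + 1)) : ℝ) : ℂ) • levelPart f m) (levelSet f m) := by
  refine ⟨((levelPart_isTest hf m).smul _).measurable, measurableSet_levelSet hf.measurable m,
    (two_rpow_mul_measureReal_levelSet_le one_pos le_rfl hf m).2, fun x => ?_⟩
  classical
  rw [Pi.smul_apply, levelPart, indicator_apply, indicator_apply]
  split_ifs with h
  · rw [norm_smul, Complex.norm_real, Real.norm_of_nonneg (by positivity), Pi.one_apply]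
    calc _ ≤ (2 : ℝ) ^ (-((m : ℝ) + 1)) * 2 ^ ((m : ℝ) + 1) := by gcongr; exact h.2
      _ = 1 := by rw [← Real.rpow_add (by norm_num)]; simp
  · simp

theorem IsTest.zero : IsTest μ (0 : α → ℂ) := ⟨measurable_zero, integrable_zero _ _ _, 0, by simp⟩

theorem IsTest.sum {ι : Type*} (s : Finset ι) {F : ι → α → ℂ} (h : ∀ i ∈ s, IsTest μ (F i)) :
    IsTest μ (∑ i ∈ s, F i) := by
  classical
  induction s using Finset.induction_on with
  | empty => simpa using IsTest.zero
  | insert i s hi ih =>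
    rw [Finset.sum_insert hi]
    exact (h i (Finset.mem_insert_self i s)).add (ih fun j hj => h j (Finset.mem_insert_of_mem hj))

namespace IsTestForm

variable {B : (α → ℂ) → (α → ℂ) → ℂ}

theorem zero_left (hB : IsTestForm μ B) {g : α → ℂ} (hg : IsTest μ g) : B 0 g = 0 := by
  have := hB.smul_left 0 0 g IsTest.zero hg
  simpa using this

theorem zero_right (hB : IsTestForm μ B) {f : α → ℂ} (hf : IsTest μ f) : B f 0 = 0 := by
  have := hB.smul_right 0 f 0 hf IsTest.zero
  simpa using this

theorem sum_left (hB : IsTestForm μ B) {ι : Type*} (s : Finset ι) {F : ι → α → ℂ} {g : α → ℂ}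
    (h : ∀ i ∈ s, IsTest μ (F i)) (hg : IsTest μ g) : B (∑ i ∈ s, F i) g = ∑ i ∈ s, B (F i) g := by
  classical
  induction s using Finset.induction_on with
  | empty => simpa using hB.zero_left hg
  | insert i s hi ih =>
    rw [Finset.sum_insert hi, Finset.sum_insert hi, hB.add_left _ _ _
      (h i (Finset.mem_insert_self i s)) (IsTest.sum s fun j hj => h j (Finset.mem_insert_of_mem hj))
      hg, ih fun j hj => h j (Finset.mem_insert_of_mem hj)]

theorem sum_right (hB : IsTestForm μ B) {ι : Type*} (s : Finset ι) {F : ι → α → ℂ} {g : α → ℂ}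
    (h : ∀ i ∈ s, IsTest μ (F i)) (hg : IsTest μ g) : B g (∑ i ∈ s, F i) = ∑ i ∈ s, B g (F i) := by
  classical
  induction s using Finset.induction_on with
  | empty => simpa using hB.zero_right hg
  | insert i s hi ih =>
    rw [Finset.sum_insert hi, Finset.sum_insert hi, hB.add_right _ _ _ hg
      (h i (Finset.mem_insert_self i s)) (IsTest.sum s fun j hj => h j (Finset.mem_insert_of_mem hj)),
      ih fun j hj => h j (Finset.mem_insert_of_mem hj)]

theorem flip (hB : IsTestForm μ B) : IsTestForm μ fun f g => B g f :=
  ⟨fun f f' g hf hf' hg => hB.add_right g f f' hg hf hf',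
    fun f g g' hf hg hg' => hB.add_left g g' f hg hg' hf,
    fun c f g hf hg => hB.smul_right c g f hg hf, fun c f g hf hg => hB.smul_left c g f hg hf, by
      obtain ⟨K, hK, h⟩ := hB.bound
      exact ⟨K, hK, fun f g hf hg => (h g f hg hf).trans (le_of_eq (by ring))⟩⟩

theorem sub_left (hB : IsTestForm μ B) {f f' g : α → ℂ} (hf : IsTest μ f) (hf' : IsTest μ f')
    (hg : IsTest μ g) : B (f - f') g = B f g - B f' g := by
  have : f - f' = f + (-1 : ℂ) • f' := by rw [neg_one_smul, sub_eq_add_neg]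
  rw [this, hB.add_left _ _ _ hf (hf'.smul _) hg, hB.smul_left _ _ _ hf' hg]
  ring

theorem tendsto_left (hB : IsTestForm μ B) {f g : α → ℂ} {F : ℕ → α → ℂ} (hf : IsTest μ f)
    (hg : IsTest μ g) (hF : ∀ n, IsTest μ (F n))
    (h : Filter.Tendsto (fun n => ∫ x, ‖F n x - f x‖ ∂μ) Filter.atTop (nhds 0)) :
    Filter.Tendsto (fun n => B (F n) g) Filter.atTop (nhds (B f g)) := by
  obtain ⟨K, hK, hb⟩ := hB.bound
  rw [tendsto_iff_norm_sub_tendsto_zero]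
  have h2 : Filter.Tendsto (fun n => K * (∫ x, ‖F n x - f x‖ ∂μ) * ∫ x, ‖g x‖ ∂μ) Filter.atTop
      (nhds 0) := by simpa using (h.const_mul K).mul_const (∫ x, ‖g x‖ ∂μ)
  refine squeeze_zero (fun n => norm_nonneg _) (fun n => ?_) h2
  rw [← hB.sub_left (hF n) hf hg]
  have hd : IsTest μ (F n - f) := by
    have := (hF n).add (hf.smul (-1))
    rwa [neg_one_smul, ← sub_eq_add_neg] at this
  exact hb _ _ hd hg

end IsTestForm

/-- The sum of the level parts with `-N ≤ m < N`. -/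
noncomputable def levelSum (f : α → ℂ) (N : ℕ) : α → ℂ :=
  ∑ m ∈ Finset.Ico (-(N : ℤ)) N, levelPart f m

theorem levelSum_eq_self {f : α → ℂ} {x : α} {N : ℕ} (h : (2 : ℝ) ^ (-(N : ℝ)) < ‖f x‖)
    (h' : ‖f x‖ ≤ 2 ^ (N : ℝ)) : levelSum f N x = f x := by
  classical
  -- A ceiling minus one, since the dyadic levels are open below and closed above.
  set m : ℤ := ⌈Real.logb 2 ‖f x‖⌉ - 1 with hm
  have hpos : 0 < ‖f x‖ := lt_trans (by positivity) h
  have h1 : x ∈ levelSet f m := by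
    constructor
    · rw [← Real.lt_logb_iff_rpow_lt (by norm_num) hpos]
      have := Int.ceil_lt_add_one (Real.logb 2 ‖f x‖)
      rw [hm]; push_cast; linarith
    · rw [← Real.logb_le_iff_le_rpow (by norm_num) hpos]
      have := Int.le_ceil (Real.logb 2 ‖f x‖)
      rw [hm]; push_cast; linarith
  have hmem : m ∈ Finset.Ico (-(N : ℤ)) N := by
    have k1 : -(N : ℝ) < Real.logb 2 ‖f x‖ := (Real.lt_logb_iff_rpow_lt (by norm_num) hpos).2 h
    have k2 : Real.logb 2 ‖f x‖ ≤ N := (Real.logb_le_iff_le_rpow (by norm_num) hpos).2 h'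
    have k3 : -(N : ℤ) < ⌈Real.logb 2 ‖f x‖⌉ := Int.lt_ceil.2 (by push_cast; exact k1)
    have k4 : ⌈Real.logb 2 ‖f x‖⌉ ≤ N := Int.ceil_le.2 (by push_cast; exact k2)
    rw [Finset.mem_Ico]
    omega
  rw [levelSum, Finset.sum_apply, Finset.sum_eq_single_of_mem m hmem]
  · rw [levelPart, indicator_of_mem h1]
  · intro n _ hn
    rw [levelPart, indicator_of_notMem]
    exact fun hx => Set.disjoint_left.1 (disjoint_levelSet f hn) hx h1

theorem norm_levelSum_le (f : α → ℂ) (N : ℕ) (x : α) : ‖levelSum f N x‖ ≤ ‖f x‖ := by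
  classical
  by_cases h : ∃ m ∈ Finset.Ico (-(N : ℤ)) N, x ∈ levelSet f m
  · obtain ⟨m, hm, hx⟩ := h
    rw [levelSum, Finset.sum_apply, Finset.sum_eq_single_of_mem m hm]
    · exact norm_indicator_le_norm_self _ _
    · intro n _ hn
      rw [levelPart, indicator_of_notMem]
      exact fun hx' => Set.disjoint_left.1 (disjoint_levelSet f hn) hx' hx
  · push Not at h
    rw [levelSum, Finset.sum_apply, Finset.sum_eq_zero, norm_zero]
    · exact norm_nonneg _
    · intro m hm
      rw [levelPart, indicator_of_notMem (h m hm)]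

theorem levelSum_isTest {f : α → ℂ} (hf : IsTest μ f) (N : ℕ) : IsTest μ (levelSum f N) :=
  IsTest.sum _ fun m _ => levelPart_isTest hf m

theorem tendsto_levelSum {f : α → ℂ} (hf : IsTest μ f) :
    Filter.Tendsto (fun N => ∫ x, ‖levelSum f N x - f x‖ ∂μ) Filter.atTop (nhds 0) := by
  have : Filter.Tendsto (fun N => ∫ x, ‖levelSum f N x - f x‖ ∂μ) Filter.atTop
      (nhds (∫ _, (0 : ℝ) ∂μ)) := by
    refine tendsto_integral_of_dominated_convergence (fun x => 2 * ‖f x‖)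
      (fun N => (((levelSum_isTest hf N).measurable.sub hf.measurable).norm).aestronglyMeasurable)
      (hf.integrable.norm.const_mul 2) (fun N => Filter.Eventually.of_forall fun x => ?_)
      (Filter.Eventually.of_forall fun x => ?_)
    · rw [norm_norm]
      have := norm_levelSum_le f N x
      have := norm_sub_le (levelSum f N x) (f x)
      linarith
    · refine tendsto_const_nhds.congr' ?_
      have hlow : Filter.Tendsto (fun N : ℕ => (2 : ℝ) ^ (-(N : ℝ))) Filter.atTop (nhds 0) := by
        have := tendsto_pow_atTop_nhds_zero_of_lt_one (r := (1 / 2 : ℝ)) (by norm_num) (by norm_num)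
        refine this.congr fun N => ?_
        rw [Real.rpow_neg (by norm_num), Real.rpow_natCast]; simp
      have hup : Filter.Tendsto (fun N : ℕ => (2 : ℝ) ^ (N : ℝ)) Filter.atTop Filter.atTop := by
        simp_rw [Real.rpow_natCast]
        exact tendsto_pow_atTop_atTop_of_one_lt (by norm_num)
      rcases (norm_nonneg (f x)).eq_or_lt with h0 | h0
      · refine Filter.Eventually.of_forall fun N => ?_
        have h1 := norm_levelSum_le f N x
        rw [← h0] at h1
        have h2 : levelSum f N x = 0 := norm_le_zero_iff.1 h1
        have h3 : f x = 0 := norm_eq_zero.1 h0.symm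
        simp [h2, h3]
      · filter_upwards [hlow.eventually (gt_mem_nhds h0), hup.eventually_ge_atTop ‖f x‖] with N h1 h2
        rw [levelSum_eq_self h1 h2]; simp
  simpa using this

theorem norm_form_levelSum_le {B : (α → ℂ) → (α → ℂ) → ℂ} (hB : IsTestForm μ B) {f g : α → ℂ}
    (hf : IsTest μ f) (hg : IsTest μ g) (N : ℕ) :
    ‖B (levelSum f N) (levelSum g N)‖ ≤ ∑ m ∈ Finset.Ico (-(N : ℤ)) N,
      ∑ n ∈ Finset.Ico (-(N : ℤ)) N, ‖B (levelPart f m) (levelPart g n)‖ := by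
  rw [levelSum, hB.sum_left _ (fun m _ => levelPart_isTest hf m) (levelSum_isTest hg N)]
  refine (norm_sum_le _ _).trans (Finset.sum_le_sum fun m _ => ?_)
  rw [levelSum, hB.sum_right _ (fun m _ => levelPart_isTest hg m) (levelPart_isTest hf m)]
  exact norm_sum_le _ _

/-- The `L¹` bound of the form serves only to pass to the limit; its constant does not enter the
result, and all estimates can be made on finite sums. -/
theorem tendsto_form_levelSum {B : (α → ℂ) → (α → ℂ) → ℂ} (hB : IsTestForm μ B) {f g : α → ℂ}
    (hf : IsTest μ f) (hg : IsTest μ g) {M : ℝ}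
    (h : ∀ N, ‖B (levelSum f N) (levelSum g N)‖ ≤ M) : ‖B f g‖ ≤ M := by
  obtain ⟨K, hK, hb⟩ := hB.bound
  have hlim : Filter.Tendsto (fun N => B (levelSum f N) (levelSum g N)) Filter.atTop
      (nhds (B f g)) := by
    have h1 := hB.tendsto_left hf hg (levelSum_isTest hf) (tendsto_levelSum hf)
    have h2 : Filter.Tendsto (fun N => B (levelSum f N) (levelSum g N) - B (levelSum f N) g)
        Filter.atTop (nhds 0) := by
      rw [tendsto_zero_iff_norm_tendsto_zero]
      have h3 : Filter.Tendsto (fun N => K * (∫ x, ‖f x‖ ∂μ) * ∫ x, ‖levelSum g N x - g x‖ ∂μ)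
          Filter.atTop (nhds 0) := by
        simpa using (tendsto_levelSum hg).const_mul (K * ∫ x, ‖f x‖ ∂μ)
      refine squeeze_zero (fun n => norm_nonneg _) (fun N => ?_) h3
      have e := hB.flip.sub_left (levelSum_isTest hg N) hg (levelSum_isTest hf N)
      rw [← e]
      have hd : IsTest μ (levelSum g N - g) := by
        have := (levelSum_isTest hg N).add (hg.smul (-1))
        rwa [neg_one_smul, ← sub_eq_add_neg] at this
      refine (hb _ _ (levelSum_isTest hf N) hd).trans ?_
      have : ∫ x, ‖levelSum f N x‖ ∂μ ≤ ∫ x, ‖f x‖ ∂μ :=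
        integral_mono (levelSum_isTest hf N).integrable.norm hf.integrable.norm
          fun x => norm_levelSum_le f N x
      have h0 : 0 ≤ ∫ x, ‖(levelSum g N - g) x‖ ∂μ := integral_nonneg fun _ => norm_nonneg _
      have : K * ∫ x, ‖levelSum f N x‖ ∂μ ≤ K * ∫ x, ‖f x‖ ∂μ := by gcongr
      exact mul_le_mul_of_nonneg_right this h0
    simpa using h2.add h1
  exact le_of_tendsto hlim.norm (Filter.Eventually.of_forall h)

theorem norm_form_levelPart_le {B : (α → ℂ) → (α → ℂ) → ℂ} (hB : IsTestForm μ B) {f g : α → ℂ}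
    (hf : IsTest μ f) (hg : IsTest μ g) {a c M : ℝ} (h : Restricted μ B a c M) (m n : ℤ) :
    ‖B (levelPart f m) (levelPart g n)‖ ≤ 4 * M * (2 ^ (m : ℝ) * 2 ^ (n : ℝ)) *
      (μ.real (levelSet f m) ^ a * μ.real (levelSet g n) ^ c) := by
  have := h _ _ _ _ (levelPart_subInd hf m) (levelPart_subInd hg n)
  rw [levelPart_eq (f := f), levelPart_eq (f := g), hB.smul_left _ _ _
    ((levelPart_isTest hf m).smul _) (((levelPart_isTest hg n).smul _).smul _),
    hB.smul_right _ _ _ ((levelPart_isTest hf m).smul _) ((levelPart_isTest hg n).smul _),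
    norm_mul, norm_mul, Complex.norm_real, Complex.norm_real, Real.norm_of_nonneg (by positivity),
    Real.norm_of_nonneg (by positivity)]
  calc _ ≤ 2 ^ ((m : ℝ) + 1) * (2 ^ ((n : ℝ) + 1) *
      (M * (μ.real (levelSet f m) ^ a * μ.real (levelSet g n) ^ c))) := by gcongr
    _ = _ := by
      rw [Real.rpow_add (by norm_num), Real.rpow_add (by norm_num), Real.rpow_one]; ring

/-- The condition p + q ≥ 1 is how the room above the diagonal a + c = 1 is used: it decouples the
two families of levels, leaving sums in which only one of them appears. -/
theorem rpow_mul_rpow_le_add {x y p q : ℝ} (hx : 0 ≤ x) (hx1 : x ≤ 1) (hy : 0 ≤ y) (hy1 : y ≤ 1)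
    (hp : 0 ≤ p) (hq : 0 ≤ q) (hpq : 1 ≤ p + q) : x ^ p * y ^ q ≤ x + y := by
  have h1 : x ^ p * y ^ q ≤ max x y ^ p * max x y ^ q := by
    gcongr
    · exact le_max_left _ _
    · exact le_max_right _ _
  rw [← Real.rpow_add_of_nonneg (le_max_of_le_left hx) hp hq] at h1
  refine h1.trans ?_
  have h2 : max x y ^ (p + q) ≤ max x y ^ (1 : ℝ) :=
    Real.rpow_le_rpow_of_exponent_ge' (le_max_of_le_left hx) (max_le hx1 hy1) zero_le_one hpq
  rw [Real.rpow_one] at h2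
  exact h2.trans (max_le (by linarith) (by linarith))

/-- A weighted geometric mean of two level estimates. -/
theorem level_geometric_mean {K M₀ M₁ a₀ a₁ c₀ c₁ a c θ σ u v m n b : ℝ} (hM₀ : 0 < M₀) (hM₁ : 0 < M₁)
    (ha : 0 < a) (hc : 0 < c) (hu : 0 ≤ u) (hv : 0 ≤ v) (hK : 0 < K)
    (hs0 : 0 ≤ θ + σ) (hs1 : θ + σ ≤ 1) (hb : 0 ≤ b)
    (h₀ : b ≤ K * M₀ * (2 ^ m * 2 ^ n) * (u ^ a₀ * v ^ c₀))
    (h₁ : b ≤ K * M₁ * (2 ^ m * 2 ^ n) * (u ^ a₁ * v ^ c₁))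
    (ha₀ : 0 ≤ a₀) (ha₁ : 0 ≤ a₁) (hc₀ : 0 ≤ c₀) (hc₁ : 0 ≤ c₁)
    (hae : a = (1 - θ) * a₀ + θ * a₁) (hce : c = (1 - θ) * c₀ + θ * c₁) :
    b ≤ K * (M₀ ^ (1 - θ) * M₁ ^ θ) *
      2 ^ (-σ * (m * ((a₁ - a₀) / a) + n * ((c₁ - c₀) / c) - Real.logb 2 (M₁ / M₀))) *
      ((2 ^ (m / a) * u) ^ (a + σ * (a₁ - a₀)) * (2 ^ (n / c) * v) ^ (c + σ * (c₁ - c₀))) := by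
  -- The mean is taken with weight θ + σ in place of θ. At σ = 0 the powers of 2 match the
  -- normalized level masses exactly; the shift σ brings out the geometric factor.
  set s := θ + σ with hs
  have h1s : 0 ≤ 1 - s := by linarith
  have hbs : b = b ^ (1 - s) * b ^ s := by
    rw [← Real.rpow_add_of_nonneg hb h1s hs0, sub_add_cancel, Real.rpow_one]
  have has : a + σ * (a₁ - a₀) = a₀ * (1 - s) + a₁ * s := by rw [hae, hs]; ring
  have hcs : c + σ * (c₁ - c₀) = c₀ * (1 - s) + c₁ * s := by rw [hce, hs]; ring
  have p2 : (0 : ℝ) < 2 := by norm_num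
  calc b = b ^ (1 - s) * b ^ s := hbs
    _ ≤ (K * M₀ * (2 ^ m * 2 ^ n) * (u ^ a₀ * v ^ c₀)) ^ (1 - s) *
        (K * M₁ * (2 ^ m * 2 ^ n) * (u ^ a₁ * v ^ c₁)) ^ s := by gcongr
    _ = (K ^ (1 - s) * K ^ s) * ((2 ^ m * 2 ^ n) ^ (1 - s) * (2 ^ m * 2 ^ n) ^ s) *
        (M₀ ^ (1 - s) * M₁ ^ s) * (u ^ (a₀ * (1 - s)) * u ^ (a₁ * s)) *
        (v ^ (c₀ * (1 - s)) * v ^ (c₁ * s)) := by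
      rw [Real.mul_rpow (by positivity) (by positivity), Real.mul_rpow (by positivity) (by positivity),
        Real.mul_rpow hK.le hM₀.le, Real.mul_rpow (x := u ^ a₀) (by positivity) (by positivity),
        Real.mul_rpow (x := K * M₁ * (2 ^ m * 2 ^ n)) (by positivity) (by positivity),
        Real.mul_rpow (x := K * M₁) (by positivity) (by positivity),
        Real.mul_rpow hK.le hM₁.le, Real.mul_rpow (x := u ^ a₁) (by positivity) (by positivity),
        ← Real.rpow_mul hu, ← Real.rpow_mul hu, ← Real.rpow_mul hv, ← Real.rpow_mul hv]
      ring
    _ = K * (2 ^ m * 2 ^ n) * (M₀ ^ (1 - s) * M₁ ^ s) *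
        (u ^ (a + σ * (a₁ - a₀)) * v ^ (c + σ * (c₁ - c₀))) := by
      rw [← Real.rpow_add hK, sub_add_cancel, Real.rpow_one, ← Real.rpow_add (by positivity),
        sub_add_cancel, Real.rpow_one, ← Real.rpow_add_of_nonneg hu (by positivity) (by positivity),
        ← Real.rpow_add_of_nonneg hv (by positivity) (by positivity), has, hcs]
      ring
    _ = _ := by
      have e1 : M₀ ^ (1 - s) * M₁ ^ s = M₀ ^ (1 - θ) * M₁ ^ θ * 2 ^ (σ * Real.logb 2 (M₁ / M₀)) := by
        rw [mul_comm σ, Real.rpow_mul p2.le, Real.rpow_logb p2 (by norm_num) (by positivity),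
          Real.div_rpow hM₁.le hM₀.le, hs, Real.rpow_add hM₁, show 1 - (θ + σ) = (1 - θ) - σ by ring,
          Real.rpow_sub hM₀]
        field_simp
      rw [e1, Real.mul_rpow (by positivity) hu, Real.mul_rpow (by positivity) hv,
        ← Real.rpow_mul p2.le, ← Real.rpow_mul p2.le]
      have e2 : (2 : ℝ) ^ m * 2 ^ n * 2 ^ (σ * Real.logb 2 (M₁ / M₀)) =
          2 ^ (-σ * (m * ((a₁ - a₀) / a) + n * ((c₁ - c₀) / c) - Real.logb 2 (M₁ / M₀))) *
          (2 ^ (m / a * (a + σ * (a₁ - a₀))) * 2 ^ (n / c * (c + σ * (c₁ - c₀)))) := by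
        rw [← Real.rpow_add p2, ← Real.rpow_add p2, ← Real.rpow_add p2, ← Real.rpow_add p2]
        congr 1
        field_simp
        ring
      linear_combination K * (M₀ ^ (1 - θ) * M₁ ^ θ) * (u ^ (a + σ * (a₁ - a₀)) *
        v ^ (c + σ * (c₁ - c₀))) * e2

theorem norm_form_le_of_normalized {B : (α → ℂ) → (α → ℂ) → ℂ} (hB : IsTestForm μ B) {a M : ℝ}
    (ha : 0 < a) (ha1 : a ≤ 1) {g : α → ℂ} (hg : IsTest μ g)
    (h : ∀ f, IsTest μ f → ∫ x, ‖f x‖ ^ (1 / a) ∂μ ≤ 1 → ‖B f g‖ ≤ M) {f : α → ℂ}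
    (hf : IsTest μ f) : ‖B f g‖ ≤ M * powNorm μ a f := by
  have hp := powNorm_nonneg (μ := μ) a f
  obtain ⟨K, hK, hb⟩ := hB.bound
  rcases hp.eq_or_lt with h' | hp
  · have h0 := ae_eq_zero_of_powNorm_eq_zero ha ha1 hf h'.symm
    have : ∫ x, ‖f x‖ ∂μ = 0 := by
      rw [integral_congr_ae (h0.mono fun x hx => by rw [hx])]; simp
    have h2 := hb f g hf hg
    rw [this, mul_zero, zero_mul] at h2
    rw [← h', mul_zero]; exact h2
  have hnf : ∫ x, ‖((((powNorm μ a f)⁻¹ : ℝ) : ℂ) • f) x‖ ^ (1 / a) ∂μ ≤ 1 := by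
    rw [← powNorm_rpow ha, powNorm_smul ha, Complex.norm_real, Real.norm_of_nonneg (by positivity),
      inv_mul_cancel₀ hp.ne', Real.one_rpow]
  have := h _ (hf.smul _) hnf
  rw [hB.smul_left _ _ _ hf hg, norm_mul, Complex.norm_real, Real.norm_of_nonneg (by positivity),
    inv_mul_le_iff₀ (by positivity)] at this
  linarith

theorem strong_of_normalized {B : (α → ℂ) → (α → ℂ) → ℂ} (hB : IsTestForm μ B) {a c M : ℝ}
    (ha : 0 < a) (ha1 : a ≤ 1) (hc : 0 < c) (hc1 : c ≤ 1)
    (h : ∀ f g, IsTest μ f → IsTest μ g → ∫ x, ‖f x‖ ^ (1 / a) ∂μ ≤ 1 →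
      ∫ x, ‖g x‖ ^ (1 / c) ∂μ ≤ 1 → ‖B f g‖ ≤ M) : Strong μ B a c M := by
  intro f g hf hg
  rw [← mul_assoc]
  refine norm_form_le_of_normalized hB.flip hc hc1 hf (fun g hg hg1 => ?_) hg
  exact norm_form_le_of_normalized hB ha ha1 hg (fun f hf hf1 => h f g hf hg hf1 hg1) hf

/-- The Marcinkiewicz interpolation theorem for bilinear forms, off the diagonal `a + c = 1`. -/
theorem exists_strong_of_restricted {a₀ a₁ c₀ c₁ θ : ℝ} (ha₀ : 0 < a₀) (ha₁ : 0 < a₁) (hc₀ : 0 < c₀)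
    (hc₁ : 0 < c₁) (hθ0 : 0 < θ) (hθ1 : θ < 1) (hane : a₀ ≠ a₁) (hcne : c₀ ≠ c₁)
    (ha : (1 - θ) * a₀ + θ * a₁ ≤ 1) (hc : (1 - θ) * c₀ + θ * c₁ ≤ 1)
    (hac : 1 < (1 - θ) * a₀ + θ * a₁ + ((1 - θ) * c₀ + θ * c₁)) :
    ∃ C : ℝ, 0 < C ∧ ∀ (B : (α → ℂ) → (α → ℂ) → ℂ) (M₀ M₁ : ℝ), IsTestForm μ B → 0 < M₀ → 0 < M₁ →
      Restricted μ B a₀ c₀ M₀ → Restricted μ B a₁ c₁ M₁ →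
      Strong μ B ((1 - θ) * a₀ + θ * a₁) ((1 - θ) * c₀ + θ * c₁) (C * (M₀ ^ (1 - θ) * M₁ ^ θ)) := by
  obtain ⟨a, hae⟩ : ∃ a, a = (1 - θ) * a₀ + θ * a₁ := ⟨_, rfl⟩
  obtain ⟨c, hce⟩ : ∃ c, c = (1 - θ) * c₀ + θ * c₁ := ⟨_, rfl⟩
  rw [← hae] at ha hac ⊢
  rw [← hce] at hc hac ⊢
  have ha0 : 0 < a := by rw [hae]; have : 0 < 1 - θ := by linarith
                         positivity
  have hc0 : 0 < c := by rw [hce]; have : 0 < 1 - θ := by linarith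
                         positivity
  set A := (a₁ - a₀) / a with hA
  set G := (c₁ - c₀) / c with hG
  have hA0 : A ≠ 0 := div_ne_zero (sub_ne_zero.2 hane.symm) ha0.ne'
  have hG0 : G ≠ 0 := div_ne_zero (sub_ne_zero.2 hcne.symm) hc0.ne'
  -- For |σ| = η the weight θ + σ stays in [0, 1], and the perturbed exponents still add up to at
  -- least 1, thanks to a + c > 1.
  obtain ⟨η, hη0, hηθ, hη1, hηac⟩ : ∃ η : ℝ, 0 < η ∧ η ≤ θ ∧ η ≤ 1 - θ ∧
      η * (|a₁ - a₀| + |c₁ - c₀|) ≤ a + c - 1 := by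
    have hD : 0 < |a₁ - a₀| + |c₁ - c₀| :=
      add_pos_of_pos_of_nonneg (abs_pos.2 (sub_ne_zero.2 hane.symm)) (abs_nonneg _)
    refine ⟨min (min θ (1 - θ)) ((a + c - 1) / (|a₁ - a₀| + |c₁ - c₀|)), ?_, ?_, ?_, ?_⟩
    · refine lt_min (lt_min hθ0 (by linarith)) (div_pos (by linarith) hD)
    · exact (min_le_left _ _).trans (min_le_left _ _)
    · exact (min_le_left _ _).trans (min_le_right _ _)
    · rw [← le_div_iff₀ hD]; exact min_le_right _ _
  obtain ⟨C₁, hC₁, hs₁⟩ := exists_sum_two_rpow_le (mul_pos hη0 (abs_pos.2 hA0))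
  obtain ⟨C₂, hC₂, hs₂⟩ := exists_sum_two_rpow_le (mul_pos hη0 (abs_pos.2 hG0))
  refine ⟨4 * (C₁ + C₂), by positivity, fun B M₀ M₁ hB hM₀ hM₁ h₀ h₁ => ?_⟩
  set L := Real.logb 2 (M₁ / M₀) with hL
  set M := M₀ ^ (1 - θ) * M₁ ^ θ with hM
  have hM0 : 0 < M := by positivity
  have main : ∀ f g : α → ℂ, IsTest μ f → IsTest μ g → ∫ x, ‖f x‖ ^ (1 / a) ∂μ ≤ 1 →
      ∫ x, ‖g x‖ ^ (1 / c) ∂μ ≤ 1 → ‖B f g‖ ≤ 4 * (C₁ + C₂) * M := by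
    intro f g hf hg hf1 hg1
    refine tendsto_form_levelSum hB hf hg fun N => (norm_form_levelSum_le hB hf hg N).trans ?_
    set S := Finset.Ico (-(N : ℤ)) N
    set x : ℤ → ℝ := fun m => 2 ^ ((m : ℝ) / a) * μ.real (levelSet f m) with hx
    set y : ℤ → ℝ := fun n => 2 ^ ((n : ℝ) / c) * μ.real (levelSet g n) with hy
    have hx0 : ∀ m, 0 ≤ x m := fun m => by positivity
    have hy0 : ∀ m, 0 ≤ y m := fun m => by positivity
    have hxs : ∑ m ∈ S, x m ≤ 1 := (sum_levelSet_le ha0 ha hf S).trans hf1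
    have hys : ∑ m ∈ S, y m ≤ 1 := (sum_levelSet_le hc0 hc hg S).trans hg1
    have hx1 : ∀ m, x m ≤ 1 := fun m => by
      have := sum_levelSet_le ha0 ha hf {m}
      rw [Finset.sum_singleton] at this
      exact this.trans hf1
    have hy1 : ∀ m, y m ≤ 1 := fun m => by
      have := sum_levelSet_le hc0 hc hg {m}
      rw [Finset.sum_singleton] at this
      exact this.trans hg1
    have hterm : ∀ m n : ℤ, ‖B (levelPart f m) (levelPart g n)‖ ≤
        4 * M * (2 ^ (-η * |m * A + n * G - L|) * (x m + y n)) := by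
      intro m n
      -- The sign of σ is free; choosing it as the sign of mA + nG - L yields decay in |mA + nG -
      -- L|.
      have key : ∀ σ : ℝ, |σ| = η → ‖B (levelPart f m) (levelPart g n)‖ ≤
          4 * M * (2 ^ (-σ * (m * A + n * G - L)) * (x m + y n)) := by
        intro σ hσ
        have hσ' := abs_le.1 hσ.le
        have b0 := norm_form_levelPart_le hB hf hg h₀ m n
        have b1 := norm_form_levelPart_le hB hf hg h₁ m n
        have k := level_geometric_mean (θ := θ) (σ := σ) hM₀ hM₁ ha0 hc0 measureReal_nonneg
          measureReal_nonneg (by norm_num : (0 : ℝ) < 4) (by linarith) (by linarith) (norm_nonneg _)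
          b0 b1 ha₀.le ha₁.le hc₀.le hc₁.le hae hce
        refine k.trans ?_
        rw [mul_assoc (4 * M)]
        have e1 : |σ * (a₁ - a₀)| ≤ η * |a₁ - a₀| := by rw [abs_mul, hσ]
        have e2 : |σ * (c₁ - c₀)| ≤ η * |c₁ - c₀| := by rw [abs_mul, hσ]
        have e1' := abs_le.1 e1
        have e2' := abs_le.1 e2
        have q1 : 0 ≤ a + σ * (a₁ - a₀) := by
          have : a + σ * (a₁ - a₀) = a₀ * (1 - (θ + σ)) + a₁ * (θ + σ) := by rw [hae]; ring
          rw [this]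
          have := mul_nonneg ha₀.le (by linarith : 0 ≤ 1 - (θ + σ))
          have := mul_nonneg ha₁.le (by linarith : 0 ≤ θ + σ)
          linarith
        have q2 : 0 ≤ c + σ * (c₁ - c₀) := by
          have : c + σ * (c₁ - c₀) = c₀ * (1 - (θ + σ)) + c₁ * (θ + σ) := by rw [hce]; ring
          rw [this]
          have := mul_nonneg hc₀.le (by linarith : 0 ≤ 1 - (θ + σ))
          have := mul_nonneg hc₁.le (by linarith : 0 ≤ θ + σ)
          linarith
        have := rpow_mul_rpow_le_add (hx0 m) (hx1 m) (hy0 n) (hy1 n) q1 q2 (by linarith)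
        gcongr
      rcases le_total 0 ((m : ℝ) * A + n * G - L) with h | h
      · rw [abs_of_nonneg h]
        exact key η (abs_of_pos hη0)
      · rw [abs_of_nonpos h]
        have := key (-η) (by rw [abs_neg, abs_of_pos hη0])
        rwa [show -(-η) * ((m : ℝ) * A + n * G - L) = -η * -((m : ℝ) * A + n * G - L) by ring] at this
    -- For fixed `m` the factor is geometric in `n`, and conversely. This needs G ≠ 0 and A ≠ 0,
    -- that is, end points that differ in both coordinates.
    have habs : ∀ (m n : ℤ), (2 : ℝ) ^ (-η * |m * A + n * G - L|) =
        2 ^ (-(η * |G|) * |(n : ℝ) - (L - m * A) / G|) := fun m n => by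
      have : (m : ℝ) * A + n * G - L = G * ((n : ℝ) - (L - m * A) / G) := by field_simp; ring
      rw [this, abs_mul]; congr 1; ring
    have habs' : ∀ (m n : ℤ), (2 : ℝ) ^ (-η * |m * A + n * G - L|) =
        2 ^ (-(η * |A|) * |(m : ℝ) - (L - n * G) / A|) := fun m n => by
      have : (m : ℝ) * A + n * G - L = A * ((m : ℝ) - (L - n * G) / A) := by field_simp; ring
      rw [this, abs_mul]; congr 1; ring
    calc ∑ m ∈ S, ∑ n ∈ S, ‖B (levelPart f m) (levelPart g n)‖
        ≤ ∑ m ∈ S, ∑ n ∈ S, 4 * M * (2 ^ (-η * |m * A + n * G - L|) * (x m + y n)) :=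
          Finset.sum_le_sum fun m _ => Finset.sum_le_sum fun n _ => hterm m n
      _ = 4 * M * (∑ m ∈ S, x m * ∑ n ∈ S, 2 ^ (-η * |m * A + n * G - L|) +
          ∑ n ∈ S, y n * ∑ m ∈ S, 2 ^ (-η * |m * A + n * G - L|)) := by
        simp_rw [← Finset.mul_sum, mul_add, Finset.sum_add_distrib, Finset.mul_sum]
        rw [mul_add, Finset.mul_sum, Finset.mul_sum]
        congr 1
        · refine Finset.sum_congr rfl fun m _ => ?_
          rw [Finset.mul_sum]
          exact Finset.sum_congr rfl fun n _ => by ring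
        · rw [Finset.sum_comm]
          refine Finset.sum_congr rfl fun m _ => ?_
          rw [Finset.mul_sum]
          exact Finset.sum_congr rfl fun n _ => by ring
      _ ≤ 4 * M * (∑ m ∈ S, x m * C₂ + ∑ n ∈ S, y n * C₁) := by
        refine mul_le_mul_of_nonneg_left (add_le_add ?_ ?_) (by positivity)
        · refine Finset.sum_le_sum fun m _ => mul_le_mul_of_nonneg_left ?_ (hx0 m)
          simp_rw [habs]; exact hs₂ _ S
        · refine Finset.sum_le_sum fun n _ => mul_le_mul_of_nonneg_left ?_ (hy0 n)
          simp_rw [habs']; exact hs₁ _ S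
      _ ≤ 4 * M * (1 * C₂ + 1 * C₁) := by
        rw [← Finset.sum_mul, ← Finset.sum_mul]
        gcongr
      _ = _ := by ring
  exact strong_of_normalized hB ha0 ha hc0 hc main

end Interpolation

end ShellProjection

namespace ShellProjection

open Complex FourierTransform

variable {d : ℕ} {f g : E d → ℂ}

/-! ### Bernstein's inequality for the shell form -/

theorem fourier_add_apply {f f' : E d → ℂ} (hf : Integrable f) (hf' : Integrable f') (ξ : E d) :
    𝓕 (f + f') ξ = 𝓕 f ξ + 𝓕 f' ξ := by
  have := VectorFourier.fourierIntegral_add (L := innerₗ (E d)) (e := Real.fourierChar)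
    (μ := volume) Real.continuous_fourierChar (by simpa using continuous_inner) hf hf'
  exact (congrFun this ξ)

theorem fourier_smul_apply (c : ℂ) (f : E d → ℂ) (ξ : E d) : 𝓕 (c • f) ξ = c * 𝓕 f ξ := by
  rw [Real.fourier_eq', Real.fourier_eq', ← integral_const_mul]
  congr 1; ext x
  simp only [Pi.smul_apply, smul_eq_mul]
  ring

theorem isTestForm_shellForm (d : ℕ) (δ : ℝ) : IsTestForm volume (shellForm d δ) := by
  have hadd : ∀ f f' g : E d → ℂ, IsTest volume f → IsTest volume f' → IsTest volume g →
      shellForm d δ (f + f') g = shellForm d δ f g + shellForm d δ f' g := fun f f' g hf hf' hg => by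
    rw [shellForm, form, form, form, ← integral_add
      (integrable_form (integrable_shellSymbol d δ) hf.integrable hg.integrable)
      (integrable_form (integrable_shellSymbol d δ) hf'.integrable hg.integrable)]
    congr 1; ext ξ
    rw [fourier_add_apply hf.integrable hf'.integrable]; ring
  have hsmul : ∀ (c : ℂ) (f g : E d → ℂ), shellForm d δ (c • f) g = c * shellForm d δ f g :=
    fun c f g => by
      rw [shellForm, form, form, ← integral_const_mul]
      congr 1; ext ξ
      rw [fourier_smul_apply]; ring
  refine ⟨hadd, fun f g g' hf hg hg' => ?_, fun c f g _ _ => hsmul c f g, fun c f g _ _ => ?_,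
    ∫ ξ, ‖shellSymbol d δ ξ‖, integral_nonneg fun _ => norm_nonneg _, fun f g hf hg => ?_⟩
  · rw [shellForm_swap, hadd g g' f hg hg' hf, shellForm_swap, shellForm_swap δ g']
  · rw [shellForm_swap, hsmul, shellForm_swap]
  · exact norm_form_le_of_kernel (integrable_shellSymbol d δ) hf.integrable hg.integrable
      (norm_fourier_le _)

/-- This is what makes Bernstein's inequality possible: a function may be replaced by any other with
the same frequencies in the unit ball. -/
theorem shellForm_congr {δ : ℝ} {f f' : E d → ℂ} (h : ∀ ξ ∈ Metric.closedBall (0 : E d) 1, 𝓕 f ξ = 𝓕 f' ξ)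
    (g : E d → ℂ) : shellForm d δ f g = shellForm d δ f' g := by
  classical
  rw [shellForm, form, form]
  congr 1; ext ξ
  rw [shellSymbol, indicator_apply]
  split_ifs with hξ
  · rw [h ξ (Metric.ball_subset_closedBall (unitShell_subset_ball d δ hξ))]
  · simp

theorem exists_schwartz_fourier_eq_one (d : ℕ) : ∃ φ : 𝓢(E d, ℂ),
    ∀ ξ ∈ Metric.closedBall (0 : E d) 1, 𝓕 (φ : E d → ℂ) ξ = 1 := by
  let b : ContDiffBump (0 : E d) := ⟨1, 2, by norm_num, by norm_num⟩
  have hc : HasCompactSupport fun x => ((b x : ℝ) : ℂ) :=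
    b.hasCompactSupport.comp_left (g := fun r : ℝ => (r : ℂ)) (by simp)
  have hs : ContDiff ℝ (⊤ : ℕ∞) fun x => ((b x : ℝ) : ℂ) := ofRealCLM.contDiff.comp b.contDiff
  let ψ : 𝓢(E d, ℂ) := hc.toSchwartzMap hs
  refine ⟨𝓕⁻ ψ, fun ξ hξ => ?_⟩
  rw [← SchwartzMap.fourier_coe, FourierTransform.fourier_fourierInv_eq]
  change ((b ξ : ℝ) : ℂ) = 1
  rw [b.one_of_mem_closedBall hξ]; simp

open Convolution in
/-- An integrable function agrees in frequency, on the unit ball, with a bounded one. -/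
theorem exists_isTest_fourier_eq (d : ℕ) : ∃ K : ℝ, 1 ≤ K ∧ ∀ f : E d → ℂ, IsTest volume f →
    ∃ h : E d → ℂ, IsTest volume h ∧ (∀ ξ ∈ Metric.closedBall (0 : E d) 1, 𝓕 h ξ = 𝓕 f ξ) ∧
      (∀ x, ‖h x‖ ≤ K * ∫ y, ‖f y‖) ∧ ∫ x, ‖h x‖ ≤ K * ∫ y, ‖f y‖ := by
  obtain ⟨φ, hφ⟩ := exists_schwartz_fourier_eq_one d
  obtain ⟨C, hC0, hC⟩ := φ.decay 0 0
  simp only [pow_zero, norm_iteratedFDeriv_zero, one_mul] at hC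
  have hφi : Integrable (φ : E d → ℂ) := φ.integrable
  -- One constant for both cases of Young's inequality for f ∗ φ: the sup norm of φ controls the sup
  -- norm, its integral the `L¹` norm.
  refine ⟨max 1 (max C (∫ x, ‖φ x‖)), le_max_left _ _, fun f hf => ?_⟩
  set K := max 1 (max C (∫ x, ‖φ x‖))
  have hKC : C ≤ K := (le_max_left _ _).trans (le_max_right _ _)
  have hKI : ∫ x, ‖φ x‖ ≤ K := (le_max_right _ _).trans (le_max_right _ _)
  set h := f ⋆[ContinuousLinearMap.mul ℂ ℂ] (φ : E d → ℂ) with hh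
  have hcont : Continuous h := BddAbove.continuous_convolution_right_of_integrable _
    ⟨C, by rintro _ ⟨x, rfl⟩; exact hC x⟩ hf.integrable φ.continuous
  have hi : Integrable h := hf.integrable.integrable_convolution _ hφi
  have hI0 : 0 ≤ ∫ y, ‖f y‖ := integral_nonneg fun _ => norm_nonneg _
  have hpt : ∀ x, ‖h x‖ ≤ K * ∫ y, ‖f y‖ := fun x => by
    rw [hh, convolution_def, ← integral_const_mul]
    refine norm_integral_le_of_norm_le (hf.integrable.norm.const_mul K)
      (Filter.Eventually.of_forall fun y => ?_)
    rw [ContinuousLinearMap.mul_apply', norm_mul, mul_comm]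
    gcongr
    exact (hC _).trans hKC
  refine ⟨h, ⟨hcont.measurable, hi, _, hpt⟩, fun ξ hξ => ?_, hpt, ?_⟩
  · rw [hh, Real.fourier_mul_convolution_eq hf.integrable hφi, hφ ξ hξ, mul_one]
  · have e := integral_convolution (ContinuousLinearMap.mul ℝ ℝ) (μ := volume) (ν := volume)
      hf.integrable.norm hφi.norm
    rw [ContinuousLinearMap.mul_apply'] at e
    calc ∫ x, ‖h x‖ ≤ ∫ x, ((fun y => ‖f y‖) ⋆[ContinuousLinearMap.mul ℝ ℝ] fun y => ‖φ y‖) x := by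
          refine integral_mono hi.norm (hf.integrable.norm.integrable_convolution _ hφi.norm) fun x => ?_
          simp only [hh, convolution_def]
          refine (norm_integral_le_integral_norm _).trans (le_of_eq ?_)
          congr 1; ext y
          simp
      _ = (∫ y, ‖f y‖) * ∫ y, ‖φ y‖ := e
      _ ≤ _ := by rw [mul_comm]; gcongr

/-- The parts of `f` where `|f| ≤ 1` and where `|f| > 1`. -/
theorem exists_truncation {α : Type*} [MeasurableSpace α] {μ : Measure α} {f : α → ℂ}
    (hf : IsTest μ f) {a : ℝ} (ha : 0 < a) (ha1 : a ≤ 1) (h1 : ∫ x, ‖f x‖ ^ (1 / a) ∂μ ≤ 1) :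
    ∃ f₀ f₁, IsTest μ f₀ ∧ IsTest μ f₁ ∧ f = f₀ + f₁ ∧ (∀ x, ‖f₀ x‖ ≤ 1) ∧
      (∀ x, ‖f₀ x‖ ≤ ‖f x‖) ∧ ∫ x, ‖f₁ x‖ ∂μ ≤ 1 := by
  classical
  set S := {x | ‖f x‖ ≤ 1} with hS
  have hSm : MeasurableSet S := measurableSet_le hf.measurable.norm measurable_const
  have ha' : 1 ≤ 1 / a := by rw [le_div_iff₀ ha]; linarith
  refine ⟨S.indicator f, Sᶜ.indicator f, hf.indicator hSm, hf.indicator hSm.compl,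
    (indicator_self_add_compl S f).symm, fun x => ?_, fun x => norm_indicator_le_norm_self _ _, ?_⟩
  · rw [indicator_apply]
    split_ifs with h
    · exact h
    · simp
  · refine (integral_mono (hf.indicator hSm.compl).integrable.norm (hf.integrable_rpow ha')
      fun x => ?_).trans h1
    simp only [indicator_apply]
    split_ifs with h
    · have h2 : 1 < ‖f x‖ := by
        by_contra h'
        exact h (not_lt.1 h')
      simpa using Real.rpow_le_rpow_of_exponent_le h2.le ha'
    · rw [norm_zero]; positivity

theorem integral_rpow_le_of_le {α : Type*} [MeasurableSpace α] {μ : Measure α} {f : α → ℂ}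
    (hf : IsTest μ f) {p q K : ℝ} (hp : 1 ≤ p) (hpq : p ≤ q) (hb : ∀ x, ‖f x‖ ≤ K) :
    ∫ x, ‖f x‖ ^ q ∂μ ≤ K ^ (q - p) * ∫ x, ‖f x‖ ^ p ∂μ := by
  rw [← integral_const_mul]
  refine integral_mono (hf.integrable_rpow (hp.trans hpq)) ((hf.integrable_rpow hp).const_mul _)
    fun x => ?_
  simp only
  calc ‖f x‖ ^ q = ‖f x‖ ^ (q - p) * ‖f x‖ ^ p := by
        rw [← Real.rpow_add_of_nonneg (norm_nonneg _) (by linarith) (by linarith)]; congr 1; ring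
    _ ≤ _ := by
        have := hb x
        have : 0 ≤ q - p := by linarith
        gcongr

/-- Split a normalized `f` at height 1. The small part has bounded L^{1/a} norm because 1/a ≥ 1/a'.
The large part has L¹ norm at most 1 because 1/a' ≥ 1, and its convolution with φ, which gives the
same form, is both bounded and integrable. -/
theorem exists_strong_of_strong_left (d : ℕ) : ∃ K : ℝ, 0 < K ∧ ∀ a a' c M δ : ℝ, 0 < a → a ≤ a' →
    a' ≤ 1 → 0 ≤ M → Strong volume (shellForm d δ) a c M →
      Strong volume (shellForm d δ) a' c (K * M) := by
  obtain ⟨K, hK1, h⟩ := exists_isTest_fourier_eq d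
  refine ⟨1 + K, by linarith, fun a a' c M δ ha haa ha1 hM hs f g hf hg => ?_⟩
  have ha' : 0 < a' := ha.trans_le haa
  have hB := isTestForm_shellForm d δ
  have hg0 := powNorm_nonneg (μ := (volume : Measure (E d))) c g
  suffices ‖shellForm d δ f g‖ ≤ ((1 + K) * M * powNorm volume c g) * powNorm volume a' f by
    linarith
  refine norm_form_le_of_normalized hB ha' ha1 hg (fun f hf hf1 => ?_) hf
  obtain ⟨f₀, f₁, hf₀, hf₁, hsum, hle, hle', hint⟩ := exists_truncation hf ha' ha1 hf1
  obtain ⟨u, hu, hue, hub, hui⟩ := h f₁ hf₁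
  have hub' : ∀ x, ‖u x‖ ≤ K := fun x => (hub x).trans (by nlinarith)
  have hui' : ∫ x, ‖u x‖ ≤ K := hui.trans (by nlinarith)
  have hexp : 1 / a' ≤ 1 / a := one_div_le_one_div_of_le ha haa
  have hexp1 : 1 ≤ 1 / a' := by rw [le_div_iff₀ ha']; linarith
  have n₀ : powNorm volume a f₀ ≤ 1 := by
    refine Real.rpow_le_one (integral_rpow_nonneg a f₀) ?_ ha.le
    have := integral_rpow_le_of_le hf₀ hexp1 hexp hle
    rw [Real.one_rpow, one_mul] at this
    refine this.trans (le_trans (integral_mono (hf₀.integrable_rpow hexp1) (hf.integrable_rpow hexp1)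
      fun x => Real.rpow_le_rpow (norm_nonneg _) (hle' x) (by positivity)) hf1)
  have n₁ : powNorm volume a u ≤ K := by
    have := integral_rpow_le_of_le hu le_rfl (hexp1.trans hexp) hub'
    simp only [Real.rpow_one] at this
    have h2 : ∫ x, ‖u x‖ ^ (1 / a) ≤ K ^ (1 / a) := by
      refine this.trans ?_
      calc _ ≤ K ^ (1 / a - 1) * K := by gcongr
        _ = K ^ (1 / a) := by
          rw [← Real.rpow_add_one (by positivity)]; congr 1; ring
    calc _ ≤ (K ^ (1 / a)) ^ a := Real.rpow_le_rpow (integral_rpow_nonneg a u) h2 ha.le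
      _ = K := by rw [← Real.rpow_mul (by linarith), one_div_mul_cancel ha.ne', Real.rpow_one]
  rw [hsum, hB.add_left _ _ _ hf₀ hf₁ hg, ← shellForm_congr hue]
  refine (norm_add_le _ _).trans ?_
  have s₀ := hs _ _ hf₀ hg
  have s₁ := hs _ _ hu hg
  calc _ ≤ M * (1 * powNorm volume c g) + M * (K * powNorm volume c g) := by
        refine add_le_add (s₀.trans ?_) (s₁.trans ?_) <;> gcongr
    _ = _ := by ring

theorem Strong.swap {a c M δ : ℝ} (h : Strong volume (shellForm d δ) a c M) :
    Strong volume (shellForm d δ) c a M := fun f g hf hg => by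
  rw [shellForm_swap, mul_comm (powNorm _ _ _)]
  exact h g f hg hf

theorem Strong.mono {a c M M' δ : ℝ} (h : Strong volume (shellForm d δ) a c M) (hM : M ≤ M') :
    Strong volume (shellForm d δ) a c M' := fun f g hf hg => by
  have h1 := powNorm_nonneg (μ := (volume : Measure (E d))) a f
  have h2 := powNorm_nonneg (μ := (volume : Measure (E d))) c g
  exact (h f g hf hg).trans (by gcongr)

theorem Restricted.mono {a c M M' δ : ℝ} (h : Restricted volume (shellForm d δ) a c M)
    (hM : M ≤ M') : Restricted volume (shellForm d δ) a c M' := fun f g X Y hf hg =>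
  (h f g X Y hf hg).trans (by gcongr)

/-- Bernstein's inequality, in the two arguments. -/
theorem exists_strong_of_strong (d : ℕ) : ∃ K : ℝ, 0 < K ∧ ∀ a a' c c' M δ : ℝ, 0 < a → a ≤ a' →
    a' ≤ 1 → 0 < c → c ≤ c' → c' ≤ 1 → 0 ≤ M → Strong volume (shellForm d δ) a c M →
      Strong volume (shellForm d δ) a' c' (K * M) := by
  obtain ⟨K, hK, h⟩ := exists_strong_of_strong_left d
  refine ⟨K * K, by positivity, fun a a' c c' M δ ha haa ha1 hc hcc hc1 hM hs => ?_⟩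
  have := h c c' a' (K * M) δ hc hcc hc1 (by positivity) (h a a' c M δ ha haa ha1 hM hs).swap
  rw [← mul_assoc] at this
  exact this.swap

theorem powNorm_half {f : E d → ℂ} : powNorm volume (1 / 2) f = √(∫ x, ‖f x‖ ^ 2) := by
  rw [powNorm, Real.sqrt_eq_rpow]; norm_num

theorem strong_shellForm_half (d : ℕ) (δ : ℝ) : Strong volume (shellForm d δ) (1 / 2) (1 / 2) 1 := by
  intro f g hf hg
  rw [powNorm_half, powNorm_half]
  exact norm_form_le_bound zero_le_one (measurable_shellSymbol d δ).aestronglyMeasurable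
    (norm_shellSymbol_le δ) hf hg

/-- Bernstein's inequality starting from L² → L². It settles δ in [1/2, 1], where powers of δ are
harmless, and controls errors in density arguments. -/
theorem exists_strong_trivial (d : ℕ) : ∃ K : ℝ, 0 < K ∧ ∀ a c δ : ℝ, 1 / 2 ≤ a → a ≤ 1 →
    1 / 2 ≤ c → c ≤ 1 → Strong volume (shellForm d δ) a c K := by
  obtain ⟨K, hK, h⟩ := exists_strong_of_strong d
  exact ⟨K, hK, fun a c δ ha ha1 hc hc1 => by
    simpa using h _ a _ c 1 δ (by norm_num) ha ha1 (by norm_num) hc hc1 zero_le_one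
      (strong_shellForm_half d δ)⟩

theorem integral_shell_eq_shellForm {δ : ℝ} (f : E d → ℂ) :
    ((∫ ξ in unitShell d δ, ‖𝓕 f ξ‖ ^ 2 : ℝ) : ℂ) =
      shellForm d δ f fun x => (starRingEnd ℂ) (f x) := by
  classical
  rw [← integral_complex_ofReal, ← integral_indicator (measurableSet_unitShell d δ), shellForm, form]
  congr 1; ext ξ
  rw [shellSymbol, indicator_apply, indicator_apply, fourierInv_conj]
  split_ifs
  · rw [Pi.one_apply, one_mul, mul_conj, normSq_eq_norm_sq]
  · simp

/-- The `T T^*` argument. -/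
theorem Strong.half_right {a M δ : ℝ} (hM : 0 ≤ M) (h : Strong volume (shellForm d δ) a a M) :
    Strong volume (shellForm d δ) a (1 / 2) (√M) := by
  intro f g hf hg
  refine (norm_shellForm_le_sqrt hf hg).trans ?_
  rw [powNorm_half, ← mul_assoc]
  gcongr
  have h1 := h _ _ hf hf.conj
  rw [← integral_shell_eq_shellForm, norm_real] at h1
  have h2 : powNorm volume a (fun x => (starRingEnd ℂ) (f x)) = powNorm volume a f := by
    simp [powNorm]
  rw [h2] at h1
  refine (Real.sqrt_le_sqrt ((le_abs_self _).trans h1)).trans ?_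
  rw [Real.sqrt_mul hM, Real.sqrt_mul_self (powNorm_nonneg _ _)]

/-- Convexity of restricted estimates. -/
theorem Restricted.geometric_mean {a₀ a₁ c₀ c₁ θ M₀ M₁ δ : ℝ} (hM₀ : 0 < M₀) (hM₁ : 0 < M₁)
    (ha₀ : 0 ≤ a₀) (ha₁ : 0 ≤ a₁) (hc₀ : 0 ≤ c₀) (hc₁ : 0 ≤ c₁) (hθ0 : 0 ≤ θ) (hθ1 : θ ≤ 1)
    (h₀ : Restricted volume (shellForm d δ) a₀ c₀ M₀)
    (h₁ : Restricted volume (shellForm d δ) a₁ c₁ M₁) :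
    Restricted volume (shellForm d δ) ((1 - θ) * a₀ + θ * a₁) ((1 - θ) * c₀ + θ * c₁)
      (M₀ ^ (1 - θ) * M₁ ^ θ) := by
  intro f g X Y hf hg
  have k₀ := h₀ f g X Y hf hg
  have k₁ := h₁ f g X Y hf hg
  set b := ‖shellForm d δ f g‖
  have hu : 0 ≤ volume.real X := measureReal_nonneg
  have hv : 0 ≤ volume.real Y := measureReal_nonneg
  set u := volume.real X
  set v := volume.real Y
  have hθ' : 0 ≤ 1 - θ := by linarith
  calc b = b ^ (1 - θ) * b ^ θ := by
        rw [← Real.rpow_add_of_nonneg (norm_nonneg _) hθ' hθ0, sub_add_cancel, Real.rpow_one]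
    _ ≤ (M₀ * (u ^ a₀ * v ^ c₀)) ^ (1 - θ) * (M₁ * (u ^ a₁ * v ^ c₁)) ^ θ := by
        gcongr
    _ = _ := by
        rw [Real.mul_rpow hM₀.le (by positivity), Real.mul_rpow hM₁.le (by positivity),
          Real.mul_rpow (by positivity) (by positivity), Real.mul_rpow (by positivity) (by positivity),
          Real.rpow_add_of_nonneg hu (by positivity) (by positivity),
          Real.rpow_add_of_nonneg hv (by positivity) (by positivity), ← Real.rpow_mul hu,
          ← Real.rpow_mul hu, ← Real.rpow_mul hv, ← Real.rpow_mul hv, mul_comm a₀, mul_comm a₁,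
          mul_comm c₀, mul_comm c₁]
        ring

end ShellProjection

namespace ShellProjection

variable {d : ℕ}

/-! ### Geometry of the regions -/

/-- The pentagon of exponents, given by inequalities. -/
def pentagon (d : ℕ) : Set (ℝ × ℝ) :=
  {X | 1 / 2 ≤ X.1 ∧ X.2 ≤ 1 / 2 ∧ ((d : ℝ) + 1) * (X.1 - X.2) ≤ 2 ∧
    ((d : ℝ) + 1) * X.1 + ((d : ℝ) - 1) * X.2 ≤ d + 1 ∧
    (d : ℝ) - 1 ≤ ((d : ℝ) - 1) * X.1 + ((d : ℝ) + 1) * X.2}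

/-- The trapezoid of exponents, given by inequalities. -/
def trapezoid (d : ℕ) : Set (ℝ × ℝ) :=
  {X | X.1 ≤ 1 ∧ X.2 ≤ 1 / 2 ∧ (d : ℝ) - 1 ≤ 2 * d * X.2 ∧
    (d : ℝ) + 1 ≤ ((d : ℝ) + 1) * X.1 + ((d : ℝ) - 1) * X.2}

theorem convex_pentagon (d : ℕ) : Convex ℝ (pentagon d) := by
  intro X hX Y hY r s hr hs hrs
  obtain ⟨h1, h2, h3, h4, h5⟩ := hX
  obtain ⟨k1, k2, k3, k4, k5⟩ := hY
  have hs' : s = 1 - r := by linarith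
  subst hs'
  refine ⟨?_, ?_, ?_, ?_, ?_⟩ <;> simp only [Prod.fst_add, Prod.snd_add, Prod.smul_fst, Prod.smul_snd,
    smul_eq_mul]
  · nlinarith [mul_le_mul_of_nonneg_left h1 hr, mul_le_mul_of_nonneg_left k1 hs]
  · nlinarith [mul_le_mul_of_nonneg_left h2 hr, mul_le_mul_of_nonneg_left k2 hs]
  · nlinarith [mul_le_mul_of_nonneg_left h3 hr, mul_le_mul_of_nonneg_left k3 hs]
  · nlinarith [mul_le_mul_of_nonneg_left h4 hr, mul_le_mul_of_nonneg_left k4 hs]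
  · nlinarith [mul_le_mul_of_nonneg_left h5 hr, mul_le_mul_of_nonneg_left k5 hs]

theorem convex_trapezoid (d : ℕ) : Convex ℝ (trapezoid d) := by
  intro X hX Y hY r s hr hs hrs
  obtain ⟨h1, h2, h3, h4⟩ := hX
  obtain ⟨k1, k2, k3, k4⟩ := hY
  have hs' : s = 1 - r := by linarith
  subst hs'
  refine ⟨?_, ?_, ?_, ?_⟩ <;> simp only [Prod.fst_add, Prod.snd_add, Prod.smul_fst, Prod.smul_snd,
    smul_eq_mul]
  · nlinarith [mul_le_mul_of_nonneg_left h1 hr, mul_le_mul_of_nonneg_left k1 hs]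
  · nlinarith [mul_le_mul_of_nonneg_left h2 hr, mul_le_mul_of_nonneg_left k2 hs]
  · nlinarith [mul_le_mul_of_nonneg_left h3 hr, mul_le_mul_of_nonneg_left k3 hs]
  · nlinarith [mul_le_mul_of_nonneg_left h4 hr, mul_le_mul_of_nonneg_left k4 hs]

theorem dual_dual (X : ℝ × ℝ) : dual (dual X) = X := by
  ext <;> simp [dual]

theorem dual_mem_pentagon {X : ℝ × ℝ} (h : X ∈ pentagon d) : dual X ∈ pentagon d := by
  obtain ⟨h1, h2, h3, h4, h5⟩ := h
  refine ⟨?_, ?_, ?_, ?_, ?_⟩ <;> simp only [dual] <;> linarith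

theorem ptC_fst (hd : 2 ≤ d) : ((d : ℝ) + 1) * ((ptC d).1 - (ptC d).2) = 2 := by
  have : (0 : ℝ) < d := by positivity
  simp only [ptC]
  field_simp
  ring

theorem ptC_snd (hd : 2 ≤ d) : 2 * (d : ℝ) * (ptC d).2 = d - 1 := by
  have : (0 : ℝ) < d := by positivity
  simp only [ptC]
  field_simp

theorem ptA_fst (d : ℕ) : ((d : ℝ) + 1) * ((ptA d).1 - 1 / 2) = 1 := by
  simp only [ptA]
  field_simp
  ring

theorem ptA_mem_pentagon (hd : 2 ≤ d) : ptA d ∈ pentagon d := by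
  have h := ptA_fst d
  have hn : (2 : ℝ) ≤ d := by exact_mod_cast hd
  have h2 : (ptA d).2 = 1 / 2 := rfl
  have h3 : 1 / 2 ≤ (ptA d).1 := by nlinarith
  refine ⟨h3, h2.le, ?_, ?_, ?_⟩ <;> rw [h2] <;> nlinarith

theorem ptC_mem_pentagon (hd : 2 ≤ d) : ptC d ∈ pentagon d := by
  have h := ptC_fst hd
  have h' := ptC_snd hd
  have hn : (2 : ℝ) ≤ d := by exact_mod_cast hd
  have h3 : (ptC d).2 ≤ 1 / 2 := by nlinarith
  have h4 : (d : ℝ) * (((d : ℝ) + 1) * ((ptC d).1 - 1 / 2)) = (3 * d - 1) / 2 := by nlinarith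
  have h5 : 1 / 2 ≤ (ptC d).1 := by
    by_contra hc
    push Not at hc
    have : (d : ℝ) * (((d : ℝ) + 1) * ((ptC d).1 - 1 / 2)) ≤ 0 :=
      mul_nonpos_of_nonneg_of_nonpos (by positivity)
        (mul_nonpos_of_nonneg_of_nonpos (by positivity) (by linarith))
    linarith
  refine ⟨h5, h3, h.le, ?_, ?_⟩ <;> nlinarith

theorem ptC_snd_pos (hd : 2 ≤ d) : 0 < (ptC d).2 := by
  have hn : (2 : ℝ) ≤ d := by exact_mod_cast hd
  exact div_pos (by linarith) (by positivity)

theorem ptC_fst_lt_one (hd : 2 ≤ d) : (ptC d).1 < 1 := by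
  have hn : (2 : ℝ) ≤ d := by exact_mod_cast hd
  have h := (ptC_mem_pentagon hd).2.2.2.1
  have h2 := ptC_snd_pos hd
  by_contra hc
  push Not at hc
  nlinarith

theorem half_mem_pentagon (d : ℕ) : ((1 / 2, 1 / 2) : ℝ × ℝ) ∈ pentagon d := by
  refine ⟨?_, ?_, ?_, ?_, ?_⟩ <;> simp only <;> linarith

theorem hull_subset_pentagon (hd : 2 ≤ d) :
    convexHull ℝ {(1 / 2, 1 / 2), ptA d, ptC d, dual (ptC d), dual (ptA d)} ⊆ pentagon d := by
  refine convexHull_min ?_ (convex_pentagon d)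
  rintro X (rfl | rfl | rfl | rfl | rfl)
  · exact half_mem_pentagon d
  · exact ptA_mem_pentagon hd
  · exact ptC_mem_pentagon hd
  · exact dual_mem_pentagon (ptC_mem_pentagon hd)
  · exact dual_mem_pentagon (ptA_mem_pentagon hd)

theorem hull_subset_trapezoid (hd : 2 ≤ d) :
    convexHull ℝ {ptA d, (1, 1 / 2), ptD d, ptC d} ⊆ trapezoid d := by
  have hn : (2 : ℝ) ≤ d := by exact_mod_cast hd
  have hD : 2 * (d : ℝ) * (ptD d).2 = d - 1 := ptC_snd hd
  have hA := ptA_mem_pentagon hd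
  have hC := ptC_mem_pentagon hd
  have hA1 := ptA_fst d
  have hC1 := ptC_fst hd
  have hC2 := ptC_snd hd
  have hA2 : (ptA d).2 = 1 / 2 := rfl
  have hD1 : (ptD d).1 = 1 := rfl
  refine convexHull_min ?_ (convex_trapezoid d)
  rintro X (rfl | rfl | rfl | rfl)
  · refine ⟨?_, hA.2.1, ?_, ?_⟩ <;> rw [hA2] at * <;> nlinarith
  · refine ⟨le_rfl, le_rfl, ?_, ?_⟩ <;> simp only <;> nlinarith
  · refine ⟨le_rfl, ?_, hD.ge, ?_⟩ <;> rw [hD1] at * <;> nlinarith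
  · refine ⟨(ptC_fst_lt_one hd).le, hC.2.1, hC2.ge, ?_⟩
    nlinarith

theorem _root_.Convex.mem_of_combination {S : Set (ℝ × ℝ)} (hS : Convex ℝ S) {P Q X : ℝ × ℝ} (hP : P ∈ S)
    (hQ : Q ∈ S) {r : ℝ} (hr : 0 ≤ r) (hr1 : r ≤ 1) (h1 : X.1 = (1 - r) * P.1 + r * Q.1)
    (h2 : X.2 = (1 - r) * P.2 + r * Q.2) : X ∈ S := by
  have := hS hP hQ (sub_nonneg.2 hr1) hr (by ring)
  convert this using 1
  ext <;> simp [h1, h2]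

theorem exists_ratio {p x q : ℝ} (h1 : p ≤ x) (h2 : x ≤ q) :
    ∃ r : ℝ, 0 ≤ r ∧ r ≤ 1 ∧ x = (1 - r) * p + r * q := by
  rcases h1.eq_or_lt with rfl | h1
  · exact ⟨0, le_rfl, zero_le_one, by ring⟩
  have : 0 < q - p := by linarith
  refine ⟨(x - p) / (q - p), by positivity, ?_, ?_⟩
  · rw [div_le_one this]; linarith
  · field_simp; ring

theorem _root_.Convex.mem_of_diagonal {S : Set (ℝ × ℝ)} (hS : Convex ℝ S) {P Q X : ℝ × ℝ} (hP : P ∈ S)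
    (hQ : Q ∈ S) (h1 : P.1 ≤ X.1) (h2 : X.1 ≤ Q.1) (h3 : X.1 - X.2 = P.1 - P.2)
    (h4 : X.1 - X.2 = Q.1 - Q.2) : X ∈ S := by
  obtain ⟨r, hr, hr1, h⟩ := exists_ratio h1 h2
  refine hS.mem_of_combination hP hQ hr hr1 h ?_
  linear_combination h - (1 - r) * h3 - r * h4

theorem _root_.Convex.mem_of_horizontal {S : Set (ℝ × ℝ)} (hS : Convex ℝ S) {P Q X : ℝ × ℝ}
    (hP : P ∈ S) (hQ : Q ∈ S) (h1 : P.1 ≤ X.1) (h2 : X.1 ≤ Q.1) (h3 : X.2 = P.2)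
    (h4 : X.2 = Q.2) : X ∈ S := by
  obtain ⟨r, hr, hr1, h⟩ := exists_ratio h1 h2
  refine hS.mem_of_combination hP hQ hr hr1 h ?_
  linear_combination (1 - r) * h3 + r * h4

/-- The point of height `b` on the line through `A` and `C`. -/
noncomputable def edgePoint (d : ℕ) (b : ℝ) : ℝ × ℝ := (1 - ((d : ℝ) - 1) / (d + 1) * b, b)

theorem edgePoint_fst (d : ℕ) (b : ℝ) :
    ((d : ℝ) + 1) * (edgePoint d b).1 + ((d : ℝ) - 1) * b = d + 1 := by
  simp only [edgePoint]; field_simp; ring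

theorem ptA_eq_edgePoint (d : ℕ) : ptA d = edgePoint d (1 / 2) := by
  ext
  · simp only [ptA, edgePoint]; field_simp; ring
  · rfl

theorem ptC_eq_edgePoint (hd : 2 ≤ d) : ptC d = edgePoint d (ptC d).2 := by
  have h := ptC_fst hd
  have h' := ptC_snd hd
  have h2 := edgePoint_fst d (ptC d).2
  ext
  · have : (0 : ℝ) < (d : ℝ) + 1 := by positivity
    refine mul_left_cancel₀ this.ne' ?_
    nlinarith
  · rfl

theorem edgePoint_mem_of_le {S : Set (ℝ × ℝ)} (hS : Convex ℝ S) (hd : 2 ≤ d) (hA : ptA d ∈ S)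
    (hC : ptC d ∈ S) {b : ℝ} (hb : (ptC d).2 ≤ b) (hb2 : b ≤ 1 / 2) : edgePoint d b ∈ S := by
  obtain ⟨r, hr, hr1, h⟩ := exists_ratio hb hb2
  rw [ptC_eq_edgePoint hd] at hC
  rw [ptA_eq_edgePoint] at hA
  refine hS.mem_of_combination hC hA hr hr1 ?_ h
  simp only [edgePoint]
  linear_combination -((d : ℝ) - 1) / (d + 1) * h

/-- Slice by the lines X.1 - X.2 = t. For (d+1)t ≤ 1 the slice ends on the two sides that meet at
(1/2, 1/2); for larger t it ends on the sides [A, C] and [A', C']. -/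
theorem pentagon_subset_hull (hd : 2 ≤ d) :
    pentagon d ⊆ convexHull ℝ {(1 / 2, 1 / 2), ptA d, ptC d, dual (ptC d), dual (ptA d)} := by
  set V : Set (ℝ × ℝ) := {(1 / 2, 1 / 2), ptA d, ptC d, dual (ptC d), dual (ptA d)} with hV
  rintro X ⟨h1, h2, h3, h4, h5⟩
  have hn : (2 : ℝ) ≤ d := by exact_mod_cast hd
  have hS := convex_convexHull ℝ V
  have hO : ((1 / 2, 1 / 2) : ℝ × ℝ) ∈ convexHull ℝ V := subset_convexHull ℝ V (by simp [hV])
  have hA : ptA d ∈ convexHull ℝ V := subset_convexHull ℝ V (by simp [hV])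
  have hC : ptC d ∈ convexHull ℝ V := subset_convexHull ℝ V (by simp [hV])
  have hC' : dual (ptC d) ∈ convexHull ℝ V := subset_convexHull ℝ V (by simp [hV])
  have hA' : dual (ptA d) ∈ convexHull ℝ V := subset_convexHull ℝ V (by simp [hV])
  have hA1 := ptA_fst d
  have hC1 := ptC_fst hd
  have hC2 := ptC_snd hd
  have hdual : Convex ℝ (dual ⁻¹' convexHull ℝ V) := by
    intro P hP Q hQ r s hr hs hrs
    have := hS hP hQ hr hs hrs
    have e : dual (r • P + s • Q) = r • dual P + s • dual Q := by
      have : s = 1 - r := by linarith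
      subst this
      ext <;> simp [dual] <;> ring
    rw [mem_preimage, e]
    exact this
  rcases le_total (((d : ℝ) + 1) * (X.1 - X.2)) 1 with ht | ht
  · have r0 : 0 ≤ ((d : ℝ) + 1) * (X.1 - X.2) := by
      have : 0 ≤ X.1 - X.2 := by linarith
      positivity
    refine hS.mem_of_diagonal (P := (1 / 2, 1 / 2 - (X.1 - X.2))) (Q := (1 / 2 + (X.1 - X.2), 1 / 2))
      ?_ ?_ h1 ?_ ?_ ?_
    · refine hS.mem_of_combination hO hA' r0 ht ?_ ?_
      · simp [dual, ptA]; ring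
      · simp only [dual]; linear_combination (X.1 - X.2) * hA1
    · refine hS.mem_of_combination hO hA r0 ht ?_ ?_
      · simp only; linear_combination -(X.1 - X.2) * hA1
      · simp [ptA]; ring
    all_goals simp only; linarith
  -- The height at which the slice through `X` meets the line A C.
  · obtain ⟨b, hb⟩ : ∃ b : ℝ, 2 * (d : ℝ) * b = (d + 1) * (1 - (X.1 - X.2)) :=
      ⟨(d + 1) * (1 - (X.1 - X.2)) / (2 * d), by field_simp⟩
    have hb1 : (ptC d).2 ≤ b := by nlinarith
    have hb2 : b ≤ 1 / 2 := by nlinarith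
    have e1 := edgePoint_fst d b
    have e2 : (edgePoint d b).2 = b := rfl
    have e3 : (edgePoint d b).1 - b = X.1 - X.2 := by
      have : (0 : ℝ) < (d : ℝ) + 1 := by positivity
      refine mul_left_cancel₀ this.ne' ?_
      linear_combination e1 - hb
    refine hS.mem_of_diagonal (P := dual (edgePoint d b)) (Q := edgePoint d b)
      (edgePoint_mem_of_le hdual hd hA' hC' hb1 hb2) (edgePoint_mem_of_le hS hd hA hC hb1 hb2)
      ?_ ?_ ?_ e3.symm
    · simp only [dual, e2]
      nlinarith
    · nlinarith
    · simp only [dual, e2]; linarith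

/-- Horizontal slices, from the side [A, C] to the side on which the first coordinate is 1. -/
theorem trapezoid_subset_hull (hd : 2 ≤ d) :
    trapezoid d ⊆ convexHull ℝ {ptA d, (1, 1 / 2), ptD d, ptC d} := by
  set V : Set (ℝ × ℝ) := {ptA d, (1, 1 / 2), ptD d, ptC d} with hV
  rintro X ⟨h1, h2, h3, h4⟩
  have hn : (2 : ℝ) ≤ d := by exact_mod_cast hd
  have hS := convex_convexHull ℝ V
  have hA : ptA d ∈ convexHull ℝ V := subset_convexHull ℝ V (by simp [hV])
  have hC : ptC d ∈ convexHull ℝ V := subset_convexHull ℝ V (by simp [hV])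
  have hD : ptD d ∈ convexHull ℝ V := subset_convexHull ℝ V (by simp [hV])
  have hE : ((1, 1 / 2) : ℝ × ℝ) ∈ convexHull ℝ V := subset_convexHull ℝ V (by simp [hV])
  have hC2 := ptC_snd hd
  have hb : (ptC d).2 ≤ X.2 := by nlinarith
  have e1 := edgePoint_fst d X.2
  refine hS.mem_of_horizontal (P := edgePoint d X.2) (Q := (1, X.2))
    (edgePoint_mem_of_le hS hd hA hC hb h2) ?_ (by nlinarith) h1 rfl rfl
  obtain ⟨r, hr, hr1, h⟩ := exists_ratio hb h2
  refine hS.mem_of_combination hD hE hr hr1 ?_ h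
  simp [ptD]

theorem mem_segment_CD {X : ℝ × ℝ} (h1 : (ptC d).1 ≤ X.1) (h2 : X.1 ≤ 1) (h3 : X.2 = (ptC d).2) :
    X ∈ segment ℝ (ptC d) (ptD d) := by
  exact (convex_segment (ptC d) (ptD d)).mem_of_horizontal (left_mem_segment ℝ _ _)
    (right_mem_segment ℝ _ _) h1 h2 h3 h3

theorem segment_CD_bounds (hd : 2 ≤ d) {X : ℝ × ℝ} (h : X ∈ segment ℝ (ptC d) (ptD d)) :
    (ptC d).1 ≤ X.1 ∧ X.1 ≤ 1 ∧ X.2 = (ptC d).2 := by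
  have hn : (2 : ℝ) ≤ d := by exact_mod_cast hd
  have hC1 := ptC_fst hd
  have hC2 := ptC_snd hd
  have hle := (ptC_fst_lt_one hd).le
  obtain ⟨r, s, hr, hs, hrs, rfl⟩ := h
  have hD1 : (ptD d).1 = 1 := rfl
  have hD2 : (ptD d).2 = (ptC d).2 := rfl
  simp only [Prod.fst_add, Prod.snd_add, Prod.smul_fst, Prod.smul_snd, smul_eq_mul, hD1, hD2]
  have hs' : s = 1 - r := by linarith
  subst hs'
  refine ⟨?_, ?_, ?_⟩
  · nlinarith
  · nlinarith
  · ring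

end ShellProjection

namespace ShellProjection

variable {d : ℕ}

/-! ### Strong estimates for the shell form -/

/-- A restricted estimate with the bound `C δ^γ`. -/
def RestrictedRate (d : ℕ) (X : ℝ × ℝ) (γ : ℝ) : Prop := ∃ C : ℝ, 0 < C ∧ ∀ δ : ℝ, 0 < δ → δ ≤ 1 / 2 →
  Restricted volume (shellForm d δ) X.1 (1 - X.2) (C * δ ^ γ)

/-- A strong estimate with the bound `C δ^γ`. -/
def StrongRate (d : ℕ) (X : ℝ × ℝ) (γ : ℝ) : Prop := ∃ C : ℝ, 0 < C ∧ ∀ δ : ℝ, 0 < δ → δ ≤ 1 →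
  Strong volume (shellForm d δ) X.1 (1 - X.2) (C * δ ^ γ)

theorem RestrictedRate.dual {X : ℝ × ℝ} {γ : ℝ} (h : RestrictedRate d X γ) :
    RestrictedRate d (dual X) γ := by
  obtain ⟨C, hC, h⟩ := h
  refine ⟨C, hC, fun δ hδ hδ1 => ?_⟩
  simpa [ShellProjection.dual] using (h δ hδ hδ1).swap

theorem StrongRate.dual {X : ℝ × ℝ} {γ : ℝ} (h : StrongRate d X γ) :
    StrongRate d (dual X) γ := by
  obtain ⟨C, hC, h⟩ := h
  refine ⟨C, hC, fun δ hδ hδ1 => ?_⟩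
  simpa [ShellProjection.dual] using (h δ hδ hδ1).swap

/-- For δ in [1/2, 1] the power δ^γ is bounded below, by 1 or by 2^{-γ} according to the sign of γ,
so the trivial bound suffices. -/
theorem strongRate_of_le_half {X : ℝ × ℝ} {γ C : ℝ} (h1 : 1 / 2 ≤ X.1) (h1' : X.1 ≤ 1) (h2 : 0 ≤ X.2)
    (h2' : X.2 ≤ 1 / 2) (hC : 0 < C) (h : ∀ δ : ℝ, 0 < δ → δ ≤ 1 / 2 →
      Strong volume (shellForm d δ) X.1 (1 - X.2) (C * δ ^ γ)) : StrongRate d X γ := by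
  obtain ⟨K, hK, ht⟩ := exists_strong_trivial d
  have hγ : 0 < min 1 ((1 / 2 : ℝ) ^ γ) := lt_min one_pos (by positivity)
  refine ⟨max C (K / min 1 ((1 / 2 : ℝ) ^ γ)), lt_max_of_lt_left hC, fun δ hδ hδ1 => ?_⟩
  rcases le_total δ (1 / 2) with hle | hle
  · refine (h δ hδ hle).mono ?_
    gcongr
    exact le_max_left _ _
  · refine (ht X.1 (1 - X.2) δ h1 h1' (by linarith) (by linarith)).mono ?_
    have hmin : min 1 ((1 / 2 : ℝ) ^ γ) ≤ δ ^ γ := by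
      rcases le_total 0 γ with hg | hg
      · exact (min_le_right _ _).trans (Real.rpow_le_rpow (by norm_num) hle hg)
      · exact (min_le_left _ _).trans (Real.one_le_rpow_of_pos_of_le_one_of_nonpos hδ hδ1 hg)
    calc K = K / min 1 ((1 / 2 : ℝ) ^ γ) * min 1 ((1 / 2 : ℝ) ^ γ) := by field_simp
      _ ≤ _ := by
        gcongr
        exact le_max_right _ _

/-- Points with nonnegative coordinates at which the rate of the pentagon holds. -/
def restrictedSet (d : ℕ) : Set (ℝ × ℝ) :=
  {X | 0 ≤ X.1 ∧ 0 ≤ 1 - X.2 ∧ RestrictedRate d X (((d : ℝ) + 1) / 2 * (X.1 - X.2))}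

theorem rpow_combination {C₀ C₁ δ γ₀ γ₁ θ : ℝ} (h₀ : 0 < C₀) (h₁ : 0 < C₁) (hδ : 0 < δ) :
    (C₀ * δ ^ γ₀) ^ (1 - θ) * (C₁ * δ ^ γ₁) ^ θ =
      C₀ ^ (1 - θ) * C₁ ^ θ * δ ^ ((1 - θ) * γ₀ + θ * γ₁) := by
  rw [Real.mul_rpow h₀.le (by positivity), Real.mul_rpow h₁.le (by positivity), ← Real.rpow_mul hδ.le,
    ← Real.rpow_mul hδ.le, Real.rpow_add hδ, mul_comm γ₀, mul_comm γ₁]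
  ring

/-- The rate is linear in the point, so the geometric mean of two rates is the rate at the
corresponding convex combination. -/
theorem convex_restrictedSet (d : ℕ) : Convex ℝ (restrictedSet d) := by
  intro X hX Y hY r s hr hs hrs
  obtain ⟨h1, h2, C, hC, h⟩ := hX
  obtain ⟨k1, k2, D, hD, k⟩ := hY
  have hr' : r = 1 - s := by linarith
  subst hr'
  refine ⟨?_, ?_, C ^ (1 - s) * D ^ s, by positivity, fun δ hδ hδ1 => ?_⟩
  · simp only [Prod.fst_add, Prod.smul_fst, smul_eq_mul]; positivity
  · simp only [Prod.snd_add, Prod.smul_snd, smul_eq_mul]; nlinarith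
  · have := Restricted.geometric_mean (θ := s) (by positivity) (by positivity) h1 k1 h2 k2 hs (by linarith)
      (h δ hδ hδ1) (k δ hδ hδ1)
    rw [rpow_combination hC hD hδ] at this
    simp only [Prod.fst_add, Prod.snd_add, Prod.smul_fst, Prod.smul_snd, smul_eq_mul]
    convert this using 1
    · ring
    · congr 2; ring

theorem dual_mem_restrictedSet {X : ℝ × ℝ} (h : X ∈ restrictedSet d) : dual X ∈ restrictedSet d := by
  obtain ⟨h1, h2, h3⟩ := h
  refine ⟨h2, by simpa [dual] using h1, ?_⟩
  convert h3.dual using 1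
  simp [dual]

/-- By convexity only the vertices matter: rate 0 at (1/2, 1/2) by Plancherel, 1/2 at A by
Stein–Tomas, 1 at C, and the duals of the last two. -/
theorem pentagon_subset_restrictedSet (hd : 2 ≤ d) : pentagon d ⊆ restrictedSet d := by
  have hA1 := ptA_fst d
  have hC1 := ptC_fst hd
  have hAm := ptA_mem_pentagon hd
  have hCm := ptC_mem_pentagon hd
  have hA : ptA d ∈ restrictedSet d := by
    refine ⟨by linarith [hAm.1], by linarith [hAm.2.1], ?_⟩
    obtain ⟨C, hC, h⟩ := exists_restricted_shellForm_A hd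
    refine ⟨C, hC, fun δ hδ _ => ?_⟩
    have e : ((d : ℝ) + 1) / 2 * ((ptA d).1 - (ptA d).2) = 1 / 2 := by
      have : (ptA d).2 = 1 / 2 := rfl
      rw [this]; linarith
    rw [e]
    have := h δ hδ
    convert this using 1
    simp only [ptA]; norm_num
  have hC : ptC d ∈ restrictedSet d := by
    refine ⟨by linarith [hCm.1], by linarith [hCm.2.1], ?_⟩
    obtain ⟨C, hC, h⟩ := exists_restricted_shellForm_C hd
    refine ⟨C, hC, fun δ hδ hδ1 => ?_⟩
    have e : ((d : ℝ) + 1) / 2 * ((ptC d).1 - (ptC d).2) = 1 := by linarith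
    rw [e, Real.rpow_one]
    exact h δ hδ.le hδ1
  refine (pentagon_subset_hull hd).trans (convexHull_min ?_ (convex_restrictedSet d))
  rintro X (rfl | rfl | rfl | rfl | rfl)
  · refine ⟨by norm_num, by norm_num, 1, one_pos, fun δ _ _ => ?_⟩
    have := restricted_shellForm_half d δ
    convert this using 1 <;> norm_num
  · exact hA
  · exact hC
  · exact dual_mem_restrictedSet hC
  · exact dual_mem_restrictedSet hA

theorem strongRate_of_mem_restrictedSet {P Q X : ℝ × ℝ} {θ : ℝ} (hP : P ∈ restrictedSet d)
    (hQ : Q ∈ restrictedSet d) (hP1 : 0 < P.1) (hP2 : P.2 < 1) (hQ1 : 0 < Q.1) (hQ2 : Q.2 < 1)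
    (hθ0 : 0 < θ) (hθ1 : θ < 1) (h1 : P.1 ≠ Q.1) (h2 : P.2 ≠ Q.2)
    (hX1 : X.1 = (1 - θ) * P.1 + θ * Q.1) (hX2 : X.2 = (1 - θ) * P.2 + θ * Q.2)
    (hX3 : 1 / 2 ≤ X.1) (hX4 : X.1 ≤ 1) (hX5 : 0 ≤ X.2) (hX6 : X.2 ≤ 1 / 2) (hX7 : X.2 < X.1) :
    StrongRate d X (((d : ℝ) + 1) / 2 * (X.1 - X.2)) := by
  obtain ⟨_, _, C, hC, h⟩ := hP
  obtain ⟨_, _, D, hD, k⟩ := hQ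
  have e2 : (1 - θ) * (1 - P.2) + θ * (1 - Q.2) = 1 - X.2 := by rw [hX2]; ring
  obtain ⟨K, hK, hs⟩ := exists_strong_of_restricted (μ := (volume : Measure (E d))) (a₀ := P.1)
    (a₁ := Q.1) (c₀ := 1 - P.2) (c₁ := 1 - Q.2) hP1 hQ1 (by linarith) (by linarith) hθ0 hθ1 h1
    (fun h => h2 (by linarith)) (by linarith) (by linarith) (by linarith)
  refine strongRate_of_le_half (C := K * (C ^ (1 - θ) * D ^ θ)) hX3 hX4 hX5 hX6 (by positivity) fun δ hδ hδ1 => ?_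
  have := hs (shellForm d δ) _ _ (isTestForm_shellForm d δ) (by positivity) (by positivity)
    (h δ hδ hδ1) (k δ hδ hδ1)
  rw [rpow_combination hC hD hδ, ← hX1, e2] at this
  convert this using 1
  rw [mul_assoc K, hX1, hX2]
  congr 3; ring

theorem pentagon_bounds (hd : 2 ≤ d) {X : ℝ × ℝ} (h : X ∈ pentagon d) :
    X.1 < 1 ∧ 0 < X.2 := by
  have hn : (2 : ℝ) ≤ d := by exact_mod_cast hd
  have key : ∀ Y ∈ pentagon d, 0 < Y.2 := fun Y hY => by
    obtain ⟨h1, h2, h3, h4, h5⟩ := hY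
    by_contra hc
    push Not at hc
    have : ((d : ℝ) + 1) * Y.1 ≤ 2 := by nlinarith
    have h6 : (d : ℝ) - 1 ≤ ((d : ℝ) - 1) * Y.1 := by nlinarith
    have h7 : 1 ≤ Y.1 := by
      by_contra h8
      push Not at h8
      nlinarith
    nlinarith
  refine ⟨?_, key X h⟩
  have := key _ (dual_mem_pentagon h)
  simp only [dual] at this
  linarith

/-- `X` is the midpoint of a short segment in the direction (1, 1), whose ends differ in both
coordinates. The side [C, C'] is parallel to it, so its relative interior is included. -/
theorem strongRate_interior (hd : 2 ≤ d) {X : ℝ × ℝ} (hX : X ∈ pentagon d) (h1 : 1 / 2 < X.1)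
    (h2 : X.2 < 1 / 2) (h3 : ((d : ℝ) + 1) * X.1 + ((d : ℝ) - 1) * X.2 < d + 1)
    (h4 : (d : ℝ) - 1 < ((d : ℝ) - 1) * X.1 + ((d : ℝ) + 1) * X.2) :
    StrongRate d X (((d : ℝ) + 1) / 2 * (X.1 - X.2)) := by
  have hb := pentagon_bounds hd hX
  obtain ⟨_, _, h5, _, _⟩ := hX
  -- A step ε along (1, 1) changes the two oblique constraints by (d+1)ε + (d-1)ε = 2dε.
  obtain ⟨ε, hε, e1, e2, e3, e4⟩ : ∃ ε : ℝ, 0 < ε ∧ ε ≤ X.1 - 1 / 2 ∧ ε ≤ 1 / 2 - X.2 ∧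
      2 * d * ε ≤ d + 1 - (((d : ℝ) + 1) * X.1 + ((d : ℝ) - 1) * X.2) ∧
      2 * d * ε ≤ ((d : ℝ) - 1) * X.1 + ((d : ℝ) + 1) * X.2 - (d - 1) := by
    have hd0 : (0 : ℝ) < 2 * d := by positivity
    refine ⟨min (min (X.1 - 1 / 2) (1 / 2 - X.2))
      (min ((d + 1 - (((d : ℝ) + 1) * X.1 + ((d : ℝ) - 1) * X.2)) / (2 * d))
        ((((d : ℝ) - 1) * X.1 + ((d : ℝ) + 1) * X.2 - (d - 1)) / (2 * d))), ?_, ?_, ?_, ?_, ?_⟩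
    · refine lt_min (lt_min (by linarith) (by linarith)) (lt_min (div_pos (by linarith) hd0)
        (div_pos (by linarith) hd0))
    · exact (min_le_left _ _).trans (min_le_left _ _)
    · exact (min_le_left _ _).trans (min_le_right _ _)
    · rw [mul_comm, ← le_div_iff₀ hd0]; exact (min_le_right _ _).trans (min_le_left _ _)
    · rw [mul_comm, ← le_div_iff₀ hd0]; exact (min_le_right _ _).trans (min_le_right _ _)
  have hP : (X.1 - ε, X.2 - ε) ∈ pentagon d := by
    refine ⟨?_, ?_, ?_, ?_, ?_⟩ <;> simp only <;> nlinarith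
  have hQ : (X.1 + ε, X.2 + ε) ∈ pentagon d := by
    refine ⟨?_, ?_, ?_, ?_, ?_⟩ <;> simp only <;> nlinarith
  refine strongRate_of_mem_restrictedSet (θ := 1 / 2) (pentagon_subset_restrictedSet hd hP)
    (pentagon_subset_restrictedSet hd hQ) ?_ ?_ ?_ ?_ (by norm_num) (by norm_num) ?_ ?_ ?_ ?_ ?_ ?_ ?_
    ?_ ?_ <;> (try simp only) <;> linarith

/-- The side [A, C] is neither horizontal nor vertical, so Marcinkiewicz applies between its end
points. -/
theorem strongRate_edge (hd : 2 ≤ d) {b : ℝ} (h1 : (ptC d).2 < b) (h2 : b < 1 / 2) :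
    StrongRate d (edgePoint d b) (((d : ℝ) + 1) / 2 * ((edgePoint d b).1 - b)) := by
  have hn : (2 : ℝ) ≤ d := by exact_mod_cast hd
  have hA := ptA_mem_pentagon hd
  have hC := ptC_mem_pentagon hd
  have hX := edgePoint_mem_of_le (convex_pentagon d) hd hA hC h1.le h2.le
  have hb := pentagon_bounds hd hX
  obtain ⟨r, hr, hr1, h⟩ := exists_ratio h1.le h2.le
  have hA' := ptA_eq_edgePoint d
  have hC' := ptC_eq_edgePoint hd
  have hbC : 0 < (ptC d).2 := ptC_snd_pos hd
  have hr0' : r ≠ 0 := by rintro rfl; linarith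
  have hr1' : r ≠ 1 := by rintro rfl; linarith
  refine strongRate_of_mem_restrictedSet (P := ptC d) (Q := ptA d) (θ := r)
    (pentagon_subset_restrictedSet hd hC) (pentagon_subset_restrictedSet hd hA)
    (by linarith [hC.1]) (by linarith) (by linarith [hA.1]) (by linarith [hA.2.1])
    (lt_of_le_of_ne hr hr0'.symm) (lt_of_le_of_ne hr1 hr1') ?_ ?_ ?_ h hX.1 hb.1.le hb.2.le h2.le ?_
  · intro he
    have e1 := edgePoint_fst d (ptC d).2
    have e2 := edgePoint_fst d (1 / 2)
    rw [← hC'] at e1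
    rw [← hA', ← he] at e2
    nlinarith
  · intro he
    have : (ptA d).2 = 1 / 2 := rfl
    linarith
  · rw [hC', hA']
    simp only [edgePoint]
    linear_combination -((d : ℝ) - 1) / (d + 1) * h
  · have := hX.1
    simp only [edgePoint] at *
    linarith

/-- On the horizontal side the second coordinates coincide and Marcinkiewicz fails. The T T^*
argument uses the self-dual point (a, 1 - a) instead; the rate there is twice the one sought. The
point A is included, as its self-dual partner is the midpoint of [C, C']. -/
theorem strongRate_half (hd : 2 ≤ d) {a : ℝ} (h : (a, 1 / 2) ∈ pentagon d) (h1 : 1 / 2 < a) :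
    StrongRate d (a, 1 / 2) (((d : ℝ) + 1) / 2 * (a - 1 / 2)) := by
  have hn : (2 : ℝ) ≤ d := by exact_mod_cast hd
  have hb := pentagon_bounds hd h
  obtain ⟨_, _, h3, h4, h5⟩ := h
  simp only at h3 h4 h5 hb
  have hX : (a, 1 - a) ∈ pentagon d := by
    refine ⟨h1.le, ?_, ?_, ?_, ?_⟩ <;> simp only <;> nlinarith
  obtain ⟨C, hC, hs⟩ := strongRate_interior hd hX h1 (by simp only; linarith)
    (by simp only; nlinarith) (by simp only; nlinarith)
  refine ⟨√C, by positivity, fun δ hδ hδ1 => ?_⟩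
  have := hs δ hδ hδ1
  simp only [sub_sub_cancel] at this
  have := this.half_right (by positivity)
  convert this using 1
  · norm_num
  · rw [Real.sqrt_mul hC.le, Real.sqrt_eq_rpow (δ ^ _), ← Real.rpow_mul hδ.le]
    congr 2; ring

theorem strongRate_pentagon (hd : 2 ≤ d) {X : ℝ × ℝ} (hX : X ∈ pentagon d) (hC : X ≠ ptC d)
    (hC' : X ≠ dual (ptC d)) : StrongRate d X (((d : ℝ) + 1) / 2 * (X.1 - X.2)) := by
  have hn : (2 : ℝ) ≤ d := by exact_mod_cast hd
  -- The two sides through A; those through A' follow by duality.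
  have key : ∀ X ∈ pentagon d, X ≠ ptC d → (X.2 = 1 / 2 ∨
      ((d : ℝ) + 1) * X.1 + ((d : ℝ) - 1) * X.2 = d + 1) →
      StrongRate d X (((d : ℝ) + 1) / 2 * (X.1 - X.2)) := by
    rintro ⟨a, b⟩ hX hC h
    rcases hX.1.eq_or_lt with h1 | h1
    · rcases h with h | h
      · simp only at h1 h
        subst h1 h
        refine ⟨1, one_pos, fun δ _ _ => ?_⟩
        have := strong_shellForm_half d δ
        convert this using 1 <;> norm_num
      · have := hX.2.1
        simp only at h1 h this
        subst h1
        exfalso; nlinarith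
    by_cases h2 : b = 1 / 2
    · subst h2
      exact strongRate_half hd hX h1
    · have h3 : ((d : ℝ) + 1) * a + ((d : ℝ) - 1) * b = d + 1 := h.resolve_left h2
      have e : ((a, b) : ℝ × ℝ) = edgePoint d b := by
        have := edgePoint_fst d b
        ext
        · have h0 : (0 : ℝ) < (d : ℝ) + 1 := by positivity
          refine mul_left_cancel₀ h0.ne' ?_
          simp only; linarith
        · rfl
      have h4 : b ≠ (ptC d).2 := by
        intro hb
        apply hC
        rw [e, hb, ← ptC_eq_edgePoint hd]
      have h5 : (ptC d).2 ≤ b := by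
        have := hX.2.2.1
        have := ptC_snd hd
        simp only at *
        nlinarith
      have h6 := lt_of_le_of_ne hX.2.1 h2
      have := strongRate_edge hd (lt_of_le_of_ne h5 h4.symm) h6
      rw [← e] at this
      exact this
  by_cases h1 : X.2 = 1 / 2 ∨ ((d : ℝ) + 1) * X.1 + ((d : ℝ) - 1) * X.2 = d + 1
  · exact key X hX hC h1
  by_cases h2 : (dual X).2 = 1 / 2 ∨ ((d : ℝ) + 1) * (dual X).1 + ((d : ℝ) - 1) * (dual X).2 = d + 1
  · have := (key _ (dual_mem_pentagon hX) (fun h => hC' (by rw [← h, dual_dual])) h2).dual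
    rw [dual_dual] at this
    simpa [dual] using this
  push Not at h1 h2
  simp only [dual] at h2
  have hX' := hX
  obtain ⟨p1, p2, p3, p4, p5⟩ := hX'
  refine strongRate_interior hd hX (lt_of_le_of_ne p1 fun h => h2.1 (by linarith))
    (lt_of_le_of_ne p2 h1.1) (lt_of_le_of_ne p4 h1.2) (lt_of_le_of_ne p5 fun h => h2.2 (by linarith))

theorem StrongRate.bernstein {X Y : ℝ × ℝ} {γ : ℝ} (h : StrongRate d X γ) (h1 : 0 < X.1)
    (h2 : X.1 ≤ Y.1) (h3 : Y.1 ≤ 1) (h4 : X.2 < 1) (h5 : Y.2 ≤ X.2) (h6 : 0 ≤ Y.2) :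
    StrongRate d Y γ := by
  obtain ⟨C, hC, h⟩ := h
  obtain ⟨K, hK, hs⟩ := exists_strong_of_strong d
  refine ⟨K * C, by positivity, fun δ hδ hδ1 => ?_⟩
  have := hs X.1 Y.1 (1 - X.2) (1 - Y.2) (C * δ ^ γ) δ h1 h2 h3 (by linarith) (by linarith) (by linarith)
    (by positivity) (h δ hδ hδ1)
  rwa [← mul_assoc] at this

/-- The rate depends on the height alone: it is the rate at the point of [A, C] of the same height,
from which Bernstein's inequality moves to the right. -/
theorem strongRate_trapezoid (hd : 2 ≤ d) {X : ℝ × ℝ} (hX : X ∈ trapezoid d)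
    (hb : (ptC d).2 < X.2) : StrongRate d X (((d : ℝ) + 1) / 2 - d * X.2) := by
  have hn : (2 : ℝ) ≤ d := by exact_mod_cast hd
  obtain ⟨h1, h2, h3, h4⟩ := hX
  have hA := ptA_mem_pentagon hd
  have hC := ptC_mem_pentagon hd
  have hY := edgePoint_mem_of_le (convex_pentagon d) hd hA hC hb.le h2
  have e := edgePoint_fst d X.2
  have e2 : (edgePoint d X.2).2 = X.2 := rfl
  have k := strongRate_pentagon hd hY (fun h => by rw [← h, e2] at hb; exact lt_irrefl _ hb)
    (fun h => by
      have h5 : X.2 = 1 - (ptC d).1 := congrArg Prod.snd h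
      have := hC.2.2.2.1
      have := ptC_fst hd
      have := ptC_snd hd
      nlinarith)
  have e3 : ((d : ℝ) + 1) / 2 * ((edgePoint d X.2).1 - (edgePoint d X.2).2) =
      ((d : ℝ) + 1) / 2 - d * X.2 := by
    rw [e2]; linarith
  rw [e3] at k
  exact k.bernstein (by linarith [hY.1]) (by nlinarith) h1 (by rw [e2]; linarith) le_rfl
    (by have := ptC_snd_pos hd; linarith)

/-- The rate is 1 on the open segment from C' to C. Bernstein's inequality moves right and down from
it and so reaches all of the corner off the lines CD and C'D'. -/
theorem strongRate_corner (hd : 2 ≤ d) {X : ℝ × ℝ} (h1 : X.1 ≤ 1) (h2 : 0 ≤ X.2)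
    (h3 : 2 ≤ ((d : ℝ) + 1) * (X.1 - X.2)) (h4 : X.2 < (ptC d).2) (h5 : 1 - (ptC d).2 < X.1) :
    StrongRate d X 1 := by
  have hn : (2 : ℝ) ≤ d := by exact_mod_cast hd
  have hC := ptC_mem_pentagon hd
  have hC1 := ptC_fst hd
  have hC2 := ptC_snd hd
  have hlt : 1 - (ptC d).2 < (ptC d).1 := by
    nlinarith
  set t := (ptC d).1 - (ptC d).2 with ht
  have htX : t ≤ X.1 - X.2 := by
    have : (0 : ℝ) < (d : ℝ) + 1 := by positivity
    nlinarith
  -- The point (a, a - t) must lie strictly between C' and C, above `X` and to its left. If t + X.2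
  -- = X.1, then `X` is itself on the segment and a = X.1 is forced.
  obtain ⟨a, ha1, ha2, ha3, ha4⟩ : ∃ a : ℝ, 1 - (ptC d).2 < a ∧ a < (ptC d).1 ∧ t + X.2 ≤ a ∧ a ≤ X.1 := by
    rcases (by linarith : t + X.2 ≤ X.1).eq_or_lt with he | hlt'
    · exact ⟨X.1, h5, by linarith, he.le, le_rfl⟩
    · have : max (1 - (ptC d).2) (t + X.2) < min (ptC d).1 X.1 :=
        max_lt (lt_min hlt h5) (lt_min (by linarith) hlt')
      obtain ⟨a, ha, ha'⟩ := exists_between this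
      exact ⟨a, (le_max_left _ _).trans_lt ha, ha'.trans_le (min_le_left _ _),
        ((le_max_right _ _).trans_lt ha).le, (ha'.trans_le (min_le_right _ _)).le⟩
  have hY : (a, a - t) ∈ pentagon d := by
    refine (convex_pentagon d).mem_of_diagonal (dual_mem_pentagon hC) hC ha1.le ha2.le ?_ ?_ <;>
      simp only [dual] <;> linarith
  have k := strongRate_pentagon hd hY (fun h => ha2.ne (congrArg Prod.fst h))
    (fun h => ha1.ne' (congrArg Prod.fst h))
  have e : ((d : ℝ) + 1) / 2 * (((a, a - t) : ℝ × ℝ).1 - ((a, a - t) : ℝ × ℝ).2) = 1 := by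
    simp only; linarith
  rw [e] at k
  refine k.bernstein ?_ ha4 h1 ?_ ?_ h2 <;> simp only <;> linarith [hC.2.1, (ptC_fst_lt_one hd)]

end ShellProjection

namespace ShellProjection

/-! ### Weak-type estimates -/

section Weak

variable {α : Type*} [MeasurableSpace α] {μ : Measure α}

theorem norm_form_levelPart_left_le {B : (α → ℂ) → (α → ℂ) → ℂ} (hB : IsTestForm μ B) {f g : α → ℂ}
    {Y : Set α} (hf : IsTest μ f) (hg : SubInd μ g Y) {a c M : ℝ} (h : Restricted μ B a c M) (m : ℤ) :
    ‖B (levelPart f m) g‖ ≤ M * μ.real Y ^ c * (2 ^ ((m : ℝ) + 1) * μ.real (levelSet f m) ^ a) := by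
  have := h _ _ _ _ (levelPart_subInd hf m) hg
  rw [levelPart_eq (f := f), hB.smul_left _ _ _ ((levelPart_isTest hf m).smul _) hg.isTest, norm_mul,
    Complex.norm_real, Real.norm_of_nonneg (by positivity)]
  calc _ ≤ 2 ^ ((m : ℝ) + 1) * (M * (μ.real (levelSet f m) ^ a * μ.real Y ^ c)) := by gcongr
    _ = _ := by ring

/-- Only `f` is decomposed into levels; `g` stays below an indicator, which is why the conclusion is
of weak type in the target. -/
theorem norm_form_le_of_sum {B : (α → ℂ) → (α → ℂ) → ℂ} (hB : IsTestForm μ B) {f g : α → ℂ}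
    {Y : Set α} (hf : IsTest μ f) (hg : SubInd μ g Y) {a c M S : ℝ} (hM : 0 ≤ M)
    (h : Restricted μ B a c M)
    (hS : ∀ s : Finset ℤ, ∑ m ∈ s, (2 : ℝ) ^ ((m : ℝ) + 1) * μ.real (levelSet f m) ^ a ≤ S) :
    ‖B f g‖ ≤ M * μ.real Y ^ c * S := by
  refine le_of_tendsto (hB.tendsto_left hf hg.isTest (levelSum_isTest hf) (tendsto_levelSum hf)).norm
    (Filter.Eventually.of_forall fun N => ?_)
  rw [levelSum, hB.sum_left _ (fun m _ => levelPart_isTest hf m) hg.isTest]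
  calc _ ≤ ∑ m ∈ Finset.Ico (-(N : ℤ)) N, ‖B (levelPart f m) g‖ := norm_sum_le _ _
    _ ≤ ∑ m ∈ Finset.Ico (-(N : ℤ)) N, M * μ.real Y ^ c *
        (2 ^ ((m : ℝ) + 1) * μ.real (levelSet f m) ^ a) :=
      Finset.sum_le_sum fun m _ => norm_form_levelPart_left_le hB hf hg h m
    _ ≤ _ := by
      rw [← Finset.mul_sum]
      gcongr
      exact hS _

/-- Levels above log₂ K are empty. Below, Chebyshev bounds the level set by K 2^{-m/a'}, and the
remaining 2^{m(1 - a/a')} is summable as m → -∞ because a < a'. -/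
theorem exists_sum_levelSet_le {a a' K : ℝ} (ha : 0 < a) (haa : a < a') (ha1 : a' ≤ 1)
    (hK : 1 ≤ K) : ∃ C : ℝ, 0 < C ∧ ∀ f : α → ℂ, IsTest μ f → (∀ x, ‖f x‖ ≤ K) →
      ∫ x, ‖f x‖ ^ (1 / a') ∂μ ≤ K → ∀ s : Finset ℤ,
        ∑ m ∈ s, (2 : ℝ) ^ ((m : ℝ) + 1) * μ.real (levelSet f m) ^ a ≤ C := by
  have ha' : 0 < a' := ha.trans haa
  set κ := 1 - a / a' with hκ
  have hκ0 : 0 < κ := by rw [hκ, sub_pos, div_lt_one ha']; exact haa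
  obtain ⟨D, hD, hs⟩ := exists_sum_two_rpow_le hκ0
  set L := Real.logb 2 K with hL
  have hK0 : 0 < K := by linarith
  refine ⟨2 * K ^ a * 2 ^ (κ * L) * D, by positivity, fun f hf hb hi s => ?_⟩
  calc _ ≤ ∑ m ∈ s, 2 * K ^ a * 2 ^ (κ * L) * 2 ^ (-κ * |(m : ℝ) - L|) := by
        refine Finset.sum_le_sum fun m _ => ?_
        rcases lt_or_ge (m : ℝ) L with hm | hm
        · have h1 := sum_levelSet_le ha' ha1 hf {m}
          rw [Finset.sum_singleton] at h1
          have h2 : μ.real (levelSet f m) ≤ K * 2 ^ (-((m : ℝ) / a')) := by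
            rw [Real.rpow_neg (by norm_num), ← div_eq_mul_inv, le_div_iff₀ (by positivity), mul_comm]
            exact h1.trans hi
          have h3 : μ.real (levelSet f m) ^ a ≤ K ^ a * 2 ^ (-((m : ℝ) / a') * a) := by
            rw [Real.rpow_mul (by norm_num), ← Real.mul_rpow hK0.le (by positivity)]
            gcongr
          rw [abs_of_neg (by linarith)]
          calc _ ≤ (2 : ℝ) ^ ((m : ℝ) + 1) * (K ^ a * 2 ^ (-((m : ℝ) / a') * a)) := by gcongr
            _ = 2 * K ^ a * (2 ^ (m : ℝ) * 2 ^ (-((m : ℝ) / a') * a)) := by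
              rw [Real.rpow_add (by norm_num), Real.rpow_one]; ring
            _ = 2 * K ^ a * (2 ^ (κ * L) * 2 ^ (-κ * -((m : ℝ) - L))) := by
              rw [← Real.rpow_add (by norm_num), ← Real.rpow_add (by norm_num)]
              congr 2
              rw [hκ]; ring
            _ = _ := by ring
        · have h0 : levelSet f m = ∅ := by
            ext x
            simp only [mem_empty_iff_false, iff_false]
            intro hx
            have h1 := hx.1
            rw [← Real.lt_logb_iff_rpow_lt (by norm_num) (lt_trans (by positivity) h1)] at h1
            have h2 : Real.logb 2 ‖f x‖ ≤ L :=
              Real.logb_le_logb_of_le (by norm_num) (lt_trans (by positivity) hx.1) (hb x)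
            linarith
          rw [h0, measureReal_empty, Real.zero_rpow ha.ne', mul_zero]
          positivity
    _ ≤ _ := by
      rw [← Finset.mul_sum]
      gcongr
      exact hs L s

/-- The level set `m` lies in {|f| > s} for every `s` in (2^{m-1}, 2^m]. These intervals are
disjoint, and their length 2^{m-1} is a quarter of 2^{m+1}. -/
theorem sum_levelSet_le_lintegral {a : ℝ} (ha : 0 < a) {f : α → ℂ} (hf : IsTest μ f) {Λ : ℝ}
    (hΛ : 0 ≤ Λ) (h : ∫⁻ s in Ioi (0 : ℝ), μ {x | s < ‖f x‖} ^ a ≤ ENNReal.ofReal Λ) (s : Finset ℤ) :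
    ∑ m ∈ s, (2 : ℝ) ^ ((m : ℝ) + 1) * μ.real (levelSet f m) ^ a ≤ 4 * Λ := by
  have hdisj : Pairwise (Function.onFun Disjoint fun m : ℤ =>
      Ioc ((2 : ℝ) ^ ((m : ℝ) - 1)) (2 ^ (m : ℝ))) := by
    have key : ∀ m n : ℤ, m < n → Disjoint (Ioc ((2 : ℝ) ^ ((m : ℝ) - 1)) (2 ^ (m : ℝ)))
        (Ioc ((2 : ℝ) ^ ((n : ℝ) - 1)) (2 ^ (n : ℝ))) := fun m n hmn => by
      rw [Set.disjoint_left]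
      intro x hx hx'
      have : (2 : ℝ) ^ (m : ℝ) ≤ 2 ^ ((n : ℝ) - 1) := by
        apply Real.rpow_le_rpow_of_exponent_le (by norm_num)
        have : (m : ℝ) + 1 ≤ n := by exact_mod_cast hmn
        linarith
      linarith [hx.2, hx'.1]
    intro m n hmn
    rcases lt_or_gt_of_ne hmn with h | h
    · exact key m n h
    · exact (key n m h).symm
  have hterm : ∀ m : ℤ, ENNReal.ofReal ((2 : ℝ) ^ ((m : ℝ) + 1) * μ.real (levelSet f m) ^ a) ≤
      4 * ∫⁻ s in Ioc ((2 : ℝ) ^ ((m : ℝ) - 1)) (2 ^ (m : ℝ)), μ {x | s < ‖f x‖} ^ a := fun m => by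
    have hfin := (two_rpow_mul_measureReal_levelSet_le one_pos le_rfl hf m).2
    have h1 : ∫⁻ _ in Ioc ((2 : ℝ) ^ ((m : ℝ) - 1)) (2 ^ (m : ℝ)), μ (levelSet f m) ^ a ≤
        ∫⁻ s in Ioc ((2 : ℝ) ^ ((m : ℝ) - 1)) (2 ^ (m : ℝ)), μ {x | s < ‖f x‖} ^ a := by
      refine setLIntegral_mono' measurableSet_Ioc fun s hs => ?_
      gcongr
      exact fun x hx => lt_of_le_of_lt hs.2 hx.1
    rw [setLIntegral_const, Real.volume_Ioc] at h1
    have h2 : (2 : ℝ) ^ ((m : ℝ) + 1) = 4 * (2 ^ (m : ℝ) - 2 ^ ((m : ℝ) - 1)) := by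
      rw [Real.rpow_add (by norm_num), Real.rpow_sub (by norm_num), Real.rpow_one]; ring
    have h3 : (0 : ℝ) ≤ 2 ^ (m : ℝ) - 2 ^ ((m : ℝ) - 1) := by
      rw [sub_nonneg]
      exact Real.rpow_le_rpow_of_exponent_le (by norm_num) (by linarith)
    rw [h2, mul_assoc, ENNReal.ofReal_mul (by norm_num), ENNReal.ofReal_mul h3,
      show ENNReal.ofReal 4 = 4 by norm_num]
    gcongr
    rw [mul_comm]
    refine le_trans (le_of_eq ?_) h1
    rw [← ENNReal.ofReal_rpow_of_nonneg measureReal_nonneg ha.le, Measure.real, ENNReal.ofReal_toReal hfin]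
  have hsum : ENNReal.ofReal (∑ m ∈ s, (2 : ℝ) ^ ((m : ℝ) + 1) * μ.real (levelSet f m) ^ a) ≤
      ENNReal.ofReal (4 * Λ) := by
    rw [ENNReal.ofReal_sum_of_nonneg fun m _ => by positivity]
    refine (Finset.sum_le_sum fun m _ => hterm m).trans ?_
    rw [← Finset.mul_sum, ENNReal.ofReal_mul (by norm_num), show ENNReal.ofReal 4 = 4 by norm_num]
    gcongr
    refine le_trans ?_ h
    rw [← lintegral_biUnion_finset (fun m _ n _ hmn => hdisj hmn) (fun m _ => measurableSet_Ioc)]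
    refine lintegral_mono_set ?_
    intro x hx
    simp only [mem_iUnion] at hx
    obtain ⟨m, _, hx⟩ := hx
    exact lt_trans (by positivity) hx.1
  exact (ENNReal.ofReal_le_ofReal_iff (by positivity)).1 hsum

theorem powNorm_le_of_subInd {c : ℝ} (hc : 0 < c) (hc1 : c ≤ 1) {g : α → ℂ} {Y : Set α}
    (hg : SubInd μ g Y) : powNorm μ c g ≤ μ.real Y ^ c := by
  refine Real.rpow_le_rpow (integral_rpow_nonneg c g) ?_ hc.le
  have := integral_rpow_le_of_le hg.isTest le_rfl (by rw [le_div_iff₀ hc]; linarith : 1 ≤ 1 / c)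
    hg.norm_le_one
  simp only [Real.one_rpow, Real.rpow_one, one_mul] at this
  exact this.trans hg.integral_norm_le

end Weak

variable {d : ℕ}

/-- The weak-type consequence of a restricted estimate, by Bernstein's inequality. -/
theorem exists_weak_of_restricted {a a' c : ℝ} (ha : 0 < a) (haa : a < a') (ha1 : a' ≤ 1) :
    ∃ C : ℝ, 0 < C ∧ ∀ M δ : ℝ, 0 ≤ M → Restricted volume (shellForm d δ) a c M →
      ∀ (f g : E d → ℂ) (Y : Set (E d)), IsTest volume f → SubInd volume g Y →
        ‖shellForm d δ f g‖ ≤ C * M * (powNorm volume a' f * volume.real Y ^ c) := by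
  have ha' : 0 < a' := ha.trans haa
  obtain ⟨K, hK1, h⟩ := exists_isTest_fourier_eq d
  -- The first constant serves the small part of `f`, controlled in L^{1/a'}; the second, with
  -- exponent 1, the smoothed large part, controlled in L¹.
  obtain ⟨C₀, hC₀, k₀⟩ := exists_sum_levelSet_le (μ := (volume : Measure (E d))) ha haa ha1 hK1
  obtain ⟨C₁, hC₁, k₁⟩ := exists_sum_levelSet_le (μ := (volume : Measure (E d))) ha
    (haa.trans_le ha1) le_rfl hK1
  refine ⟨C₀ + C₁, by positivity, fun M δ hM hs f g Y hf hg => ?_⟩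
  have hB := isTestForm_shellForm d δ
  suffices ‖shellForm d δ f g‖ ≤ ((C₀ + C₁) * M * volume.real Y ^ c) * powNorm volume a' f by
    linarith
  refine norm_form_le_of_normalized hB ha' ha1 hg.isTest (fun f hf hf1 => ?_) hf
  obtain ⟨f₀, f₁, hf₀, hf₁, hsum, hle, hle', hint⟩ := exists_truncation hf ha' ha1 hf1
  obtain ⟨u, hu, hue, hub, hui⟩ := h f₁ hf₁
  have hub' : ∀ x, ‖u x‖ ≤ K := fun x => (hub x).trans (by nlinarith)
  have hui' : ∫ x, ‖u x‖ ≤ K := hui.trans (by nlinarith)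
  have hexp1 : 1 ≤ 1 / a' := by rw [le_div_iff₀ ha']; linarith
  have i₀ : ∫ x, ‖f₀ x‖ ^ (1 / a') ≤ K := by
    refine le_trans (integral_mono (hf₀.integrable_rpow hexp1) (hf.integrable_rpow hexp1)
      fun x => Real.rpow_le_rpow (norm_nonneg _) (hle' x) (by positivity)) (hf1.trans hK1)
  rw [hsum, hB.add_left _ _ _ hf₀ hf₁ hg.isTest, ← shellForm_congr hue]
  refine (norm_add_le _ _).trans ?_
  have s₀ := norm_form_le_of_sum hB hf₀ hg hM hs (k₀ f₀ hf₀ (fun x => (hle x).trans hK1) i₀)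
  have s₁ := norm_form_le_of_sum hB hu hg hM hs (k₁ u hu hub' (by simpa using hui'))
  linarith

/-- A weak-type estimate with the bound `C δ^γ`. -/
def WeakRate (d : ℕ) (X : ℝ × ℝ) (γ : ℝ) : Prop := ∃ C : ℝ, 0 < C ∧ ∀ δ : ℝ, 0 < δ → δ ≤ 1 →
  ∀ (f g : E d → ℂ) (Y : Set (E d)), IsTest volume f → SubInd volume g Y →
    ‖shellForm d δ f g‖ ≤ C * δ ^ γ * (powNorm volume X.1 f * volume.real Y ^ (1 - X.2))

/-- A Lorentz restricted weak-type estimate with the bound `C δ^γ`. -/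
def LorentzRate (d : ℕ) (X : ℝ × ℝ) (γ : ℝ) : Prop := ∃ C : ℝ, 0 < C ∧ ∀ δ : ℝ, 0 < δ → δ ≤ 1 →
  ∀ (f g : E d → ℂ) (Y : Set (E d)) (Λ : ℝ), 0 ≤ Λ → IsTest volume f → SubInd volume g Y →
    ∫⁻ s in Ioi (0 : ℝ), volume {x | s < ‖f x‖} ^ X.1 ≤ ENNReal.ofReal Λ →
    ‖shellForm d δ f g‖ ≤ C * δ ^ γ * (Λ * volume.real Y ^ (1 - X.2))

theorem restricted_of_strong {a c M δ : ℝ} (hM : 0 ≤ M) (ha : 0 < a) (ha1 : a ≤ 1) (hc : 0 < c)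
    (hc1 : c ≤ 1) (h : Strong volume (shellForm d δ) a c M) :
    Restricted volume (shellForm d δ) a c M := fun f g X Y hf hg => by
  refine (h f g hf.isTest hg.isTest).trans ?_
  have := powNorm_nonneg (μ := (volume : Measure (E d))) c g
  gcongr
  · exact powNorm_le_of_subInd ha ha1 hf
  · exact powNorm_le_of_subInd hc hc1 hg

theorem exists_restricted_of_rate {X : ℝ × ℝ} (h1 : 1 / 2 ≤ X.1) (h1' : X.1 ≤ 1) (h2 : 0 ≤ X.2)
    (h2' : X.2 ≤ 1 / 2) (h : RestrictedRate d X 1) : ∃ C : ℝ, 0 < C ∧ ∀ δ : ℝ, 0 < δ → δ ≤ 1 →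
      Restricted volume (shellForm d δ) X.1 (1 - X.2) (C * δ) := by
  obtain ⟨C, hC, h⟩ := h
  obtain ⟨K, hK, ht⟩ := exists_strong_trivial d
  refine ⟨C + 2 * K, by positivity, fun δ hδ hδ1 => ?_⟩
  rcases le_total δ (1 / 2) with hle | hle
  · have := h δ hδ hle
    rw [Real.rpow_one] at this
    exact this.mono (by nlinarith)
  · refine (restricted_of_strong hK.le (by linarith) h1' (by linarith) (by linarith)
      (ht X.1 (1 - X.2) δ h1 h1' (by linarith) (by linarith))).mono ?_
    nlinarith

theorem restrictedRate_C (hd : 2 ≤ d) : RestrictedRate d (ptC d) 1 := by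
  have h := (pentagon_subset_restrictedSet hd (ptC_mem_pentagon hd)).2.2
  have e : ((d : ℝ) + 1) / 2 * ((ptC d).1 - (ptC d).2) = 1 := by linarith [ptC_fst hd]
  rwa [e] at h

/-- The strict inequality at C is what makes the level sum of the Bernstein argument converge. -/
theorem weakRate_CD (hd : 2 ≤ d) {a : ℝ} (h1 : (ptC d).1 < a) (h2 : a ≤ 1) :
    WeakRate d (a, (ptC d).2) 1 := by
  have hC := ptC_mem_pentagon hd
  obtain ⟨C, hC0, h⟩ := exists_restricted_of_rate hC.1 (ptC_fst_lt_one hd).le (ptC_snd_pos hd).le hC.2.1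
    (restrictedRate_C hd)
  obtain ⟨K, hK, k⟩ := exists_weak_of_restricted (d := d) (c := 1 - (ptC d).2)
    (by linarith [hC.1] : 0 < (ptC d).1) h1 h2
  refine ⟨K * C, by positivity, fun δ hδ hδ1 f g Y hf hg => ?_⟩
  have := k (C * δ) δ (by positivity) (h δ hδ hδ1) f g Y hf hg
  rw [Real.rpow_one, mul_assoc K]
  exact this

theorem lorentzRate_of_restrictedRate {X : ℝ × ℝ} (h1 : 1 / 2 ≤ X.1) (h1' : X.1 ≤ 1) (h2 : 0 ≤ X.2)
    (h2' : X.2 ≤ 1 / 2) (h : RestrictedRate d X 1) : LorentzRate d X 1 := by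
  obtain ⟨C, hC0, h⟩ := exists_restricted_of_rate h1 h1' h2 h2' h
  refine ⟨4 * C, by positivity, fun δ hδ hδ1 f g Y Λ hΛ hf hg hi => ?_⟩
  have := norm_form_le_of_sum (isTestForm_shellForm d δ) hf hg (by positivity) (h δ hδ hδ1)
    (sum_levelSet_le_lintegral (by linarith) hf hΛ hi)
  rw [Real.rpow_one]
  linarith

end ShellProjection

namespace ShellProjection

variable {d : ℕ}

/-! ### Duality -/

theorem integral_mul_eq_of_phase {u w : E d → ℂ} {F : Set (E d)} (hF : MeasurableSet F) {ρ : E d → ℝ}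
    (h : ∀ x, u x * w x = (ρ x : ℂ)) : ∫ x, u x * F.indicator w x = ((∫ x in F, ρ x : ℝ) : ℂ) := by
  rw [← integral_complex_ofReal, ← integral_indicator hF]
  congr 1; ext x
  classical
  simp only [indicator_apply, ← h]
  split_ifs <;> simp

/-- Test against the conjugate phase of `u` on a superlevel set, cut to a ball so that its measure
is finite. -/
theorem mul_measureReal_le_of_forall_subInd {u : E d → ℂ} (hu : Measurable u)
    (hb : ∃ K, ∀ x, ‖u x‖ ≤ K) {A c : ℝ} (h : ∀ (g : E d → ℂ) (Y : Set (E d)), SubInd volume g Y →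
      ‖∫ x, u x * g x‖ ≤ A * volume.real Y ^ c) {s : ℝ} (N : ℕ) :
    s * volume.real ({x | s < ‖u x‖} ∩ Metric.ball 0 N) ≤
      A * volume.real ({x | s < ‖u x‖} ∩ Metric.ball 0 N) ^ c := by
  classical
  obtain ⟨K, hK⟩ := hb
  set F := {x | s < ‖u x‖} ∩ Metric.ball 0 N with hF
  have hFm : MeasurableSet F := (measurableSet_lt measurable_const hu.norm).inter measurableSet_ball
  have hfin : volume F ≠ ∞ :=
    ((measure_mono inter_subset_right).trans_lt Metric.isBounded_ball.measure_lt_top).ne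
  set w : E d → ℂ := fun x => (starRingEnd ℂ) (u x) * ((‖u x‖⁻¹ : ℝ) : ℂ) with hw
  have hwm : Measurable w := (Complex.continuous_conj.measurable.comp hu).mul
    (Complex.measurable_ofReal.comp hu.norm.inv)
  have hw1 : ∀ x, ‖w x‖ ≤ 1 := fun x => by
    rw [hw]
    simp only [norm_mul, RCLike.norm_conj, Complex.norm_real, norm_inv, norm_norm]
    exact mul_inv_le_one
  have huw : ∀ x, u x * w x = ((‖u x‖ : ℝ) : ℂ) := fun x => by
    rw [hw]
    simp only
    rw [← mul_assoc, Complex.mul_conj, Complex.normSq_eq_norm_sq, ← Complex.ofReal_mul]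
    congr 1
    rcases eq_or_ne ‖u x‖ 0 with h0 | h0
    · rw [h0]; simp
    · field_simp
  have hg : SubInd volume (F.indicator w) F := ⟨hwm.indicator hFm, hFm, hfin, fun x => by
    rw [indicator_apply, indicator_apply]
    split_ifs
    · exact hw1 x
    · simp⟩
  have := h _ _ hg
  rw [integral_mul_eq_of_phase hFm huw, Complex.norm_real] at this
  refine le_trans ?_ ((le_abs_self _).trans this)
  rw [mul_comm, ← smul_eq_mul, ← setIntegral_const]
  refine setIntegral_mono_on (integrableOn_const hfin) ?_ hFm fun x hx => hx.1.le
  exact Measure.integrableOn_of_bounded (M := K) hfin hu.norm.aestronglyMeasurable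
    (Filter.Eventually.of_forall fun x => by rw [norm_norm]; exact hK x)

theorem tendsto_measure_inter_ball (S : Set (E d)) :
    Filter.Tendsto (fun N : ℕ => volume (S ∩ Metric.ball 0 N)) Filter.atTop (nhds (volume S)) := by
  have hm : Monotone fun N : ℕ => S ∩ Metric.ball (0 : E d) N := fun m n hmn =>
    inter_subset_inter_right _ (Metric.ball_subset_ball (by exact_mod_cast hmn))
  have := tendsto_measure_iUnion_atTop (μ := (volume : Measure (E d))) hm
  rwa [← inter_iUnion, Metric.iUnion_ball_nat, inter_univ] at this

/-- The dual characterization of weak `L^q`. -/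
theorem weak_le_of_forall_subInd {u : E d → ℂ} (hu : Measurable u)
    (hb : ∃ K, ∀ x, ‖u x‖ ≤ K) {A b : ℝ} (hA : 0 ≤ A) (hb0 : 0 < b)
    (h : ∀ (g : E d → ℂ) (Y : Set (E d)), SubInd volume g Y →
      ‖∫ x, u x * g x‖ ≤ A * volume.real Y ^ (1 - b)) {s : ℝ} (hs : 0 < s) :
    ENNReal.ofReal s * distribution u s ^ b ≤ ENNReal.ofReal A := by
  have hlim : Filter.Tendsto (fun N : ℕ => ENNReal.ofReal s *
      volume ({x | s < ‖u x‖} ∩ Metric.ball 0 N) ^ b) Filter.atTop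
      (nhds (ENNReal.ofReal s * distribution u s ^ b)) :=
    ENNReal.Tendsto.const_mul (((ENNReal.continuous_rpow_const (y := b)).tendsto _).comp
      (tendsto_measure_inter_ball _)) (Or.inr ENNReal.ofReal_ne_top)
  refine le_of_tendsto hlim (Filter.Eventually.of_forall fun N => ?_)
  have k := mul_measureReal_le_of_forall_subInd hu hb h (s := s) N
  set F := {x | s < ‖u x‖} ∩ Metric.ball 0 N
  have hfin : volume F ≠ ∞ :=
    ((measure_mono inter_subset_right).trans_lt Metric.isBounded_ball.measure_lt_top).ne
  rw [← ENNReal.ofReal_toReal hfin, ENNReal.ofReal_rpow_of_nonneg ENNReal.toReal_nonneg hb0.le,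
    ← ENNReal.ofReal_mul hs.le]
  refine ENNReal.ofReal_le_ofReal ?_
  change s * volume.real F ^ b ≤ A
  have hv : 0 ≤ volume.real F := measureReal_nonneg
  rcases hv.eq_or_lt with h0 | h0
  · rw [← h0, Real.zero_rpow hb0.ne', mul_zero]; exact hA
  · have e : volume.real F = volume.real F ^ b * volume.real F ^ (1 - b) := by
      rw [← Real.rpow_add h0]; simp
    nth_rw 1 [e] at k
    have h1 : 0 < volume.real F ^ (1 - b) := by positivity
    rw [← mul_assoc] at k
    exact le_of_mul_le_mul_right k h1

/-- The dual characterization of `L^∞`. -/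
theorem eLpNorm_top_le_of_forall_subInd {u : E d → ℂ} (hu : Measurable u)
    (hb : ∃ K, ∀ x, ‖u x‖ ≤ K) {A : ℝ} (hA : 0 ≤ A)
    (h : ∀ (g : E d → ℂ) (Y : Set (E d)), SubInd volume g Y →
      ‖∫ x, u x * g x‖ ≤ A * volume.real Y) : eLpNorm u ∞ volume ≤ ENNReal.ofReal A := by
  have key : ∀ n : ℕ, volume {x | A + ((n : ℝ) + 1)⁻¹ < ‖u x‖} = 0 := fun n => by
    have hs : 0 < A + ((n : ℝ) + 1)⁻¹ := by positivity
    have hz : ∀ N : ℕ, volume ({x | A + ((n : ℝ) + 1)⁻¹ < ‖u x‖} ∩ Metric.ball 0 N) = 0 := fun N => by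
      have k := mul_measureReal_le_of_forall_subInd hu hb (c := 1) (s := A + ((n : ℝ) + 1)⁻¹) (by simpa using h) N
      set F := {x | A + ((n : ℝ) + 1)⁻¹ < ‖u x‖} ∩ Metric.ball 0 N
      have hfin : volume F ≠ ∞ :=
        ((measure_mono inter_subset_right).trans_lt Metric.isBounded_ball.measure_lt_top).ne
      have hv : 0 ≤ volume.real F := measureReal_nonneg
      have hn : 0 < ((n : ℝ) + 1)⁻¹ := by positivity
      rw [Real.rpow_one] at k
      have : volume.real F = 0 := by nlinarith
      rwa [Measure.real, ENNReal.toReal_eq_zero_iff, or_iff_left hfin] at this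
    have := tendsto_measure_inter_ball {x : E d | A + ((n : ℝ) + 1)⁻¹ < ‖u x‖}
    simp_rw [hz] at this
    exact tendsto_nhds_unique this tendsto_const_nhds
  have hae : ∀ᵐ x, ‖u x‖ ≤ A := by
    have : ∀ᵐ x, ∀ n : ℕ, ‖u x‖ ≤ A + ((n : ℝ) + 1)⁻¹ := by
      rw [ae_all_iff]
      intro n
      rw [ae_iff]
      simpa using key n
    filter_upwards [this] with x hx
    have hlim : Filter.Tendsto (fun n : ℕ => A + ((n : ℝ) + 1)⁻¹) Filter.atTop (nhds (A + 0)) :=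
      tendsto_inv_succ.const_add A
    rw [add_zero] at hlim
    exact ge_of_tendsto' hlim hx
  rw [eLpNorm_exponent_top]
  exact eLpNormEssSup_le_of_ae_bound hae

/-- The dual characterization of `L^q`. -/
theorem eLpNorm_le_of_forall_isTest {u : E d → ℂ} (hu : Measurable u)
    (hb : ∃ K, ∀ x, ‖u x‖ ≤ K) {A r : ℝ} (hA : 0 ≤ A) (hr : 2 ≤ r)
    (h : ∀ g : E d → ℂ, IsTest volume g →
      ‖∫ x, u x * g x‖ ≤ A * powNorm volume (1 - 1 / r) g) :
    eLpNorm u (ENNReal.ofReal r) volume ≤ ENNReal.ofReal A := by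
  classical
  obtain ⟨K, hK⟩ := hb
  have hK0 : 0 ≤ K := (norm_nonneg _).trans (hK 0)
  have hr0 : 0 < r := by linarith
  have hc : 1 - 1 / r = (r - 1) / r := by field_simp
  have hc0 : 0 < 1 - 1 / r := by rw [hc]; exact div_pos (by linarith) hr0
  -- The extremal function in Hölder's inequality. Cut to a ball it is an admissible test function
  -- because `u` is bounded; the balls then exhaust the space.
  set w : E d → ℂ := fun x => (starRingEnd ℂ) (u x) * ((‖u x‖ ^ (r - 2) : ℝ) : ℂ) with hw
  have hwm : Measurable w := (Complex.continuous_conj.measurable.comp hu).mul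
    (Complex.measurable_ofReal.comp (hu.norm.pow_const _))
  have hwn : ∀ x, ‖w x‖ = ‖u x‖ ^ (r - 1) := fun x => by
    rw [hw]
    simp only [norm_mul, RCLike.norm_conj, Complex.norm_real]
    rw [Real.norm_of_nonneg (by positivity), mul_comm, ← Real.rpow_add_one' (norm_nonneg _) (by linarith)]
    congr 1; ring
  have huw : ∀ x, u x * w x = ((‖u x‖ ^ r : ℝ) : ℂ) := fun x => by
    rw [hw]
    simp only
    rw [← mul_assoc, Complex.mul_conj, Complex.normSq_eq_norm_sq, ← Complex.ofReal_mul]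
    congr 1
    rw [← Real.rpow_natCast ‖u x‖ 2, ← Real.rpow_add_of_nonneg (norm_nonneg _) (by norm_num)
      (by linarith)]
    congr 1; push_cast; ring
  have hwb : ∀ x, ‖w x‖ ≤ K ^ (r - 1) := fun x => by
    rw [hwn]
    exact Real.rpow_le_rpow (norm_nonneg _) (hK x) (by linarith)
  have key : ∀ N : ℕ, ∫⁻ x in Metric.ball (0 : E d) N, ‖u x‖ₑ ^ r ≤ ENNReal.ofReal (A ^ r) := fun N => by
    set F := Metric.ball (0 : E d) N
    have hfin : volume F ≠ ∞ := Metric.isBounded_ball.measure_lt_top.ne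
    have hg : IsTest volume (F.indicator w) := by
      refine ⟨hwm.indicator measurableSet_ball, ?_, K ^ (r - 1), fun x =>
        (norm_indicator_le_norm_self _ _).trans (hwb x)⟩
      rw [integrable_indicator_iff measurableSet_ball]
      exact Measure.integrableOn_of_bounded hfin hwm.aestronglyMeasurable
        (Filter.Eventually.of_forall hwb)
    have hi : IntegrableOn (fun x => ‖u x‖ ^ r) F := by
      refine Measure.integrableOn_of_bounded (M := K ^ r) hfin (hu.norm.pow_const r).aestronglyMeasurable
        (Filter.Eventually.of_forall fun x => ?_)
      rw [Real.norm_of_nonneg (by positivity)]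
      exact Real.rpow_le_rpow (norm_nonneg _) (hK x) (by linarith)
    have k := h _ hg
    set I := ∫ x in F, ‖u x‖ ^ r with hI
    have hI0 : 0 ≤ I := integral_nonneg fun _ => by positivity
    have e : powNorm volume (1 - 1 / r) (F.indicator w) = I ^ (1 - 1 / r) := by
      rw [powNorm, hI, ← integral_indicator measurableSet_ball]
      congr 2; ext x
      simp only [indicator_apply]
      split_ifs
      · rw [hwn, ← Real.rpow_mul (norm_nonneg _), hc]
        congr 1
        have : r - 1 ≠ 0 := by linarith
        field_simp
      · rw [norm_zero, Real.zero_rpow (by positivity)]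
    rw [integral_mul_eq_of_phase measurableSet_ball huw, Complex.norm_real, e] at k
    replace k := (le_abs_self I).trans k
    have hIA : I ≤ A ^ r := by
      rcases hI0.eq_or_lt with h0 | h0
      · rw [← h0]; positivity
      · have e2 : I = I ^ (1 / r) * I ^ (1 - 1 / r) := by
          rw [← Real.rpow_add h0]; simp
        nth_rw 1 [e2] at k
        have h1 : 0 < I ^ (1 - 1 / r) := by positivity
        have h2 := Real.rpow_le_rpow (by positivity) (le_of_mul_le_mul_right k h1) hr0.le
        rwa [← Real.rpow_mul hI0, one_div_mul_cancel hr0.ne', Real.rpow_one] at h2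
    calc ∫⁻ x in F, ‖u x‖ₑ ^ r = ENNReal.ofReal I := by
          rw [hI, ofReal_integral_eq_lintegral_ofReal hi (Filter.Eventually.of_forall fun x => by positivity)]
          congr 1; ext x
          rw [← ENNReal.ofReal_rpow_of_nonneg (norm_nonneg _) hr0.le, ofReal_norm]
      _ ≤ _ := ENNReal.ofReal_le_ofReal hIA
  have hcov := aecover_ball (μ := (volume : Measure (E d))) (x := 0) tendsto_natCast_atTop_atTop
  have hlim := hcov.lintegral_tendsto_of_nat (hu.enorm.pow_const r).aemeasurable
  have hle := le_of_tendsto' hlim key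
  rw [eLpNorm_eq_lintegral_rpow_enorm_toReal (by positivity) ENNReal.ofReal_ne_top,
    ENNReal.toReal_ofReal hr0.le]
  calc _ ≤ ENNReal.ofReal (A ^ r) ^ (1 / r) := by gcongr
    _ = ENNReal.ofReal A := by
      rw [ENNReal.ofReal_rpow_of_nonneg (by positivity) (by positivity), ← Real.rpow_mul hA,
        mul_one_div_cancel hr0.ne', Real.rpow_one]

end ShellProjection

namespace ShellProjection

open Complex FourierTransform

variable {d : ℕ}

/-! ### Rescaling -/

/-- The dilation `f(· / l)`. -/
noncomputable def dil (l : ℝ) (f : E d → ℂ) : E d → ℂ := fun y => f (l⁻¹ • y)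

theorem finrank_E (d : ℕ) : Module.finrank ℝ (E d) = d := by simp

theorem integral_dil {F : Type*} [NormedAddCommGroup F] [NormedSpace ℝ F] {l : ℝ} (hl : 0 < l)
    (f : E d → F) : ∫ y, f (l⁻¹ • y) = l ^ d • ∫ y, f y := by
  rw [Measure.integral_comp_smul, finrank_E, inv_pow, inv_inv, abs_of_pos (by positivity)]

theorem isTest_dil {l : ℝ} (hl : 0 < l) {f : E d → ℂ} (hf : IsTest volume f) :
    IsTest volume (dil l f) := by
  obtain ⟨C, hC⟩ := hf.bounded
  exact ⟨hf.measurable.comp (measurable_const_smul l⁻¹), hf.integrable.comp_smul (inv_pos.2 hl).ne',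
    C, fun x => hC _⟩

theorem powNorm_dil {l : ℝ} (hl : 0 < l) (a : ℝ) (f : E d → ℂ) :
    powNorm volume a (dil l f) = l ^ (d * a) * powNorm volume a f := by
  unfold powNorm dil
  rw [integral_dil hl (fun y => ‖f y‖ ^ (1 / a)), smul_eq_mul, Real.mul_rpow (by positivity)
    (integral_rpow_nonneg a f), ← Real.rpow_natCast, ← Real.rpow_mul hl.le]

theorem volume_preimage_dil {l : ℝ} (hl : 0 < l) (Y : Set (E d)) :
    volume {y : E d | l⁻¹ • y ∈ Y} = ENNReal.ofReal (l ^ d) * volume Y := by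
  have := Measure.addHaar_preimage_smul (volume : Measure (E d)) (inv_pos.2 hl).ne' Y
  rw [finrank_E, inv_pow, inv_inv, abs_of_pos (by positivity)] at this
  exact this

theorem subInd_dil {l : ℝ} (hl : 0 < l) {g : E d → ℂ} {Y : Set (E d)} (hg : SubInd volume g Y) :
    SubInd volume (dil l g) {y | l⁻¹ • y ∈ Y} := by
  refine ⟨hg.measurable.comp (measurable_const_smul l⁻¹), measurable_const_smul l⁻¹ hg.measurableSet, ?_,
    fun x => hg.le _⟩
  rw [volume_preimage_dil hl]
  exact ENNReal.mul_ne_top ENNReal.ofReal_ne_top hg.finite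

theorem fourier_dil {l : ℝ} (hl : 0 < l) (f : E d → ℂ) (ζ : E d) :
    𝓕 (dil l f) ζ = (l : ℂ) ^ d * 𝓕 f (l • ζ) := by
  rw [Real.fourier_eq', Real.fourier_eq']
  have := integral_dil hl fun y : E d => cexp (((-2 * Real.pi * inner ℝ y (l • ζ) : ℝ) : ℂ) * I) • f y
  rw [Complex.real_smul, ofReal_pow] at this
  rw [← this]
  congr 1; ext y
  rw [dil, real_inner_smul_right, real_inner_smul_left, mul_inv_cancel_left₀ hl.ne']

/-- The normalized projection. -/
noncomputable def shellProj (δ : ℝ) (f : E d → ℂ) : E d → ℂ :=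
  𝓕⁻ fun ζ => shellSymbol d δ ζ * 𝓕 f ζ

theorem hat_eq (f : 𝓢(E d, ℂ)) (ξ : E d) : hat f ξ = 𝓕 (f : E d → ℂ) ((2 * Real.pi)⁻¹ • ξ) := by
  rw [Real.fourier_eq', hat]
  congr 1; ext x
  rw [smul_eq_mul, real_inner_smul_right]
  congr 2
  have : (Real.pi : ℂ) ≠ 0 := by exact_mod_cast Real.pi_ne_zero
  push_cast
  field_simp

/-- The dilation factor of the shell `k`. -/
noncomputable def scale (k : ℝ) : ℝ := √k / (2 * Real.pi)

theorem scale_pos {k : ℝ} (hk : 1 ≤ k) : 0 < scale k := by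
  have : 0 < k := by linarith
  unfold scale; positivity

/-- The substitution ξ = √k ζ carries the normalized shell of width 1/k onto the shell `k`, since k
- 1 = k(1 - 1/k). The 2π in `scale` passes from e^{-ix·ξ} to the convention e^{-2πix·ξ} of 𝓕. -/
theorem wp_eq {k : ℝ} (hk : 1 ≤ k) (f : 𝓢(E d, ℂ)) (x : E d) :
    wp k f x = shellProj k⁻¹ (dil (scale k) f) (scale k • x) := by
  classical
  have hk0 : 0 < k := by linarith
  have hs : 0 < √k := by positivity
  have hl := scale_pos hk
  have hπ : (Real.pi : ℂ) ≠ 0 := by exact_mod_cast Real.pi_ne_zero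
  have hsC : ((√k : ℝ) : ℂ) ≠ 0 := by exact_mod_cast hs.ne'
  rw [wp, shellProj, Real.fourierInv_eq']
  have hm : MeasurableSet (shell d k) := by
    have h : Measurable fun ξ : E d => ‖ξ‖ ^ 2 := by fun_prop
    exact (measurableSet_le measurable_const h).inter (measurableSet_lt h measurable_const)
  rw [← integral_indicator hm]
  set G : E d → ℂ := (shell d k).indicator fun ξ =>
    cexp (I * ((inner ℝ x ξ : ℝ) : ℂ)) * hat f ξ with hG
  have h1 := Measure.integral_comp_smul (volume : Measure (E d)) G (√k)
  rw [finrank_E, abs_of_pos (by positivity), Complex.real_smul] at h1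
  have h2 : ∀ ζ : E d, cexp (((2 * Real.pi * inner ℝ ζ (scale k • x) : ℝ) : ℂ) * I) •
      (shellSymbol d k⁻¹ ζ * 𝓕 (dil (scale k) f) ζ) = (scale k : ℂ) ^ d * G (√k • ζ) := fun ζ => by
    have hmem : √k • ζ ∈ shell d k ↔ ζ ∈ unitShell d k⁻¹ := by
      simp only [shell, unitShell, mem_ofPred_eq, norm_smul, Real.norm_of_nonneg hs.le, mul_pow,
        Real.sq_sqrt hk0.le]
      have e1 : k - 1 = k * (1 - k⁻¹) := by field_simp
      rw [e1, mul_le_mul_iff_right₀ hk0, mul_lt_iff_lt_one_right hk0]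
    rw [hG, indicator_apply, shellSymbol, indicator_apply, fourier_dil hl]
    simp only [hmem]
    split_ifs with h
    · rw [hat_eq, smul_smul, Pi.one_apply, one_mul, smul_eq_mul, real_inner_smul_right,
        real_inner_smul_right, real_inner_comm]
      have e2 : (2 * Real.pi)⁻¹ * √k = scale k := by rw [scale]; ring
      have e3 : ((2 * Real.pi * (scale k * inner ℝ x ζ) : ℝ) : ℂ) * I =
          I * ((√k * inner ℝ x ζ : ℝ) : ℂ) := by
        rw [scale]; push_cast; field_simp
      rw [e2, e3]
      ring
    · simp
  simp_rw [h2]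
  rw [integral_const_mul, h1, scale]
  push_cast
  rw [div_pow]
  field_simp

theorem continuous_shellProj (δ : ℝ) {f : E d → ℂ} (hf : Integrable f) :
    Continuous (shellProj δ f) :=
  continuous_fourierInv ((integrable_shellSymbol d δ).mul_bdd (c := ∫ x, ‖f x‖)
    (continuous_fourier hf).aestronglyMeasurable (Filter.Eventually.of_forall (norm_fourier_le f)))

theorem schwartz_isTest (f : 𝓢(E d, ℂ)) : IsTest volume (f : E d → ℂ) := by
  obtain ⟨C, hC0, hC⟩ := f.decay 0 0
  simp only [pow_zero, norm_iteratedFDeriv_zero, one_mul] at hC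
  exact ⟨f.continuous.measurable, f.integrable, C, hC⟩

theorem continuous_wp {k : ℝ} (hk : 1 ≤ k) (f : 𝓢(E d, ℂ)) : Continuous (wp k f) := by
  have : wp k f = fun x => shellProj k⁻¹ (dil (scale k) f) (scale k • x) := funext (wp_eq hk f)
  rw [this]
  exact (continuous_shellProj _ (isTest_dil (scale_pos hk) (schwartz_isTest f)).integrable).comp
    (continuous_const_smul _)

theorem bounded_wp {k : ℝ} (hk : 1 ≤ k) (f : 𝓢(E d, ℂ)) : ∃ K, ∀ x, ‖wp k f x‖ ≤ K :=
  ⟨_, fun x => by rw [wp_eq hk]; exact norm_fourierInv_le _ _⟩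

theorem integral_wp_mul {k : ℝ} (hk : 1 ≤ k) (f : 𝓢(E d, ℂ)) {g : E d → ℂ} (hg : IsTest volume g) :
    ∫ x, wp k f x * g x =
      ((scale k : ℂ) ^ d)⁻¹ * shellForm d k⁻¹ (dil (scale k) f) (dil (scale k) g) := by
  have hl := scale_pos hk
  rw [shellForm, form_eq_integral_mul (integrable_shellSymbol d k⁻¹)
    (isTest_dil hl (schwartz_isTest f)).integrable (isTest_dil hl hg).integrable]
  have h := integral_dil hl fun x => wp k f x * g x
  rw [Complex.real_smul, ofReal_pow] at h
  have h2 : ∀ y : E d, wp k f ((scale k)⁻¹ • y) * g ((scale k)⁻¹ • y) =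
      𝓕⁻ (fun ξ => shellSymbol d k⁻¹ ξ * 𝓕 (dil (scale k) f) ξ) y * dil (scale k) g y := fun y => by
    rw [wp_eq hk, smul_inv_smul₀ hl.ne']; rfl
  simp_rw [h2] at h
  rw [h, inv_mul_cancel_left₀]
  have : (scale k : ℂ) ≠ 0 := by exact_mod_cast hl.ne'
  positivity

theorem norm_integral_wp_mul {k : ℝ} (hk : 1 ≤ k) (f : 𝓢(E d, ℂ)) {g : E d → ℂ}
    (hg : IsTest volume g) : ‖∫ x, wp k f x * g x‖ =
      scale k ^ (-(d : ℝ)) * ‖shellForm d k⁻¹ (dil (scale k) f) (dil (scale k) g)‖ := by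
  rw [integral_wp_mul hk f hg, norm_mul, norm_inv, norm_pow, Complex.norm_real,
    Real.norm_of_nonneg (scale_pos hk).le, Real.rpow_neg (scale_pos hk).le, Real.rpow_natCast]

theorem scale_rpow {k : ℝ} (hk : 1 ≤ k) (t γ : ℝ) :
    scale k ^ (d * t) * (k⁻¹) ^ γ = (2 * Real.pi) ^ (-(d * t)) * k ^ ((d : ℝ) / 2 * t - γ) := by
  have hk0 : 0 < k := by linarith
  rw [scale, Real.div_rpow (by positivity) (by positivity), Real.sqrt_eq_rpow, ← Real.rpow_mul hk0.le,
    Real.inv_rpow hk0.le, Real.rpow_sub hk0, Real.rpow_neg (by positivity)]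
  rw [show (1 / 2 : ℝ) * (d * t) = d / 2 * t by ring]
  field_simp

/-- The powers of `scale k` come from the change of variables and from the norms of the two dilated
functions; together their exponent is d(X.1 - X.2). -/
theorem scale_identity {k : ℝ} (hk : 1 ≤ k) (C γ : ℝ) (X : ℝ × ℝ) :
    C * (2 * Real.pi) ^ (-((d : ℝ) * (X.1 - X.2))) * k ^ ((d : ℝ) / 2 * (X.1 - X.2) - γ) =
      C * (scale k ^ (-(d : ℝ)) * (scale k ^ (d * X.1) * scale k ^ (d * (1 - X.2))) * k⁻¹ ^ γ) := by
  have hl := scale_pos hk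
  rw [mul_assoc C, ← scale_rpow hk, ← Real.rpow_add hl, ← Real.rpow_add hl]
  congr 3; ring

/-- The form of `wp k` under a strong estimate. -/
theorem norm_integral_wp_mul_le {k : ℝ} (hk : 1 ≤ k) {X : ℝ × ℝ} {C γ : ℝ}
    (h : Strong volume (shellForm d k⁻¹) X.1 (1 - X.2) (C * k⁻¹ ^ γ)) (f : 𝓢(E d, ℂ)) {g : E d → ℂ}
    (hg : IsTest volume g) : ‖∫ x, wp k f x * g x‖ ≤
      C * (2 * Real.pi) ^ (-((d : ℝ) * (X.1 - X.2))) * k ^ ((d : ℝ) / 2 * (X.1 - X.2) - γ) *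
        (powNorm volume X.1 f * powNorm volume (1 - X.2) g) := by
  have hl := scale_pos hk
  have h1 := h _ _ (isTest_dil hl (schwartz_isTest f)) (isTest_dil hl hg)
  rw [norm_integral_wp_mul hk f hg]
  refine (mul_le_mul_of_nonneg_left h1 (by positivity)).trans (le_of_eq ?_)
  rw [powNorm_dil hl, powNorm_dil hl, scale_identity hk]
  ring

theorem powNorm_eq_toReal {a : ℝ} {f : E d → ℂ} {p : ℝ≥0∞} (hp : p ≠ 0) (hp' : p ≠ ∞)
    (hpa : 1 / p.toReal = a) (hf : MemLp f p volume) :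
    ENNReal.ofReal (powNorm volume a f) = eLpNorm f p volume := by
  rw [hf.eLpNorm_eq_integral_rpow_norm hp hp', powNorm, ← hpa]
  simp

/-- The exponents of the corollary. -/
structure IsPair (p q : ℝ≥0∞) : Prop where
  one_le : 1 ≤ p
  le_two : p ≤ 2
  two_le : 2 ≤ q

namespace IsPair

variable {p q : ℝ≥0∞}

theorem p_ne_top (h : IsPair p q) : p ≠ ∞ := ne_top_of_le_ne_top (by simp) h.le_two

theorem p_ne_zero (h : IsPair p q) : p ≠ 0 := (zero_lt_one.trans_le h.one_le).ne'

theorem fst_eq (_ : IsPair p q) : (expPoint p q).1 = 1 / p.toReal := by simp [expPoint]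

theorem snd_eq (_ : IsPair p q) : (expPoint p q).2 = 1 / q.toReal := by simp [expPoint]

theorem one_le_toReal (h : IsPair p q) : 1 ≤ p.toReal := by
  have := ENNReal.toReal_mono h.p_ne_top h.one_le
  simpa using this

theorem toReal_le_two (h : IsPair p q) : p.toReal ≤ 2 := by
  have := ENNReal.toReal_mono (by simp) h.le_two
  simpa using this

theorem half_le_fst (h : IsPair p q) : 1 / 2 ≤ (expPoint p q).1 := by
  rw [h.fst_eq]
  exact one_div_le_one_div_of_le (by linarith [h.one_le_toReal]) h.toReal_le_two

theorem fst_le_one (h : IsPair p q) : (expPoint p q).1 ≤ 1 := by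
  rw [h.fst_eq, div_le_one (by linarith [h.one_le_toReal])]
  exact h.one_le_toReal

theorem snd_nonneg (h : IsPair p q) : 0 ≤ (expPoint p q).2 := by
  rw [h.snd_eq]; positivity

theorem two_le_toReal (h : IsPair p q) (hq : q ≠ ∞) : 2 ≤ q.toReal := by
  have := ENNReal.toReal_mono hq h.two_le
  simpa using this

theorem snd_le_half (h : IsPair p q) : (expPoint p q).2 ≤ 1 / 2 := by
  rw [h.snd_eq]
  rcases eq_or_ne q ∞ with rfl | hq
  · simp
  · exact one_div_le_one_div_of_le (by norm_num) (h.two_le_toReal hq)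

end IsPair

/-- The `L^p → L^q` bound from a strong rate. -/
theorem opNorm_le_of_strongRate {p q : ℝ≥0∞} (hpq : IsPair p q) {γ : ℝ}
    (h : StrongRate d (expPoint p q) γ) : ∃ C : ℝ, 0 < C ∧ ∀ k : ℝ, 1 ≤ k →
      opNorm (lebesgueNorm p) (lebesgueNorm q) (wp (d := d) k) ≤
        ENNReal.ofReal (C * k ^ ((d : ℝ) / 2 * ((expPoint p q).1 - (expPoint p q).2) - γ)) := by
  obtain ⟨C, hC, h⟩ := h
  set X := expPoint p q with hX
  refine ⟨C * (2 * Real.pi) ^ (-((d : ℝ) * (X.1 - X.2))), by positivity, fun k hk => ?_⟩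
  have hk0 : 0 < k := by linarith
  refine iSup₂_le fun f hf => ?_
  have hp1 : powNorm volume X.1 f ≤ 1 := by
    have := powNorm_eq_toReal (f := f) hpq.p_ne_zero
      hpq.p_ne_top hpq.fst_eq.symm ((schwartz_isTest f).memLp hpq.one_le)
    rw [lebesgueNorm, ← this] at hf
    simpa using hf
  have hmain := fun (g : E d → ℂ) (hg : IsTest volume g) => norm_integral_wp_mul_le hk
    (h k⁻¹ (inv_pos.2 hk0) (inv_le_one_of_one_le₀ hk)) f hg
  set A := C * (2 * Real.pi) ^ (-((d : ℝ) * (X.1 - X.2))) * k ^ ((d : ℝ) / 2 * (X.1 - X.2) - γ) with hA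
  have hA0 : 0 ≤ A := by positivity
  have hmain' : ∀ (g : E d → ℂ), IsTest volume g → ‖∫ x, wp k f x * g x‖ ≤
      A * powNorm volume (1 - X.2) g := fun g hg => by
    refine (hmain g hg).trans ?_
    have := powNorm_nonneg (μ := (volume : Measure (E d))) (1 - X.2) g
    calc _ ≤ A * (1 * powNorm volume (1 - X.2) g) := by gcongr
      _ = _ := by rw [one_mul]
  rw [lebesgueNorm]
  rcases eq_or_ne q ∞ with rfl | hq
  -- For q = ∞ the dual exponent is 1, and functions dominated by indicators suffice as tests.
  · have hX2 : X.2 = 0 := by simp [hX, expPoint]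
    refine eLpNorm_top_le_of_forall_subInd (continuous_wp hk f).measurable (bounded_wp hk f) hA0
      fun g Y hg => (hmain' g hg.isTest).trans ?_
    have := powNorm_le_of_subInd one_pos le_rfl hg
    rw [Real.rpow_one] at this
    rw [hX2, sub_zero]
    gcongr
  · have := eLpNorm_le_of_forall_isTest (continuous_wp hk f).measurable (bounded_wp hk f) hA0
      (hpq.two_le_toReal hq) (fun g hg => by have := hmain' g hg; rwa [hpq.snd_eq] at this)
    rwa [ENNReal.ofReal_toReal hq] at this

theorem lorentz_top_le {q : ℝ≥0∞} {u : E d → ℂ} {A : ℝ}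
    (h : ∀ s : ℝ, 0 < s → ENNReal.ofReal s * distribution u s ^ (1 / q.toReal) ≤ ENNReal.ofReal A) :
    lorentzNorm q ∞ u ≤ ENNReal.ofReal A := by
  rw [lorentzNorm, if_pos rfl]
  exact iSup₂_le fun s hs => h s hs

/-- The weak-type bound from a weak rate. -/
theorem opNorm_le_of_weakRate {p q : ℝ≥0∞} (hpq : IsPair p q) {γ : ℝ} (hb : 0 < (expPoint p q).2)
    (h : WeakRate d (expPoint p q) γ) : ∃ C : ℝ, 0 < C ∧ ∀ k : ℝ, 1 ≤ k →
      opNorm (lebesgueNorm p) (lorentzNorm q ∞) (wp (d := d) k) ≤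
        ENNReal.ofReal (C * k ^ ((d : ℝ) / 2 * ((expPoint p q).1 - (expPoint p q).2) - γ)) := by
  obtain ⟨C, hC, h⟩ := h
  set X := expPoint p q with hX
  refine ⟨C * (2 * Real.pi) ^ (-((d : ℝ) * (X.1 - X.2))), by positivity, fun k hk => ?_⟩
  have hk0 : 0 < k := by linarith
  have hl := scale_pos hk
  refine iSup₂_le fun f hf => ?_
  have hp1 : powNorm volume X.1 f ≤ 1 := by
    have := powNorm_eq_toReal (f := f) hpq.p_ne_zero
      hpq.p_ne_top hpq.fst_eq.symm ((schwartz_isTest f).memLp hpq.one_le)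
    rw [lebesgueNorm, ← this] at hf
    simpa using hf
  set A := C * (2 * Real.pi) ^ (-((d : ℝ) * (X.1 - X.2))) * k ^ ((d : ℝ) / 2 * (X.1 - X.2) - γ) with hA
  have hA0 : 0 ≤ A := by positivity
  have hmain : ∀ (g : E d → ℂ) (Y : Set (E d)), SubInd volume g Y → ‖∫ x, wp k f x * g x‖ ≤
      A * volume.real Y ^ (1 - X.2) := fun g Y hg => by
    have h1 := h k⁻¹ (inv_pos.2 hk0) (inv_le_one_of_one_le₀ hk) _ _ _
      (isTest_dil hl (schwartz_isTest f)) (subInd_dil hl hg)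
    rw [norm_integral_wp_mul hk f hg.isTest]
    refine (mul_le_mul_of_nonneg_left h1 (by positivity)).trans ?_
    rw [powNorm_dil hl, Measure.real, volume_preimage_dil hl, ENNReal.toReal_mul,
      ENNReal.toReal_ofReal (by positivity), Real.mul_rpow (by positivity) ENNReal.toReal_nonneg,
      ← Real.rpow_natCast (scale k) d, ← Real.rpow_mul hl.le, hA, scale_identity hk]
    calc _ = C * (scale k ^ (-(d : ℝ)) * (scale k ^ (d * X.1) * scale k ^ (d * (1 - X.2))) * k⁻¹ ^ γ) *
        (volume Y).toReal ^ (1 - X.2) * powNorm volume X.1 f := by ring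
      _ ≤ C * (scale k ^ (-(d : ℝ)) * (scale k ^ (d * X.1) * scale k ^ (d * (1 - X.2))) * k⁻¹ ^ γ) *
        (volume Y).toReal ^ (1 - X.2) * 1 := by gcongr
      _ = _ := by rw [mul_one]; rfl
  refine lorentz_top_le fun s hs => ?_
  have := weak_le_of_forall_subInd (continuous_wp hk f).measurable (bounded_wp hk f) hA0 hb hmain hs
  rwa [hpq.snd_eq] at this

/-- The restricted weak-type bound from a Lorentz rate. -/
theorem opNorm_le_of_lorentzRate {p q : ℝ≥0∞} (hpq : IsPair p q) {γ : ℝ} (hb : 0 < (expPoint p q).2)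
    (h : LorentzRate d (expPoint p q) γ) : ∃ C : ℝ, 0 < C ∧ ∀ k : ℝ, 1 ≤ k →
      opNorm (lorentzNorm p 1) (lorentzNorm q ∞) (wp (d := d) k) ≤
        ENNReal.ofReal (C * k ^ ((d : ℝ) / 2 * ((expPoint p q).1 - (expPoint p q).2) - γ)) := by
  obtain ⟨C, hC, h⟩ := h
  set X := expPoint p q with hX
  refine ⟨C * (2 * Real.pi) ^ (-((d : ℝ) * (X.1 - X.2))), by positivity, fun k hk => ?_⟩
  have hk0 : 0 < k := by linarith
  have hl := scale_pos hk
  have ha : 0 < X.1 := by linarith [hpq.half_le_fst]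
  refine iSup₂_le fun f hf => ?_
  -- For second index 1 the powers of `s` in the Lorentz norm cancel; the prefactor p ≥ 1 is
  -- dropped.
  have hp1 : ∫⁻ s in Ioi (0 : ℝ), volume {x | s < ‖f x‖} ^ X.1 ≤ 1 := by
    rw [lorentzNorm, if_neg (by simp)] at hf
    simp only [ENNReal.toReal_one, div_one, ENNReal.rpow_one] at hf
    have e : ∫⁻ s in Ioi (0 : ℝ), ENNReal.ofReal s * distribution (f : E d → ℂ) s ^ (1 / p.toReal) /
        ENNReal.ofReal s = ∫⁻ s in Ioi (0 : ℝ), volume {x | s < ‖f x‖} ^ X.1 := by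
      refine setLIntegral_congr_fun measurableSet_Ioi fun s hs => ?_
      have h0 : ENNReal.ofReal s ≠ 0 := by simpa using hs
      rw [mul_comm, ENNReal.mul_div_cancel_right h0 ENNReal.ofReal_ne_top, hX, hpq.fst_eq]
      rfl
    rw [e] at hf
    refine le_trans ?_ hf
    calc _ = 1 * ∫⁻ s in Ioi (0 : ℝ), volume {x | s < ‖f x‖} ^ X.1 := (one_mul _).symm
      _ ≤ _ := by gcongr; exact hpq.one_le
  have hp2 : ∫⁻ s in Ioi (0 : ℝ), volume {x | s < ‖dil (scale k) f x‖} ^ X.1 ≤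
      ENNReal.ofReal (scale k ^ (d * X.1)) := by
    have : ∀ s : ℝ, volume {x | s < ‖dil (scale k) f x‖} =
        ENNReal.ofReal (scale k ^ d) * volume {x | s < ‖f x‖} := fun s =>
      volume_preimage_dil hl {x | s < ‖f x‖}
    simp_rw [this, ENNReal.mul_rpow_of_nonneg _ _ ha.le]
    rw [lintegral_const_mul' _ _ (by simp [ha.le]), ENNReal.ofReal_rpow_of_nonneg (by positivity) ha.le,
      ← Real.rpow_natCast (scale k) d, ← Real.rpow_mul hl.le]
    calc _ ≤ ENNReal.ofReal (scale k ^ (d * X.1)) * 1 := by gcongr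
      _ = _ := mul_one _
  set A := C * (2 * Real.pi) ^ (-((d : ℝ) * (X.1 - X.2))) * k ^ ((d : ℝ) / 2 * (X.1 - X.2) - γ) with hA
  have hA0 : 0 ≤ A := by positivity
  have hmain : ∀ (g : E d → ℂ) (Y : Set (E d)), SubInd volume g Y → ‖∫ x, wp k f x * g x‖ ≤
      A * volume.real Y ^ (1 - X.2) := fun g Y hg => by
    have h1 := h k⁻¹ (inv_pos.2 hk0) (inv_le_one_of_one_le₀ hk) _ _ _ _ (by positivity)
      (isTest_dil hl (schwartz_isTest f)) (subInd_dil hl hg) hp2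
    rw [norm_integral_wp_mul hk f hg.isTest]
    refine (mul_le_mul_of_nonneg_left h1 (by positivity)).trans (le_of_eq ?_)
    rw [Measure.real, volume_preimage_dil hl, ENNReal.toReal_mul,
      ENNReal.toReal_ofReal (by positivity), Real.mul_rpow (by positivity) ENNReal.toReal_nonneg,
      ← Real.rpow_natCast (scale k) d, ← Real.rpow_mul hl.le, hA, scale_identity hk, Measure.real]
    ring
  refine lorentz_top_le fun s hs => ?_
  have := weak_le_of_forall_subInd (continuous_wp hk f).measurable (bounded_wp hk f) hA0 hb hmain hs
  rwa [hpq.snd_eq] at this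

end ShellProjection

namespace ShellProjection

open Complex FourierTransform

variable {d : ℕ}

/-! ### Testing the operator norm -/

theorem IsPair.exists_conj {p q : ℝ≥0∞} (h : IsPair p q) : ∃ q' : ℝ≥0∞, 1 ≤ q' ∧ q' ≠ ∞ ∧
    1 / q'.toReal = 1 - (expPoint p q).2 ∧ q.HolderConjugate q' := by
  have hc : 0 < 1 - (expPoint p q).2 := by linarith [h.snd_le_half]
  have hb := h.snd_nonneg
  refine ⟨ENNReal.ofReal (1 / (1 - (expPoint p q).2)), ?_, ENNReal.ofReal_ne_top, ?_, ?_⟩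
  · rw [ENNReal.one_le_ofReal, le_div_iff₀ hc]; linarith
  · rw [ENNReal.toReal_ofReal (by positivity), one_div_one_div]
  · rw [ENNReal.holderConjugate_iff, one_div, ENNReal.ofReal_inv_of_pos hc, inv_inv]
    have hq : q⁻¹ ≠ ∞ := by
      simpa using (lt_of_lt_of_le (by norm_num) h.two_le).ne'
    have e : q⁻¹ = ENNReal.ofReal (expPoint p q).2 := (ENNReal.ofReal_toReal hq).symm
    rw [e, ← ENNReal.ofReal_add hb hc.le]
    simp

theorem norm_integral_mul_le_eLpNorm {p q : ℝ≥0∞} (hpq : IsPair p q) {u g : E d → ℂ}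
    (hu : Measurable u) (hg : IsTest volume g) {A : ℝ} (hA : 0 ≤ A)
    (h : eLpNorm u q volume ≤ ENNReal.ofReal A) :
    ‖∫ x, u x * g x‖ ≤ A * powNorm volume (1 - (expPoint p q).2) g := by
  obtain ⟨q', h1, h2, h3, h4⟩ := hpq.exists_conj
  have e := powNorm_eq_toReal (zero_lt_one.trans_le h1).ne' h2 h3 (hg.memLp h1)
  have k : eLpNorm (u • g) 1 volume ≤ eLpNorm u q volume * eLpNorm g q' volume :=
    eLpNorm_smul_le_mul_eLpNorm hg.measurable.aestronglyMeasurable hu.aestronglyMeasurable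
  rw [← e] at k
  have h5 : ‖∫ x, u x * g x‖ₑ ≤ ENNReal.ofReal (A * powNorm volume (1 - (expPoint p q).2) g) := by
    refine (enorm_integral_le_lintegral_enorm _).trans ?_
    rw [eLpNorm_one_eq_lintegral_enorm] at k
    rw [ENNReal.ofReal_mul hA]
    exact k.trans (by gcongr)
  rw [← ofReal_norm] at h5
  exact (ENNReal.ofReal_le_ofReal_iff (mul_nonneg hA (powNorm_nonneg _ _))).1 h5

theorem dil_dil {l : ℝ} (hl : 0 < l) (f : E d → ℂ) : dil l (dil l⁻¹ f) = f := by
  ext x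
  simp [dil, smul_smul, hl.ne']

theorem exists_schwartz_dil {l : ℝ} (hl : 0 < l) (f : 𝓢(E d, ℂ)) :
    ∃ h : 𝓢(E d, ℂ), (h : E d → ℂ) = dil l f := by
  let e : E d ≃L[ℝ] E d := ContinuousLinearEquiv.smulLeft (Units.mk0 l⁻¹ (inv_pos.2 hl).ne')
  exact ⟨SchwartzMap.compCLMOfContinuousLinearEquiv ℝ e f, by ext x; rfl⟩

/-- The way back from ℘_k to the normalized shell, used for lower bounds: undo the dilation,
normalize, and pair by Hölder. -/
theorem norm_shellForm_schwartz_le {p q : ℝ≥0∞} (hpq : IsPair p q) {k A : ℝ} (hk : 1 ≤ k)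
    (hA : 0 ≤ A) (h : opNorm (lebesgueNorm p) (lebesgueNorm q) (wp (d := d) k) ≤ ENNReal.ofReal A)
    (f : 𝓢(E d, ℂ)) {g : E d → ℂ} (hg : IsTest volume g) :
    ‖shellForm d k⁻¹ f g‖ ≤ A * scale k ^ (-(d * ((expPoint p q).1 - (expPoint p q).2))) *
      (powNorm volume (expPoint p q).1 f * powNorm volume (1 - (expPoint p q).2) g) := by
  set a := (expPoint p q).1
  set b := (expPoint p q).2
  have ha : 0 < a := by linarith [hpq.half_le_fst]
  have hl := scale_pos hk
  have hB := isTestForm_shellForm d k⁻¹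
  have hp0 := powNorm_nonneg (μ := (volume : Measure (E d))) a f
  have hf := schwartz_isTest f
  rcases hp0.eq_or_lt with h0 | h0
  · have hz := ae_eq_zero_of_powNorm_eq_zero ha hpq.fst_le_one hf h0.symm
    obtain ⟨K, -, hb⟩ := hB.bound
    have h2 := hb f g hf hg
    have : ∫ x, ‖f x‖ = 0 := by
      rw [integral_congr_ae (hz.mono fun x hx => by rw [hx])]; simp
    rw [this, mul_zero, zero_mul] at h2
    rw [← h0, zero_mul, mul_zero]; exact h2
  obtain ⟨F, hF⟩ := exists_schwartz_dil (inv_pos.2 hl) f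
  -- The factor that gives norm 1, as the inverse dilation multiplies the norm by `scale k` to the
  -- power -da.
  set t : ℝ := scale k ^ (d * a) * (powNorm volume a f)⁻¹ with ht
  have ht0 : 0 < t := by positivity
  have hFt : ((((t : ℝ) : ℂ) • F : 𝓢(E d, ℂ)) : E d → ℂ) = ((t : ℝ) : ℂ) • dil (scale k)⁻¹ f := by
    rw [← hF]; rfl
  have hn : powNorm volume a (((t : ℂ) • F : 𝓢(E d, ℂ)) : E d → ℂ) = 1 := by
    rw [hFt, powNorm_smul ha, powNorm_dil (inv_pos.2 hl), Complex.norm_real,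
      Real.norm_of_nonneg ht0.le, ht, Real.inv_rpow hl.le]
    field_simp
  have hn' : lebesgueNorm p (((t : ℂ) • F : 𝓢(E d, ℂ)) : E d → ℂ) ≤ 1 := by
    have := powNorm_eq_toReal hpq.p_ne_zero hpq.p_ne_top hpq.fst_eq.symm
      ((schwartz_isTest ((t : ℂ) • F)).memLp hpq.one_le)
    change powNorm volume a _ = 1 at hn
    rw [lebesgueNorm, ← this, hn, ENNReal.ofReal_one]
  have hle : eLpNorm (wp k ((t : ℂ) • F)) q volume ≤ ENNReal.ofReal A :=
    (le_iSup₂ (f := fun (f : 𝓢(E d, ℂ)) (_ : lebesgueNorm p f ≤ 1) => lebesgueNorm q (wp k f))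
      ((t : ℂ) • F) hn').trans h
  have hg' := isTest_dil (inv_pos.2 hl) hg
  have key := norm_integral_mul_le_eLpNorm hpq (continuous_wp hk _).measurable hg' hA hle
  have hd : dil (scale k) ((t : ℂ) • dil (scale k)⁻¹ (f : E d → ℂ)) = (t : ℂ) • (f : E d → ℂ) := by
    conv_rhs => rw [← dil_dil hl (f : E d → ℂ)]
    rfl
  rw [norm_integral_wp_mul hk _ hg', hFt, hd, dil_dil hl, hB.smul_left _ _ _ hf hg, norm_mul,
    Complex.norm_real, Real.norm_of_nonneg ht0.le, powNorm_dil (inv_pos.2 hl), ht] at key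
  change _ ≤ A * ((scale k)⁻¹ ^ (d * (1 - b)) * powNorm volume (1 - b) g) at key
  rw [Real.inv_rpow hl.le, ← Real.rpow_neg hl.le] at key
  set S := ‖shellForm d k⁻¹ (f : E d → ℂ) g‖
  have e1 : scale k ^ (-(d * (a - b))) =
      scale k ^ (d : ℝ) * (scale k ^ (d * a))⁻¹ * scale k ^ (-((d : ℝ) * (1 - b))) := by
    rw [← Real.rpow_neg hl.le, ← Real.rpow_add hl, ← Real.rpow_add hl]; congr 1; ring
  have e2 : scale k ^ (-(d : ℝ)) = (scale k ^ (d : ℝ))⁻¹ := Real.rpow_neg hl.le _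
  rw [e2] at key
  rw [e1]
  have q1 : 0 < scale k ^ (d : ℝ) := by positivity
  have q2 : 0 < scale k ^ ((d : ℝ) * a) := by positivity
  calc S = (scale k ^ (d : ℝ)) * (scale k ^ ((d : ℝ) * a))⁻¹ * powNorm volume a f *
      ((scale k ^ (d : ℝ))⁻¹ * (scale k ^ (d * a) * (powNorm volume a f)⁻¹ * S)) := by
        field_simp
    _ ≤ (scale k ^ (d : ℝ)) * (scale k ^ ((d : ℝ) * a))⁻¹ * powNorm volume a f *
      (A * (scale k ^ (-((d : ℝ) * (1 - b))) * powNorm volume (1 - b) g)) := by gcongr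
    _ = _ := by ring

/-- A bound on the operator norm bounds the form on all bounded integrable functions. -/
theorem norm_shellForm_le_of_opNorm {p q : ℝ≥0∞} (hpq : IsPair p q) {k A : ℝ} (hk : 1 ≤ k)
    (hA : 0 ≤ A) (h : opNorm (lebesgueNorm p) (lebesgueNorm q) (wp (d := d) k) ≤ ENNReal.ofReal A) :
    Strong volume (shellForm d k⁻¹) (expPoint p q).1 (1 - (expPoint p q).2)
      (A * scale k ^ (-(d * ((expPoint p q).1 - (expPoint p q).2)))) := by
  intro f g hf hg
  set a := (expPoint p q).1
  set b := (expPoint p q).2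
  have ha : 0 < a := by linarith [hpq.half_le_fst]
  have hB := isTestForm_shellForm d k⁻¹
  obtain ⟨K, hK, ht⟩ := exists_strong_trivial d
  have htr := ht a (1 - b) k⁻¹ hpq.half_le_fst hpq.fst_le_one (by linarith [hpq.snd_le_half])
    (by linarith [hpq.snd_nonneg])
  set M := A * scale k ^ (-(d * (a - b))) with hM
  have hM0 : 0 ≤ M := by have := scale_pos hk; positivity
  set G := powNorm volume (1 - b) g with hG
  have hG0 : 0 ≤ G := powNorm_nonneg _ _
  -- `f` is approximated by a Schwartz function. The error is paid for by the trivial bound `K`,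
  -- which multiplies ε and disappears in the limit.
  have key : ∀ ε : ℝ, 0 < ε →
      ‖shellForm d k⁻¹ f g‖ ≤ M * (powNorm volume a f * G) + ε * ((M + K) * G) := by
    intro ε hε
    obtain ⟨s, hs1, hs2, hs3⟩ := MemLp.exist_eLpNorm_sub_le hpq.p_ne_top hpq.one_le
      (hf.memLp hpq.one_le) hε
    set S : 𝓢(E d, ℂ) := hs1.toSchwartzMap hs2 with hS
    have hSs : (S : E d → ℂ) = s := rfl
    have hSt := schwartz_isTest S
    have hw : IsTest volume (f - (S : E d → ℂ)) := by
      have := hf.add (hSt.smul (-1))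
      rwa [neg_one_smul, ← sub_eq_add_neg] at this
    have ew := powNorm_eq_toReal hpq.p_ne_zero hpq.p_ne_top hpq.fst_eq.symm (hw.memLp hpq.one_le)
    have ef := powNorm_eq_toReal hpq.p_ne_zero hpq.p_ne_top hpq.fst_eq.symm (hf.memLp hpq.one_le)
    have eS := powNorm_eq_toReal hpq.p_ne_zero hpq.p_ne_top hpq.fst_eq.symm (hSt.memLp hpq.one_le)
    have n1 : powNorm volume a (f - (S : E d → ℂ)) ≤ ε := by
      rw [hSs] at ew ⊢
      rw [← ew] at hs3
      exact (ENNReal.ofReal_le_ofReal_iff hε.le).1 hs3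
    have n2 : powNorm volume a S ≤ powNorm volume a f + powNorm volume a (f - (S : E d → ℂ)) := by
      have k := eLpNorm_sub_le (p := p) hf.measurable.aestronglyMeasurable
        hw.measurable.aestronglyMeasurable hpq.one_le (μ := volume)
      rw [sub_sub_cancel, ← ew, ← ef, ← eS, ← ENNReal.ofReal_add (powNorm_nonneg _ _)
        (powNorm_nonneg _ _)] at k
      exact (ENNReal.ofReal_le_ofReal_iff (add_nonneg (powNorm_nonneg _ _) (powNorm_nonneg _ _))).1 k
    have h1 := norm_shellForm_schwartz_le hpq hk hA h S hg
    have h2 := htr _ _ hw hg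
    have h3 : shellForm d k⁻¹ f g = shellForm d k⁻¹ S g + shellForm d k⁻¹ (f - (S : E d → ℂ)) g := by
      rw [hB.sub_left hf hSt hg]; ring
    rw [h3]
    refine (norm_add_le _ _).trans ?_
    calc _ ≤ M * ((powNorm volume a f + ε) * G) + K * (ε * G) := by
          refine add_le_add (h1.trans ?_) (h2.trans ?_)
          · have : powNorm volume a S ≤ powNorm volume a f + ε := n2.trans (by linarith)
            gcongr
          · gcongr
      _ = _ := by ring
  refine le_of_forall_pos_le_add fun η hη => ?_
  have hD : 0 < (M + K) * G + 1 := by positivity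
  have := key (η / ((M + K) * G + 1)) (by positivity)
  refine this.trans ?_
  have h4 : η / ((M + K) * G + 1) * ((M + K) * G) ≤ η := by
    rw [div_mul_eq_mul_div, div_le_iff₀ hD]
    nlinarith
  linarith

/-- A lower bound for the form gives a lower bound for the operator norm. -/
theorem exists_le_opNorm {p q : ℝ≥0∞} (hpq : IsPair p q) {γ : ℝ}
    (h : ∃ c : ℝ, 0 < c ∧ ∀ δ M : ℝ, 0 < δ → δ ≤ 1 → 0 ≤ M →
      Strong volume (shellForm d δ) (expPoint p q).1 (1 - (expPoint p q).2) M → c * δ ^ γ ≤ M) :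
    ∃ c : ℝ, 0 < c ∧ ∀ k : ℝ, 1 ≤ k →
      ENNReal.ofReal (c * k ^ ((d : ℝ) / 2 * ((expPoint p q).1 - (expPoint p q).2) - γ)) ≤
        opNorm (lebesgueNorm p) (lebesgueNorm q) (wp (d := d) k) := by
  obtain ⟨c, hc, h⟩ := h
  set a := (expPoint p q).1
  set b := (expPoint p q).2
  refine ⟨c * (2 * Real.pi) ^ (-((d : ℝ) * (a - b))), by positivity, fun k hk => ?_⟩
  have hl := scale_pos hk
  by_cases htop : opNorm (lebesgueNorm p) (lebesgueNorm q) (wp (d := d) k) = ∞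
  · rw [htop]; exact le_top
  rw [← ENNReal.ofReal_toReal htop]
  refine ENNReal.ofReal_le_ofReal ?_
  set A := (opNorm (lebesgueNorm p) (lebesgueNorm q) (wp (d := d) k)).toReal with hA
  have hA0 : 0 ≤ A := ENNReal.toReal_nonneg
  have k1 := norm_shellForm_le_of_opNorm hpq hk hA0 (ENNReal.ofReal_toReal htop).ge
  have k2 := h k⁻¹ _ (inv_pos.2 (by linarith)) (inv_le_one_of_one_le₀ hk) (by positivity) k1
  rw [mul_assoc c, ← scale_rpow hk]
  change c * k⁻¹ ^ γ ≤ A * scale k ^ (-((d : ℝ) * (a - b))) at k2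
  rw [Real.rpow_neg hl.le, ← div_eq_mul_inv, le_div_iff₀ (by positivity)] at k2
  linarith

end ShellProjection

namespace ShellProjection

open Complex FourierTransform

variable {d : ℕ}

/-! ### Volumes -/

/-- The volume of the unit ball. -/
noncomputable def ballVolume (d : ℕ) : ℝ := volume.real (Metric.ball (0 : E d) 1)

theorem ballVolume_pos (d : ℕ) : 0 < ballVolume d :=
  ENNReal.toReal_pos (Metric.measure_ball_pos volume _ one_pos).ne'
    Metric.isBounded_ball.measure_lt_top.ne

theorem nontrivial_E (hd : 2 ≤ d) : Nontrivial (E d) := by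
  have : Nonempty (Fin d) := ⟨⟨0, by omega⟩⟩
  infer_instance

theorem measureReal_ball (hd : 2 ≤ d) (x : E d) {r : ℝ} (hr : 0 ≤ r) :
    volume.real (Metric.ball x r) = r ^ d * ballVolume d := by
  have := nontrivial_E hd
  rw [Measure.real, Measure.addHaar_ball _ _ hr, ENNReal.toReal_mul, finrank_E,
    ENNReal.toReal_ofReal (by positivity)]
  rfl

theorem measureReal_annulus (hd : 2 ≤ d) {r₀ r₁ : ℝ} (h1 : r₀ ≤ r₁) :
    volume.real {ξ : E d | r₀ ≤ ‖ξ‖ ^ 2 ∧ ‖ξ‖ ^ 2 < r₁} = (√r₁ ^ d - √r₀ ^ d) * ballVolume d := by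
  have e : {ξ : E d | r₀ ≤ ‖ξ‖ ^ 2 ∧ ‖ξ‖ ^ 2 < r₁} = Metric.ball 0 (√r₁) \ Metric.ball 0 (√r₀) := by
    ext ξ
    rw [mem_sdiff, mem_ball_zero_iff, mem_ball_zero_iff, Real.lt_sqrt (norm_nonneg _), not_lt,
      Real.sqrt_le_left (norm_nonneg _), and_comm]
    rfl
  rw [e, measureReal_sdiff (Metric.ball_subset_ball (Real.sqrt_le_sqrt h1)) measurableSet_ball
    Metric.isBounded_ball.measure_lt_top.ne, measureReal_ball hd _ (Real.sqrt_nonneg _),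
    measureReal_ball hd _ (Real.sqrt_nonneg _)]
  ring

theorem le_measureReal_annulus (hd : 2 ≤ d) {r₀ r₁ : ℝ} (h0 : 0 ≤ r₀) (h1 : r₀ ≤ r₁) :
    √r₁ ^ (d - 2) * (r₁ - r₀) * ballVolume d ≤
      volume.real {ξ : E d | r₀ ≤ ‖ξ‖ ^ 2 ∧ ‖ξ‖ ^ 2 < r₁} := by
  rw [measureReal_annulus hd h1]
  refine mul_le_mul_of_nonneg_right ?_ (ballVolume_pos d).le
  have e : ∀ r : ℝ, 0 ≤ r → √r ^ d = √r ^ (d - 2) * r := fun r hr => by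
    nth_rw 3 [← Real.sq_sqrt hr]
    rw [← pow_add]; congr 1; omega
  rw [e r₁ (h0.trans h1), e r₀ h0, mul_sub]
  have : √r₀ ^ (d - 2) * r₀ ≤ √r₁ ^ (d - 2) * r₀ := by gcongr
  linarith

theorem measureReal_unitShell_le (hd : 2 ≤ d) {δ : ℝ} (hδ : 0 ≤ δ) (hδ1 : δ ≤ 1) :
    volume.real (unitShell d δ) ≤ d * δ * ballVolume d := by
  have h := measureReal_annulus hd (by linarith : 1 - δ ≤ 1)
  change volume.real (unitShell d δ) = _ at h
  rw [h, Real.sqrt_one, one_pow]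
  refine mul_le_mul_of_nonneg_right ?_ (ballVolume_pos d).le
  have h1 : 1 - δ ≤ √(1 - δ) := by
    apply Real.le_sqrt_of_sq_le
    nlinarith
  have h2 := one_add_mul_le_pow (a := -δ) (by linarith) d
  have h3 : (1 + -δ) ^ d ≤ √(1 - δ) ^ d := by
    rw [← sub_eq_add_neg]
    have : 0 ≤ 1 - δ := by linarith
    gcongr
  linarith

theorem le_measureReal_unitShell (hd : 2 ≤ d) {δ : ℝ} (hδ : 0 ≤ δ) (hδ1 : δ ≤ 1) :
    δ * ballVolume d ≤ volume.real (unitShell d δ) := by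
  have := le_measureReal_annulus hd (by linarith : 0 ≤ 1 - δ) (by linarith : 1 - δ ≤ 1)
  rw [Real.sqrt_one, one_pow, one_mul, sub_sub_cancel] at this
  exact this

/-! ### Lower bounds from a localized function -/

theorem shellForm_eq_setIntegral {f : E d → ℂ}
    (hf : ∀ ξ ∈ Metric.closedBall (0 : E d) 1, 𝓕 f ξ = 1) (δ : ℝ) (g : E d → ℂ) :
    shellForm d δ f g = ∫ ξ in unitShell d δ, 𝓕⁻ g ξ := by
  classical
  rw [shellForm, form, ← integral_indicator (measurableSet_unitShell d δ)]
  congr 1; ext ξ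
  rw [shellSymbol, indicator_apply, indicator_apply]
  split_ifs with h
  · rw [hf ξ (Metric.ball_subset_closedBall (unitShell_subset_ball d δ h))]; simp
  · simp

/-- For a Schwartz function whose transform is 1 on the unit ball, paired with its reflection, the
form is the measure of the shell, hence at least a multiple of δ, while the norms do not depend on
δ. -/
theorem exists_le_of_strong_ball (hd : 2 ≤ d) (a c : ℝ) : ∃ κ : ℝ, 0 < κ ∧ ∀ δ M : ℝ, 0 < δ → δ ≤ 1 →
    0 ≤ M → Strong volume (shellForm d δ) a c M → κ * δ ^ (1 : ℝ) ≤ M := by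
  obtain ⟨φ, hφ⟩ := exists_schwartz_fourier_eq_one d
  have hφt := schwartz_isTest φ
  set ψ : E d → ℂ := fun x => φ (-x) with hψ
  have hψt : IsTest volume ψ := by
    obtain ⟨C, hC⟩ := hφt.bounded
    exact ⟨hφt.measurable.comp measurable_neg, hφt.integrable.comp_neg, C, fun x => hC _⟩
  have hψf : ∀ ξ, 𝓕⁻ ψ ξ = 𝓕 (φ : E d → ℂ) ξ := fun ξ => by
    rw [Real.fourierInv_eq', Real.fourier_eq', ← integral_neg_eq_self]
    congr 1; ext x
    rw [hψ, inner_neg_left]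
    simp
  set D := powNorm volume a (φ : E d → ℂ) * powNorm volume c ψ with hD
  have hD0 : 0 ≤ D := mul_nonneg (powNorm_nonneg _ _) (powNorm_nonneg _ _)
  refine ⟨ballVolume d / (D + 1), div_pos (ballVolume_pos d) (by linarith), fun δ M hδ hδ1 hM h => ?_⟩
  have h1 := h _ _ hφt hψt
  have h2 : shellForm d δ φ ψ = ((volume.real (unitShell d δ) : ℝ) : ℂ) := by
    rw [shellForm_eq_setIntegral hφ]
    calc ∫ ξ in unitShell d δ, 𝓕⁻ ψ ξ = ∫ _ in unitShell d δ, (1 : ℂ) := by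
          refine setIntegral_congr_fun (measurableSet_unitShell d δ) fun ξ hξ => ?_
          rw [hψf, hφ ξ (Metric.ball_subset_closedBall (unitShell_subset_ball d δ hξ))]
      _ = _ := by rw [setIntegral_const]; simp
  rw [h2, Complex.norm_real, Real.norm_of_nonneg measureReal_nonneg] at h1
  have h3 := le_measureReal_unitShell hd hδ.le hδ1
  rw [Real.rpow_one, div_mul_eq_mul_div, div_le_iff₀ (by linarith)]
  nlinarith

/-- Interpolation between L¹ and L²: split |g| at the height W/U, where the two contributions
balance. -/
theorem powNorm_le_of_bounds {g : E d → ℂ} (hg : IsTest volume g) {U W c : ℝ} (hU : 0 < U)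
    (hW : 0 < W) (h1 : ∫ x, ‖g x‖ ≤ U) (h2 : ∫ x, ‖g x‖ ^ 2 ≤ W) (hc : 1 / 2 ≤ c) (hc1 : c ≤ 1) :
    powNorm volume c g ≤ 2 * (U ^ (2 * c - 1) * W ^ (1 - c)) := by
  have hc0 : 0 < c := by linarith
  set s := 1 / c with hs
  have hs1 : 1 ≤ s := by rw [hs, le_div_iff₀ hc0]; linarith
  have hs2 : s ≤ 2 := by rw [hs, div_le_iff₀ hc0]; linarith
  set T := W / U with hT
  have hT0 : 0 < T := by positivity
  have hpt : ∀ x : ℝ, 0 ≤ x → x ^ s ≤ T ^ (s - 1) * x + T ^ (s - 2) * x ^ 2 := fun x hx => by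
    rcases le_total x T with h | h
    · have : x ^ s ≤ T ^ (s - 1) * x := by
        calc x ^ s = x ^ (s - 1) * x := by
              rw [← Real.rpow_add_one' hx (by linarith)]; congr 1; ring
          _ ≤ _ := by
            have : 0 ≤ s - 1 := by linarith
            gcongr
      have : 0 ≤ T ^ (s - 2) * x ^ 2 := by positivity
      linarith
    · have hx0 : 0 < x := hT0.trans_le h
      have : x ^ s ≤ T ^ (s - 2) * x ^ 2 := by
        calc x ^ s = x ^ (s - 2) * x ^ 2 := by
              rw [← Real.rpow_natCast x 2, ← Real.rpow_add hx0]; congr 1; push_cast; ring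
          _ ≤ _ := mul_le_mul_of_nonneg_right
              (Real.rpow_le_rpow_of_nonpos hT0 h (by linarith)) (by positivity)
      have : 0 ≤ T ^ (s - 1) * x := by positivity
      linarith
  have hint : ∫ x, ‖g x‖ ^ s ≤ 2 * (U ^ (2 - s) * W ^ (s - 1)) := by
    calc ∫ x, ‖g x‖ ^ s ≤ ∫ x, (T ^ (s - 1) * ‖g x‖ + T ^ (s - 2) * ‖g x‖ ^ 2) :=
          integral_mono (hg.integrable_rpow hs1)
            ((hg.integrable.norm.const_mul _).add (hg.integrable_sq.const_mul _))
            fun x => hpt _ (norm_nonneg _)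
      _ = T ^ (s - 1) * (∫ x, ‖g x‖) + T ^ (s - 2) * ∫ x, ‖g x‖ ^ 2 := by
          rw [integral_add (hg.integrable.norm.const_mul _) (hg.integrable_sq.const_mul _),
            integral_const_mul, integral_const_mul]
      _ ≤ T ^ (s - 1) * U + T ^ (s - 2) * W := by gcongr
      _ = _ := by
          have e : ∀ r : ℝ, T ^ r = W ^ r * U ^ (-r) := fun r => by
            rw [hT, Real.div_rpow hW.le hU.le, Real.rpow_neg hU.le]; rfl
          rw [e, e]
          have e1 : W ^ (s - 1) * U ^ (-(s - 1)) * U = U ^ (2 - s) * W ^ (s - 1) := by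
            rw [mul_assoc, ← Real.rpow_add_one hU.ne', mul_comm]; congr 2; ring
          have e2 : W ^ (s - 2) * U ^ (-(s - 2)) * W = U ^ (2 - s) * W ^ (s - 1) := by
            rw [mul_right_comm, ← Real.rpow_add_one hW.ne', mul_comm]; congr 2 <;> ring
          rw [e1, e2]; ring
  calc powNorm volume c g ≤ (2 * (U ^ (2 - s) * W ^ (s - 1))) ^ c :=
        Real.rpow_le_rpow (integral_rpow_nonneg c g) hint hc0.le
    _ = 2 ^ c * (U ^ (2 * c - 1) * W ^ (1 - c)) := by
        rw [Real.mul_rpow (by norm_num) (by positivity), Real.mul_rpow (by positivity) (by positivity),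
          ← Real.rpow_mul hU.le, ← Real.rpow_mul hW.le]
        have e1 : (2 - s) * c = 2 * c - 1 := by rw [hs]; field_simp
        have e2 : (s - 1) * c = 1 - c := by rw [hs]; field_simp
        rw [e1, e2]
    _ ≤ _ := by
        gcongr
        exact (Real.rpow_le_rpow_of_exponent_le (by norm_num) hc1).trans (by norm_num)

/-- The standard Gaussian. -/
noncomputable def gaussian (d : ℕ) (x : E d) : ℂ := (Real.exp (-Real.pi * ‖x‖ ^ 2) : ℂ)

theorem gaussian_isTest (d : ℕ) : IsTest volume (gaussian d) := by
  have hc : Continuous (gaussian d) := by unfold gaussian; fun_prop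
  refine ⟨hc.measurable, ?_, 1, fun x => ?_⟩
  · have := GaussianFourier.integrable_cexp_neg_mul_sq_norm_add (b := (Real.pi : ℂ))
      (by simpa using Real.pi_pos) 0 (0 : E d)
    refine this.congr (Filter.Eventually.of_forall fun v => ?_)
    simp [gaussian]
  · rw [gaussian, norm_real, Real.norm_of_nonneg (Real.exp_pos _).le, Real.exp_le_one_iff]
    have := Real.pi_pos
    nlinarith [sq_nonneg ‖x‖]

theorem fourier_gaussian (ξ : E d) : 𝓕 (gaussian d) ξ = gaussian d ξ := by
  have h := fourier_gaussian_innerProductSpace (V := E d) (b := (Real.pi : ℂ))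
    (by simpa using Real.pi_pos) ξ
  have hπ : (Real.pi : ℂ) ≠ 0 := by exact_mod_cast Real.pi_ne_zero
  have e : gaussian d = fun v : E d => cexp (-(Real.pi : ℂ) * ‖v‖ ^ 2) := by
    ext v; simp [gaussian]
  rw [div_self hπ, Complex.one_cpow, one_mul] at h
  rw [e, h]
  congr 1
  field_simp

theorem norm_gaussian (ξ : E d) : ‖gaussian d ξ‖ = Real.exp (-Real.pi * ‖ξ‖ ^ 2) := by
  rw [gaussian, norm_real, Real.norm_of_nonneg (Real.exp_pos _).le]

theorem fourierInv_mul_fourier {G m : E d → ℂ} (hG : Integrable G) (hm : Integrable m) (ξ : E d) :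
    𝓕⁻ (fun x => G x * 𝓕 m x) ξ = ∫ η, m η * 𝓕 G (η - ξ) := by
  set h : E d → ℂ := fun x => cexp (((2 * Real.pi * inner ℝ x ξ : ℝ) : ℂ) * I) * G x with hh
  have hhi : Integrable h := by
    refine hG.bdd_mul (c := 1) (by fun_prop) (Filter.Eventually.of_forall fun x => ?_)
    rw [norm_exp_ofReal_mul_I]
  have e := integral_fourier_mul hm hhi
  rw [Real.fourierInv_eq']
  calc _ = ∫ x, 𝓕 m x * h x := by
        congr 1; ext x
        rw [hh, smul_eq_mul]; ring
    _ = ∫ η, m η * 𝓕 h η := e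
    _ = _ := by
        congr 1; ext η
        congr 1
        rw [Real.fourier_eq', Real.fourier_eq']
        congr 1; ext x
        rw [hh, smul_eq_mul, smul_eq_mul, ← mul_assoc, ← Complex.exp_add, inner_sub_right]
        congr 2
        push_cast
        ring

end ShellProjection

namespace ShellProjection

open Complex FourierTransform

variable {d : ℕ}

/-! ### Lower bounds from a localized kernel -/

/-- The kernel of the projection, localized at the scale `1/δ`. -/
noncomputable def localKernel (d : ℕ) (δ : ℝ) (x : E d) : ℂ :=
  dil δ⁻¹ (gaussian d) x * 𝓕 (shellSymbol d δ) x

theorem localKernel_isTest {δ : ℝ} (hδ : 0 < δ) : IsTest volume (localKernel d δ) := by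
  have hG := isTest_dil (inv_pos.2 hδ) (gaussian_isTest d)
  have hK := continuous_fourier (integrable_shellSymbol d δ)
  have hKb := norm_fourier_le (shellSymbol d δ)
  obtain ⟨C, hC⟩ := hG.bounded
  refine ⟨hG.measurable.mul hK.measurable, hG.integrable.mul_bdd (c := ∫ x, ‖shellSymbol d δ x‖)
    hK.aestronglyMeasurable (Filter.Eventually.of_forall hKb), C * ∫ x, ‖shellSymbol d δ x‖, fun x => ?_⟩
  rw [localKernel, norm_mul]
  have := (norm_nonneg _).trans (hC x)
  gcongr
  · exact hC x
  · exact hKb x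

theorem integral_norm_sq_fourier_shellSymbol_le (hd : 2 ≤ d) {δ : ℝ} (hδ : 0 ≤ δ) (hδ1 : δ ≤ 1) :
    ∫ x, ‖𝓕 (shellSymbol d δ) x‖ ^ 2 ≤ d * ballVolume d * δ := by
  classical
  rw [integral_norm_sq_fourier (isTest_shellSymbol d δ)]
  have : ∀ ξ, ‖shellSymbol d δ ξ‖ ^ 2 = (unitShell d δ).indicator (1 : E d → ℝ) ξ := fun ξ => by
    simp only [shellSymbol, indicator_apply]
    split_ifs <;> simp
  simp_rw [this]
  rw [integral_indicator_one (measurableSet_unitShell d δ)]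
  linarith [measureReal_unitShell_le hd hδ hδ1]

/-- By Plancherel the L² norm is at most a multiple of δ^{1/2}, the square root of the measure of
the shell. Cauchy–Schwarz against a Gaussian of width 1/δ costs δ^{-d/2} and gives L¹; interpolation
does the rest. -/
theorem powNorm_localKernel_le (hd : 2 ≤ d) {c : ℝ} (hc : 1 / 2 ≤ c) (hc1 : c ≤ 1) :
    ∃ P : ℝ, 0 < P ∧ ∀ δ : ℝ, 0 < δ → δ ≤ 1 →
      powNorm volume c (localKernel d δ) ≤ P * δ ^ (1 / 2 - d * (c - 1 / 2)) := by
  set Γ := (∫ x, ‖gaussian d x‖ ^ 2) + 1 with hΓ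
  have hΓ0 : 0 ≤ ∫ x, ‖gaussian d x‖ ^ 2 := integral_nonneg fun _ => by positivity
  have hΓ1 : 0 < Γ := by positivity
  have hV := ballVolume_pos d
  have hd0 : (0 : ℝ) < d := by positivity
  set L := (d : ℝ) * ballVolume d with hL
  have hL0 : 0 < L := by positivity
  refine ⟨2 * ((√Γ * √L) ^ (2 * c - 1) * L ^ (1 - c)), by positivity, fun δ hδ hδ1 => ?_⟩
  have ht := localKernel_isTest (d := d) hδ
  have hG := isTest_dil (inv_pos.2 hδ) (gaussian_isTest d)
  have hK := continuous_fourier (integrable_shellSymbol d δ)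
  have hKi := integrable_norm_sq_fourier (isTest_shellSymbol d δ)
  have hK2 := integral_norm_sq_fourier_shellSymbol_le hd hδ.le hδ1
  have hW : ∫ x, ‖localKernel d δ x‖ ^ 2 ≤ L * δ := by
    refine le_trans (integral_mono ht.integrable_sq hKi fun x => ?_) hK2
    simp only [localKernel, norm_mul, mul_pow]
    have h1 : ‖dil δ⁻¹ (gaussian d) x‖ ≤ 1 := by
      rw [dil, norm_gaussian, Real.exp_le_one_iff]
      have := Real.pi_pos
      nlinarith [sq_nonneg ‖δ⁻¹⁻¹ • x‖]
    have h2 : ‖dil δ⁻¹ (gaussian d) x‖ ^ 2 ≤ 1 := pow_le_one₀ (norm_nonneg _) h1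
    exact mul_le_of_le_one_left (by positivity) h2
  have hU : ∫ x, ‖localKernel d δ x‖ ≤ √Γ * √L * δ ^ ((1 - d : ℝ) / 2) := by
    have h1 := integral_norm_mul_le_sqrt hG.measurable.aestronglyMeasurable hK.aestronglyMeasurable
      hG.integrable_sq hKi
    have h2 : ∫ x, ‖dil δ⁻¹ (gaussian d) x‖ ^ 2 ≤ δ ^ (-(d : ℝ)) * Γ := by
      have := integral_dil (inv_pos.2 hδ) fun x => ‖gaussian d x‖ ^ 2
      rw [smul_eq_mul, inv_pow, ← Real.rpow_natCast, ← Real.rpow_neg hδ.le] at this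
      unfold dil
      rw [this]
      gcongr
      linarith
    simp only [localKernel, norm_mul]
    refine h1.trans ?_
    calc _ ≤ √(δ ^ (-(d : ℝ)) * Γ) * √(L * δ) := by gcongr
      _ = _ := by
        rw [Real.sqrt_mul (by positivity), Real.sqrt_mul hL0.le, Real.sqrt_eq_rpow (δ ^ _),
          Real.sqrt_eq_rpow δ, ← Real.rpow_mul hδ.le,
          show (1 - d : ℝ) / 2 = -(d : ℝ) * (1 / 2) + 1 / 2 by ring, Real.rpow_add hδ]
        ring
  refine (powNorm_le_of_bounds ht (by positivity) (by positivity) hU hW hc hc1).trans (le_of_eq ?_)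
  rw [Real.mul_rpow (by positivity) (by positivity), Real.mul_rpow hL0.le hδ.le, ← Real.rpow_mul hδ.le,
    show (1 / 2 - d * (c - 1 / 2) : ℝ) = (1 - d) / 2 * (2 * c - 1) + (1 - c) by ring, Real.rpow_add hδ]
  ring

/-- Localizing the kernel in space at scale 1/δ convolves the symbol with a Gaussian of width δ, so
the form becomes a positive double integral over the shell. -/
theorem shellForm_localKernel {f : E d → ℂ}
    (hf : ∀ ξ ∈ Metric.closedBall (0 : E d) 1, 𝓕 f ξ = 1) {δ : ℝ} (hδ : 0 < δ) :
    shellForm d δ f (localKernel d δ) = ((∫ ξ in unitShell d δ, ∫ η in unitShell d δ,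
      (δ⁻¹) ^ d * Real.exp (-Real.pi * ‖δ⁻¹ • (η - ξ)‖ ^ 2) : ℝ) : ℂ) ∧
    Integrable (fun ξ => ∫ η in unitShell d δ, (δ⁻¹) ^ d * Real.exp (-Real.pi * ‖δ⁻¹ • (η - ξ)‖ ^ 2))
      (volume.restrict (unitShell d δ)) := by
  classical
  have hG := isTest_dil (inv_pos.2 hδ) (gaussian_isTest d)
  have hinv : ∀ ξ, 𝓕⁻ (localKernel d δ) ξ = ((∫ η in unitShell d δ,
      (δ⁻¹) ^ d * Real.exp (-Real.pi * ‖δ⁻¹ • (η - ξ)‖ ^ 2) : ℝ) : ℂ) := fun ξ => by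
    have := fourierInv_mul_fourier hG.integrable (integrable_shellSymbol d δ) ξ
    change 𝓕⁻ (localKernel d δ) ξ = _ at this
    rw [this, ← integral_complex_ofReal, ← integral_indicator (measurableSet_unitShell d δ)]
    congr 1; ext η
    rw [fourier_dil (inv_pos.2 hδ), fourier_gaussian, shellSymbol, indicator_apply, indicator_apply]
    split_ifs
    · rw [gaussian, Pi.one_apply, one_mul]; push_cast; ring
    · simp
  constructor
  · rw [shellForm_eq_setIntegral hf, ← integral_complex_ofReal]
    simp_rw [hinv]
  · have hc := continuous_fourierInv (localKernel_isTest (d := d) hδ).integrable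
    have hb := norm_fourierInv_le (localKernel d δ)
    have hfin := volume_unitShell_ne_top d δ
    have h1 : IntegrableOn (𝓕⁻ (localKernel d δ)) (unitShell d δ) :=
      Measure.integrableOn_of_bounded hfin hc.aestronglyMeasurable (Filter.Eventually.of_forall hb)
    refine (Integrable.re h1).congr (Filter.Eventually.of_forall fun ξ => ?_)
    change RCLike.re (𝓕⁻ (localKernel d δ) ξ) = _
    rw [hinv]
    exact ofReal_re _

/-- The middle half of the shell stays away from both boundary spheres: a displacement of δ/16
changes |ξ|² by less than δ/4. -/
theorem ball_subset_unitShell {δ : ℝ} (hδ : 0 < δ) (hδ1 : δ ≤ 1) {ξ : E d}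
    (h1 : 1 - 3 * δ / 4 ≤ ‖ξ‖ ^ 2) (h2 : ‖ξ‖ ^ 2 < 1 - δ / 4) :
    Metric.ball ξ (δ / 16) ⊆ unitShell d δ := by
  intro η hη
  rw [mem_ball_iff_norm] at hη
  have k1 : ‖η‖ ≤ ‖ξ‖ + δ / 16 := by
    have := norm_add_le ξ (η - ξ)
    rw [add_sub_cancel] at this
    linarith
  have k2 : ‖ξ‖ ≤ ‖η‖ + δ / 16 := by
    have := norm_sub_le η (η - ξ)
    rw [sub_sub_cancel] at this
    linarith
  have k3 : ‖ξ‖ ≤ 1 := by nlinarith [norm_nonneg ξ]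
  have k4 := norm_nonneg ξ
  have k5 := norm_nonneg η
  constructor
  · by_contra hc
    push Not at hc
    have : ‖ξ‖ ^ 2 ≤ ‖η‖ ^ 2 + (δ / 16) * (‖ξ‖ + ‖η‖) := by nlinarith
    nlinarith
  · have : ‖η‖ ^ 2 ≤ ‖ξ‖ ^ 2 + (δ / 16) * (‖ξ‖ + ‖η‖) := by nlinarith
    nlinarith

/-- Blurring the shell at its own width keeps a fixed proportion of it: the inner integral is
bounded below on the middle half, so the form is at least a multiple of δ. Dividing by the norm of
the localized kernel gives the exponent. -/
theorem exists_le_of_strong_kernel (hd : 2 ≤ d) (a : ℝ) {c : ℝ} (hc : 1 / 2 ≤ c) (hc1 : c ≤ 1) :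
    ∃ κ : ℝ, 0 < κ ∧ ∀ δ M : ℝ, 0 < δ → δ ≤ 1 → 0 ≤ M → Strong volume (shellForm d δ) a c M →
      κ * δ ^ (1 / 2 + d * (c - 1 / 2)) ≤ M := by
  obtain ⟨φ, hφ⟩ := exists_schwartz_fourier_eq_one d
  have hφt := schwartz_isTest φ
  obtain ⟨P, hP, hPle⟩ := powNorm_localKernel_le hd hc hc1
  have hV := ballVolume_pos d
  set D := powNorm volume a (φ : E d → ℂ) with hD
  have hD0 : 0 ≤ D := powNorm_nonneg _ _
  set κ' := (1 / 16 : ℝ) ^ d * ballVolume d * Real.exp (-Real.pi) with hκ'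
  have hκ0 : 0 < κ' := by have := Real.exp_pos (-Real.pi); positivity
  set B := κ' * ((1 / 2 : ℝ) ^ (d - 2) * (1 / 2) * ballVolume d) with hB
  have hB0 : 0 < B := by positivity
  refine ⟨B / (D * P + 1), by positivity, fun δ M hδ hδ1 hM h => ?_⟩
  obtain ⟨e, hi⟩ := shellForm_localKernel hφ hδ
  have h1 := h _ _ hφt (localKernel_isTest hδ)
  set J : E d → ℝ := fun ξ => ∫ η in unitShell d δ,
    (δ⁻¹) ^ d * Real.exp (-Real.pi * ‖δ⁻¹ • (η - ξ)‖ ^ 2) with hJ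
  have hJ0 : ∀ ξ, 0 ≤ J ξ := fun ξ => integral_nonneg fun η => by
    have := Real.exp_pos (-Real.pi * ‖δ⁻¹ • (η - ξ)‖ ^ 2)
    positivity
  set S' := {ξ : E d | 1 - 3 * δ / 4 ≤ ‖ξ‖ ^ 2 ∧ ‖ξ‖ ^ 2 < 1 - δ / 4} with hS'
  have hS'm : MeasurableSet S' := by
    have h : Measurable fun ξ : E d => ‖ξ‖ ^ 2 := by fun_prop
    exact (measurableSet_le measurable_const h).inter (measurableSet_lt h measurable_const)
  have hsub : S' ⊆ unitShell d δ := fun ξ hξ => ⟨by linarith [hξ.1], by linarith [hξ.2]⟩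
  have hfin := volume_unitShell_ne_top d δ
  have hfin' : volume S' ≠ ∞ := ((measure_mono hsub).trans_lt hfin.lt_top).ne
  have hJle : ∀ ξ ∈ S', κ' ≤ J ξ := fun ξ hξ => by
    have hbs := ball_subset_unitShell hδ hδ1 hξ.1 hξ.2
    have hcont : Continuous fun η : E d =>
        (δ⁻¹) ^ d * Real.exp (-Real.pi * ‖δ⁻¹ • (η - ξ)‖ ^ 2) := by fun_prop
    have hin : IntegrableOn (fun η : E d =>
        (δ⁻¹) ^ d * Real.exp (-Real.pi * ‖δ⁻¹ • (η - ξ)‖ ^ 2)) (unitShell d δ) := by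
      refine Measure.integrableOn_of_bounded (M := (δ⁻¹) ^ d) hfin hcont.aestronglyMeasurable
        (Filter.Eventually.of_forall fun η => ?_)
      rw [Real.norm_of_nonneg (by have := Real.exp_pos (-Real.pi * ‖δ⁻¹ • (η - ξ)‖ ^ 2); positivity)]
      refine mul_le_of_le_one_right (by positivity) (Real.exp_le_one_iff.2 ?_)
      have := Real.pi_pos
      nlinarith [sq_nonneg ‖δ⁻¹ • (η - ξ)‖]
    calc κ' = volume.real (Metric.ball ξ (δ / 16)) * ((δ⁻¹) ^ d * Real.exp (-Real.pi)) := by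
          rw [measureReal_ball hd _ (by positivity), hκ', div_pow, inv_pow, div_pow]
          field_simp
          rw [one_pow]
      _ = ∫ _ in Metric.ball ξ (δ / 16), (δ⁻¹) ^ d * Real.exp (-Real.pi) := by
          rw [setIntegral_const, smul_eq_mul]
      _ ≤ ∫ η in Metric.ball ξ (δ / 16), (δ⁻¹) ^ d * Real.exp (-Real.pi * ‖δ⁻¹ • (η - ξ)‖ ^ 2) := by
          refine setIntegral_mono_on (integrableOn_const Metric.isBounded_ball.measure_lt_top.ne)
            (hin.mono_set hbs) measurableSet_ball fun η hη => ?_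
          rw [mem_ball_iff_norm] at hη
          have h2 : ‖δ⁻¹ • (η - ξ)‖ ≤ 1 := by
            rw [norm_smul, Real.norm_of_nonneg (by positivity), inv_mul_le_iff₀ hδ]
            linarith
          have h3 : ‖δ⁻¹ • (η - ξ)‖ ^ 2 ≤ 1 := pow_le_one₀ (norm_nonneg _) h2
          gcongr
          nlinarith [Real.pi_pos]
      _ ≤ J ξ := setIntegral_mono_set hin
          (Filter.Eventually.of_forall fun η => by
            have := Real.exp_pos (-Real.pi * ‖δ⁻¹ • (η - ξ)‖ ^ 2)
            simp only [Pi.zero_apply]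
            positivity)
          hbs.eventuallyLE
  have hvol : (1 / 2 : ℝ) ^ (d - 2) * (1 / 2) * ballVolume d * δ ≤ volume.real S' := by
    refine le_trans ?_ (le_measureReal_annulus hd (by linarith) (by linarith))
    have h2 : (1 / 2 : ℝ) ≤ √(1 - δ / 4) := Real.le_sqrt_of_sq_le (by linarith)
    have h3 : (1 / 2 : ℝ) ^ (d - 2) ≤ √(1 - δ / 4) ^ (d - 2) := by gcongr
    calc _ = (1 / 2 : ℝ) ^ (d - 2) * (1 - δ / 4 - (1 - 3 * δ / 4)) * ballVolume d := by ring
      _ ≤ _ := by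
        have : 0 ≤ 1 - δ / 4 - (1 - 3 * δ / 4) := by linarith
        gcongr
  have hlow : B * δ ≤ ∫ ξ in unitShell d δ, J ξ := by
    calc B * δ = κ' * ((1 / 2 : ℝ) ^ (d - 2) * (1 / 2) * ballVolume d * δ) := by rw [hB]; ring
      _ ≤ κ' * volume.real S' := by gcongr
      _ = ∫ _ in S', κ' := by rw [setIntegral_const, smul_eq_mul, mul_comm]
      _ ≤ ∫ ξ in S', J ξ := setIntegral_mono_on (integrableOn_const hfin')
          (IntegrableOn.mono_set (t := unitShell d δ) hi hsub) hS'm hJle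
      _ ≤ _ := setIntegral_mono_set hi (Filter.Eventually.of_forall hJ0) hsub.eventuallyLE
  rw [e, norm_real, Real.norm_of_nonneg (integral_nonneg hJ0)] at h1
  have h4 : B * δ ≤ M * (D * (P * δ ^ (1 / 2 - d * (c - 1 / 2)))) := by
    refine hlow.trans (h1.trans ?_)
    gcongr
    exact hPle δ hδ hδ1
  have h5 : δ = δ ^ (1 / 2 + d * (c - 1 / 2)) * δ ^ (1 / 2 - d * (c - 1 / 2)) := by
    rw [← Real.rpow_add hδ, show (1 / 2 + d * (c - 1 / 2) + (1 / 2 - d * (c - 1 / 2)) : ℝ) = 1 by ring,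
      Real.rpow_one]
  have h6 : 0 < δ ^ (1 / 2 - d * (c - 1 / 2)) := by positivity
  have h7 : B * δ ^ (1 / 2 + d * (c - 1 / 2)) ≤ M * (D * P) := by
    refine le_of_mul_le_mul_right ?_ h6
    calc _ = B * δ := by rw [mul_assoc, ← h5]
      _ ≤ M * (D * (P * δ ^ (1 / 2 - d * (c - 1 / 2)))) := h4
      _ = _ := by ring
  rw [div_mul_eq_mul_div, div_le_iff₀ (by positivity)]
  nlinarith

/-! ### The Knapp example -/

/-- A box with one distinguished side. -/
def slab (d : ℕ) (i : Fin d) (s t w : ℝ) : Set (E d) :=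
  {x | ∀ j, x j ∈ Icc (if j = i then s else -w) (if j = i then t else w)}

theorem slab_eq_preimage (i : Fin d) (s t w : ℝ) : slab d i s t w =
    (@WithLp.ofLp 2 (Fin d → ℝ)) ⁻¹' Icc (fun j => if j = i then s else -w) (fun j => if j = i then t else w) := by
  ext x
  simp only [slab, mem_ofPred_eq, mem_preimage, mem_Icc, Pi.le_def]
  exact forall_and

theorem measurableSet_slab (i : Fin d) (s t w : ℝ) : MeasurableSet (slab d i s t w) := by
  rw [slab_eq_preimage]
  exact (PiLp.volume_preserving_ofLp (Fin d)).measurable measurableSet_Icc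

theorem volume_slab (i : Fin d) {s t w : ℝ} (hst : s ≤ t) (hw : 0 ≤ w) :
    volume (slab d i s t w) ≠ ∞ ∧
      volume.real (slab d i s t w) = (t - s) * (2 * w) ^ (d - 1) := by
  have h1 : volume (slab d i s t w) =
      volume (Icc (fun j => if j = i then s else -w) (fun j => if j = i then t else w)) := by
    rw [slab_eq_preimage]
    exact (PiLp.volume_preserving_ofLp (Fin d)).measure_preimage measurableSet_Icc.nullMeasurableSet
  constructor
  · rw [h1, Real.volume_Icc_pi]
    exact ENNReal.prod_ne_top fun _ _ => ENNReal.ofReal_ne_top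
  · rw [Measure.real, h1, Real.volume_Icc_pi_toReal]
    · have : ∀ j : Fin d, (if j = i then t else w) - (if j = i then s else -w) =
          if j = i then t - s else 2 * w := fun j => by split_ifs <;> ring
      simp_rw [this]
      rw [Fintype.prod_eq_mul_prod_compl i, if_pos rfl]
      congr 1
      rw [Finset.prod_congr rfl (g := fun _ => 2 * w) fun j hj => by
        rw [if_neg]; simpa using hj]
      rw [Finset.prod_const, Finset.card_compl, Fintype.card_fin, Finset.card_singleton]
    · intro j
      simp only
      split_ifs <;> linarith

theorem norm_sq_eq_add (i : Fin d) (x : E d) :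
    ‖x‖ ^ 2 = x i ^ 2 + ∑ j ∈ ({i} : Finset (Fin d))ᶜ, x j ^ 2 := by
  rw [EuclideanSpace.real_norm_sq_eq, Fintype.sum_eq_add_sum_compl i]

theorem sum_compl_le {i : Fin d} {f : Fin d → ℝ} {b : ℝ} (hb : 0 ≤ b) (h : ∀ j, j ≠ i → f j ≤ b) :
    ∑ j ∈ ({i} : Finset (Fin d))ᶜ, f j ≤ d * b := by
  refine (Finset.sum_le_card_nsmul _ _ b fun j hj => h j (by simpa using hj)).trans ?_
  rw [nsmul_eq_mul, Finset.card_compl, Fintype.card_fin, Finset.card_singleton]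
  have : ((d - 1 : ℕ) : ℝ) ≤ d := by exact_mod_cast Nat.sub_le _ _
  gcongr

/-- The cap of the shell in the direction `i`. -/
def cap (d : ℕ) (i : Fin d) (δ : ℝ) : Set (E d) := slab d i (1 - δ / 2) (1 - δ / 4) (√δ / (2 * √d))

/-- The box dual to the cap. -/
def dualBox (d : ℕ) (i : Fin d) (δ : ℝ) : Set (E d) :=
  slab d i (-(1 / (8 * δ))) (1 / (8 * δ)) (1 / (8 * (√d * √δ)))

theorem cap_subset (i : Fin d) {δ : ℝ} (hδ : 0 < δ) (hδ1 : δ ≤ 1) : cap d i δ ⊆ unitShell d δ := by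
  intro x hx
  have hd0 : (0 : ℝ) < d := by
    have : 0 < d := i.pos
    exact_mod_cast this
  have h1 := hx i
  simp only [if_true] at h1
  have h2 : ∑ j ∈ ({i} : Finset (Fin d))ᶜ, x j ^ 2 ≤ d * (δ / (4 * d)) := by
    refine sum_compl_le (by positivity) fun j hj => ?_
    have h3 := hx j
    simp only [if_neg hj] at h3
    have h4 := sq_le_sq' h3.1 h3.2
    refine h4.trans (le_of_eq ?_)
    rw [div_pow, mul_pow, Real.sq_sqrt hδ.le, Real.sq_sqrt hd0.le]; norm_num
  have h5 : (d : ℝ) * (δ / (4 * d)) = δ / 4 := by field_simp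
  have h6 : 0 ≤ ∑ j ∈ ({i} : Finset (Fin d))ᶜ, x j ^ 2 := Finset.sum_nonneg fun _ _ => sq_nonneg _
  rw [h5] at h2
  constructor
  · rw [norm_sq_eq_add i]; nlinarith [h1.1, h1.2]
  · rw [norm_sq_eq_add i]; nlinarith [h1.1, h1.2]

theorem abs_inner_le_of_mem {i : Fin d} {δ : ℝ} (hδ : 0 < δ) {x ξ : E d} (hx : x ∈ dualBox d i δ)
    (hξ : ξ ∈ cap d i δ) : |inner ℝ x (ξ - EuclideanSpace.single i 1)| ≤ 1 / 8 := by
  have hd0 : (0 : ℝ) < d := by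
    have : 0 < d := i.pos
    exact_mod_cast this
  have e : inner ℝ x (ξ - EuclideanSpace.single i (1 : ℝ)) =
      x i * (ξ i - 1) + ∑ j ∈ ({i} : Finset (Fin d))ᶜ, x j * ξ j := by
    rw [PiLp.inner_apply, Fintype.sum_eq_add_sum_compl i]
    congr 1
    · simp [mul_comm]
    · refine Finset.sum_congr rfl fun j hj => ?_
      have : j ≠ i := by simpa using hj
      simp [this, mul_comm]
  have h1 := hx i
  have h2 := hξ i
  simp only [if_true] at h1 h2
  have h3 : |x i * (ξ i - 1)| ≤ 1 / 16 := by
    rw [abs_mul]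
    have k1 : |x i| ≤ 1 / (8 * δ) := abs_le.2 h1
    have k2 : |ξ i - 1| ≤ δ / 2 := abs_le.2 ⟨by linarith [h2.1], by linarith [h2.2]⟩
    calc _ ≤ 1 / (8 * δ) * (δ / 2) := by gcongr
      _ = 1 / 16 := by field_simp; norm_num
  have h4 : |∑ j ∈ ({i} : Finset (Fin d))ᶜ, x j * ξ j| ≤ 1 / 16 := by
    refine (Finset.abs_sum_le_sum_abs _ _).trans ?_
    refine (sum_compl_le (b := 1 / (16 * d)) (by positivity) fun j hj => ?_).trans (le_of_eq ?_)
    · have k1 := hx j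
      have k2 := hξ j
      simp only [if_neg hj] at k1 k2
      rw [abs_mul]
      have k3 : |x j| ≤ 1 / (8 * (√d * √δ)) := abs_le.2 k1
      have k4 : |ξ j| ≤ √δ / (2 * √d) := abs_le.2 k2
      calc _ ≤ 1 / (8 * (√d * √δ)) * (√δ / (2 * √d)) := by gcongr
        _ = 1 / (16 * (√d * √d)) := by
          have : 0 < √δ := Real.sqrt_pos.2 hδ
          have : 0 < √(d : ℝ) := Real.sqrt_pos.2 hd0
          field_simp; norm_num
        _ = _ := by rw [Real.mul_self_sqrt hd0.le]
    · field_simp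
  rw [e]
  refine (abs_add_le _ _).trans ?_
  linarith

/-- The wave packet on the dual box. -/
noncomputable def wavePacket (d : ℕ) (i : Fin d) (δ : ℝ) : E d → ℂ :=
  (dualBox d i δ).indicator fun x =>
    cexp (((2 * Real.pi * inner ℝ x (EuclideanSpace.single i (1 : ℝ)) : ℝ) : ℂ) * I)

theorem wavePacket_subInd (i : Fin d) {δ : ℝ} (hδ : 0 < δ) :
    SubInd volume (wavePacket d i δ) (dualBox d i δ) := by
  classical
  have h0 : (0 : ℝ) < 1 / (8 * δ) := by positivity
  refine ⟨Measurable.indicator (by fun_prop) (measurableSet_slab _ _ _ _), measurableSet_slab _ _ _ _,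
    (volume_slab i (by linarith) (by positivity)).1, fun x => ?_⟩
  rw [wavePacket, indicator_apply, indicator_apply]
  split_ifs
  · rw [norm_exp_ofReal_mul_I]; rfl
  · simp

/-- No cancellation: once the modulation is removed, the phase on the box is at most 2π/8 ≤ π/3, so
the integrand has real part at least 1/2. -/
theorem le_norm_fourier_wavePacket (i : Fin d) {δ : ℝ} (hδ : 0 < δ) {ξ : E d} (hξ : ξ ∈ cap d i δ) :
    volume.real (dualBox d i δ) / 2 ≤ ‖𝓕 (wavePacket d i δ) ξ‖ := by
  classical
  have hm : MeasurableSet (dualBox d i δ) := measurableSet_slab _ _ _ _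
  have hfin := (wavePacket_subInd i hδ).finite
  have e : 𝓕 (wavePacket d i δ) ξ = ∫ x in dualBox d i δ,
      cexp (((-2 * Real.pi * inner ℝ x (ξ - EuclideanSpace.single i (1 : ℝ)) : ℝ) : ℂ) * I) := by
    rw [Real.fourier_eq', ← integral_indicator hm]
    congr 1; ext x
    rw [wavePacket, indicator_apply, indicator_apply]
    split_ifs
    · rw [smul_eq_mul, ← Complex.exp_add, inner_sub_right]
      congr 1; push_cast; ring
    · simp
  have hi : IntegrableOn (fun x : E d =>
      cexp (((-2 * Real.pi * inner ℝ x (ξ - EuclideanSpace.single i (1 : ℝ)) : ℝ) : ℂ) * I))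
      (dualBox d i δ) := by
    refine Measure.integrableOn_of_bounded (M := 1) hfin
      (by fun_prop : Continuous _).aestronglyMeasurable (Filter.Eventually.of_forall fun x => ?_)
    rw [norm_exp_ofReal_mul_I]
  refine le_trans ?_ (re_le_norm _)
  rw [e]
  have hre := integral_re hi
  simp only [RCLike.re_to_complex] at hre
  rw [← hre]
  calc volume.real (dualBox d i δ) / 2 = ∫ _ in dualBox d i δ, (1 / 2 : ℝ) := by
        rw [setIntegral_const, smul_eq_mul]; ring
    _ ≤ _ := by
        refine setIntegral_mono_on (integrableOn_const hfin) (Integrable.re hi) hm fun x hx => ?_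
        change _ ≤ (cexp _).re
        rw [exp_ofReal_mul_I_re]
        have h1 := abs_inner_le_of_mem hδ hx hξ
        set θ := inner ℝ x (ξ - EuclideanSpace.single i (1 : ℝ))
        have h2 : |-2 * Real.pi * θ| ≤ Real.pi / 3 := by
          rw [abs_mul, abs_mul, abs_of_pos Real.pi_pos]
          norm_num
          nlinarith [Real.pi_pos]
        rw [← Real.cos_abs, ← Real.cos_pi_div_three]
        exact Real.cos_le_cos_of_nonneg_of_le_pi (abs_nonneg _) (by linarith [Real.pi_pos]) h2

/-- Put e = (d+1)/2. The cap has volume of order δ^e and the dual box volume v of order δ^{-e}.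
Pairing the wave packet with its conjugate gives a form of size at least |cap| (v/2)² against norms
at most v^{a+c}, so M is at least of order δ^e v^{2-a-c}, that is, δ^{e(a+c-1)}. -/
theorem exists_le_of_strong_knapp (hd : 2 ≤ d) {a c : ℝ} (ha : 0 < a) (ha1 : a ≤ 1) (hc : 0 < c)
    (hc1 : c ≤ 1) : ∃ κ : ℝ, 0 < κ ∧ ∀ δ M : ℝ, 0 < δ → δ ≤ 1 → 0 ≤ M →
      Strong volume (shellForm d δ) a c M → κ * δ ^ (((d : ℝ) + 1) / 2 * (a + c - 1)) ≤ M := by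
  let i : Fin d := ⟨0, by omega⟩
  have hd0 : (0 : ℝ) < d := by positivity
  have hs : 0 < √(d : ℝ) := Real.sqrt_pos.2 hd0
  set κ₁ := (1 / 4 : ℝ) * (1 / (4 * √d)) ^ (d - 1) with hκ₁
  set κ₂ := (1 / 4 : ℝ) * (1 / √d) ^ (d - 1) with hκ₂
  have hκ₁0 : 0 < κ₁ := by positivity
  have hκ₂0 : 0 < κ₂ := by positivity
  refine ⟨κ₂ / 4 * κ₁ ^ (2 - (a + c)), by positivity, fun δ M hδ hδ1 hM h => ?_⟩
  have hsδ : 0 < √δ := Real.sqrt_pos.2 hδ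
  set f := wavePacket d i δ with hf
  have hfS := wavePacket_subInd i hδ
  have h1 := h _ _ hfS.isTest hfS.isTest.conj
  rw [← integral_shell_eq_shellForm, norm_real] at h1
  replace h1 := (le_abs_self _).trans h1
  have hp : ∀ b : ℝ, 0 < b → b ≤ 1 → powNorm volume b f ≤ volume.real (dualBox d i δ) ^ b :=
    fun b hb hb1 => powNorm_le_of_subInd hb hb1 hfS
  have hp' : powNorm volume c (fun x => (starRingEnd ℂ) (f x)) = powNorm volume c f := by
    simp [powNorm]
  rw [hp'] at h1
  set v := volume.real (dualBox d i δ) with hv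
  set e := ((d : ℝ) + 1) / 2 with he
  have hpow : √δ ^ (d - 1) * δ = δ ^ e := by
    rw [Real.sqrt_eq_rpow, ← Real.rpow_natCast, ← Real.rpow_mul hδ.le, ← Real.rpow_add_one hδ.ne',
      Nat.cast_sub (by omega), he]
    congr 1; push_cast; ring
  have hv1 : v = κ₁ * δ ^ (-e) := by
    have h0 : (0 : ℝ) < 1 / (8 * δ) := by positivity
    have := (volume_slab i (s := -(1 / (8 * δ))) (t := 1 / (8 * δ)) (w := 1 / (8 * (√d * √δ)))
      (by linarith) (by positivity)).2
    rw [hv, dualBox, this, Real.rpow_neg hδ.le, ← hpow, hκ₁,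
      show 2 * (1 / (8 * (√(d : ℝ) * √δ))) = 1 / (4 * √d) * (1 / √δ) by field_simp; norm_num, mul_pow,
      one_div_pow (√δ)]
    field_simp
    norm_num
  have hq : volume.real (cap d i δ) = κ₂ * δ ^ e := by
    have := (volume_slab i (s := 1 - δ / 2) (t := 1 - δ / 4) (w := √δ / (2 * √d))
      (by linarith) (by positivity)).2
    rw [cap, this, ← hpow, hκ₂,
      show 2 * (√δ / (2 * √(d : ℝ))) = 1 / √d * √δ by field_simp, mul_pow]
    ring
  have hv0 : 0 < v := by rw [hv1]; positivity
  have hlow : κ₂ * δ ^ e * (v / 2) ^ 2 ≤ ∫ ξ in unitShell d δ, ‖𝓕 f ξ‖ ^ 2 := by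
    have hcm : MeasurableSet (cap d i δ) := measurableSet_slab _ _ _ _
    have hcf : volume (cap d i δ) ≠ ∞ :=
      ((measure_mono (cap_subset i hδ hδ1)).trans_lt (volume_unitShell_ne_top d δ).lt_top).ne
    have hi := integrable_norm_sq_fourier hfS.isTest
    calc _ = ∫ _ in cap d i δ, (v / 2) ^ 2 := by rw [setIntegral_const, smul_eq_mul, hq]
      _ ≤ ∫ ξ in cap d i δ, ‖𝓕 f ξ‖ ^ 2 := by
          refine setIntegral_mono_on (integrableOn_const hcf) hi.integrableOn hcm fun ξ hξ => ?_
          have := le_norm_fourier_wavePacket i hδ hξ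
          gcongr
      _ ≤ _ := setIntegral_mono_set hi.integrableOn
          (Filter.Eventually.of_forall fun ξ => by simp only [Pi.zero_apply]; positivity)
          (cap_subset i hδ hδ1).eventuallyLE
  have hup : κ₂ * δ ^ e * (v / 2) ^ 2 ≤ M * v ^ (a + c) := by
    refine hlow.trans (h1.trans ?_)
    rw [Real.rpow_add hv0]
    have := powNorm_nonneg (μ := (volume : Measure (E d))) c f
    gcongr
    · exact hp a ha ha1
    · exact hp c hc hc1
  have h5 : v ^ 2 = v ^ (2 - (a + c)) * v ^ (a + c) := by
    rw [← Real.rpow_add hv0, sub_add_cancel]; norm_num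
  have h6 : κ₂ / 4 * δ ^ e * v ^ (2 - (a + c)) ≤ M := by
    refine le_of_mul_le_mul_right ?_ (by positivity : 0 < v ^ (a + c))
    calc _ = κ₂ * δ ^ e * (v / 2) ^ 2 := by rw [div_pow, h5]; ring
      _ ≤ _ := hup
  refine le_trans (le_of_eq ?_) h6
  rw [hv1, Real.mul_rpow hκ₁0.le (by positivity), ← Real.rpow_mul hδ.le,
    show e * (a + c - 1) = e + -e * (2 - (a + c)) by ring, Real.rpow_add hδ]
  ring

end ShellProjection

namespace ShellProjection

variable {d : ℕ}

/-! ### The exponent on each region -/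

theorem mem_segment_dual {X P Q : ℝ × ℝ} (h : dual X ∈ segment ℝ P Q) :
    X ∈ segment ℝ (dual P) (dual Q) := by
  obtain ⟨r, s, hr, hs, hrs, h⟩ := h
  have h1 := congrArg Prod.fst h
  have h2 := congrArg Prod.snd h
  simp only [dual, Prod.fst_add, Prod.snd_add, Prod.smul_fst, Prod.smul_snd, smul_eq_mul] at h1 h2
  refine ⟨r, s, hr, hs, hrs, ?_⟩
  ext
  · simp only [dual, Prod.fst_add, Prod.smul_fst, smul_eq_mul]
    linarith
  · simp only [dual, Prod.snd_add, Prod.smul_snd, smul_eq_mul]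
    linarith

theorem mem_dual_image {S : Set (ℝ × ℝ)} {X : ℝ × ℝ} : X ∈ dual '' S ↔ dual X ∈ S := by
  constructor
  · rintro ⟨Y, hY, rfl⟩
    rwa [dual_dual]
  · exact fun h => ⟨dual X, h, dual_dual X⟩

/-- Beyond `C` on the line through `C` and `D'`, no point belongs to the dual trapezoid. -/
theorem dual_notMem_trapezoid (hd : 2 ≤ d) {X : ℝ × ℝ} (h : (ptC d).1 ≤ X.1) :
    dual X ∉ trapezoid d := by
  intro hX
  have hn : (2 : ℝ) ≤ d := by exact_mod_cast hd
  have h3 := hX.2.2.1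
  have h1 := ptC_fst hd
  have h2 := ptC_snd hd
  simp only [dual] at h3
  have h4 : 2 * (d : ℝ) * (ptC d).1 ≤ d + 1 := by nlinarith
  nlinarith

theorem ptC_notMem_regionR2 (d : ℕ) : ptC d ∉ regionR2 d :=
  fun h => h.2 (left_mem_segment ℝ _ _)

/-- At the height of C the pentagon reaches only as far right as C, which is removed from R1; the
segment is removed from R2; and R2' lies further left. So the last case of `beta` applies. -/
theorem beta_eq_of_mem_segment (hd : 2 ≤ d) {X : ℝ × ℝ} (hX : X ∈ segment ℝ (ptC d) (ptD d)) :
    beta d X = (d : ℝ) / 2 * (X.1 - X.2) - 1 := by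
  have hn : (2 : ℝ) ≤ d := by exact_mod_cast hd
  obtain ⟨h1, -, h2⟩ := segment_CD_bounds hd hX
  have hR1 : X ∉ regionR1 d := by
    intro h
    have h3 := (hull_subset_pentagon hd h.1).2.2.1
    have h4 := ptC_fst hd
    have : X.1 = (ptC d).1 := by nlinarith
    exact h.2 (Or.inl (Prod.ext this h2))
  have hR2 : X ∉ regionR2 d := fun h => h.2 hX
  have hR3 : X ∉ dual '' regionR2 d := by
    rw [mem_dual_image]
    exact fun h => dual_notMem_trapezoid hd h1 (hull_subset_trapezoid hd h.1)
  rw [beta, if_neg hR1, if_neg hR2, if_neg hR3]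

theorem beta_dual_ptC (hd : 2 ≤ d) :
    beta d (dual (ptC d)) = (d : ℝ) / 2 * ((dual (ptC d)).1 - (dual (ptC d)).2) - 1 := by
  have hR1 : dual (ptC d) ∉ regionR1 d := fun h => h.2 (Or.inr rfl)
  have hR2 : dual (ptC d) ∉ regionR2 d :=
    fun h => dual_notMem_trapezoid hd le_rfl (hull_subset_trapezoid hd h.1)
  have hR3 : dual (ptC d) ∉ dual '' regionR2 d := by
    rw [mem_dual_image, dual_dual]
    exact ptC_notMem_regionR2 d
  rw [beta, if_neg hR1, if_neg hR2, if_neg hR3]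

/-! ### Sharp rates -/

/-- The form of the shell is of size exactly `δ ^ γ` at `X`. -/
def SharpRate (d : ℕ) (X : ℝ × ℝ) (γ : ℝ) : Prop :=
  StrongRate d X γ ∧ ∃ c : ℝ, 0 < c ∧ ∀ δ M : ℝ, 0 < δ → δ ≤ 1 → 0 ≤ M →
    Strong volume (shellForm d δ) X.1 (1 - X.2) M → c * δ ^ γ ≤ M

theorem SharpRate.dual {X : ℝ × ℝ} {γ : ℝ} (h : SharpRate d X γ) :
    SharpRate d (dual X) γ := by
  obtain ⟨h1, c, hc, h2⟩ := h
  refine ⟨h1.dual, c, hc, fun δ M hδ hδ1 hM h => h2 δ M hδ hδ1 hM ?_⟩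
  simpa [ShellProjection.dual] using h.swap

theorem sharpRate_regionR1 (hd : 2 ≤ d) {X : ℝ × ℝ} (hX : X ∈ regionR1 d) (h1 : X.1 ≤ 1)
    (h2 : 0 ≤ X.2) : SharpRate d X (((d : ℝ) + 1) / 2 * (X.1 - X.2)) := by
  have hP := hull_subset_pentagon hd hX.1
  refine ⟨strongRate_pentagon hd hP (fun h => hX.2 (Or.inl h)) (fun h => hX.2 (Or.inr h)), ?_⟩
  have := exists_le_of_strong_knapp hd (a := X.1) (c := 1 - X.2) (by linarith [hP.1]) h1
    (by linarith [hP.2.1]) (by linarith)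
  rwa [show X.1 + (1 - X.2) - 1 = X.1 - X.2 by ring] at this

theorem sharpRate_regionR2 (hd : 2 ≤ d) {X : ℝ × ℝ} (hX : X ∈ regionR2 d) :
    SharpRate d X (((d : ℝ) + 1) / 2 - d * X.2) := by
  have hn : (2 : ℝ) ≤ d := by exact_mod_cast hd
  have hT := hull_subset_trapezoid hd hX.1
  obtain ⟨h1, h2, h3, h4⟩ := id hT
  have hC1 := ptC_fst hd
  have hC2 := ptC_snd hd
  have h5 : (ptC d).2 ≤ X.2 := by nlinarith
  have hlt : (ptC d).2 < X.2 := by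
    refine lt_of_le_of_ne h5 fun he => hX.2 (mem_segment_CD ?_ h1 he.symm)
    nlinarith
  refine ⟨strongRate_trapezoid hd hT hlt, ?_⟩
  have := exists_le_of_strong_kernel hd X.1 (c := 1 - X.2) (by linarith)
    (by linarith [ptC_snd_pos hd])
  rwa [show 1 / 2 + (d : ℝ) * (1 - X.2 - 1 / 2) = ((d : ℝ) + 1) / 2 - d * X.2 by ring] at this

/-- At or above the height of C, the line A C separates the pentagon from the trapezoid and the two
cover everything; the other constraints hold there automatically. -/
theorem snd_lt_of_notMem (hd : 2 ≤ d) {X : ℝ × ℝ} (h1 : 1 / 2 ≤ X.1) (h1' : X.1 ≤ 1)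
    (h2' : X.2 ≤ 1 / 2) (hP : X ∉ pentagon d)
    (hT : X ∉ trapezoid d ∨ X ∈ segment ℝ (ptC d) (ptD d))
    (hs : X ∉ segment ℝ (ptC d) (ptD d)) : X.2 < (ptC d).2 := by
  have hn : (2 : ℝ) ≤ d := by exact_mod_cast hd
  have hC2 := ptC_snd hd
  have hT := hT.resolve_right hs
  by_contra! h
  have h3 : (d : ℝ) - 1 ≤ 2 * d * X.2 := by nlinarith
  have h4 : ((d : ℝ) + 1) * X.1 + ((d : ℝ) - 1) * X.2 < d + 1 := by
    by_contra! h4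
    exact hT ⟨h1', h2', h3, h4⟩
  refine hP ⟨h1, h2', by nlinarith, h4.le, ?_⟩
  have h5 : ((d : ℝ) - 1) * (1 / 2) ≤ (d - 1) * X.1 := by
    have : (0 : ℝ) ≤ d - 1 := by linarith
    gcongr
  have h6 : 0 ≤ X.2 := (ptC_snd_pos hd).le.trans h
  nlinarith

theorem sharpRate_corner (hd : 2 ≤ d) {X : ℝ × ℝ} (h1 : 1 / 2 ≤ X.1) (h1' : X.1 ≤ 1)
    (h2 : 0 ≤ X.2) (h2' : X.2 ≤ 1 / 2) (hR1 : X ∉ regionR1 d) (hR2 : X ∉ regionR2 d)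
    (hR3 : dual X ∉ regionR2 d) (hs : X ∉ segment ℝ (ptC d) (ptD d))
    (hs' : X ∉ segment ℝ (dual (ptC d)) (dual (ptD d))) : SharpRate d X 1 := by
  have hn : (2 : ℝ) ≤ d := by exact_mod_cast hd
  have hC2 := ptC_snd hd
  have hP : X ∉ pentagon d := by
    intro h
    refine hR1 ⟨pentagon_subset_hull hd h, ?_⟩
    rintro (rfl | rfl)
    · exact hs (left_mem_segment ℝ _ _)
    · exact hs' (left_mem_segment ℝ _ _)
  have key : ∀ Y, Y ∉ regionR2 d → Y ∉ trapezoid d ∨ Y ∈ segment ℝ (ptC d) (ptD d) := by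
    intro Y hY
    by_contra! h
    exact hY ⟨trapezoid_subset_hull hd h.1, h.2⟩
  -- Applied to `X` and to its dual, this places `X` strictly below the line CD and strictly to the
  -- right of the line C'D'.
  have k1 := snd_lt_of_notMem hd h1 h1' h2' hP (key X hR2) hs
  have k2 := snd_lt_of_notMem (X := dual X) hd (by simp only [dual]; linarith)
    (by simp only [dual]; linarith) (by simp only [dual]; linarith)
    (fun h => hP (by simpa only [dual_dual] using dual_mem_pentagon h)) (key _ hR3)
    (fun h => hs' (mem_segment_dual h))
  simp only [dual] at k2
  refine ⟨strongRate_corner hd h1' h2 ?_ k1 (by linarith), exists_le_of_strong_ball hd _ _⟩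
  -- Otherwise `X` would lie on the inner side of the line C C', hence in the pentagon.
  by_contra! h
  exact hP ⟨h1, h2', h.le, by nlinarith, by nlinarith⟩

/-- The cases follow those of `beta`, so no agreement of the formulas on overlaps is needed. -/
theorem exists_sharpRate (hd : 2 ≤ d) {X : ℝ × ℝ} (h1 : 1 / 2 ≤ X.1) (h1' : X.1 ≤ 1)
    (h2 : 0 ≤ X.2) (h2' : X.2 ≤ 1 / 2) (hs : X ∉ segment ℝ (ptC d) (ptD d))
    (hs' : X ∉ segment ℝ (dual (ptC d)) (dual (ptD d))) :
    ∃ γ : ℝ, SharpRate d X γ ∧ (d : ℝ) / 2 * (X.1 - X.2) - γ = beta d X := by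
  by_cases hR1 : X ∈ regionR1 d
  · refine ⟨_, sharpRate_regionR1 hd hR1 h1' h2, ?_⟩
    rw [beta, if_pos hR1]
    ring
  by_cases hR2 : X ∈ regionR2 d
  · refine ⟨_, sharpRate_regionR2 hd hR2, ?_⟩
    rw [beta, if_neg hR1, if_pos hR2]
    ring
  by_cases hR3 : X ∈ dual '' regionR2 d
  · rw [mem_dual_image] at hR3
    refine ⟨_, by simpa only [dual_dual] using (sharpRate_regionR2 hd hR3).dual, ?_⟩
    rw [beta, if_neg hR1, if_neg hR2, if_pos (mem_dual_image.2 hR3)]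
    simp only [dual]
    ring
  · refine ⟨_, sharpRate_corner hd h1 h1' h2 h2' hR1 hR2 (fun h => hR3 (mem_dual_image.2 h)) hs hs', ?_⟩
    rw [beta, if_neg hR1, if_neg hR2, if_neg hR3]

end ShellProjection

/-! ### The theorem, from the sharp, weak and Lorentz rates -/

open ShellProjection in
theorem corollary3p7 (d : ℕ) (hd : 2 ≤ d) (p q : ℝ≥0∞) (hp1 : 1 ≤ p) (hp2 : p ≤ 2)
    (hq : 2 ≤ q) :
    (expPoint p q ∉ segment ℝ (ptC d) (ptD d) ∪ segment ℝ (dual (ptC d)) (dual (ptD d)) →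
      ∃ c C : ℝ, 0 < c ∧ 0 < C ∧ ∀ k : ℝ, 1 ≤ k →
        ENNReal.ofReal (c * k ^ beta d (expPoint p q)) ≤
            opNorm (lebesgueNorm p) (lebesgueNorm q) (wp (d := d) k) ∧
          opNorm (lebesgueNorm p) (lebesgueNorm q) (wp (d := d) k) ≤
            ENNReal.ofReal (C * k ^ beta d (expPoint p q))) ∧
    (expPoint p q ∈ segment ℝ (ptC d) (ptD d) \ {ptC d} →
      ∃ C : ℝ, 0 < C ∧ ∀ k : ℝ, 1 ≤ k →
        opNorm (lebesgueNorm p) (lorentzNorm q ∞) (wp (d := d) k) ≤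
          ENNReal.ofReal (C * k ^ beta d (expPoint p q))) ∧
    (expPoint p q = ptC d ∨ expPoint p q = dual (ptC d) →
      ∃ C : ℝ, 0 < C ∧ ∀ k : ℝ, 1 ≤ k →
        opNorm (lorentzNorm p 1) (lorentzNorm q ∞) (wp (d := d) k) ≤
          ENNReal.ofReal (C * k ^ beta d (expPoint p q))) := by
  have hpq : IsPair p q := ⟨hp1, hp2, hq⟩
  have h1 := hpq.half_le_fst
  have h1' := hpq.fst_le_one
  have h2 := hpq.snd_nonneg
  have h2' := hpq.snd_le_half
  refine ⟨fun hX => ?_, fun hX => ?_, fun hX => ?_⟩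
  · obtain ⟨γ, ⟨hu, hl⟩, hβ⟩ := exists_sharpRate hd h1 h1' h2 h2' (fun h => hX (Or.inl h))
      (fun h => hX (Or.inr h))
    obtain ⟨C, hC, hu⟩ := opNorm_le_of_strongRate hpq hu
    obtain ⟨c, hc, hl⟩ := exists_le_opNorm hpq hl
    rw [hβ] at hu hl
    exact ⟨c, C, hc, hC, fun k hk => ⟨hl k hk, hu k hk⟩⟩
  · obtain ⟨k1, k2, k3⟩ := segment_CD_bounds hd hX.1
    have hne : (ptC d).1 ≠ (expPoint p q).1 := fun h => hX.2 (Prod.ext h.symm k3)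
    have hw := weakRate_CD hd (lt_of_le_of_ne k1 hne) k2
    rw [← k3, Prod.mk.eta] at hw
    rw [beta_eq_of_mem_segment hd hX.1]
    exact opNorm_le_of_weakRate hpq (k3 ▸ ptC_snd_pos hd) hw
  · have hC := restrictedRate_C hd
    rcases hX with h | h
    · have hr := lorentzRate_of_restrictedRate h1 h1' h2 h2' (h ▸ hC)
      rw [beta_eq_of_mem_segment hd (h ▸ left_mem_segment ℝ _ _)]
      exact opNorm_le_of_lorentzRate hpq (h ▸ ptC_snd_pos hd) hr
    -- Restricted estimates are symmetric in the two functions, so the one at C' is dual to the one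
    -- at C; the value of `beta` there is computed separately.
    · have hr := lorentzRate_of_restrictedRate h1 h1' h2 h2' (h ▸ hC.dual)
      have hb : beta d (expPoint p q) =
          (d : ℝ) / 2 * ((expPoint p q).1 - (expPoint p q).2) - 1 := by
        rw [h]
        exact beta_dual_ptC hd
      rw [hb]
      refine opNorm_le_of_lorentzRate hpq ?_ hr
      rw [h]
      exact sub_pos.2 (ptC_fst_lt_one hd)
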